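/- Let $\Bbbk$ be an algebraically closed field of characteristic zero, let $\ell\ge 2$, $I=\{1,\dots,\ell\}$, and let $V$ be a superspace over $\Bbbk$ with a basis $v_1,\dots,v_{\ell+1}$ of homogeneous vectors of parities $\bar 1,\dots,\overline{\ell+1}\in\mathbb Z/2$ (an arbitrary sequence of parities; write $\bar a$ for the parity of $v_a$). Put $(\epsilon_a,\epsilon_b)=\delta_{ab}(-1)^{\bar a}$, $\alpha_i=\epsilon_i-\epsilon_{i+1}$, $|\epsilon_a-\epsilon_b|=\bar a+\bar b$, $c_{ij}=(\alpha_i,\alpha_j)$, $\Delta^+=\{\epsilon_a-\epsilon_b: a<b\}$. Assume that * if $\ell=3$ then $|\alpha_1|\ne|\alpha_3|$; * every $i\in I$ with $|\alpha_i|=\bar 1$ has a neighbour $j\in I$, $|i-j|=1$, with $|\alpha_j|=\bar 0$. For homogeneous elements write $[x,y]=xy-(-1)^{|x||y|}yx$ and $\{x,y\}=xy+(-1)^{|x||y|}yx$. Let $Y=Y_\hbar(\mathfrak g)$ be the unital associative $\Bbbk[[\hbar]]$-superalgebra generated by $h_{ir}$ (even) and $x_{ir}^{\pm}$ (of parity $|\alpha_i|$),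 $i\in I$, $r\ge 0$, with the defining relations (all $i,j\in I$, $r,s,t\ge0$) $$[h_{ir},h_{js}]=0,\quad [h_{i0},x_{js}^\pm]=\pm c_{ij}x_{js}^\pm,\quad [x_{ir}^+,x_{js}^-]=\delta_{ij}h_{i,r+s},$$ $$[h_{i,r+1},x_{js}^\pm]-[h_{ir},x_{j,s+1}^\pm]=\pm\tfrac{c_{ij}\hbar}{2}\{h_{ir},x_{js}^\pm\}\ \text{ unless } i=j,\ |\alpha_i|=\bar1,$$ $$[x_{i,r+1}^\pm,x_{js}^\pm]-[x_{ir}^\pm,x_{j,s+1}^\pm]=\pm\tfrac{c_{ij}\hbar}{2}\{x_{ir}^\pm,x_{js}^\pm\}\ \text{ unless } i=j,\ |\alpha_i|=\bar1,$$ $$[h_{ir},x_{is}^\pm]=0\ \text{ if } |\alpha_i|=\bar1,\qquad [x_{ir}^\pm,x_{js}^\pm]=0\ \text{ if } c_{ij}=0,$$ $$[x_{ir}^\pm,[x_{is}^\pm,x_{jt}^\pm]]+[x_{is}^\pm,[x_{ir}^\pm,x_{jt}^\pm]]=0\ \text{ if } |i-j|=1,\ |\alpha_i|=\bar0,$$ $$[[x_{j-1,r}^\pm,x_{j0}^\pm],[x_{j0}^\pm,x_{j+1,s}^\pm]]=0\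 \text{ if } j-1,j,j+1\in I,\ |\alpha_j|=\bar1.$$ Let $\mathfrak g=\mathfrak{sl}(V)$ be the Lie superalgebra of matrices of supertrace zero, with the form $\langle A,B\rangle=\operatorname{str}(AB)$; for $\alpha=\epsilon_a-\epsilon_b\in\Delta^+$ put $e_\alpha=E_{ab}$ and $f_\alpha=(-1)^{\bar a}E_{ba}$, so that $\langle e_\alpha,f_\alpha\rangle=1$. Then there is a unique homomorphism of Lie superalgebras $\mathfrak g\to Y$ with $e_{\alpha_i}\mapsto x_{i0}^+$, $f_{\alpha_i}\mapsto x_{i0}^-$, $[e_{\alpha_i},f_{\alpha_i}]\mapsto h_{i0}$; elements of $\mathfrak g$ are identified with their images in $Y$. Let $Y\otimes Y$ be the graded tensor product over $\Bbbk[[\hbar]]$, with $(u\otimes v)(u'\otimes v')=(-1)^{|v||u'|}uu'\otimes vv'$, and put $\square(y)=y\otimes1+1\otimes y$. Then there is a homomorphism of superalgebras (a parity-preserving homomorphism of $\Bbbk[[\hbar]]$-algebras) $\Delta:Y\to Y\otimes Y$ such that $$\Delta(x)=\square(x)\quad(x\in\mathfrak g),$$ $$\Delta(h_{i1})=\square(h_{i1})+\hbar\big(h_{i0}\otimes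 h_{i0}+[h_{i0}\otimes1,\Omega^+]\big)=\square(h_{i1})+\hbar\Big(h_{i0}\otimes h_{i0}-\sum_{\alpha\in\Delta^+}(\alpha_i,\alpha)\,f_\alpha\otimes e_\alpha\Big)\quad(i\in I),$$ where $\Omega^+=\sum_{k\in I}h^{(k)}\otimes h^{(k)}+\sum_{\alpha\in\Delta^+}f_\alpha\otimes e_\alpha$ is half of the Casimir element and $(h^{(k)})_{k\in I}$ is any orthonormal basis, with respect to $\langle\cdot,\cdot\rangle$, of the space of diagonal matrices in $\mathfrak g$. (If $V$ has equally many even and odd basis vectors, there is no such basis, and the second rule is the last expression, which does not involve it.) Moreover $\Delta$ is the only homomorphism of $\Bbbk[[\hbar]]$-algebras that satisfies these two rules. -/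

import Mathlib

open scoped TensorProduct

noncomputable section

namespace SuperYangian

/-! ### Signs, weights, roots and the Cartan matrix -/

/-- The sign `(-1)^a` of a parity `a`. -/
def psign (a : ZMod 2) : ℤ := (((-1 : ℤˣ) ^ a : ℤˣ) : ℤ)

/-- The positive roots `ε_a - ε_b` with `a < b`; the basis of `V` is indexed by `Fin (ℓ + 1)`,
the simple roots by `Fin ℓ`. -/
abbrev PosRoot (ℓ : ℕ) : Type := {ab : Fin (ℓ + 1) × Fin (ℓ + 1) // ab.1 < ab.2}

/-- The simple root `α_i = ε_i - ε_{i+1}`. -/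
def simpleRoot {ℓ : ℕ} (i : Fin ℓ) : PosRoot ℓ := ⟨(i.castSucc, i.succ), Fin.castSucc_lt_succ⟩

/-- The root `ε_a - ε_b` as an element of the lattice spanned by the `ε_a`. -/
def weight {ℓ : ℕ} (α : PosRoot ℓ) : Fin (ℓ + 1) → ℤ := Pi.single α.1.1 1 - Pi.single α.1.2 1

variable {ℓ : ℕ} (p : Fin (ℓ + 1) → ZMod 2)

/-- The bilinear form `(ε_a, ε_b) = δ_{ab} (-1)^{p a}`, evaluated at two roots. -/
def rootForm (α β : PosRoot ℓ) : ℤ := ∑ a, psign (p a) * weight α a * weight β a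

/-- The parity of a root. -/
def rootParity (α : PosRoot ℓ) : ZMod 2 := p α.1.1 + p α.1.2

/-- The Cartan matrix `c_{ij} = (α_i, α_j)`. -/
def cartan (i j : Fin ℓ) : ℤ := rootForm p (simpleRoot i) (simpleRoot j)

/-- The parity `|α_i|` of the `i`-th vertex of the Dynkin diagram. -/
def vtxParity (i : Fin ℓ) : ZMod 2 := rootParity p (simpleRoot i)

/-- Two vertices of the Dynkin diagram are neighbours. -/
def Adjacent (i j : Fin ℓ) : Prop := (i : ℕ) + 1 = j ∨ (j : ℕ) + 1 = i

/-- The constraints on the set of vertices and on the Dynkin diagram: there are at least two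
vertices; if there are exactly three, the two end vertices have different parities; every odd
vertex has an even neighbour. -/
structure Admissible : Prop where
  two_le : 2 ≤ ℓ
  three : ∀ i j : Fin ℓ, ℓ = 3 → (i : ℕ) = 0 → (j : ℕ) = 2 → vtxParity p i ≠ vtxParity p j
  odd : ∀ i : Fin ℓ, vtxParity p i = 1 → ∃ j : Fin ℓ, Adjacent i j ∧ vtxParity p j = 0

/-! ### Super brackets -/

/-- `[x, y] = x y - (-1)^{a b} y x` for homogeneous `x`, `y` of parities `a`, `b`. -/
def sbr {A : Type*} [Ring A] (a b : ZMod 2) (x y : A) : A := x * y - psign (a * b) • (y * x)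

/-- `{x, y} = x y + (-1)^{a b} y x` for homogeneous `x`, `y` of parities `a`, `b`. -/
def sabr {A : Type*} [Ring A] (a b : ZMod 2) (x y : A) : A := x * y + psign (a * b) • (y * x)

/-! ### The Drinfeld super Yangian -/

/-- The generators `h_{i,r}` and `x_{i,r}^{±}`; the sign is an element of `ℤˣ`. -/
inductive Gen (ℓ : ℕ) : Type
  | h (i : Fin ℓ) (r : ℕ) : Gen ℓ
  | x (s : ℤˣ) (i : Fin ℓ) (r : ℕ) : Gen ℓ

/-- The parities of the generators. -/
def Gen.parity : Gen ℓ → ZMod 2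
  | .h _ _ => 0
  | .x _ i _ => vtxParity p i

section Yangian

variable (k : Type*) [Field k]

/-- The free `k⟦ħ⟧`-algebra on the generators. -/
abbrev Free (ℓ : ℕ) : Type _ := FreeAlgebra (PowerSeries k) (Gen ℓ)

/-- `h_{i,r}` in the free algebra. -/
def fh (i : Fin ℓ) (r : ℕ) : Free k ℓ := FreeAlgebra.ι _ (.h i r)

/-- `x_{i,r}^{±}` in the free algebra. -/
def fx (s : ℤˣ) (i : Fin ℓ) (r : ℕ) : Free k ℓ := FreeAlgebra.ι _ (.x s i r)

/-- The coefficient `± c_{ij} ħ / 2`. -/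
def coef (s : ℤˣ) (i j : Fin ℓ) : PowerSeries k :=
  PowerSeries.C ((((s : ℤ) * cartan p i j : ℤ) : k) / 2) * PowerSeries.X

/-- The defining relations of the Drinfeld super Yangian. -/
inductive Rel : Free k ℓ → Free k ℓ → Prop
  | hh (i j : Fin ℓ) (r s : ℕ) : Rel (sbr 0 0 (fh k i r) (fh k j s)) 0
  | h0x (e : ℤˣ) (i j : Fin ℓ) (s : ℕ) :
      Rel (sbr 0 (vtxParity p j) (fh k i 0) (fx k e j s)) ((((e : ℤ) * cartan p i j : ℤ) : PowerSeries k) • fx k e j s)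
  | xx (i j : Fin ℓ) (r s : ℕ) :
      Rel (sbr (vtxParity p i) (vtxParity p j) (fx k 1 i r) (fx k (-1) j s))
        (if i = j then fh k i (r + s) else 0)
  | hx (e : ℤˣ) (i j : Fin ℓ) (r s : ℕ) (hij : ¬ (i = j ∧ vtxParity p i = 1)) :
      Rel (sbr 0 (vtxParity p j) (fh k i (r + 1)) (fx k e j s)
          - sbr 0 (vtxParity p j) (fh k i r) (fx k e j (s + 1)))
        (coef p k e i j • sabr 0 (vtxParity p j) (fh k i r) (fx k e j s))
  | xxs (e : ℤˣ) (i j : Fin ℓ) (r s : ℕ) (hij : ¬ (i = j ∧ vtxParity p i = 1)) :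
      Rel (sbr (vtxParity p i) (vtxParity p j) (fx k e i (r + 1)) (fx k e j s)
          - sbr (vtxParity p i) (vtxParity p j) (fx k e i r) (fx k e j (s + 1)))
        (coef p k e i j • sabr (vtxParity p i) (vtxParity p j) (fx k e i r) (fx k e j s))
  | hx_odd (e : ℤˣ) (i : Fin ℓ) (r s : ℕ) (hi : vtxParity p i = 1) :
      Rel (sbr 0 (vtxParity p i) (fh k i r) (fx k e i s)) 0
  | serre_zero (e : ℤˣ) (i j : Fin ℓ) (r s : ℕ) (hij : cartan p i j = 0) :
      Rel (sbr (vtxParity p i) (vtxParity p j) (fx k e i r) (fx k e j s)) 0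
  | serre_cubic (e : ℤˣ) (i j : Fin ℓ) (r s t : ℕ) (hij : Adjacent i j)
      (hi : vtxParity p i = 0) :
      Rel (sbr (vtxParity p i) (vtxParity p i + vtxParity p j) (fx k e i r)
            (sbr (vtxParity p i) (vtxParity p j) (fx k e i s) (fx k e j t))
          + sbr (vtxParity p i) (vtxParity p i + vtxParity p j) (fx k e i s)
            (sbr (vtxParity p i) (vtxParity p j) (fx k e i r) (fx k e j t))) 0
  | serre_quartic (e : ℤˣ) (i j l : Fin ℓ) (r s : ℕ) (hij : (i : ℕ) + 1 = j)
      (hjl : (j : ℕ) + 1 = l) (hj : vtxParity p j = 1) :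
      Rel (sbr (vtxParity p i + vtxParity p j) (vtxParity p j + vtxParity p l)
            (sbr (vtxParity p i) (vtxParity p j) (fx k e i r) (fx k e j 0))
            (sbr (vtxParity p j) (vtxParity p l) (fx k e j 0) (fx k e l s))) 0

/-- The Drinfeld super Yangian `Y_ħ(𝔤)` over `k⟦ħ⟧`. -/
def Y : Type _ := RingQuot (Rel p k)

instance : Ring (Y p k) := inferInstanceAs (Ring (RingQuot (Rel p k)))

instance : Algebra (PowerSeries k) (Y p k) :=
  inferInstanceAs (Algebra (PowerSeries k) (RingQuot (Rel p k)))

/-- The Yangian as an algebra over the ground field. -/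
instance : Algebra k (Y p k) := Algebra.compHom (Y p k) (algebraMap k (PowerSeries k))

instance : IsScalarTower k (PowerSeries k) (Y p k) := IsScalarTower.of_algebraMap_eq fun _ => rfl

/-- The quotient map from the free algebra. -/
def mk : Free k ℓ →ₐ[PowerSeries k] Y p k := RingQuot.mkAlgHom (PowerSeries k) (Rel p k)

theorem mk_rel {u v : Free k ℓ} (huv : Rel p k u v) : mk p k u = mk p k v :=
  RingQuot.mkAlgHom_rel (PowerSeries k) huv

/-- The universal property of the Yangian. -/
def lift {B : Type*} [Ring B] [Algebra (PowerSeries k) B] (f : Free k ℓ →ₐ[PowerSeries k] B)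
    (hf : ∀ u v, Rel p k u v → f u = f v) : Y p k →ₐ[PowerSeries k] B :=
  RingQuot.liftAlgHom (PowerSeries k) ⟨f, fun u v huv => hf u v huv⟩

theorem lift_mk {B : Type*} [Ring B] [Algebra (PowerSeries k) B]
    (f : Free k ℓ →ₐ[PowerSeries k] B) (hf : ∀ u v, Rel p k u v → f u = f v) (u : Free k ℓ) :
    lift p k f hf (mk p k u) = f u :=
  RingQuot.liftAlgHom_mkAlgHom_apply (S := PowerSeries k) f (fun u v huv => hf u v huv) u

theorem hom_ext {B : Type*} [Ring B] [Algebra (PowerSeries k) B]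
    {f g : Y p k →ₐ[PowerSeries k] B}
    (hfg : ∀ t : Gen ℓ, f (mk p k (FreeAlgebra.ι _ t)) = g (mk p k (FreeAlgebra.ι _ t))) :
    f = g := by
  apply RingQuot.ringQuot_ext' (S := PowerSeries k)
  apply FreeAlgebra.hom_ext
  funext t
  exact hfg t

/-- The class of a generator. -/
def gen (g : Gen ℓ) : Y p k := mk p k (FreeAlgebra.ι _ g)

/-- The generator `h_{i,r}` of the Yangian. -/
def hGen (i : Fin ℓ) (r : ℕ) : Y p k := gen p k (.h i r)

/-- The generator `x_{i,r}^{±}` of the Yangian. -/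
def xGen (s : ℤˣ) (i : Fin ℓ) (r : ℕ) : Y p k := gen p k (.x s i r)

/-! ### The `ℤ/2`-grading of the Yangian -/

theorem psign_zero : psign 0 = 1 := by simp [psign]

theorem psign_mul_self (a : ZMod 2) : psign a * psign a = 1 := by
  unfold psign
  rw [← Units.val_mul, Int.units_mul_self]; rfl

theorem psign_add (a b : ZMod 2) : psign (a + b) = psign a * psign b := by
  unfold psign
  rw [uzpow_add, Units.val_mul]

/-- The parity automorphism before passing to the quotient: it multiplies each generator by
`(-1)` to the parity of that generator. -/
def preInvol : Free k ℓ →ₐ[PowerSeries k] Y p k :=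
  FreeAlgebra.lift (PowerSeries k) fun g => psign (g.parity p) • gen p k g

theorem sbr_zsmul_left {A : Type*} [Ring A] (a b : ZMod 2) (m : ℤ) (u v : A) :
    sbr a b (m • u) v = m • sbr a b u v := by
  simp only [sbr, smul_mul_assoc, mul_smul_comm, smul_sub]
  rw [smul_comm m]

theorem sbr_zsmul_right {A : Type*} [Ring A] (a b : ZMod 2) (m : ℤ) (u v : A) :
    sbr a b u (m • v) = m • sbr a b u v := by
  simp only [sbr, smul_mul_assoc, mul_smul_comm, smul_sub]
  rw [smul_comm m]

theorem sabr_zsmul_left {A : Type*} [Ring A] (a b : ZMod 2) (m : ℤ) (u v : A) :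
    sabr a b (m • u) v = m • sabr a b u v := by
  simp only [sabr, smul_mul_assoc, mul_smul_comm, smul_add]
  rw [smul_comm m]

theorem sabr_zsmul_right {A : Type*} [Ring A] (a b : ZMod 2) (m : ℤ) (u v : A) :
    sabr a b u (m • v) = m • sabr a b u v := by
  simp only [sabr, smul_mul_assoc, mul_smul_comm, smul_add]
  rw [smul_comm m]

theorem map_sbr {R A B : Type*} [CommRing R] [Ring A] [Ring B] [Algebra R A] [Algebra R B]
    (f : A →ₐ[R] B) (a b : ZMod 2) (u v : A) : f (sbr a b u v) = sbr a b (f u) (f v) := by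
  simp [sbr]

theorem map_sabr {R A B : Type*} [CommRing R] [Ring A] [Ring B] [Algebra R A] [Algebra R B]
    (f : A →ₐ[R] B) (a b : ZMod 2) (u v : A) : f (sabr a b u v) = sabr a b (f u) (f v) := by
  simp [sabr]

theorem preInvol_fh (i : Fin ℓ) (r : ℕ) :
    preInvol p k (fh k i r) = mk p k (fh k i r) := by
  simp [preInvol, fh, Gen.parity, psign_zero, gen]

theorem preInvol_fx (e : ℤˣ) (i : Fin ℓ) (r : ℕ) :
    preInvol p k (fx k e i r) =
      psign (vtxParity p i) • mk p k (fx k e i r) := by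
  simp [preInvol, fx, Gen.parity, gen]

theorem preInvol_rel (u v : Free k ℓ) (huv : Rel p k u v) :
    preInvol p k u = preInvol p k v := by
  have key := mk_rel p k huv
  cases huv <;>
    simp only [map_sbr, map_sabr, map_sub, map_add, map_smul, map_zero, preInvol_fh, preInvol_fx,
      sbr_zsmul_left, sbr_zsmul_right, sabr_zsmul_left, sabr_zsmul_right] at key ⊢
  case hh => exact key
  case h0x => rw [key, smul_comm]
  case xx i j r s =>
    rw [key]
    split_ifs with hij
    · subst hij; rw [smul_smul, psign_mul_self, one_smul, preInvol_fh]
    · simp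
  case hx => rw [← smul_sub, key, smul_comm]
  case xxs i j _ _ _ =>
    rw [← smul_sub, ← smul_sub, key, smul_comm (psign (vtxParity p i)) (coef p k _ i j),
      smul_comm (psign (vtxParity p j)) (coef p k _ i j)]
  case hx_odd => rw [key, smul_zero]
  case serre_zero => rw [key, smul_zero, smul_zero]
  case serre_cubic => simp only [← smul_add, key, smul_zero]
  case serre_quartic => rw [key]; simp only [smul_zero]

/-- The parity automorphism of the Yangian: `h_{i,r} ↦ h_{i,r}`,
`x_{i,r}^{±} ↦ (-1)^{|α_i|} x_{i,r}^{±}`. -/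
def invol : Y p k →ₐ[PowerSeries k] Y p k :=
  lift p k (preInvol p k) (preInvol_rel p k)

theorem invol_gen (g : Gen ℓ) : invol p k (gen p k g) = psign (g.parity p) • gen p k g := by
  rw [invol, gen, lift_mk]
  simp [preInvol, gen]

theorem invol_invol (y : Y p k) : invol p k (invol p k y) = y := by
  have : (invol p k).comp (invol p k) = AlgHom.id _ _ := by
    apply hom_ext
    intro g
    change invol p k (invol p k (gen p k g)) = gen p k g
    rw [invol_gen, map_zsmul, invol_gen, smul_smul, psign_mul_self, one_smul]
  exact DFunLike.congr_fun this y

/-- The `ℤ/2`-grading of the Yangian, as eigenspaces of the parity automorphism. By the instance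
and the lemma `gen_mem_grading` below, it is the one in which every generator has its parity. -/
def grading (c : ZMod 2) : Submodule (PowerSeries k) (Y p k) where
  carrier := {y | invol p k y = psign c • y}
  add_mem' := by
    intro u v hu hv
    simp only [Set.mem_ofPred_eq] at *
    rw [map_add, hu, hv, smul_add]
  zero_mem' := by simp
  smul_mem' := by
    intro t u hu
    simp only [Set.mem_ofPred_eq] at *
    rw [map_smul, hu, smul_comm]

theorem mem_grading {c : ZMod 2} {y : Y p k} :
    y ∈ grading p k c ↔ invol p k y = psign c • y := Iff.rfl

theorem gen_mem_grading (g : Gen ℓ) : gen p k g ∈ grading p k (g.parity p) := invol_gen p k g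

instance gradedMonoid : SetLike.GradedMonoid (grading p k) where
  one_mem := by simp [mem_grading, psign_zero]
  mul_mem := by
    intro a b u v hu hv
    rw [mem_grading] at *
    rw [map_mul, hu, hv, smul_mul_smul_comm, psign_add]

/-- `1/2` in `k⟦ħ⟧`. -/
def half : PowerSeries k := PowerSeries.C (1 / 2 : k)

/-- The projection of the Yangian to its part of parity `c`. -/
def proj (c : ZMod 2) : Y p k →ₗ[PowerSeries k] Y p k :=
  half k • (LinearMap.id + psign c • (invol p k).toLinearMap)

theorem proj_apply (c : ZMod 2) (y : Y p k) :
    proj p k c y = half k • (y + psign c • invol p k y) := rfl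

theorem proj_mem (c : ZMod 2) (y : Y p k) : proj p k c y ∈ grading p k c := by
  rw [mem_grading, proj_apply, map_smul, map_add, map_zsmul, invol_invol, smul_comm (psign c),
    smul_add (psign c), smul_smul, psign_mul_self, one_smul, add_comm]

theorem psign_one : psign 1 = -1 := by simp [psign]

theorem proj_ne {c d : ZMod 2} (hcd : d ≠ c) {y : Y p k} (hy : y ∈ grading p k c) :
    proj p k d y = 0 := by
  rw [mem_grading] at hy
  have hd : ∀ c d : ZMod 2, d ≠ c → d = c + 1 := by decide
  have hd := hd c d hcd
  subst hd
  rw [proj_apply, hy, smul_smul, psign_add, psign_one, mul_neg, mul_one, neg_mul, psign_mul_self,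
    neg_smul, one_smul, add_neg_cancel, smul_zero]

variable [CharZero k]

theorem half_add_half : half k + half k = 1 := by
  rw [half, ← map_add]
  norm_num

theorem proj_add_proj (y : Y p k) : proj p k 0 y + proj p k 1 y = y := by
  rw [proj_apply, proj_apply, psign_zero, psign_one, ← smul_add]
  have : y + (1 : ℤ) • invol p k y + (y + (-1 : ℤ) • invol p k y) = y + y := by
    rw [one_smul, neg_smul, one_smul]; abel
  rw [this, smul_add, ← add_smul, half_add_half, one_smul]

theorem proj_self {c : ZMod 2} {y : Y p k} (hy : y ∈ grading p k c) : proj p k c y = y := by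
  rw [mem_grading] at hy
  rw [proj_apply, hy, smul_smul, psign_mul_self, one_smul, smul_add, ← add_smul, half_add_half,
    one_smul]

/-- The projections to the two homogeneous parts, as a map to the direct sum. -/
def decomp : Y p k →ₗ[PowerSeries k] DirectSum (ZMod 2) fun c => grading p k c :=
  ∑ c : ZMod 2, (DirectSum.lof (PowerSeries k) (ZMod 2) (fun c => grading p k c) c).comp
    ((proj p k c).codRestrict (grading p k c) (proj_mem p k c))

instance gradedDecomposition : DirectSum.Decomposition (grading p k) :=
  DirectSum.Decomposition.ofLinearMap (grading p k) (decomp p k)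
    (by
      ext y
      simp only [decomp, LinearMap.comp_apply, LinearMap.sum_apply, map_sum,
        DirectSum.coeLinearMap_lof, LinearMap.codRestrict_apply, LinearMap.id_apply]
      exact (Fin.sum_univ_two _).trans (proj_add_proj p k y))
    (by
      ext c y : 2
      simp only [LinearMap.comp_apply, DirectSum.coeLinearMap_lof, LinearMap.id_apply, decomp,
        LinearMap.sum_apply]
      rw [Finset.sum_eq_single c]
      · congr 1
        exact Subtype.ext (proj_self p k y.2)
      · intro d _ hd
        have : (proj p k d).codRestrict (grading p k d) (proj_mem p k d) (y : Y p k) = 0 :=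
          Subtype.ext (proj_ne p k hd y.2)
        rw [this, map_zero]
      · simp)

instance gradedAlgebra : GradedAlgebra (grading p k) where

/-! ### The graded tensor square of the Yangian -/

/-- `Y ⊗ Y` over `k⟦ħ⟧`, with `(u ⊗ v)(u' ⊗ v') = (-1)^{|v||u'|} u u' ⊗ v v'`. -/
abbrev YY : Type _ := grading p k ᵍ⊗[PowerSeries k] grading p k

/-- The pure tensor `u ⊗ v`. -/
abbrev tens (u v : Y p k) : YY p k := u ᵍ⊗ₜ[PowerSeries k] v

/-- `□(y) = y ⊗ 1 + 1 ⊗ y`. -/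
def box (y : Y p k) : YY p k := tens p k y 1 + tens p k 1 y

/-- The part of parity `c` of `Y ⊗ Y`. -/
def tensorGrading (c : ZMod 2) : Submodule (PowerSeries k) (YY p k) :=
  Submodule.span (PowerSeries k) {t | ∃ (a b : ZMod 2) (u v : Y p k),
    a + b = c ∧ u ∈ grading p k a ∧ v ∈ grading p k b ∧ t = tens p k u v}

/-- The algebra homomorphism `Δ` is a homomorphism of superalgebras: it preserves parities. -/
def IsSuperHom (Δ : Y p k →ₐ[PowerSeries k] YY p k) : Prop :=
  ∀ (c : ZMod 2) (y : Y p k), y ∈ grading p k c → Δ y ∈ tensorGrading p k c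

end Yangian

/-! ### The Lie superalgebra `𝔤 = 𝔰𝔩(V)` and its map to the Yangian -/

section SpecialLinear

variable (k : Type*) [Field k]

/-- The supertrace `∑ (-1)^{p a} A_{aa}`. -/
def supertrace : Matrix (Fin (ℓ + 1)) (Fin (ℓ + 1)) k →ₗ[k] k where
  toFun A := ∑ a, psign (p a) • A a a
  map_add' A B := by simp [Finset.sum_add_distrib]
  map_smul' t A := by simp [Finset.mul_sum, mul_left_comm]

/-- The matrices of supertrace zero. -/
def sl : Submodule k (Matrix (Fin (ℓ + 1)) (Fin (ℓ + 1)) k) := LinearMap.ker (supertrace p k)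

/-- The matrix `A` is homogeneous of parity `c`. -/
def IsHomog {k : Type*} [Field k] (c : ZMod 2) (A : Matrix (Fin (ℓ + 1)) (Fin (ℓ + 1)) k) : Prop :=
  ∀ a b, p a + p b ≠ c → A a b = 0

variable {k} in
theorem supertrace_mul_comm {a b : ZMod 2} {A B : Matrix (Fin (ℓ + 1)) (Fin (ℓ + 1)) k}
    (hA : IsHomog p a A) (hB : IsHomog p b B) :
    supertrace p k (A * B) = psign (a * b) • supertrace p k (B * A) := by
  simp only [supertrace, LinearMap.coe_mk, AddHom.coe_mk, Matrix.mul_apply, Finset.smul_sum]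
  rw [Finset.sum_comm]
  refine Finset.sum_congr rfl fun d _ => Finset.sum_congr rfl fun c _ => ?_
  by_cases h1 : p c + p d = a
  · by_cases h2 : p d + p c = b
    · have hab : a = b := by rw [← h1, ← h2, add_comm]
      subst hab
      have hsq : ∀ t : ZMod 2, t * t = t := by decide
      rw [hsq, ← h1, psign_add, smul_smul, mul_assoc, psign_mul_self, mul_one, mul_comm (A c d)]
    · simp [hB d c h2]
  · simp [hA c d h1]

variable {k} in
/-- `𝔰𝔩(V)` is closed under the super bracket. -/
theorem sbr_mem_sl {a b : ZMod 2} {A B : Matrix (Fin (ℓ + 1)) (Fin (ℓ + 1)) k}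
    (hA : IsHomog p a A) (hB : IsHomog p b B) : sbr a b A B ∈ sl p k := by
  rw [sl, LinearMap.mem_ker, sbr, map_sub, map_zsmul, supertrace_mul_comm p hA hB, sub_self]

/-- The root vector `e_α = E_{ab}` for `α = ε_a - ε_b`, `a < b`. -/
def rootE (α : PosRoot ℓ) : sl p k := ⟨Matrix.single α.1.1 α.1.2 1, by
  rw [sl, LinearMap.mem_ker]
  change ∑ c, psign (p c) • Matrix.single _ _ _ c c = (0 : k)
  refine Finset.sum_eq_zero fun c _ => ?_
  rw [Matrix.single_apply_of_ne, smul_zero]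
  rintro ⟨h1, h2⟩
  exact α.2.ne (h1.trans h2.symm)⟩

/-- The root vector `f_α = (-1)^{p a} E_{ba}` for `α = ε_a - ε_b`, `a < b`. It is dual to `e_α`
for the supertrace form `⟨A, B⟩ = str (A B)`. -/
def rootF (α : PosRoot ℓ) : sl p k := ⟨Matrix.single α.1.2 α.1.1 (psign (p α.1.1) : k), by
  rw [sl, LinearMap.mem_ker]
  change ∑ c, psign (p c) • Matrix.single _ _ _ c c = (0 : k)
  refine Finset.sum_eq_zero fun c _ => ?_
  rw [Matrix.single_apply_of_ne, smul_zero]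
  rintro ⟨h1, h2⟩
  exact α.2.ne (h2.trans h1.symm)⟩

theorem supertrace_rootE_mul_rootF (α : PosRoot ℓ) :
    supertrace p k ((rootE p k α : Matrix _ _ k) * (rootF p k α : Matrix _ _ k)) = 1 := by
  simp only [rootE, rootF, supertrace, LinearMap.coe_mk, AddHom.coe_mk,
    Matrix.single_mul_single_same, one_mul]
  rw [Finset.sum_eq_single α.1.1]
  · rw [Matrix.single_apply_same, zsmul_eq_mul, ← Int.cast_mul, psign_mul_self, Int.cast_one]
  · intro c _ hc
    rw [Matrix.single_apply_of_ne, smul_zero]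
    rintro ⟨h1, -⟩
    exact hc h1.symm
  · simp

/-- The element `h_i = [e_i, f_i]`, that is,
`(-1)^{p i} E_{ii} - (-1)^{p (i+1)} E_{i+1,i+1}`. -/
def cartanH (i : Fin ℓ) : sl p k :=
  ⟨sbr (vtxParity p i) (vtxParity p i) (rootE p k (simpleRoot i) : Matrix _ _ k)
    (rootF p k (simpleRoot i) : Matrix _ _ k), by
    apply sbr_mem_sl
    · intro a b hab
      apply Matrix.single_apply_of_ne
      rintro ⟨rfl, rfl⟩
      exact hab rfl
    · intro a b hab
      apply Matrix.single_apply_of_ne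
      rintro ⟨rfl, rfl⟩
      exact hab (add_comm _ _)⟩

/-- An orthonormal basis, for the supertrace form, of the Cartan subalgebra of diagonal matrices
in `𝔰𝔩(V)` (orthonormality and the number `ℓ` of elements make it a basis). -/
structure IsOrthonormalCartan (b : Fin ℓ → sl p k) : Prop where
  diag : ∀ i, (b i : Matrix (Fin (ℓ + 1)) (Fin (ℓ + 1)) k).IsDiag
  orthonormal : ∀ i j, supertrace p k ((b i : Matrix (Fin (ℓ + 1)) (Fin (ℓ + 1)) k) *
    (b j : Matrix (Fin (ℓ + 1)) (Fin (ℓ + 1)) k)) = if i = j then 1 else 0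

/-- `φ` is the homomorphism of Lie superalgebras `𝔤 → Y_ħ(𝔤)` with `h_i ↦ h_{i,0}`,
`e_i ↦ x_{i,0}^+`, `f_i ↦ x_{i,0}^-`. -/
structure IsCanonicalMap (φ : sl p k →ₗ[k] Y p k) : Prop where
  even : ∀ (c : ZMod 2) (A : sl p k), IsHomog p c (A : Matrix _ _ k) → φ A ∈ grading p k c
  bracket : ∀ (a b : ZMod 2) (A B : sl p k) (hA : IsHomog p a (A : Matrix _ _ k))
    (hB : IsHomog p b (B : Matrix _ _ k)),
    φ ⟨sbr a b (A : Matrix _ _ k) (B : Matrix _ _ k), sbr_mem_sl p hA hB⟩ = sbr a b (φ A) (φ B)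
  map_h : ∀ i, φ (cartanH p k i) = hGen p k i 0
  map_e : ∀ i, φ (rootE p k (simpleRoot i)) = xGen p k 1 i 0
  map_f : ∀ i, φ (rootF p k (simpleRoot i)) = xGen p k (-1) i 0

variable {k} [CharZero k] (φ : sl p k →ₗ[k] Y p k)

/-- The half `Ω^+ = ∑ h^{(i)} ⊗ h^{(i)} + ∑_{α > 0} f_α ⊗ e_α` of the Casimir element, for an
orthonormal basis `h^{(i)}` of the Cartan subalgebra. -/
def omegaPlus (b : Fin ℓ → sl p k) : YY p k :=
  ∑ i, tens p k (φ (b i)) (φ (b i)) +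
    ∑ α : PosRoot ℓ, tens p k (φ (rootF p k α)) (φ (rootE p k α))

/-- The first rule: `Δ(A) = □(A)` for `A` in `𝔤`. -/
def PrimitiveRule (Δ : Y p k →ₐ[PowerSeries k] YY p k) : Prop :=
  ∀ A : sl p k, Δ (φ A) = box p k (φ A)

/-- The second rule: `Δ(h_{i1}) = □(h_{i1}) + ħ (h_{i0} ⊗ h_{i0} + [h_{i0} ⊗ 1, Ω^+])`. -/
def CasimirRule (b : Fin ℓ → sl p k) (Δ : Y p k →ₐ[PowerSeries k] YY p k) : Prop :=
  ∀ i : Fin ℓ, Δ (hGen p k i 1) = box p k (hGen p k i 1) +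
    (PowerSeries.X : PowerSeries k) • (tens p k (hGen p k i 0) (hGen p k i 0) +
      sbr 0 0 (tens p k (hGen p k i 0) 1) (omegaPlus p φ b))

/-- The second rule written out, without the Cartan part of `Ω^+` (which commutes with
`h_{i0} ⊗ 1`):
`Δ(h_{i1}) = □(h_{i1}) + ħ (h_{i0} ⊗ h_{i0} - ∑_{α > 0} (α_i, α) f_α ⊗ e_α)`. -/
def ExplicitRule (Δ : Y p k →ₐ[PowerSeries k] YY p k) : Prop :=
  ∀ i : Fin ℓ, Δ (hGen p k i 1) = box p k (hGen p k i 1) +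
    (PowerSeries.X : PowerSeries k) • (tens p k (hGen p k i 0) (hGen p k i 0) -
      ∑ α : PosRoot ℓ, rootForm p (simpleRoot i) α •
        tens p k (φ (rootF p k α)) (φ (rootE p k α)))

end SpecialLinear

end SuperYangian

end

noncomputable section

namespace SuperYangian

/-! ### Calculus of super brackets -/

section SuperBracket

/-! Uniqueness of the coproduct and its existence rest on the same observation. Put `t_i = h_{i1} -
(ħ/2) h_{i0}²`. Then `[t_i, x_{jr}^±] = ± c_{ij} x_{j,r+1}^±`. Every vertex has a neighbour, and the
Cartan entry of two neighbours is `±1`, so the `x_{i0}^±` and `h_{i1}` generate `Y`, and a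
homomorphism is determined by its values on them (`hom_ext_of_zero_one`).

For existence it suffices to solve, in any `k⟦ħ⟧`-algebra, the relations among the generators of
levels zero and one (`MinRel`): all defining relations follow from these (`MinRel.lift_rel`). Higher
`x_{ir}^±` are defined by iterating `ad t_a`. Applied to a relation between distinct vertices, `ad
t_a` raises the levels with coefficients from two columns of the Cartan matrix. Such columns are
linearly independent (`Admissible.columns_indep`), which is where three vertices with ends of equal
parity must be excluded, so a relation at level zero spreads to all levels. At a single vertex `ad
t_a` cannot separate the levels. There one uses a current `H(u) = ∑ h_r u^r`: conjugation by `1 + ħ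
u H(u)` acts on the shifted sequences `sh` through the twisted derivations `IsTwisted`, and
comparing coefficients gives the missing extreme term (`quadratic_step`, `cubic_step`). The delicate
point is that `[x_{ir}^+, x_{is}^-]` depends on `r + s` only and that the `h_{ir}` commute. In
degree `N` the defects `d_i` of neighbouring vertices satisfy `d_i = -N d_j` and `d_j = -N d_i`,
hence vanish for `N ≥ 2` (`MinRel.good_all`).

The solution in `Y ⊗ Y` that gives the coproduct is `□` on level zero and `T_i = □(t_i) + ħ ω_i`,
where `ω_i = [h_{i0} ⊗ 1, Ω] = -∑ (α_i, α) f_α ⊗ e_α` and `Ω = ∑ f_α ⊗ e_α`. Since `[Ω, □(x_j^+)] =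
-h_j ⊗ x_j^+` and `[Ω, □(x_j^-)] = x_j^- ⊗ h_j`, the remaining relations of level one other than
`[T_i, T_j] = 0` follow from the derivation property of `ad Ω` and `ad ω_i`. The relation `[T_i,
T_j] = 0` needs the action of `t_i` on all root vectors (`IsRootFamily.lie_tGen`). Its
anticommutator terms combine into commutators of the tensors `f_α ⊗ e_α`, and what is left is
symmetric in `i` and `j` (`lie_box_tGen_omegaPart`).

The map from `𝔰𝔩(V)` is built by realizing matrix units as nested brackets of simple root vectors,
whose brackets are controlled by the Serre relations (`IsChain`). On the diagonal a choice is
needed, and the resulting error in the bracket is a multiple of the supertrace, so it disappears on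
`𝔰𝔩(V)`. Uniqueness holds because the simple root vectors generate. -/

theorem zmod_two_cases (a : ZMod 2) : a = 0 ∨ a = 1 := by revert a; decide

theorem zmod_two_one_add_one : (1 + 1 : ZMod 2) = 0 := by decide

variable {A : Type*} [Ring A]

theorem sbr_zero_left (b : ZMod 2) (x y : A) : sbr 0 b x y = ⁅x, y⁆ := by
  simp [sbr, psign_zero, Ring.lie_def]

theorem sbr_zero_right (a : ZMod 2) (x y : A) : sbr a 0 x y = ⁅x, y⁆ := by
  simp [sbr, psign_zero, Ring.lie_def]

theorem sabr_zero_left (b : ZMod 2) (x y : A) : sabr 0 b x y = x * y + y * x := by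
  simp [sabr, psign_zero]

theorem sbr_one_one (x y : A) : sbr 1 1 x y = x * y + y * x := by
  simp [sbr, psign_one]

/-- The parities are parameters and are not read off from the elements, so this is an identity in
every associative ring, checked for the eight parity triples. No grading of the target algebra is
needed in the minimalistic presentation. -/
theorem sbr_jacobi (a b c : ZMod 2) (x y z : A) :
    sbr a (b + c) x (sbr b c y z) =
      sbr (a + b) c (sbr a b x y) z + psign (a * b) • sbr b (a + c) y (sbr a c x z) := by
  rcases zmod_two_cases a with rfl | rfl <;> rcases zmod_two_cases b with rfl | rfl <;>
    rcases zmod_two_cases c with rfl | rfl <;>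
    simp only [sbr, psign_zero, psign_one, zero_add, add_zero, zmod_two_one_add_one, mul_one,
      mul_zero, one_smul, neg_smul] <;> noncomm_ring

theorem sbr_skew (a b : ZMod 2) (x y : A) : sbr a b x y = -(psign (a * b) • sbr b a y x) := by
  rcases zmod_two_cases a with rfl | rfl <;> rcases zmod_two_cases b with rfl | rfl <;>
    simp only [sbr, psign_zero, psign_one, mul_one, mul_zero, one_smul, neg_smul] <;>
    noncomm_ring

theorem sbr_sabr (a b c : ZMod 2) (x y z : A) :
    sbr a (b + c) x (sabr b c y z) =
      sabr (a + b) c (sbr a b x y) z + psign (a * b) • sabr b (a + c) y (sbr a c x z) := by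
  rcases zmod_two_cases a with rfl | rfl <;> rcases zmod_two_cases b with rfl | rfl <;>
    rcases zmod_two_cases c with rfl | rfl <;>
    simp only [sbr, sabr, psign_zero, psign_one, zero_add, add_zero, zmod_two_one_add_one, mul_one,
      mul_zero, one_smul, neg_smul] <;> noncomm_ring

theorem sbr_jacobi_left (a b c : ZMod 2) (x y z : A) :
    sbr (a + b) c (sbr a b x y) z =
      sbr a (b + c) x (sbr b c y z) - psign (a * b) • sbr b (a + c) y (sbr a c x z) := by
  rw [sbr_jacobi]; abel

theorem sbr_add_left (a b : ZMod 2) (x x' y : A) :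
    sbr a b (x + x') y = sbr a b x y + sbr a b x' y := by
  simp only [sbr, add_mul, mul_add, smul_add]; abel

theorem sbr_add_right (a b : ZMod 2) (x y y' : A) :
    sbr a b x (y + y') = sbr a b x y + sbr a b x y' := by
  simp only [sbr, add_mul, mul_add, smul_add]; abel

theorem sbr_neg_left (a b : ZMod 2) (x y : A) : sbr a b (-x) y = -sbr a b x y := by
  simp only [sbr, neg_mul, mul_neg, smul_neg]; abel

theorem sbr_neg_right (a b : ZMod 2) (x y : A) : sbr a b x (-y) = -sbr a b x y := by
  simp only [sbr, neg_mul, mul_neg, smul_neg]; abel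

theorem sbr_sub_left (a b : ZMod 2) (x x' y : A) :
    sbr a b (x - x') y = sbr a b x y - sbr a b x' y := by
  simp only [sub_eq_add_neg, sbr_add_left, sbr_neg_left]

theorem sbr_zero_elt_left (a b : ZMod 2) (y : A) : sbr a b 0 y = 0 := by simp [sbr]

theorem sbr_zero_elt_right (a b : ZMod 2) (x : A) : sbr a b x 0 = 0 := by simp [sbr]

theorem sabr_add_left (a b : ZMod 2) (x x' y : A) :
    sabr a b (x + x') y = sabr a b x y + sabr a b x' y := by
  simp only [sabr, add_mul, mul_add, smul_add]; abel

theorem sabr_add_right (a b : ZMod 2) (x y y' : A) :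
    sabr a b x (y + y') = sabr a b x y + sabr a b x y' := by
  simp only [sabr, add_mul, mul_add, smul_add]; abel

theorem sabr_zero_elt_left (a b : ZMod 2) (y : A) : sabr a b 0 y = 0 := by simp [sabr]

theorem sabr_zero_elt_right (a b : ZMod 2) (x : A) : sabr a b x 0 = 0 := by simp [sabr]

/-- The commutator with a fixed element is a derivation of the super bracket. -/
theorem lie_sbr (a b : ZMod 2) (t x y : A) :
    ⁅t, sbr a b x y⁆ = sbr a b ⁅t, x⁆ y + sbr a b x ⁅t, y⁆ := by
  simp only [sbr, Ring.lie_def, mul_sub, sub_mul, smul_sub, mul_smul_comm, smul_mul_assoc,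
    mul_assoc]
  abel

theorem lie_sabr (a b : ZMod 2) (t x y : A) :
    ⁅t, sabr a b x y⁆ = sabr a b ⁅t, x⁆ y + sabr a b x ⁅t, y⁆ := by
  simp only [sabr, Ring.lie_def, mul_add, add_mul, mul_sub, sub_mul, smul_sub,
    mul_smul_comm, smul_mul_assoc, mul_assoc]
  abel

theorem lie_mul (t x y : A) : ⁅t, x * y⁆ = ⁅t, x⁆ * y + x * ⁅t, y⁆ := by
  simp only [Ring.lie_def]; noncomm_ring

theorem rlie_add (t x y : A) : ⁅t, x + y⁆ = ⁅t, x⁆ + ⁅t, y⁆ := by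
  simp only [Ring.lie_def]; noncomm_ring

theorem rlie_sub (t x y : A) : ⁅t, x - y⁆ = ⁅t, x⁆ - ⁅t, y⁆ := by
  simp only [Ring.lie_def]; noncomm_ring

theorem rlie_neg (t x : A) : ⁅t, -x⁆ = -⁅t, x⁆ := by
  simp only [Ring.lie_def]; noncomm_ring

theorem rlie_zero (t : A) : ⁅t, (0 : A)⁆ = 0 := by
  simp only [Ring.lie_def, mul_zero, zero_mul, sub_zero]

theorem add_rlie (t t' x : A) : ⁅t + t', x⁆ = ⁅t, x⁆ + ⁅t', x⁆ := by
  simp only [Ring.lie_def]; noncomm_ring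

theorem rlie_sum {ι : Type*} (s : Finset ι) (t : A) (f : ι → A) :
    ⁅t, ∑ i ∈ s, f i⁆ = ∑ i ∈ s, ⁅t, f i⁆ := by
  simp only [Ring.lie_def, Finset.sum_mul, Finset.mul_sum, Finset.sum_sub_distrib]

theorem rlie_skew (x y : A) : ⁅x, y⁆ = -⁅y, x⁆ := by
  simp only [Ring.lie_def]; noncomm_ring

theorem rlie_jacobi (x y z : A) : ⁅x, ⁅y, z⁆⁆ = ⁅⁅x, y⁆, z⁆ + ⁅y, ⁅x, z⁆⁆ := by
  simp only [Ring.lie_def]; noncomm_ring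

theorem lie_zsmul_right (n : ℤ) (t x : A) : ⁅t, n • x⁆ = n • ⁅t, x⁆ := by
  simp only [Ring.lie_def, mul_smul_comm, smul_mul_assoc, smul_sub]

theorem sbr_sum_left {ι : Type*} (s : Finset ι) (a b : ZMod 2) (f : ι → A) (y : A) :
    sbr a b (∑ i ∈ s, f i) y = ∑ i ∈ s, sbr a b (f i) y := by
  simp only [sbr, Finset.sum_mul, Finset.mul_sum, Finset.smul_sum, Finset.sum_sub_distrib]

theorem sbr_sum_right {ι : Type*} (s : Finset ι) (a b : ZMod 2) (x : A) (f : ι → A) :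
    sbr a b x (∑ i ∈ s, f i) = ∑ i ∈ s, sbr a b x (f i) := by
  simp only [sbr, Finset.sum_mul, Finset.mul_sum, Finset.smul_sum, Finset.sum_sub_distrib]

variable {R : Type*} [CommRing R] [Algebra R A]

theorem sbr_smul_left (a b : ZMod 2) (r : R) (x y : A) :
    sbr a b (r • x) y = r • sbr a b x y := by
  simp only [sbr, smul_mul_assoc, mul_smul_comm, smul_sub, smul_comm r]

theorem sbr_smul_right (a b : ZMod 2) (r : R) (x y : A) :
    sbr a b x (r • y) = r • sbr a b x y := by
  simp only [sbr, smul_mul_assoc, mul_smul_comm, smul_sub, smul_comm r]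

theorem lie_smul_right (r : R) (t x : A) : ⁅t, r • x⁆ = r • ⁅t, x⁆ := by
  simp only [Ring.lie_def, mul_smul_comm, smul_mul_assoc, smul_sub]

end SuperBracket

theorem psign_eq_one_or (a : ZMod 2) : psign a = 1 ∨ psign a = -1 := by
  rcases zmod_two_cases a with rfl | rfl
  · exact Or.inl psign_zero
  · exact Or.inr psign_one

/-! ### The Cartan matrix -/

section Cartan

variable {ℓ : ℕ} (p : Fin (ℓ + 1) → ZMod 2)

theorem rootForm_comm (α β : PosRoot ℓ) : rootForm p α β = rootForm p β α := by
  unfold rootForm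
  exact Finset.sum_congr rfl fun a _ => by ring

theorem cartan_comm (i j : Fin ℓ) : cartan p i j = cartan p j i := rootForm_comm _ _ _

theorem Adjacent.symm {i j : Fin ℓ} (h : Adjacent i j) : Adjacent j i := Or.symm h

theorem Adjacent.ne {i j : Fin ℓ} (h : Adjacent i j) : i ≠ j := by
  rintro rfl; rcases h with h | h <;> omega

/-- The form `(ε_a - ε_b, ε_c - ε_d)`. -/
theorem rootForm_eq (α β : PosRoot ℓ) :
    rootForm p α β = psign (p α.1.1) * (weight β α.1.1) - psign (p α.1.2) * weight β α.1.2 := by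
  unfold rootForm
  conv_lhs => enter [2, a]; rw [weight]
  simp only [Pi.sub_apply, mul_sub, sub_mul, Finset.sum_sub_distrib]
  congr 1 <;>
  · rw [Finset.sum_eq_single_of_mem _ (Finset.mem_univ _)]
    · rw [Pi.single_eq_same, mul_one]
    · intro b _ hb
      rw [Pi.single_eq_of_ne hb]; ring

theorem cartan_self (i : Fin ℓ) :
    cartan p i i = psign (p i.castSucc) + psign (p i.succ) := by
  rw [cartan, rootForm_eq]
  have h : i.castSucc ≠ i.succ := Fin.castSucc_lt_succ.ne
  simp [simpleRoot, weight, h, h.symm]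

theorem cartan_succ {i j : Fin ℓ} (hij : (i : ℕ) + 1 = j) :
    cartan p i j = -psign (p j.castSucc) := by
  rw [cartan, rootForm_eq]
  have h1 : i.succ = j.castSucc := Fin.ext (by simpa using hij)
  have h2 : i.castSucc ≠ j.castSucc := fun h => by simp [Fin.ext_iff] at h; omega
  have h3 : i.castSucc ≠ j.succ := fun h => by simp [Fin.ext_iff] at h; omega
  have h4 : j.castSucc ≠ j.succ := Fin.castSucc_lt_succ.ne
  simp [simpleRoot, weight, h1, h2, h3, h4]

theorem cartan_of_lt {i j : Fin ℓ} (hij : (i : ℕ) + 1 < j) : cartan p i j = 0 := by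
  rw [cartan, rootForm_eq]
  have h1 : i.castSucc ≠ j.castSucc := fun h => by simp [Fin.ext_iff] at h; omega
  have h2 : i.castSucc ≠ j.succ := fun h => by simp [Fin.ext_iff] at h; omega
  have h3 : i.succ ≠ j.castSucc := fun h => by simp [Fin.ext_iff] at h; omega
  have h4 : i.succ ≠ j.succ := fun h => by simp [Fin.ext_iff] at h; omega
  simp only [simpleRoot, weight, Pi.sub_apply, Pi.single_apply, h1, h2, h3, h4, if_false,
    sub_self, mul_zero]

theorem cartan_eq_zero_of_not_adjacent {i j : Fin ℓ} (h : i ≠ j) (h' : ¬ Adjacent i j) :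
    cartan p i j = 0 := by
  rcases lt_or_gt_of_ne (Fin.val_ne_of_ne h) with hl | hl
  · exact cartan_of_lt p (by unfold Adjacent at h'; omega)
  · rw [cartan_comm]; exact cartan_of_lt p (by unfold Adjacent at h'; omega)

theorem cartan_adjacent {i j : Fin ℓ} (h : Adjacent i j) :
    cartan p i j = 1 ∨ cartan p i j = -1 := by
  rcases h with h | h
  · rw [cartan_succ p h]
    rcases psign_eq_one_or (p j.castSucc) with h | h <;> simp [h]
  · rw [cartan_comm, cartan_succ p h]
    rcases psign_eq_one_or (p i.castSucc) with h | h <;> simp [h]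

theorem cartan_adjacent_sq {i j : Fin ℓ} (h : Adjacent i j) :
    cartan p i j * cartan p i j = 1 := by
  rcases cartan_adjacent p h with h | h <;> simp [h]

theorem vtxParity_eq (i : Fin ℓ) : vtxParity p i = p i.castSucc + p i.succ := rfl

theorem psign_of_even {i : Fin ℓ} (h : vtxParity p i = 0) :
    psign (p i.succ) = psign (p i.castSucc) := by
  have : ∀ a b : ZMod 2, a + b = 0 → b = a := by decide
  rw [this (p i.castSucc) (p i.succ) h]

theorem psign_of_odd {i : Fin ℓ} (h : vtxParity p i = 1) :
    psign (p i.succ) = -psign (p i.castSucc) := by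
  have : ∀ a b : ZMod 2, a + b = 1 → b = a + 1 := by decide
  rw [this (p i.castSucc) (p i.succ) h, psign_add, psign_one]; ring

theorem cartan_even {i : Fin ℓ} (h : vtxParity p i = 0) :
    cartan p i i = 2 * psign (p i.castSucc) := by
  rw [cartan_self, psign_of_even p h]; ring

theorem cartan_odd {i : Fin ℓ} (h : vtxParity p i = 1) : cartan p i i = 0 := by
  rw [cartan_self, psign_of_odd p h]; ring

theorem cartan_even_ne {i : Fin ℓ} (h : vtxParity p i = 0) : cartan p i i ≠ 0 := by
  rw [cartan_even p h]
  rcases psign_eq_one_or (p i.castSucc) with h | h <;> simp [h]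

variable {p}

theorem Admissible.exists_adjacent (hp : Admissible p) (j : Fin ℓ) :
    ∃ i : Fin ℓ, Adjacent i j := by
  have h2 := hp.two_le
  have hj := j.2
  by_cases h : (j : ℕ) + 1 < ℓ
  · exact ⟨⟨j + 1, h⟩, Or.inr rfl⟩
  · exact ⟨⟨j - 1, by omega⟩, Or.inl (by simp only; omega)⟩

end Cartan

/-! ### Independence of columns of the Cartan matrix -/

section Independence

variable {ℓ : ℕ} {p : Fin (ℓ + 1) → ZMod 2} {M : Type*} [AddCommGroup M] [IsAddTorsionFree M]

theorem eq_zero_of_zsmul {n : ℤ} (hn : n ≠ 0) {x : M} (h : n • x = 0) : x = 0 :=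
  (IsAddTorsionFree.zsmul_eq_zero_iff_right hn).mp h

theorem cartan_adjacent_ne {i j : Fin ℓ} (h : Adjacent i j) : cartan p i j ≠ 0 := by
  rcases cartan_adjacent p h with h | h <;> simp [h]

/-- Two distinct columns of the Cartan matrix are linearly independent. -/
theorem Admissible.columns_indep (hp : Admissible p) {i j : Fin ℓ} (hij : i ≠ j) {u v : M}
    (h : ∀ a, cartan p a i • u + cartan p a j • v = 0) : u = 0 ∧ v = 0 := by
  have of_left : u = 0 → u = 0 ∧ v = 0 := by
    intro hu
    obtain ⟨a, ha⟩ := hp.exists_adjacent j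
    have := h a
    rw [hu, smul_zero, zero_add] at this
    exact ⟨hu, eq_zero_of_zsmul (cartan_adjacent_ne ha) this⟩
  have of_right : v = 0 → u = 0 ∧ v = 0 := by
    intro hv
    obtain ⟨a, ha⟩ := hp.exists_adjacent i
    have := h a
    rw [hv, smul_zero, add_zero] at this
    exact ⟨eq_zero_of_zsmul (cartan_adjacent_ne ha) this, hv⟩
  by_cases hadj : Adjacent i j
  · apply of_left
    have h1 := h i
    have h2 := h j
    have hsq := cartan_adjacent_sq p hadj
    rw [cartan_comm p j i] at h2
    set c := cartan p i j
    -- Rows `i` and `j` give a minor with determinant `c_ii c_jj - c_ij²`. It is odd, hence nonzero,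
    -- because `c_ij² = 1` and `c_ii` is even.
    have h3 : (1 - cartan p i i * cartan p j j) • u = 0 := by
      have : (1 - cartan p i i * cartan p j j) • u =
          c • (c • u + cartan p j j • v) - cartan p j j • (cartan p i i • u + c • v)
            + (1 - c * c) • u := by module
      rw [this, h1, h2, hsq]; simp
    refine eq_zero_of_zsmul ?_ h3
    have hi : ∃ m, cartan p i i = 2 * m := by
      rcases zmod_two_cases (vtxParity p i) with hi | hi
      · exact ⟨_, cartan_even p hi⟩
      · exact ⟨0, cartan_odd p hi⟩
    obtain ⟨m, hm⟩ := hi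
    rw [hm, mul_assoc]
    omega
  · have h0 := cartan_eq_zero_of_not_adjacent p hij hadj
    rcases zmod_two_cases (vtxParity p i) with hi | hi
    · apply of_left
      have := h i
      rw [h0, zero_smul, add_zero] at this
      exact eq_zero_of_zsmul (cartan_even_ne p hi) this
    rcases zmod_two_cases (vtxParity p j) with hj | hj
    · apply of_right
      have := h j
      rw [cartan_comm, h0, zero_smul, zero_add] at this
      exact eq_zero_of_zsmul (cartan_even_ne p hj) this
    -- Both vertices are odd, so their own rows say nothing. A row `a` adjacent to exactly one of
    -- them isolates one coefficient.
    by_cases hex : ∃ a, (Adjacent a i ∧ a ≠ j ∧ ¬ Adjacent a j) ∨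
        (Adjacent a j ∧ a ≠ i ∧ ¬ Adjacent a i)
    · obtain ⟨a, ⟨h1, h2, h3⟩ | ⟨h1, h2, h3⟩⟩ := hex
      · apply of_left
        have := h a
        rw [cartan_eq_zero_of_not_adjacent p h2 h3, zero_smul, add_zero] at this
        exact eq_zero_of_zsmul (cartan_adjacent_ne h1) this
      · apply of_right
        have := h a
        rw [cartan_eq_zero_of_not_adjacent p h2 h3, zero_smul, zero_add] at this
        exact eq_zero_of_zsmul (cartan_adjacent_ne h1) this
    · exfalso
      have key : ∀ i j : Fin ℓ, (i : ℕ) < j → ¬ Adjacent i j → vtxParity p i = 1 →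
          vtxParity p j = 1 → ∃ a, (Adjacent a i ∧ a ≠ j ∧ ¬ Adjacent a j) ∨
          (Adjacent a j ∧ a ≠ i ∧ ¬ Adjacent a i) := by
        intro i j hlt hn hi hj
        have hj2 := j.2
        simp only [Adjacent, ne_eq, Fin.ext_iff] at hn ⊢
        by_cases h1 : 0 < (i : ℕ)
        · exact ⟨⟨i - 1, by omega⟩, Or.inl (by simp only; omega)⟩
        by_cases h2 : (j : ℕ) + 1 < ℓ
        · exact ⟨⟨j + 1, by omega⟩, Or.inr ⟨Or.inr rfl, by simp only; omega, by simp only; omega⟩⟩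
        by_cases h3 : (i : ℕ) + 2 < j
        · exact ⟨⟨i + 1, by omega⟩, Or.inl ⟨Or.inr rfl, by simp only; omega, by simp only; omega⟩⟩
        -- No row distinguishes the two vertices only if they are the two ends of a diagram with
        -- three vertices.
        exact absurd (hi.trans hj.symm) (hp.three i j (by omega) (by omega) (by omega))
      rcases lt_or_gt_of_ne (Fin.val_ne_of_ne hij) with hl | hl
      · exact hex (key i j hl hadj hi hj)
      · obtain ⟨a, ha⟩ := key j i hl (fun h => hadj h.symm) hj hi
        exact hex ⟨a, ha.symm⟩

/-- If the middle one of three consecutive vertices is odd, the columns of these vertices are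
linearly independent. -/
theorem Admissible.columns_indep_triple (hp : Admissible p) {i j l : Fin ℓ}
    (hij : (i : ℕ) + 1 = j) (hjl : (j : ℕ) + 1 = l) (hj : vtxParity p j = 1) {u v w : M}
    (h : ∀ a, cartan p a i • u + cartan p a j • w + cartan p a l • v = 0) : u = 0 ∧ v = 0 := by
  have hl := l.2
  have hsucc : j.succ = l.castSucc := Fin.ext (by simpa using hjl)
  have hc1 : cartan p i j = -psign (p j.castSucc) := cartan_succ p hij
  have hc2 : cartan p j l = psign (p j.castSucc) := by
    rw [cartan_succ p hjl, ← hsucc, psign_of_odd p hj, neg_neg]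
  have hc3 : cartan p i l = 0 := cartan_of_lt p (by omega)
  have hs := psign_mul_self (p j.castSucc)
  set s := psign (p j.castSucc) with hsdef
  -- Row `j` has zero diagonal entry, as `j` is odd, and opposite entries at its two neighbours.
  have huv : u = v := by
    have h1 := h j
    rw [cartan_comm p j i, hc1, hc2, cartan_odd p hj] at h1
    have : u - v = -s • (-s • u + (0 : ℤ) • w + s • v) + (1 - s * s) • (u - v) := by module
    rw [h1, hs] at this
    simpa [sub_eq_zero] using this
  suffices u = 0 from ⟨this, huv ▸ this⟩
  by_cases h1 : 0 < (i : ℕ)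
  · have h2 := h ⟨i - 1, by omega⟩
    rw [cartan_of_lt p (i := ⟨i - 1, _⟩) (j := j) (by simp only; omega),
      cartan_of_lt p (i := ⟨i - 1, _⟩) (j := l) (by simp only; omega), zero_smul, zero_smul,
      add_zero, add_zero] at h2
    exact eq_zero_of_zsmul (cartan_adjacent_ne (Or.inl (by simp only; omega))) h2
  by_cases h1' : (l : ℕ) + 1 < ℓ
  · have h2 := h ⟨l + 1, by omega⟩
    rw [cartan_comm p _ i, cartan_comm p _ j,
      cartan_of_lt p (i := i) (j := ⟨l + 1, _⟩) (by simp only; omega),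
      cartan_of_lt p (i := j) (j := ⟨l + 1, _⟩) (by simp only; omega), zero_smul, zero_smul,
      zero_add, zero_add] at h2
    rw [huv]
    exact eq_zero_of_zsmul (cartan_adjacent_ne (Or.inr rfl)) h2
  -- The three vertices are the whole diagram. Adding rows `i` and `l` cancels `w` and leaves `(c_ii
  -- + c_ll) u`, where exactly one of the two entries is nonzero because the ends have different
  -- parities.
  have hne := hp.three i l (by omega) (by omega) (by omega)
  have h2 := h i
  have h3 := h l
  rw [hc1, hc3] at h2
  rw [cartan_comm p l i, cartan_comm p l j, hc3, hc2, ← huv] at h3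
  rw [← huv] at h2
  have h4 : (cartan p i i + cartan p l l) • u = 0 := by
    have : (cartan p i i + cartan p l l) • u =
      (cartan p i i • u + -s • w + (0 : ℤ) • u) + ((0 : ℤ) • u + s • w + cartan p l l • u) := by
      module
    rw [this, h2, h3, add_zero]
  refine eq_zero_of_zsmul ?_ h4
  rcases zmod_two_cases (vtxParity p i) with hi | hi <;>
    rcases zmod_two_cases (vtxParity p l) with hl' | hl'
  · exact (hne (hi.trans hl'.symm)).elim
  · rw [cartan_odd p hl', add_zero]; exact cartan_even_ne p hi
  · rw [cartan_odd p hi, zero_add]; exact cartan_even_ne p hl'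
  · exact (hne (hi.trans hl'.symm)).elim

/-- A doubly indexed family with the value zero at the origin that is moved by all `t_a` according
to two distinct columns of the Cartan matrix vanishes. -/
theorem Admissible.family_eq_zero (hp : Admissible p) {B : Type*} [Ring B] [IsAddTorsionFree B]
    {i j : Fin ℓ} (hij : i ≠ j) {t : Fin ℓ → B} {Q : ℕ → ℕ → B} {e e' : ℤˣ} (h0 : Q 0 0 = 0)
    (h : ∀ a r s, ⁅t a, Q r s⁆ =
      ((e : ℤ) * cartan p a i) • Q (r + 1) s + ((e' : ℤ) * cartan p a j) • Q r (s + 1))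
    (r s : ℕ) : Q r s = 0 := by
  have step : ∀ r s, Q r s = 0 → Q (r + 1) s = 0 ∧ Q r (s + 1) = 0 := by
    intro r s hrs
    have h1 : (e : ℤ) • Q (r + 1) s = 0 ∧ (e' : ℤ) • Q r (s + 1) = 0 := by
      apply hp.columns_indep hij
      intro a
      have := h a r s
      rw [hrs, rlie_zero] at this
      rw [this]; module
    exact ⟨eq_zero_of_zsmul e.ne_zero h1.1, eq_zero_of_zsmul e'.ne_zero h1.2⟩
  have hr : ∀ r, Q r 0 = 0 := by
    intro r
    induction r with
    | zero => exact h0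
    | succ r ih => exact (step r 0 ih).1
  induction s with
  | zero => exact hr r
  | succ s ih => exact (step r s ih).2

end Independence

/-! ### Twisted derivations -/

section Twisted

variable {C : Type*} [Ring C] {H w : C}

/-- `H f - f H = f' (1 + w H)`. -/
def IsTwisted (H w f f' : C) : Prop := ⁅H, f⁆ = f' * (1 + w * H)

/-- With `K = 1 + w H` and `w` central, the hypothesis gives `K f = (f + w f') K`. So `f ↦ f + w f'`
behaves like conjugation by `K`, and the formula is the expansion of `(f + w f') (g + w g')`. -/
theorem IsTwisted.mul {f f' g g' : C} (hw : ∀ z, w * z = z * w) (hf : IsTwisted H w f f')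
    (hg : IsTwisted H w g g') : IsTwisted H w (f * g) (f' * g + f * g' + w * (f' * g')) := by
  unfold IsTwisted at *
  have h1 : (1 + w * H) * g = g * (1 + w * H) + w * ⁅H, g⁆ := by
    rw [Ring.lie_def, mul_add, mul_sub, add_mul, ← mul_assoc g w H, ← hw g]; noncomm_ring
  rw [lie_mul, hf, hg, mul_assoc, h1, hg]
  have h2 : f' * (w * (g' * (1 + w * H))) = w * (f' * g') * (1 + w * H) := by
    rw [← mul_assoc f', ← hw f']; simp only [mul_assoc]
  rw [mul_add, h2]
  noncomm_ring

theorem IsTwisted.sub {f f' g g' : C} (hf : IsTwisted H w f f') (hg : IsTwisted H w g g') :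
    IsTwisted H w (f - g) (f' - g') := by
  unfold IsTwisted at *; rw [rlie_sub, hf, hg, sub_mul]

theorem IsTwisted.smul {R : Type*} [CommRing R] [Algebra R C] {f f' : C} (r : R)
    (hf : IsTwisted H w f f') : IsTwisted H w (r • f) (r • f') := by
  unfold IsTwisted at *; rw [lie_smul_right, hf, smul_mul_assoc]

theorem IsTwisted.lie {f f' g g' : C} (hw : ∀ z, w * z = z * w) (hf : IsTwisted H w f f')
    (hg : IsTwisted H w g g') : IsTwisted H w ⁅f, g⁆ (⁅f', g⁆ + ⁅f, g'⁆ + w * ⁅f', g'⁆) := by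
  have := (hf.mul hw hg).sub (hg.mul hw hf)
  rw [Ring.lie_def f g, Ring.lie_def f' g, Ring.lie_def f g', Ring.lie_def f' g', mul_sub]
  convert this using 1
  abel

/-- The commutator with `H` of a super bracket, for a left factor that is twisted from the right
and a right factor that is twisted from the left, up to an error `Z`. -/
theorem lie_twisted_pair (hw : ∀ z, w * z = z * w) (a b : ZMod 2) (c : ℤ) {x y X Y Z : C}
    (hx : ⁅H, x⁆ = c • (X * (1 + w * H))) (hy : ⁅H, y⁆ = -(c • ((1 + w * H) * Y)) + Z) :
    ⁅H, sbr a b x y⁆ = c • (sbr a b X y * (1 + w * H) - (1 + w * H) * sbr a b x Y)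
      + sbr a b x Z + c • (w * X * Z) := by
  set K := 1 + w * H with hK
  have h1 : K * y = y * K + w * ⁅H, y⁆ := by
    rw [hK, Ring.lie_def, mul_add, mul_sub, add_mul, ← mul_assoc y w H, ← hw y]; noncomm_ring
  have h2 : x * K = K * x - w * ⁅H, x⁆ := by
    rw [hK, Ring.lie_def, mul_add, mul_sub, add_mul, ← mul_assoc x w H, ← hw x]; noncomm_ring
  -- The terms in `w X K Y` produced here and in `h4` enter with opposite signs and cancel.
  have h3 : X * K * y = X * y * K - c • (w * (X * K * Y)) + w * (X * Z) := by
    rw [mul_assoc, h1, hy, mul_add X (y * K), ← mul_assoc X w, ← hw X, mul_add (w * X), mul_neg,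
      mul_smul_comm]
    simp only [mul_assoc]; abel
  have h4 : x * (K * Y) = K * x * Y - c • (w * (X * K * Y)) := by
    rw [← mul_assoc, h2, hx, sub_mul, mul_smul_comm, smul_mul_assoc]; simp only [mul_assoc]
  rw [lie_sbr, hx, hy]
  simp only [sbr, smul_mul_assoc, mul_smul_comm, h3, mul_add, add_mul, mul_neg, neg_mul, h4,
    sub_mul, mul_sub, mul_assoc]
  module

/-- The second factor has constant coefficient `1`, so the coefficients of `D` vanish one after
another. This cancels the factor `K` in a twisted identity. -/
theorem eq_zero_of_mul_one_add_X {B R : Type*} [CommRing R] [Ring B] [Algebra R B] {r : R}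
    {D H : PowerSeries B} (h : D * (1 + (r • (PowerSeries.X : PowerSeries B)) * H) = 0) :
    D = 0 := by
  ext n
  induction n using Nat.strong_induction_on with
  | _ n ih =>
    have h1 := congrArg (PowerSeries.coeff n) h
    rw [mul_add, mul_one, map_add, smul_mul_assoc, mul_smul_comm, PowerSeries.coeff_smul] at h1
    have h2 : PowerSeries.coeff n (D * (PowerSeries.X * H)) = 0 := by
      rw [PowerSeries.coeff_mul]
      refine Finset.sum_eq_zero fun q hq => ?_
      have hq := Finset.HasAntidiagonal.mem_antidiagonal.mp hq
      rcases q with ⟨a, b⟩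
      cases b with
      | zero => simp
      | succ b =>
        simp only at hq ⊢
        rw [ih a (by omega), map_zero, zero_mul]
    rw [h2, smul_zero, add_zero] at h1
    simpa using h1

end Twisted

/-! ### Shifted sequences -/

section Shift

variable {R : Type*} [CommRing R] {B : Type*} [Ring B] [Algebra R B]

/-- The sequence `X`, shifted `m` times by `σ + κ`, where `σ` is the shift of the index. -/
def sh (κ : R) (X : ℕ → B) : ℕ → ℕ → B
  | 0, s => X s
  | m + 1, s => sh κ X m (s + 1) + κ • sh κ X m s

/-- The generating series of the iterated shifts. -/
def shSeries (κ : R) (X : ℕ → B) (s : ℕ) : PowerSeries B := PowerSeries.mk fun m => sh κ X m s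

theorem sh_sh (κ : R) (X : ℕ → B) (a m s : ℕ) :
    sh κ (sh κ X a) m s = sh κ X (a + m) s := by
  induction m generalizing s with
  | zero => rfl
  | succ m ih => rw [sh, ih, ih, ← add_assoc, sh]

theorem shSeries_eq (κ : R) (X : ℕ → B) (s : ℕ) :
    shSeries κ X s = PowerSeries.C (X s) +
      PowerSeries.X * (shSeries κ X (s + 1) + κ • shSeries κ X s) := by
  ext n
  cases n with
  | zero => simp [shSeries, sh]
  | succ n => simp [shSeries, sh, PowerSeries.coeff_succ_X_mul]

/-- `sh` in the linear span of the sequence. -/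
theorem sh_map {B' : Type*} [Ring B'] [Algebra R B'] (f : B →ₗ[R] B') (κ : R) (X : ℕ → B)
    (m s : ℕ) : f (sh κ X m s) = sh κ (fun s => f (X s)) m s := by
  induction m generalizing s with
  | zero => rfl
  | succ m ih => rw [sh, map_add, map_smul, ih, ih, sh]

theorem sh_add (κ : R) (X Y : ℕ → B) (m s : ℕ) :
    sh κ (fun s => X s + Y s) m s = sh κ X m s + sh κ Y m s := by
  induction m generalizing s with
  | zero => rfl
  | succ m ih => simp only [sh, ih, smul_add]; abel

theorem sh_congr {κ : R} {X Y : ℕ → B} {m s : ℕ} (h : ∀ b, s ≤ b → b ≤ s + m → X b = Y b) :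
    sh κ X m s = sh κ Y m s := by
  induction m generalizing s with
  | zero => exact h s le_rfl (by omega)
  | succ m ih =>
    rw [sh, sh, ih fun b h1 h2 => h b (by omega) (by omega),
      ih fun b h1 h2 => h b (by omega) (by omega)]

theorem sh_zero (κ : R) (m s : ℕ) : sh κ (fun _ => (0 : B)) m s = 0 := by
  induction m generalizing s with
  | zero => rfl
  | succ m ih => rw [sh, ih, ih, smul_zero, add_zero]

theorem sh_of_lower_zero {κ : R} {X : ℕ → B} {m s : ℕ}
    (h : ∀ b, s ≤ b → b < s + m → X b = 0) : sh κ X m s = X (s + m) := by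
  induction m generalizing s with
  | zero => rfl
  | succ m ih =>
    rw [sh, ih fun b h1 h2 => h b (by omega) (by omega)]
    have : sh κ X m s = sh κ (fun _ => (0 : B)) m s :=
      sh_congr fun b h1 h2 => h b h1 (by omega)
    rw [this, sh_zero, smul_zero, add_zero, show s + 1 + m = s + (m + 1) by omega]

theorem sh_offset (κ : R) (X : ℕ → B) (d m s : ℕ) :
    sh κ (fun b => X (d + b)) m s = sh κ X m (d + s) := by
  induction m generalizing s with
  | zero => rfl
  | succ m ih => rw [sh, ih, ih, sh, add_assoc]

variable (η : R) {h X : ℕ → B} {c : ℤ}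

/-- The current `1 + 2 η u ∑ h_r u^r`. -/
abbrev current (η : R) (h : ℕ → B) : PowerSeries B :=
  1 + ((2 * η) • (PowerSeries.X : PowerSeries B)) * PowerSeries.mk h

theorem coeff_succ_current (h : ℕ → B) (r : ℕ) :
    PowerSeries.coeff (r + 1) (current η h) = (2 * η) • h r := by
  rw [current, map_add, smul_mul_assoc, PowerSeries.coeff_smul, PowerSeries.coeff_succ_X_mul]
  simp [PowerSeries.coeff_one]

theorem smul_X_comm (r : R) (z : PowerSeries B) :
    (r • (PowerSeries.X : PowerSeries B)) * z = z * (r • (PowerSeries.X : PowerSeries B)) := by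
  rw [smul_mul_assoc, mul_smul_comm, PowerSeries.X_mul]

/-- Moving `h` to the right turns the hypothesis into the recursion `⁅h (r + 1), X s⁆ = ⁅h r, X (s +
1) + (c • η) • X s⁆ + 2 (c • η) • X s * h r`, which the product of the shift series with the current
satisfies. The bound `n` allows for relations that are so far known only in low levels. -/
theorem lie_shift_right {n : ℕ} (h0 : ∀ s, ⁅h 0, X s⁆ = c • X s)
    (hr : ∀ r < n, ∀ s, ⁅h (r + 1), X s⁆ - ⁅h r, X (s + 1)⁆ =
      (c • η) • (h r * X s + X s * h r)) (r : ℕ) (hrn : r ≤ n) (s : ℕ) :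
    ⁅h r, X s⁆ = c • PowerSeries.coeff r (shSeries (c • η) X s * current η h) := by
  induction r generalizing s with
  | zero =>
    rw [h0, PowerSeries.coeff_mul]
    simp [shSeries, sh]
  | succ r ih =>
    have h1 := hr r (by omega) s
    rw [sub_eq_iff_eq_add, ih (by omega)] at h1
    have h2 : h r * X s = X s * h r + ⁅h r, X s⁆ := by rw [Ring.lie_def]; abel
    rw [h1, h2, ih (by omega)]
    conv_rhs => rw [shSeries_eq, add_mul, map_add, PowerSeries.coeff_C_mul, coeff_succ_current,
      mul_assoc PowerSeries.X, PowerSeries.coeff_succ_X_mul, add_mul, map_add, smul_mul_assoc,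
      PowerSeries.coeff_smul]
    rw [mul_smul_comm]
    module

/-- The same recursion with `h` moved to the left, which reverses the sign of the shift parameter.
-/
theorem lie_shift_left {n : ℕ} (h0 : ∀ s, ⁅h 0, X s⁆ = c • X s)
    (hr : ∀ r < n, ∀ s, ⁅h (r + 1), X s⁆ - ⁅h r, X (s + 1)⁆ =
      (c • η) • (h r * X s + X s * h r)) (r : ℕ) (hrn : r ≤ n) (s : ℕ) :
    ⁅h r, X s⁆ = c • PowerSeries.coeff r (current η h * shSeries (-(c • η)) X s) := by
  induction r generalizing s with
  | zero =>
    rw [h0, PowerSeries.coeff_mul]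
    simp [shSeries, sh]
  | succ r ih =>
    have h1 := hr r (by omega) s
    rw [sub_eq_iff_eq_add, ih (by omega)] at h1
    have h2 : X s * h r = h r * X s - ⁅h r, X s⁆ := by rw [Ring.lie_def]; abel
    rw [h1, h2, ih (by omega)]
    conv_rhs => rw [shSeries_eq, mul_add, map_add, PowerSeries.coeff_mul_C, coeff_succ_current,
      ← mul_assoc _ PowerSeries.X, ← PowerSeries.X_mul, mul_assoc PowerSeries.X,
      PowerSeries.coeff_succ_X_mul, mul_add, map_add, mul_smul_comm,
      PowerSeries.coeff_smul]
    rw [smul_mul_assoc]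
    module

/-- The shifted sequences are twisted by `h`. -/
theorem isTwisted_sh (h0 : ∀ s, ⁅h 0, X s⁆ = c • X s)
    (hr : ∀ r s, ⁅h (r + 1), X s⁆ - ⁅h r, X (s + 1)⁆ =
      (c • η) • (h r * X s + X s * h r)) (a : ℕ) :
    IsTwisted (PowerSeries.mk h) ((2 * η) • (PowerSeries.X : PowerSeries B))
      (PowerSeries.C (sh (c • η) X a 0))
      (c • PowerSeries.mk fun m => sh (c • η) X (a + m) 0) := by
  -- The relations with `h` are linear in `X` and stable under shifting the index, so they pass to
  -- every iterated shift.
  have h0' : ∀ s, ⁅h 0, sh (c • η) X a s⁆ = c • sh (c • η) X a s := by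
    induction a with
    | zero => exact h0
    | succ a ih => intro s; rw [sh, rlie_add, lie_smul_right, ih, ih]; module
  have hr' : ∀ r s, ⁅h (r + 1), sh (c • η) X a s⁆ - ⁅h r, sh (c • η) X a (s + 1)⁆ =
      (c • η) • (h r * sh (c • η) X a s + sh (c • η) X a s * h r) := by
    clear h0'
    induction a with
    | zero => exact hr
    | succ a ih =>
      intro r s
      have e1 := ih r (s + 1)
      have e2 := ih r s
      rw [sub_eq_iff_eq_add] at e1 e2
      simp only [sh, rlie_add, lie_smul_right, e1, e2, mul_add, add_mul, mul_smul_comm,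
        smul_mul_assoc]
      module
  have key := fun r => lie_shift_right η (n := r) h0' (fun r _ s => hr' r s) r le_rfl 0
  unfold IsTwisted
  ext r
  have e : shSeries (c • η) (fun s => sh (c • η) X a s) 0 =
      PowerSeries.mk fun m => sh (c • η) X (a + m) 0 := by
    ext m; simp [shSeries, sh_sh]
  have := key r
  rw [e] at this
  rw [Ring.lie_def, map_sub, PowerSeries.coeff_mul_C, PowerSeries.coeff_C_mul,
    PowerSeries.coeff_mk, ← Ring.lie_def, this, smul_mul_assoc, map_zsmul]

end Shift

/-! ### Propagation of relations by comparing coefficients of currents -/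

section Vanishing

variable {R : Type*} [CommRing R] {B : Type*} [Ring B] [Algebra R B]

/-- The super bracket as a bilinear map. -/
def sbrLin (R : Type*) [CommRing R] {B : Type*} [Ring B] [Algebra R B] (a b : ZMod 2) :
    B →ₗ[R] B →ₗ[R] B :=
  LinearMap.mk₂ R (sbr a b) (sbr_add_left a b) (sbr_smul_left a b) (sbr_add_right a b)
    (sbr_smul_right a b)

theorem sbr_sh_left (a b : ZMod 2) (κ : R) (X : ℕ → B) (m s : ℕ) (y : B) :
    sbr a b (sh κ X m s) y = sh κ (fun s => sbr a b (X s) y) m s :=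
  sh_map ((sbrLin R a b).flip y) κ X m s

theorem sbr_sh_right (a b : ZMod 2) (κ : R) (x : B) (Y : ℕ → B) (m s : ℕ) :
    sbr a b x (sh κ Y m s) = sh κ (fun s => sbr a b x (Y s)) m s :=
  sh_map (sbrLin R a b x) κ Y m s

theorem lie_sh (κ : R) (x : B) (Y : ℕ → B) (m s : ℕ) :
    ⁅x, sh κ Y m s⁆ = sh κ (fun s => ⁅x, Y s⁆) m s := by
  simp only [← sbr_zero_left 0]
  exact sbr_sh_right 0 0 κ x Y m s

theorem lie_sh_eq_zero {κ : R} {x : B} {Y : ℕ → B} {m s : ℕ}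
    (h : ∀ b, s ≤ b → b ≤ s + m → ⁅x, Y b⁆ = 0) : ⁅x, sh κ Y m s⁆ = 0 := by
  rw [lie_sh, sh_congr h, sh_zero]

theorem coeff_lie_C (F : PowerSeries B) (a : B) (m : ℕ) :
    PowerSeries.coeff m ⁅F, PowerSeries.C a⁆ = ⁅PowerSeries.coeff m F, a⁆ := by
  rw [Ring.lie_def, Ring.lie_def, map_sub, PowerSeries.coeff_mul_C, PowerSeries.coeff_C_mul]

theorem coeff_C_lie (F : PowerSeries B) (a : B) (m : ℕ) :
    PowerSeries.coeff m ⁅PowerSeries.C a, F⁆ = ⁅a, PowerSeries.coeff m F⁆ := by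
  rw [Ring.lie_def, Ring.lie_def, map_sub, PowerSeries.coeff_mul_C, PowerSeries.coeff_C_mul]

theorem C_lie (a b : B) : PowerSeries.C ⁅a, b⁆ = ⁅PowerSeries.C a, PowerSeries.C b⁆ := by
  rw [Ring.lie_def, Ring.lie_def, map_sub, map_mul, map_mul]

theorem C_smul (r : R) (a : B) : PowerSeries.C (r • a) = r • PowerSeries.C a := by
  ext n
  rw [PowerSeries.coeff_smul, PowerSeries.coeff_C, PowerSeries.coeff_C]
  split_ifs <;> simp

theorem coeff_sbr_C (a b : ZMod 2) (F : PowerSeries B) (y : B) (m : ℕ) :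
    PowerSeries.coeff m (sbr a b F (PowerSeries.C y)) = sbr a b (PowerSeries.coeff m F) y := by
  rw [sbr, sbr, map_sub, map_zsmul, PowerSeries.coeff_mul_C, PowerSeries.coeff_C_mul]

theorem coeff_C_sbr (a b : ZMod 2) (F : PowerSeries B) (y : B) (m : ℕ) :
    PowerSeries.coeff m (sbr a b (PowerSeries.C y) F) = sbr a b y (PowerSeries.coeff m F) := by
  rw [sbr, sbr, map_sub, map_zsmul, PowerSeries.coeff_mul_C, PowerSeries.coeff_C_mul]

theorem C_sbr (a b : ZMod 2) (x y : B) :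
    PowerSeries.C (sbr a b x y) = sbr a b (PowerSeries.C x) (PowerSeries.C y) := by
  rw [sbr, sbr, map_sub, map_zsmul, map_mul, map_mul]

/-- The commutator of `h_n` with a super bracket `[X_s, Y_{s'}]`, where `X` has weight `c` and
`Y` has weight `-c`, if the lower terms cancel. -/
theorem lie_sbr_of_shift (η : R) {h X Y : ℕ → B} {c : ℤ} (a b : ZMod 2) (n s s' : ℕ)
    (hX0 : ∀ s, ⁅h 0, X s⁆ = c • X s)
    (hX : ∀ r s, ⁅h (r + 1), X s⁆ - ⁅h r, X (s + 1)⁆ = (c • η) • (h r * X s + X s * h r))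
    (hY0 : ∀ s, ⁅h 0, Y s⁆ = (-c) • Y s)
    (hY : ∀ r < n, ∀ s, ⁅h (r + 1), Y s⁆ - ⁅h r, Y (s + 1)⁆ =
      ((-c) • η) • (h r * Y s + Y s * h r))
    (heq : ∀ m < n, sbr a b (sh (c • η) X m s) (Y s') = sbr a b (X s) (sh (c • η) Y m s'))
    (hcomm : ∀ m r, m + r + 1 = n → ⁅h r, sbr a b (sh (c • η) X m s) (Y s')⁆ = 0) :
    ⁅h n, sbr a b (X s) (Y s')⁆ =
      c • (sbr a b (sh (c • η) X n s) (Y s') - sbr a b (X s) (sh (c • η) Y n s')) := by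
  set w : PowerSeries B := (2 * η) • (PowerSeries.X : PowerSeries B)
  set H : PowerSeries B := PowerSeries.mk h
  set XX := shSeries (c • η) X s
  set YY := shSeries (c • η) Y s'
  -- The relation for `Y` is assumed only below level `n`. The series `Z` is the failure of the
  -- twisted identity; it vanishes in all degrees up to `n` and so does not affect coefficient `n`.
  set Z := ⁅H, PowerSeries.C (Y s')⁆ + c • ((1 + w * H) * YY) with hZ
  have hx : ⁅H, PowerSeries.C (X s)⁆ = c • (XX * (1 + w * H)) := by
    ext r
    rw [coeff_lie_C, PowerSeries.coeff_mk, map_zsmul]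
    exact lie_shift_right η (n := r) hX0 (fun r _ => hX r) r le_rfl s
  have hZ0 : ∀ r ≤ n, PowerSeries.coeff r Z = 0 := by
    intro r hr
    have := lie_shift_left η (n := n) hY0 hY r hr s'
    rw [neg_smul c η, neg_neg, neg_smul] at this
    rw [hZ, map_add, coeff_lie_C, PowerSeries.coeff_mk, map_zsmul, this]
    exact neg_add_cancel _
  have hy : ⁅H, PowerSeries.C (Y s')⁆ = -(c • ((1 + w * H) * YY)) + Z := by rw [hZ]; abel
  have key := congrArg (PowerSeries.coeff n)
    (lie_twisted_pair (smul_X_comm (2 * η)) a b c hx hy)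
  rw [← C_sbr, coeff_lie_C, PowerSeries.coeff_mk, map_add, map_add, coeff_C_sbr, hZ0 n le_rfl,
    sbr_zero_elt_right, add_zero, map_zsmul, map_zsmul] at key
  have e1 : PowerSeries.coeff n (w * XX * Z) = 0 := by
    rw [smul_mul_assoc, smul_mul_assoc, PowerSeries.coeff_smul, mul_assoc]
    cases n with
    | zero => simp
    | succ n =>
      rw [PowerSeries.coeff_succ_X_mul, PowerSeries.coeff_mul, Finset.sum_eq_zero, smul_zero]
      intro q hq
      have := Finset.HasAntidiagonal.mem_antidiagonal.mp hq
      rw [hZ0 _ (by omega), mul_zero]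
  rw [e1, smul_zero, add_zero] at key
  rw [key]
  congr 1
  set S := sbr a b XX (PowerSeries.C (Y s')) with hS
  set T := sbr a b (PowerSeries.C (X s)) YY with hT
  have hSc : ∀ m, PowerSeries.coeff m S = sbr a b (sh (c • η) X m s) (Y s') := by
    intro m; rw [hS, coeff_sbr_C]; simp [XX, shSeries]
  have hTc : ∀ m, PowerSeries.coeff m T = sbr a b (X s) (sh (c • η) Y m s') := by
    intro m; rw [hT, coeff_C_sbr]; simp [YY, shSeries]
  -- Below degree `n` the series `S` and `T` agree, and the coefficients of `S` commute with the
  -- complementary ones of `H`. The part with the factor `w` therefore drops out in degree `n`.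
  have e2 : S * (1 + w * H) - (1 + w * H) * T = S - T + w * (S * H - H * T) := by
    rw [mul_add, add_mul, mul_one, one_mul, ← mul_assoc S w, ← smul_X_comm, mul_sub]
    simp only [mul_assoc]; abel
  have e3 : PowerSeries.coeff n (w * (S * H - H * T)) = 0 := by
    rw [smul_mul_assoc, PowerSeries.coeff_smul]
    cases n with
    | zero => simp
    | succ n =>
      rw [PowerSeries.coeff_succ_X_mul, map_sub, PowerSeries.coeff_mul, PowerSeries.coeff_mul,
        ← Finset.Nat.sum_antidiagonal_swap (n := n)
          (f := fun q => PowerSeries.coeff q.1 H * PowerSeries.coeff q.2 T),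
        ← Finset.sum_sub_distrib, Finset.sum_eq_zero, smul_zero]
      rintro ⟨m, r⟩ hq
      have hq : m + r = n := Finset.HasAntidiagonal.mem_antidiagonal.mp hq
      simp only [Prod.swap]
      rw [hSc, hTc, ← heq m (by omega), PowerSeries.coeff_mk]
      have := hcomm m r (by omega)
      rw [Ring.lie_def, sub_eq_zero] at this
      rw [this, sub_self]
  rw [e2, map_add, e3, add_zero, map_sub, hSc, hTc]

/-- Undoes the shifts: the twisted calculus yields relations for iterated shifts at index zero, and
reading `sh` backwards trades each shift for a raised index. -/
theorem shift_eq_zero {κ : R} {F : ℕ → ℕ → B} (h0 : ∀ a, F a 0 = 0)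
    (h : ∀ a r, F (a + 1) r = F a (r + 1) + κ • F a r) (a r : ℕ) : F a r = 0 := by
  induction r generalizing a with
  | zero => exact h0 a
  | succ r ih =>
    have := h a r
    rw [ih, ih, smul_zero, add_zero] at this
    exact this.symm

/-- By induction on `n = a + b`: along each antidiagonal neighbouring entries are opposite, so one
vanishing end entry kills all of them. In both hypotheses the lower antidiagonals may be used. -/
theorem symm_family_eq_zero {Q : ℕ → ℕ → B}
    (h1 : ∀ n, (∀ a b, a + b < n → Q a b = 0) → Q n 0 = 0)
    (h2 : ∀ n, (∀ a b, a + b < n → Q a b = 0) → ∀ a b, a + b + 1 = n →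
      Q (a + 1) b + Q a (b + 1) = 0) (a b : ℕ) : Q a b = 0 := by
  have : ∀ n a b, a + b = n → Q a b = 0 := by
    intro n
    induction n using Nat.strong_induction_on with
    | _ n ih =>
      have hlow : ∀ a b, a + b < n → Q a b = 0 := fun a b hab => ih _ hab a b rfl
      intro a b
      induction b generalizing a with
      | zero => rintro rfl; exact h1 _ hlow
      | succ b ihb =>
        intro hab
        have := h2 n hlow a b (by omega)
        rwa [ihb (a + 1) (by omega), zero_add] at this
  exact this _ a b rfl

variable [IsAddTorsionFree B]

theorem eq_zero_of_add_self {x : B} (h : x + x = 0) : x = 0 :=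
  eq_zero_of_zsmul (n := 2) (by norm_num) (by rwa [two_smul])

/-- A sum over an antidiagonal vanishes if its symmetrization does. -/
theorem sum_antidiagonal_eq_zero {n : ℕ} {f : ℕ → ℕ → B}
    (h : ∀ a b, a + b = n → f a b + f b a = 0) :
    ∑ q ∈ Finset.HasAntidiagonal.antidiagonal n, f q.1 q.2 = 0 := by
  apply eq_zero_of_add_self
  nth_rw 2 [← Finset.Nat.sum_antidiagonal_swap]
  rw [← Finset.sum_add_distrib]
  exact Finset.sum_eq_zero fun q hq => h _ _ (Finset.HasAntidiagonal.mem_antidiagonal.mp hq)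

section Quadratic

variable {η : R} {h y : ℕ → B} {c : ℤ}

/-- A quadratic relation at level zero propagates to higher levels. -/
theorem quadratic_step (hc : c ≠ 0)
    (hy : ∀ a, IsTwisted (PowerSeries.mk h) ((2 * η) • (PowerSeries.X : PowerSeries B))
      (PowerSeries.C (y a)) (c • PowerSeries.mk fun m => y (a + m)))
    (α κ : R) {q : ℕ → ℕ → B}
    (hq : ∀ a b, q a b = α • (y (a + 1) * y b - y a * y (b + 1)) - κ • (y a * y b))
    (h0 : q 0 0 = 0) (n : ℕ) (hlow : ∀ a b, a + b < n → q a b + q b a = 0) :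
    q n 0 + q 0 n = 0 := by
  set w : PowerSeries B := (2 * η) • (PowerSeries.X : PowerSeries B)
  have hw : ∀ z, w * z = z * w := smul_X_comm (2 * η)
  have hD := ((((hy 1).mul hw (hy 0)).sub ((hy 0).mul hw (hy 1))).smul α).sub
    (((hy 0).mul hw (hy 0)).smul κ)
  set D := α • (c • (PowerSeries.mk fun m => y (1 + m)) * PowerSeries.C (y 0) +
      PowerSeries.C (y 1) * (c • PowerSeries.mk fun m => y (0 + m)) +
      w * (c • (PowerSeries.mk fun m => y (1 + m)) * (c • PowerSeries.mk fun m => y (0 + m))) -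
      (c • (PowerSeries.mk fun m => y (0 + m)) * PowerSeries.C (y 1) +
      PowerSeries.C (y 0) * (c • PowerSeries.mk fun m => y (1 + m)) +
      w * (c • (PowerSeries.mk fun m => y (0 + m)) * (c • PowerSeries.mk fun m => y (1 + m))))) -
      κ • (c • (PowerSeries.mk fun m => y (0 + m)) * PowerSeries.C (y 0) +
      PowerSeries.C (y 0) * (c • PowerSeries.mk fun m => y (0 + m)) +
      w * (c • (PowerSeries.mk fun m => y (0 + m)) * (c • PowerSeries.mk fun m => y (0 + m))))
      with hDdef
  have hzero : α • (PowerSeries.C (y 1) * PowerSeries.C (y 0) -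
      PowerSeries.C (y 0) * PowerSeries.C (y 1)) -
      κ • (PowerSeries.C (y 0) * PowerSeries.C (y 0)) = PowerSeries.C (q 0 0) := by
    rw [hq]; simp only [map_sub, map_mul, C_smul, zero_add]
  rw [hzero, h0, map_zero, IsTwisted, rlie_zero] at hD
  -- The commutator of `H` with the relation of level zero is zero and equals its twisted derivative
  -- `D` times an invertible current.
  have hD0 : D = 0 := eq_zero_of_mul_one_add_X hD.symm
  have hcoef := congrArg (PowerSeries.coeff n) hD0
  have hlast : ∀ F G : PowerSeries B, PowerSeries.coeff n (w * (c • F * (c • G))) =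
      (2 * η) • (c * c) • PowerSeries.coeff n (PowerSeries.X * (F * G)) := by
    intro F G
    rw [smul_mul_assoc, PowerSeries.coeff_smul, smul_mul_assoc, mul_smul_comm, mul_smul_comm,
      mul_smul_comm, map_zsmul, map_zsmul, smul_smul]
  simp only [hDdef, map_sub, map_add, PowerSeries.coeff_smul, hlast, map_zero,
    PowerSeries.coeff_mul_C, PowerSeries.coeff_C_mul, map_zsmul,
    PowerSeries.coeff_mk, zero_add] at hcoef
  set F0 := PowerSeries.mk fun m => y m
  set F1 := PowerSeries.mk fun m => y (1 + m)
  -- The second-order part of `D` is a multiple of `u` times the sum of the `q a b` over the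
  -- antidiagonal `a + b = n - 1`, and symmetrization reduces it to the lower relations. What
  -- remains in degree `n` is `c (q n 0 + q 0 n)`.
  have hsum : PowerSeries.coeff n (PowerSeries.X *
      (α • (F1 * F0 - F0 * F1) - κ • (F0 * F0))) = 0 := by
    cases n with
    | zero => simp
    | succ n =>
      rw [PowerSeries.coeff_succ_X_mul]
      have : PowerSeries.coeff n (α • (F1 * F0 - F0 * F1) - κ • (F0 * F0)) =
          ∑ r ∈ Finset.HasAntidiagonal.antidiagonal n, q r.1 r.2 := by
        simp only [map_sub, PowerSeries.coeff_smul, PowerSeries.coeff_mul, F0, F1,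
          PowerSeries.coeff_mk, hq, Finset.smul_sum, ← Finset.sum_sub_distrib]
        exact Finset.sum_congr rfl fun r _ => by rw [add_comm 1, add_comm 1]
      rw [this]
      exact sum_antidiagonal_eq_zero fun a b hab => hlow a b (by omega)
  have hfin : c • (q n 0 + q 0 n) = 0 := by
    rw [mul_sub, mul_smul_comm, mul_smul_comm, mul_sub] at hsum
    simp only [map_sub, PowerSeries.coeff_smul] at hsum
    rw [hq, hq]
    rw [add_comm 1 n] at hcoef
    simp only [zero_add]
    simp only [smul_mul_assoc, mul_smul_comm] at hcoef
    have h3 := congrArg (fun z => (2 * η) • (c * c) • z) hsum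
    simp only [smul_zero] at h3
    rw [← sub_eq_zero.mpr (hcoef.trans h3.symm)]
    module
  exact eq_zero_of_zsmul hc hfin

end Quadratic

section Cubic

variable {c c' : ℤ} {η : R} {h y z : ℕ → B}

/-- The cubic Serre relation at level zero propagates to higher levels. -/
theorem cubic_step (hc : c ≠ 0)
    (hy : ∀ a, IsTwisted (PowerSeries.mk h) ((2 * η) • (PowerSeries.X : PowerSeries B))
      (PowerSeries.C (y a)) (c • PowerSeries.mk fun m => y (a + m)))
    (hz : ∀ a, IsTwisted (PowerSeries.mk h) ((2 * η) • (PowerSeries.X : PowerSeries B))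
      (PowerSeries.C (z a)) (c' • PowerSeries.mk fun m => z (a + m)))
    (h0 : ∀ t, ⁅y 0, ⁅y 0, z t⁆⁆ = 0) (n : ℕ)
    (hlow : ∀ a b t, a + b < n → ⁅y a, ⁅y b, z t⁆⁆ + ⁅y b, ⁅y a, z t⁆⁆ = 0) (t : ℕ) :
    ⁅y n, ⁅y 0, z t⁆⁆ + ⁅y 0, ⁅y n, z t⁆⁆ = 0 := by
  set w : PowerSeries B := (2 * η) • (PowerSeries.X : PowerSeries B)
  have hw : ∀ z, w * z = z * w := smul_X_comm (2 * η)
  set Y := PowerSeries.mk fun m => y (0 + m)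
  set Z : ℕ → PowerSeries B := fun t => PowerSeries.mk fun m => z (t + m) with hZ
  set y0 := PowerSeries.C (y 0)
  have hY : ∀ m, PowerSeries.coeff m Y = y m := fun m => by
    rw [PowerSeries.coeff_mk, zero_add]
  have hZeq : ∀ t, Z t = PowerSeries.C (z t) + PowerSeries.X * Z (t + 1) := by
    intro t
    ext m
    cases m with
    | zero => simp [Z]
    | succ m =>
      simp only [Z, PowerSeries.coeff_mk, map_add, PowerSeries.coeff_succ_X_mul,
        PowerSeries.coeff_C, Nat.succ_ne_zero, if_false, zero_add]
      congr 1; omega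
  have hX : ∀ F G : PowerSeries B, ⁅F, PowerSeries.X * G⁆ = PowerSeries.X * ⁅F, G⁆ := by
    intro F G
    rw [Ring.lie_def, Ring.lie_def, mul_sub, ← mul_assoc F, ← PowerSeries.X_mul]
    simp only [mul_assoc]
  have hwl : ∀ F G : PowerSeries B, ⁅F, w * G⁆ = w * ⁅F, G⁆ := by
    intro F G
    rw [Ring.lie_def, Ring.lie_def, mul_sub, ← mul_assoc F, ← hw]
    simp only [mul_assoc]
  have vsym : ∀ m < n, ∀ t, PowerSeries.coeff m (⁅Y, ⁅y0, Z t⁆⁆ + ⁅y0, ⁅Y, Z t⁆⁆) = 0 := by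
    intro m
    induction m with
    | zero =>
      intro hm t
      rw [hZeq]
      simp only [rlie_add, hX, map_add, PowerSeries.coeff_zero_X_mul, y0, ← C_lie, coeff_lie_C,
        coeff_C_lie, hY, add_zero]
      exact hlow 0 0 t hm
    | succ m ih =>
      intro hm t
      have h1 := ih (by omega) (t + 1)
      simp only [map_add, y0, coeff_C_lie] at h1
      rw [hZeq]
      simp only [rlie_add, hX, map_add, PowerSeries.coeff_succ_X_mul, y0, ← C_lie, coeff_lie_C,
        coeff_C_lie, hY]
      have h2 := hlow (m + 1) 0 t hm
      rw [add_add_add_comm, h2, h1, add_zero]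
  have vdblC : ∀ m < n, ∀ t, PowerSeries.coeff m ⁅Y, ⁅Y, PowerSeries.C (z t)⁆⁆ = 0 := by
    intro m hm t
    have : PowerSeries.coeff m ⁅Y, ⁅Y, PowerSeries.C (z t)⁆⁆ =
        ∑ r ∈ Finset.HasAntidiagonal.antidiagonal m, ⁅y r.1, ⁅y r.2, z t⁆⁆ := by
      rw [Ring.lie_def, map_sub, PowerSeries.coeff_mul, PowerSeries.coeff_mul,
        ← Finset.Nat.sum_antidiagonal_swap (n := m) (f := fun q =>
          PowerSeries.coeff q.1 ⁅Y, PowerSeries.C (z t)⁆ * PowerSeries.coeff q.2 Y),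
        ← Finset.sum_sub_distrib]
      refine Finset.sum_congr rfl fun r _ => ?_
      simp only [Prod.swap, coeff_lie_C, hY]
      rw [Ring.lie_def (y r.1)]
    rw [this]
    exact sum_antidiagonal_eq_zero (f := fun a b => ⁅y a, ⁅y b, z t⁆⁆)
      fun a b hab => hlow a b t (by omega)
  have vdbl : ∀ m < n, ∀ t, PowerSeries.coeff m ⁅Y, ⁅Y, Z t⁆⁆ = 0 := by
    intro m
    induction m with
    | zero =>
      intro hm t
      rw [hZeq]
      simp only [rlie_add, hX, map_add, PowerSeries.coeff_zero_X_mul, add_zero]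
      exact vdblC 0 hm t
    | succ m ih =>
      intro hm t
      rw [hZeq]
      simp only [rlie_add, hX, map_add, PowerSeries.coeff_succ_X_mul]
      rw [vdblC _ hm, ih (by omega), add_zero]
  have hD := (hy 0).lie hw ((hy 0).lie hw (hz t))
  rw [← C_lie, ← C_lie, h0, map_zero, IsTwisted, rlie_zero] at hD
  have hD0 := eq_zero_of_mul_one_add_X hD.symm
  have hsm : ∀ (c : ℤ) (F G : PowerSeries B), ⁅c • F, G⁆ = c • ⁅F, G⁆ := by
    intro c F G; simp only [Ring.lie_def, smul_mul_assoc, mul_smul_comm, smul_sub]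
  -- In degree `n` the term with `c'` vanishes by the base relation for every level of `z`, and the
  -- terms with `w` contain only double brackets of total level below `n`. The first-order terms in
  -- `Y` give the claim.
  have hform : c • (⁅Y, ⁅y0, PowerSeries.C (z t)⁆⁆ + ⁅y0, ⁅Y, PowerSeries.C (z t)⁆⁆) +
      (c' • ⁅y0, ⁅y0, Z t⁆⁆ + w * ((c * c) • ⁅Y, ⁅Y, PowerSeries.C (z t)⁆⁆ +
        (c * c') • (⁅Y, ⁅y0, Z t⁆⁆ + ⁅y0, ⁅Y, Z t⁆⁆) + w * ((c * c * c') • ⁅Y, ⁅Y, Z t⁆⁆)))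
      = 0 := by
    rw [← hD0]
    simp only [rlie_add, hsm, lie_zsmul_right, hwl, mul_add, mul_smul_comm, smul_add]
    rw [C_lie]
    simp only [smul_smul, Y, Z]
    module
  have hcoef := congrArg (PowerSeries.coeff n) hform
  have e1 : PowerSeries.coeff n ⁅y0, ⁅y0, Z t⁆⁆ = 0 := by
    simp only [y0, coeff_C_lie, Z, PowerSeries.coeff_mk, h0]
  have e2 : ∀ F : PowerSeries B, (∀ m < n, PowerSeries.coeff m F = 0) →
      PowerSeries.coeff n (w * F) = 0 := by
    intro F hF
    rw [smul_mul_assoc, PowerSeries.coeff_smul]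
    cases n with
    | zero => simp
    | succ n => rw [PowerSeries.coeff_succ_X_mul, hF n (by omega), smul_zero]
  have e3 : ∀ F : PowerSeries B, (∀ m < n, PowerSeries.coeff m F = 0) →
      ∀ m < n, PowerSeries.coeff m (w * F) = 0 := by
    intro F hF m hm
    rw [smul_mul_assoc, PowerSeries.coeff_smul]
    cases m with
    | zero => simp
    | succ m => rw [PowerSeries.coeff_succ_X_mul, hF m (by omega), smul_zero]
  rw [map_add, map_add, map_zsmul, map_zsmul, e1, e2, smul_zero, add_zero, add_zero,
    map_zero] at hcoef
  · have := eq_zero_of_zsmul hc hcoef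
    simpa only [map_add, y0, ← C_lie, coeff_lie_C, coeff_C_lie, hY] using this
  · intro m hm
    rw [map_add, map_add, map_zsmul, map_zsmul, vdblC m hm, vsym m hm, e3 _ _ m hm]
    · simp
    · intro m hm
      rw [map_zsmul, vdbl m hm, smul_zero]

end Cubic

/-- The relation between `h` and `x` at one even vertex follows from that between the `x`. -/
theorem hx_even_of_xx {h x y : ℕ → B} {ε : ℤ} (hε : ε ≠ 0) (κ : R)
    (hxy : ∀ r q, ⁅x r, y q⁆ = ε • h (r + q))
    (hxx : ∀ r s, ⁅x (r + 1), x s⁆ - ⁅x r, x (s + 1)⁆ - κ • (x r * x s + x s * x r) = 0)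
    (r s : ℕ) :
    ⁅h (r + 1), x s⁆ - ⁅h r, x (s + 1)⁆ - κ • (h r * x s + x s * h r) = 0 := by
  set E : ℕ → ℕ → B := fun r s =>
    ⁅h (r + 1), x s⁆ - ⁅h r, x (s + 1)⁆ - κ • (h r * x s + x s * h r) with hE
  -- Bracket the relation among the `x` with `y q`. Each of the two `x` becomes some `h`, which
  -- produces two copies of the desired relation.
  have key : ∀ r s q, E (r + q) s + E (s + q) r = 0 := by
    intro r s q
    apply eq_zero_of_zsmul hε
    have h1 : ∀ r s, ⁅⁅x r, x s⁆, y q⁆ = ε • (⁅h (r + q), x s⁆ - ⁅h (s + q), x r⁆) := by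
      intro r s
      have : ⁅⁅x r, x s⁆, y q⁆ = ⁅⁅x r, y q⁆, x s⁆ - ⁅⁅x s, y q⁆, x r⁆ := by
        simp only [Ring.lie_def]; noncomm_ring
      rw [this, hxy, hxy]
      simp only [Ring.lie_def, smul_mul_assoc, mul_smul_comm, smul_sub]
    have h2 : ⁅x r * x s + x s * x r, y q⁆ =
        ε • (h (r + q) * x s + x s * h (r + q) + (h (s + q) * x r + x r * h (s + q))) := by
      have : ⁅x r * x s + x s * x r, y q⁆ =
        ⁅x r, y q⁆ * x s + x s * ⁅x r, y q⁆ + (⁅x s, y q⁆ * x r + x r * ⁅x s, y q⁆) := by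
        simp only [Ring.lie_def]; noncomm_ring
      rw [this, hxy, hxy]
      simp only [smul_mul_assoc, mul_smul_comm, smul_add]
    have h3 : ⁅⁅x (r + 1), x s⁆ - ⁅x r, x (s + 1)⁆ - κ • (x r * x s + x s * x r), y q⁆ = 0 := by
      rw [hxx, Ring.lie_def, zero_mul, mul_zero, sub_zero]
    have h4 : ∀ a b c : B, ⁅a - b - κ • c, y q⁆ = ⁅a, y q⁆ - ⁅b, y q⁆ - κ • ⁅c, y q⁆ := by
      intro a b c
      simp only [Ring.lie_def, sub_mul, mul_sub, smul_mul_assoc, mul_smul_comm, smul_sub]; abel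
    rw [h4, h1, h1, h2] at h3
    rw [← h3, hE]
    simp only [show r + 1 + q = r + q + 1 by omega, show s + 1 + q = s + q + 1 by omega]
    module
  -- Equal levels give twice `E q 0`. Setting only one of the two levels to zero then gives the
  -- general case.
  have h5 : ∀ q, E q 0 = 0 := fun q => eq_zero_of_add_self (by simpa using key 0 0 q)
  have := key s 0 r
  rwa [h5, zero_add, zero_add] at this

/-- The relation between `h` and `x` at one odd vertex follows from that between the `x`. -/
theorem hx_odd_of_xx {h x y : ℕ → B}
    (hxy : ∀ r q, x r * y q + y q * x r = h (r + q))
    (hxx : ∀ r s, x r * x s + x s * x r = 0) (r s : ℕ) : ⁅h r, x s⁆ = 0 := by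
  have key : ∀ r s q, ⁅h (r + q), x s⁆ + ⁅h (s + q), x r⁆ = 0 := by
    intro r s q
    rw [← hxy, ← hxy]
    have : ⁅x r * y q + y q * x r, x s⁆ + ⁅x s * y q + y q * x s, x r⁆ =
        y q * (x r * x s + x s * x r) - (x r * x s + x s * x r) * y q := by
      simp only [Ring.lie_def]; noncomm_ring
    rw [this, hxx, mul_zero, zero_mul, sub_zero]
  have h5 : ∀ q, ⁅h q, x 0⁆ = 0 := fun q => eq_zero_of_add_self (by simpa using key 0 0 q)
  simpa [h5] using key 0 s r

end Vanishing

/-! ### The minimalistic presentation -/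

section Minimal

variable {ℓ : ℕ} (p : Fin (ℓ + 1) → ZMod 2) {R : Type*} [CommRing R] {B : Type*} [Ring B]
  [Algebra R B]

/-- The relations of the minimalistic presentation: those of the Yangian that involve only the
generators of levels zero and one; `t_i` stands for `h_{i1} - η h_{i0}²`, where `2 η = ħ`. -/
structure MinRel (η : R) (h t : Fin ℓ → B) (x x₁ : ℤˣ → Fin ℓ → B) : Prop where
  hh : ∀ i j, ⁅h i, h j⁆ = 0
  ht : ∀ i j, ⁅t i, h j⁆ = 0
  tt : ∀ i j, ⁅t i, t j⁆ = 0
  hx : ∀ e i j, ⁅h i, x e j⁆ = ((e : ℤ) * cartan p i j) • x e j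
  tx : ∀ e i j, ⁅t i, x e j⁆ = ((e : ℤ) * cartan p i j) • x₁ e j
  xx : ∀ i j, sbr (vtxParity p i) (vtxParity p j) (x 1 i) (x (-1) j) = if i = j then h i else 0
  x₁x : ∀ i, sbr (vtxParity p i) (vtxParity p i) (x₁ 1 i) (x (-1) i) = t i + η • (h i * h i)
  xxs : ∀ e i j, ¬ (i = j ∧ vtxParity p i = 1) →
    sbr (vtxParity p i) (vtxParity p j) (x₁ e i) (x e j) -
      sbr (vtxParity p i) (vtxParity p j) (x e i) (x₁ e j) =
      (((e : ℤ) * cartan p i j) • η) • sabr (vtxParity p i) (vtxParity p j) (x e i) (x e j)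
  serre_zero : ∀ e i j, cartan p i j = 0 →
    sbr (vtxParity p i) (vtxParity p j) (x e i) (x e j) = 0
  serre_cubic : ∀ e i j, Adjacent i j → vtxParity p i = 0 → ⁅x e i, ⁅x e i, x e j⁆⁆ = 0
  serre_quartic : ∀ e (i j l : Fin ℓ), (i : ℕ) + 1 = j → (j : ℕ) + 1 = l → vtxParity p j = 1 →
    sbr (vtxParity p i + vtxParity p j) (vtxParity p j + vtxParity p l)
      (sbr (vtxParity p i) (vtxParity p j) (x e i) (x e j))
      (sbr (vtxParity p j) (vtxParity p l) (x e j) (x e l)) = 0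

variable {p}

/-- A neighbour of a vertex. -/
def Admissible.nb (hp : Admissible p) (j : Fin ℓ) : Fin ℓ := (hp.exists_adjacent j).choose

theorem Admissible.nb_adj (hp : Admissible p) (j : Fin ℓ) : Adjacent (hp.nb j) j :=
  (hp.exists_adjacent j).choose_spec

theorem unit_mul_cartan_sq (e : ℤˣ) {i j : Fin ℓ} (h : Adjacent i j) :
    ((e : ℤ) * cartan p i j) * ((e : ℤ) * cartan p i j) = 1 := by
  have h1 : (e : ℤ) * e = 1 := by rw [← Units.val_mul, Int.units_mul_self]; rfl
  rw [mul_mul_mul_comm, h1, cartan_adjacent_sq p h, one_mul]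

theorem unit_mul_cartan_ne (e : ℤˣ) {i j : Fin ℓ} (h : cartan p i j ≠ 0) :
    ((e : ℤ) * cartan p i j) ≠ 0 := mul_ne_zero e.ne_zero h

/-- The elements `x_{j,r}^{e}` generated from `x_{j,0}^e` by the `t_i`. -/
def xs (hp : Admissible p) (t : Fin ℓ → B) (x : ℤˣ → Fin ℓ → B) (e : ℤˣ) (j : Fin ℓ) : ℕ → B
  | 0 => x e j
  -- The coefficient is `±1`, hence its own inverse, so dividing by it is the same as multiplying.
  | r + 1 => ((e : ℤ) * cartan p (hp.nb j) j) • ⁅t (hp.nb j), xs hp t x e j r⁆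

/-- The brackets `[x_{i,r}^+, x_{j,s}^-]`. -/
def xxBr (hp : Admissible p) (t : Fin ℓ → B) (x : ℤˣ → Fin ℓ → B) (i j : Fin ℓ) (r s : ℕ) : B :=
  sbr (vtxParity p i) (vtxParity p j) (xs hp t x 1 i r) (xs hp t x (-1) j s)

/-- The elements `h_{i,r} = [x_{i,r}^+, x_{i,0}^-]`. -/
def hs (hp : Admissible p) (t : Fin ℓ → B) (x : ℤˣ → Fin ℓ → B) (i : Fin ℓ) (r : ℕ) : B :=
  xxBr hp t x i i r 0

namespace MinRel

variable {η : R} {h t : Fin ℓ → B} {x x₁ : ℤˣ → Fin ℓ → B}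

/-- The neighbour chosen in the recursion does not matter, because the `t_i` commute: every `ad t_a`
acts on the sequence as one and the same shift, scaled by a Cartan entry. -/
theorem t_xs (hM : MinRel p η h t x x₁) (hp : Admissible p) (e : ℤˣ) (a j : Fin ℓ) (r : ℕ) :
    ⁅t a, xs hp t x e j r⁆ = ((e : ℤ) * cartan p a j) • xs hp t x e j (r + 1) := by
  induction r with
  | zero =>
    rw [xs, xs, xs, hM.tx, hM.tx, smul_smul, smul_smul, mul_assoc,
      unit_mul_cartan_sq e (hp.nb_adj j), mul_one]
  | succ r ih =>
    conv_lhs => rw [xs, lie_zsmul_right, rlie_jacobi, hM.tt, ih, lie_zsmul_right]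
    conv_rhs => rw [xs]
    rw [Ring.lie_def 0, zero_mul, mul_zero, sub_zero, zero_add, smul_comm]

theorem xs_one (hM : MinRel p η h t x x₁) (hp : Admissible p) (e : ℤˣ) (j : Fin ℓ) :
    xs hp t x e j 1 = x₁ e j := by
  rw [xs, xs, hM.tx, smul_smul, unit_mul_cartan_sq e (hp.nb_adj j), one_smul]

theorem h_xs (hM : MinRel p η h t x x₁) (hp : Admissible p) (e : ℤˣ) (a j : Fin ℓ) (r : ℕ) :
    ⁅h a, xs hp t x e j r⁆ = ((e : ℤ) * cartan p a j) • xs hp t x e j r := by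
  induction r with
  | zero => exact hM.hx e a j
  | succ r ih =>
    have h0 : ⁅h a, t (hp.nb j)⁆ = 0 := by rw [rlie_skew, hM.ht, neg_zero]
    rw [xs, lie_zsmul_right, rlie_jacobi, h0, ih, lie_zsmul_right,
      Ring.lie_def 0, zero_mul, mul_zero, sub_zero, zero_add, smul_comm]

theorem t_xxBr (hM : MinRel p η h t x x₁) (hp : Admissible p) (a i j : Fin ℓ) (r s : ℕ) :
    ⁅t a, xxBr hp t x i j r s⁆ = cartan p a i • xxBr hp t x i j (r + 1) s -
      cartan p a j • xxBr hp t x i j r (s + 1) := by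
  rw [xxBr, lie_sbr, hM.t_xs, hM.t_xs, sbr_zsmul_left, sbr_zsmul_right]
  simp only [xxBr, Units.val_one, Units.val_neg]; module

theorem h_hs (hM : MinRel p η h t x x₁) (hp : Admissible p) (a i : Fin ℓ) (r : ℕ) :
    ⁅h a, hs hp t x i r⁆ = 0 := by
  rw [hs, xxBr, lie_sbr, hM.h_xs, hM.h_xs, sbr_zsmul_left, sbr_zsmul_right]
  simp only [Units.val_one, Units.val_neg]; module

theorem hs_zero (hM : MinRel p η h t x x₁) (hp : Admissible p) (i : Fin ℓ) :
    hs hp t x i 0 = h i := by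
  rw [hs, xxBr, xs, xs, hM.xx, if_pos rfl]

theorem hs_one (hM : MinRel p η h t x x₁) (hp : Admissible p) (i : Fin ℓ) :
    hs hp t x i 1 = t i + η • (h i * h i) := by
  rw [hs, xxBr, hM.xs_one, xs, hM.x₁x]

section DistinctVertices

variable [IsAddTorsionFree B]

/-- The brackets form a doubly indexed family on which each `ad t_a` acts through columns `i` and
`j`, so `Admissible.family_eq_zero` spreads the relation from level zero. The two lemmas that follow
use the same argument. -/
theorem xxBr_of_ne (hM : MinRel p η h t x x₁) (hp : Admissible p) {i j : Fin ℓ} (hij : i ≠ j)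
    (r s : ℕ) : xxBr hp t x i j r s = 0 := by
  refine hp.family_eq_zero hij (t := t) (e := 1) (e' := -1) ?_ (fun a r s => ?_) r s
  · rw [xxBr, xs, xs, hM.xx, if_neg hij]
  · rw [hM.t_xxBr]; simp only [Units.val_one, Units.val_neg]; module

theorem serre_zero_of_ne (hM : MinRel p η h t x x₁) (hp : Admissible p) (e : ℤˣ) {i j : Fin ℓ}
    (hij : i ≠ j) (hc : cartan p i j = 0) (r s : ℕ) :
    sbr (vtxParity p i) (vtxParity p j) (xs hp t x e i r) (xs hp t x e j s) = 0 := by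
  refine hp.family_eq_zero hij (t := t) (e := e) (e' := e)
    (Q := fun r s => sbr (vtxParity p i) (vtxParity p j) (xs hp t x e i r) (xs hp t x e j s))
    ?_ (fun a r s => ?_) r s
  · exact hM.serre_zero e i j hc
  · rw [lie_sbr, hM.t_xs, hM.t_xs, sbr_zsmul_left, sbr_zsmul_right]

theorem xxs_of_ne (hM : MinRel p η h t x x₁) (hp : Admissible p) (e : ℤˣ) {i j : Fin ℓ}
    (hij : i ≠ j) (r s : ℕ) :
    sbr (vtxParity p i) (vtxParity p j) (xs hp t x e i (r + 1)) (xs hp t x e j s) -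
      sbr (vtxParity p i) (vtxParity p j) (xs hp t x e i r) (xs hp t x e j (s + 1)) =
      (((e : ℤ) * cartan p i j) • η) •
        sabr (vtxParity p i) (vtxParity p j) (xs hp t x e i r) (xs hp t x e j s) := by
  rw [← sub_eq_zero]
  refine hp.family_eq_zero hij (t := t) (e := e) (e' := e)
    (Q := fun r s => sbr (vtxParity p i) (vtxParity p j) (xs hp t x e i (r + 1)) (xs hp t x e j s) -
      sbr (vtxParity p i) (vtxParity p j) (xs hp t x e i r) (xs hp t x e j (s + 1)) -
      (((e : ℤ) * cartan p i j) • η) •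
        sabr (vtxParity p i) (vtxParity p j) (xs hp t x e i r) (xs hp t x e j s))
    ?_ (fun a r s => ?_) r s
  · rw [sub_eq_zero, zero_add, hM.xs_one, hM.xs_one]
    exact hM.xxs e i j fun h => hij h.1
  · simp only [rlie_sub, lie_smul_right, lie_sbr, lie_sabr, hM.t_xs, sbr_zsmul_left,
      sbr_zsmul_right, sabr_zsmul_left, sabr_zsmul_right]
    module

theorem serre_quartic' (hM : MinRel p η h t x x₁) (hp : Admissible p) (e : ℤˣ) {i j l : Fin ℓ}
    (hij : (i : ℕ) + 1 = j) (hjl : (j : ℕ) + 1 = l) (hj : vtxParity p j = 1) (r s : ℕ) :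
    sbr (vtxParity p i + vtxParity p j) (vtxParity p j + vtxParity p l)
      (sbr (vtxParity p i) (vtxParity p j) (xs hp t x e i r) (xs hp t x e j 0))
      (sbr (vtxParity p j) (vtxParity p l) (xs hp t x e j 0) (xs hp t x e l s)) = 0 := by
  set Q : ℕ → ℕ → B := fun r s =>
    sbr (vtxParity p i + vtxParity p j) (vtxParity p j + vtxParity p l)
      (sbr (vtxParity p i) (vtxParity p j) (xs hp t x e i r) (xs hp t x e j 0))
      (sbr (vtxParity p j) (vtxParity p l) (xs hp t x e j 0) (xs hp t x e l s)) with hQ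
  have step : ∀ r s, Q r s = 0 → Q (r + 1) s = 0 ∧ Q r (s + 1) = 0 := by
    intro r s hrs
    have h1 : (e : ℤ) • Q (r + 1) s = 0 ∧ (e : ℤ) • Q r (s + 1) = 0 := by
      -- Here `w` collects the two terms in which one of the copies of `x_j` is raised. Nothing need
      -- be known about it: the lemma on three columns controls the outer two coefficients
      -- regardless.
      apply hp.columns_indep_triple hij hjl hj (w := (e : ℤ) •
        (sbr (vtxParity p i + vtxParity p j) (vtxParity p j + vtxParity p l)
          (sbr (vtxParity p i) (vtxParity p j) (xs hp t x e i r) (xs hp t x e j 1))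
          (sbr (vtxParity p j) (vtxParity p l) (xs hp t x e j 0) (xs hp t x e l s)) +
        sbr (vtxParity p i + vtxParity p j) (vtxParity p j + vtxParity p l)
          (sbr (vtxParity p i) (vtxParity p j) (xs hp t x e i r) (xs hp t x e j 0))
          (sbr (vtxParity p j) (vtxParity p l) (xs hp t x e j 1) (xs hp t x e l s))))
      intro a
      have h2 : ⁅t a, Q r s⁆ = 0 := by rw [hrs, rlie_zero]
      rw [← h2, hQ]
      simp only [lie_sbr, hM.t_xs, sbr_zsmul_left, sbr_zsmul_right, sbr_add_left, sbr_add_right,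
        zero_add]
      module
    exact ⟨eq_zero_of_zsmul e.ne_zero h1.1, eq_zero_of_zsmul e.ne_zero h1.2⟩
  have hr : ∀ r, Q r 0 = 0 := by
    intro r
    induction r with
    | zero => exact hM.serre_quartic e i j l hij hjl hj
    | succ r ih => exact (step r 0 ih).1
  change Q r s = 0
  induction s with
  | zero => exact hr r
  | succ s ih => exact (step r s ih).2

theorem bracket_sbr_of_comm {A : Type*} [Ring A] (a b : ZMod 2) {X Z y : A}
    (h : sbr b a Z y = 0) :
    sbr (a + b) a (sbr a b X Z) y = psign (a * b) • ⁅sbr a a X y, Z⁆ := by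
  have h1 : sbr (a + b) a (sbr a b X Z) y =
      psign (a * b) • ⁅sbr a a X y, Z⁆ + sbr a (b + a) X (sbr b a Z y) := by
    rcases zmod_two_cases a with rfl | rfl <;> rcases zmod_two_cases b with rfl | rfl <;>
    simp only [sbr, Ring.lie_def, psign_zero, psign_one, zero_add, add_zero, zmod_two_one_add_one,
      mul_one, mul_zero, one_smul, neg_smul] <;> noncomm_ring
  rw [h1, h, sbr_zero_elt_right, add_zero]

theorem bracket_sabr_of_comm {A : Type*} [Ring A] (a b : ZMod 2) {X Z y : A}
    (h : sbr b a Z y = 0) :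
    sbr (a + b) a (sabr a b X Z) y =
      psign (a * b) • (sbr a a X y * Z + Z * sbr a a X y) := by
  have h1 : sbr (a + b) a (sabr a b X Z) y =
      psign (a * b) • (sbr a a X y * Z + Z * sbr a a X y) + sabr a (b + a) X (sbr b a Z y) := by
    rcases zmod_two_cases a with rfl | rfl <;> rcases zmod_two_cases b with rfl | rfl <;>
    simp only [sbr, sabr, psign_zero, psign_one, zero_add, add_zero, zmod_two_one_add_one,
      mul_one, mul_zero, one_smul, neg_smul] <;> noncomm_ring
  rw [h1, h, sabr_zero_elt_right, add_zero]

/-- A relation of type `xxs` implies one of type `hx` by bracketing. -/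
theorem hx_of_xxs {A : Type*} [Ring A] [Algebra R A] {a b : ZMod 2} {X X' Z Z' y : A} {κ : R}
    (hZ : sbr b a Z y = 0)
    (hZ' : sbr b a Z' y = 0) (hrel : sbr a b X' Z - sbr a b X Z' = κ • sabr a b X Z) :
    ⁅sbr a a X' y, Z⁆ - ⁅sbr a a X y, Z'⁆ =
      κ • (sbr a a X y * Z + Z * sbr a a X y) := by
  have h1 := congrArg (fun z => psign (a * b) • sbr (a + b) a z y) hrel
  simp only [sbr_sub_left, sbr_smul_left, bracket_sbr_of_comm a b hZ,
    bracket_sbr_of_comm a b hZ', bracket_sabr_of_comm a b hZ] at h1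
  rw [← smul_sub, smul_smul, psign_mul_self, one_smul, smul_comm κ, smul_smul, psign_mul_self,
    one_smul] at h1
  exact h1

theorem hx_pos_of_ne (hM : MinRel p η h t x x₁) (hp : Admissible p) {i j : Fin ℓ} (hij : i ≠ j)
    (r s : ℕ) :
    ⁅hs hp t x i (r + 1), xs hp t x 1 j s⁆ - ⁅hs hp t x i r, xs hp t x 1 j (s + 1)⁆ =
      (cartan p i j • η) • (hs hp t x i r * xs hp t x 1 j s + xs hp t x 1 j s * hs hp t x i r) := by
  have := hx_of_xxs (hM.xxBr_of_ne hp hij.symm s 0) (hM.xxBr_of_ne hp hij.symm (s + 1) 0)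
    (hM.xxs_of_ne hp 1 hij r s)
  rwa [Units.val_one, one_mul] at this

/-- Bracketing the relation between negative generators with `x_{i,0}^+` yields the brackets
`[x_{i,0}^+, x_{i,r}^-]`. That these agree with `hs`, which raises the positive factor instead, is
part of `good_all`. -/
theorem hx_neg_of_ne (hM : MinRel p η h t x x₁) (hp : Admissible p) {i j : Fin ℓ} (hij : i ≠ j)
    (r s : ℕ) :
    ⁅xxBr hp t x i i 0 (r + 1), xs hp t x (-1) j s⁆ -
        ⁅xxBr hp t x i i 0 r, xs hp t x (-1) j (s + 1)⁆ =
      ((-cartan p i j) • η) • (xxBr hp t x i i 0 r * xs hp t x (-1) j s +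
        xs hp t x (-1) j s * xxBr hp t x i i 0 r) := by
  have e : ∀ s, sbr (vtxParity p j) (vtxParity p i) (xs hp t x (-1) j s) (xs hp t x 1 i 0) = 0 := by
    intro s
    rw [sbr_skew]
    have := hM.xxBr_of_ne hp hij 0 s
    rw [xxBr] at this
    rw [this, smul_zero, neg_zero]
  have h1 := hx_of_xxs (e s) (e (s + 1)) (hM.xxs_of_ne hp (-1) hij r s)
  have e2 : ∀ r, sbr (vtxParity p i) (vtxParity p i) (xs hp t x (-1) i r) (xs hp t x 1 i 0) =
      (-psign (vtxParity p i * vtxParity p i)) • xxBr hp t x i i 0 r := by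
    intro r; rw [sbr_skew, xxBr, neg_smul]
  rw [e2, e2, Units.val_neg, Units.val_one, neg_one_mul] at h1
  have h2 := congrArg (fun z => (-psign (vtxParity p i * vtxParity p i)) • z) h1
  have e3 : ∀ (m : ℤ) (u v : B), ⁅m • u, v⁆ = m • ⁅u, v⁆ := by
    intro m u v; simp only [Ring.lie_def, smul_mul_assoc, mul_smul_comm, smul_sub]
  have e4 : psign (vtxParity p i * vtxParity p i) * psign (vtxParity p i * vtxParity p i) = 1 :=
    psign_mul_self _
  simp only [e3, smul_mul_assoc, mul_smul_comm] at h2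
  simp only [← smul_add, ← smul_sub] at h2
  rw [smul_comm ((-cartan p i j) • η), smul_smul, smul_smul, neg_mul_neg, e4, one_smul,
    one_smul] at h2
  exact h2

end DistinctVertices

end MinRel

end Minimal

/-! ### Well-definedness and commutativity of the elements `h_{i,r}` -/

namespace MinRel

section Commutativity

variable {ℓ : ℕ} {p : Fin (ℓ + 1) → ZMod 2} {R : Type*} [CommRing R] {B : Type*} [Ring B]
  [Algebra R B] {η : R} {h t : Fin ℓ → B} {x x₁ : ℤˣ → Fin ℓ → B}

/-- The brackets `[x_{i,r}^+, x_{i,s}^-]` with `r + s ≤ N` depend on `r + s` only. -/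
def GoodUpTo (hp : Admissible p) (t : Fin ℓ → B) (x : ℤˣ → Fin ℓ → B) (N : ℕ) : Prop :=
  ∀ i r s, r + s ≤ N → xxBr hp t x i i r s = hs hp t x i (r + s)

/-- The elements `h_{i,r}` and `h_{j,q}` with `i ≠ j` and `r + q ≤ N` commute. -/
def CommUpTo (hp : Admissible p) (t : Fin ℓ → B) (x : ℤˣ → Fin ℓ → B) (N : ℕ) : Prop :=
  ∀ i j, i ≠ j → ∀ r q, r + q ≤ N → ⁅hs hp t x i r, hs hp t x j q⁆ = 0

theorem GoodUpTo.sbr_sh_left {hp : Admissible p} {N : ℕ} (hG : GoodUpTo hp t x N) (κ : R)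
    (j : Fin ℓ) {m s s' : ℕ} (hm : s + s' + m ≤ N) :
    sbr (vtxParity p j) (vtxParity p j) (sh κ (xs hp t x 1 j) m s) (xs hp t x (-1) j s') =
      sh κ (hs hp t x j) m (s + s') := by
  rw [SuperYangian.sbr_sh_left, add_comm s s', ← sh_offset]
  refine sh_congr fun b h1 h2 => ?_
  rw [add_comm s' b]
  exact hG j b s' (by omega)

theorem GoodUpTo.sbr_sh_right {hp : Admissible p} {N : ℕ} (hG : GoodUpTo hp t x N) (κ : R)
    (j : Fin ℓ) {m s s' : ℕ} (hm : s + s' + m ≤ N) :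
    sbr (vtxParity p j) (vtxParity p j) (xs hp t x 1 j s) (sh κ (xs hp t x (-1) j) m s') =
      sh κ (hs hp t x j) m (s + s') := by
  rw [SuperYangian.sbr_sh_right, ← sh_offset]
  exact sh_congr fun b h1 h2 => hG j s b (by omega)

/-- The defect of well-definedness in degree `N + 1`. -/
theorem t_hs_eq (hM : MinRel p η h t x x₁) {hp : Admissible p} {N : ℕ}
    (hG : GoodUpTo hp t x N) (a i : Fin ℓ) {r s : ℕ} (hrs : r + s = N) :
    ⁅t a, hs hp t x i N⁆ =
      cartan p a i • (xxBr hp t x i i (r + 1) s - xxBr hp t x i i r (s + 1)) := by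
  have := hM.t_xxBr hp a i i r s
  rw [hG i r s hrs.le, hrs] at this
  rw [this, smul_sub]

theorem h0_xs (hM : MinRel p η h t x x₁) (hp : Admissible p) (e : ℤˣ) (i j : Fin ℓ) (s : ℕ) :
    ⁅hs hp t x i 0, xs hp t x e j s⁆ = ((e : ℤ) * cartan p i j) • xs hp t x e j s := by
  rw [hM.hs_zero, hM.h_xs]

/-- The action of `t_a` on shifted sequences. -/
theorem t_sh (hM : MinRel p η h t x x₁) (hp : Admissible p) (e : ℤˣ) (a j : Fin ℓ) (κ : R)
    (m s : ℕ) : ⁅t a, sh κ (xs hp t x e j) m s⁆ =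
      ((e : ℤ) * cartan p a j) • sh κ (xs hp t x e j) m (s + 1) := by
  induction m generalizing s with
  | zero => exact hM.t_xs hp e a j s
  | succ m ih => rw [sh, rlie_add, lie_smul_right, ih, ih, sh]; module

theorem t_sh_zero (hM : MinRel p η h t x x₁) (hp : Admissible p) (e : ℤˣ) (a j : Fin ℓ) (κ : R)
    (m : ℕ) : ⁅t a, sh κ (xs hp t x e j) m 0⁆ = ((e : ℤ) * cartan p a j) •
      (sh κ (xs hp t x e j) (m + 1) 0 - κ • sh κ (xs hp t x e j) m 0) := by
  rw [hM.t_sh, sh]; congr 1; abel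

/-- Applying `t_a` to `h_{i,N} = [x_{ir}^+, x_{is}^-]` with `r + s = N` shows that consecutive
brackets on the next antidiagonal have the same difference `d`. So there the bracket is affine in
`s`, and `d` measures both this dependence and the failure of `t_a` to commute with `h_{i,N}`. -/
theorem exists_defect (hM : MinRel p η h t x x₁) {hp : Admissible p} {N : ℕ}
    (hG : GoodUpTo hp t x N) (i : Fin ℓ) : ∃ d : B,
      (∀ a, ⁅t a, hs hp t x i N⁆ = cartan p a i • d) ∧
      ∀ r s, r + s = N + 1 → xxBr hp t x i i r s = hs hp t x i (N + 1) - s • d := by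
  refine ⟨xxBr hp t x i i (N + 1) 0 - xxBr hp t x i i N 1, fun a => hM.t_hs_eq hG a i (by omega),
    ?_⟩
  set d := xxBr hp t x i i (N + 1) 0 - xxBr hp t x i i N 1
  have hd : ∀ r s, r + s = N → xxBr hp t x i i (r + 1) s - xxBr hp t x i i r (s + 1) = d := by
    intro r s hrs
    have h1 := hM.t_hs_eq hG (hp.nb i) i hrs
    rw [hM.t_hs_eq hG (hp.nb i) i (show N + 0 = N by omega)] at h1
    have h2 := congrArg (fun z => cartan p (hp.nb i) i • z) h1
    simp only [smul_smul, cartan_adjacent_sq p (hp.nb_adj i), one_smul] at h2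
    exact h2.symm
  intro r s hrs
  induction s generalizing r with
  | zero => rw [zero_smul, sub_zero, show r = N + 1 by omega]; rfl
  | succ s ih =>
    have h1 := ih (r + 1) (by omega)
    have h2 := hd r s (by omega)
    rw [h1, sub_eq_iff_eq_add] at h2
    rw [succ_nsmul, ← sub_sub, h2]
    abel

variable [IsAddTorsionFree B]

/-- The hypotheses in lower degree remove all but the top terms in `lie_sbr_of_shift`. The
commutator is then the difference between shifting the positive and shifting the negative factor. -/
theorem lie_hs_xxBr (hM : MinRel p η h t x x₁) {hp : Admissible p} {N : ℕ}
    (hG : GoodUpTo hp t x N) {i j : Fin ℓ} (hij : i ≠ j) {n s s' : ℕ} (hn : n ≤ N)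
    (hns : s + s' + n ≤ N + 1) (hC : ∀ r q, r + q + 1 ≤ s + s' + n →
      ⁅hs hp t x i r, hs hp t x j q⁆ = 0) :
    ⁅hs hp t x i n, xxBr hp t x j j s s'⁆ = cartan p i j •
      (sbr (vtxParity p j) (vtxParity p j) (sh (cartan p i j • η) (xs hp t x 1 j) n s)
        (xs hp t x (-1) j s') -
      sbr (vtxParity p j) (vtxParity p j) (xs hp t x 1 j s)
        (sh (cartan p i j • η) (xs hp t x (-1) j) n s')) := by
  refine lie_sbr_of_shift η _ _ n s s' ?_ (hM.hx_pos_of_ne hp hij) ?_ ?_ ?_ ?_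
  · intro s
    rw [hM.hs_zero, hM.h_xs, Units.val_one, one_mul]
  · intro s
    rw [hM.hs_zero, hM.h_xs, Units.val_neg, Units.val_one, neg_one_mul]
  · intro r hr s
    have := hM.hx_neg_of_ne hp hij r s
    rwa [hG i 0 (r + 1) (by omega), hG i 0 r (by omega), zero_add, zero_add] at this
  · intro m hm
    rw [hG.sbr_sh_left _ j (by omega), hG.sbr_sh_right _ j (by omega)]
  · intro m r hmr
    rw [hG.sbr_sh_left _ j (by omega)]
    exact lie_sh_eq_zero fun b h1 h2 => hC r b (by omega)

/-- The two `N`-fold shifts agree term by term except at the top, where one has `[x_{N+1}^+, x_0^-]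
= h_{N+1}` and the other `[x_1^+, x_N^-] = h_{N+1} - N d`. -/
theorem lie_hs_hs_one (hM : MinRel p η h t x x₁) {hp : Admissible p} {N : ℕ} (hN : 1 ≤ N)
    (hG : GoodUpTo hp t x N) (hC : CommUpTo hp t x N) {i j : Fin ℓ} (hij : i ≠ j) {d : B}
    (hd : ∀ r s, r + s = N + 1 → xxBr hp t x j j r s = hs hp t x j (N + 1) - s • d) :
    ⁅hs hp t x i N, hs hp t x j 1⁆ = cartan p i j • N • d := by
  have h1 := hM.lie_hs_xxBr hG hij (n := N) (s := 1) (s' := 0) le_rfl (by omega)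
    (fun r q hrq => hC i j hij r q (by omega))
  change ⁅hs hp t x i N, xxBr hp t x j j 1 0⁆ = _
  rw [h1, SuperYangian.sbr_sh_left, SuperYangian.sbr_sh_right]
  set κ := cartan p i j • η
  have h2 : sh κ (fun s => sbr (vtxParity p j) (vtxParity p j) (xs hp t x 1 j 1)
      (xs hp t x (-1) j s)) N 0 = sh κ (fun b => hs hp t x j (1 + b) +
        (if b = N then -(N • d) else 0)) N 0 := by
    refine sh_congr fun b _ hb => ?_
    change xxBr hp t x j j 1 b = _
    split_ifs with hbN
    · subst hbN
      rw [hd 1 b (by omega), add_comm 1 b, sub_eq_add_neg]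
    · rw [hG j 1 b (by omega), add_zero]
  rw [h2, sh_add κ (fun b => hs hp t x j (1 + b)), sh_offset,
    sh_of_lower_zero (X := fun b => if b = N then -(N • d) else 0)
      (fun b _ hb => if_neg (by omega))]
  simp only [zero_add, add_zero, if_true]
  change cartan p i j • (sh κ (hs hp t x j) N 1 - _) = _
  congr 1
  abel

/-- Once the `t_a` commute with `h_{i,N}`, the defect is zero, and then both shifts in `lie_hs_xxBr`
give the same element. -/
theorem good_succ (hM : MinRel p η h t x x₁) {hp : Admissible p} {N : ℕ}
    (hG : GoodUpTo hp t x N) (hC : CommUpTo hp t x N)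
    (ht : ∀ a i, ⁅t a, hs hp t x i N⁆ = 0) :
    GoodUpTo hp t x (N + 1) ∧ CommUpTo hp t x (N + 1) := by
  have hG' : GoodUpTo hp t x (N + 1) := by
    intro i r s hrs
    rcases Nat.lt_or_eq_of_le hrs with h | h
    · exact hG i r s (by omega)
    · obtain ⟨d, hd1, hd2⟩ := hM.exists_defect hG i
      have hd0 : d = 0 := by
        have := hd1 (hp.nb i)
        rw [ht] at this
        exact eq_zero_of_zsmul (cartan_adjacent_ne (hp.nb_adj i)) this.symm
      rw [hd2 r s h, hd0, smul_zero, sub_zero, h]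
  refine ⟨hG', fun i j hij r q hrq => ?_⟩
  have h1 := hM.lie_hs_xxBr hG' hij (n := r) (s := q) (s' := 0) (by omega) (by omega)
    (fun r q hrq => hC i j hij r q (by omega))
  change ⁅hs hp t x i r, xxBr hp t x j j q 0⁆ = 0
  rw [h1, hG'.sbr_sh_left _ j (by omega), hG'.sbr_sh_right _ j (by omega), sub_self,
    smul_zero]

/-- The inductive step needs `[t_a, h_{i,N}] = 0`. For `N ≤ 1` this is immediate from `h_{i1} = t_i
+ η h_i²`. For `N ≥ 2` and adjacent `i`, `j`, compute `[h_{i,N}, h_{j,1}]` twice: by `lie_hs_hs_one`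
it is `c_ij N d_j`, and by substituting `h_{j1} = t_j + η h_j²` it is `-c_ij d_i`. Hence `d_i = -N
d_j`; exchanging the vertices gives `(N² - 1) d_i = 0`. -/
theorem good_all (hM : MinRel p η h t x x₁) (hp : Admissible p) (N : ℕ) :
    GoodUpTo hp t x N ∧ CommUpTo hp t x N := by
  induction N with
  | zero =>
    constructor
    · intro i r s hrs
      rw [show r = 0 by omega, show s = 0 by omega]; rfl
    · intro i j hij r q hrq
      rw [show r = 0 by omega, show q = 0 by omega, hM.hs_zero, hM.hs_zero, hM.hh]
  | succ N ih =>
    obtain ⟨hG, hC⟩ := ih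
    refine hM.good_succ hG hC ?_
    match N with
    | 0 => intro a i; rw [hM.hs_zero, hM.ht]
    | 1 =>
      intro a i
      rw [hM.hs_one, rlie_add, hM.tt, lie_smul_right, lie_mul, hM.ht]
      simp
    | N + 2 =>
      set M := N + 2 with hM'
      choose d hd1 hd2 using fun i => hM.exists_defect hG i
      have key : ∀ i j, Adjacent i j → d i = -(M • d j) := by
        intro i j hij
        have h1 := hM.lie_hs_hs_one (by omega) hG hC hij.ne (hd2 j)
        have h2 : ⁅hs hp t x i M, hs hp t x j 1⁆ = -(cartan p i j • d i) := by
          have e1 : ⁅hs hp t x i M, h j⁆ = 0 := by rw [rlie_skew, hM.h_hs, neg_zero]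
          rw [hM.hs_one, rlie_add, lie_smul_right, lie_mul, e1, rlie_skew, hd1, cartan_comm]
          simp
        rw [h2] at h1
        have h3 := congrArg (fun z => cartan p i j • z) h1
        simp only [smul_neg, smul_smul, cartan_adjacent_sq p hij, one_smul] at h3
        rw [← h3, neg_neg]
      have hd0 : ∀ i, d i = 0 := by
        intro i
        have hadj := hp.nb_adj i
        have h1 := key _ _ hadj
        have h2 := key _ _ hadj.symm
        rw [h1, smul_neg, neg_neg, smul_smul] at h2
        apply eq_zero_of_zsmul (n := (M : ℤ) * M - 1)
        · have : (2 : ℤ) ≤ M := by omega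
          nlinarith
        · rw [sub_smul, one_smul, sub_eq_zero]
          exact_mod_cast h2.symm
      intro a i
      rw [hd1, hd0, smul_zero]

theorem xxBr_self (hM : MinRel p η h t x x₁) (hp : Admissible p) (i : Fin ℓ) (r s : ℕ) :
    xxBr hp t x i i r s = hs hp t x i (r + s) :=
  (hM.good_all hp (r + s)).1 i r s le_rfl

theorem hs_comm_of_ne (hM : MinRel p η h t x x₁) (hp : Admissible p) {i j : Fin ℓ} (hij : i ≠ j)
    (r q : ℕ) : ⁅hs hp t x i r, hs hp t x j q⁆ = 0 :=
  (hM.good_all hp (r + q)).2 i j hij r q le_rfl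

theorem units_cases {P : ℤˣ → Prop} (h1 : P 1) (h2 : P (-1)) (e : ℤˣ) : P e := by
  rcases Int.units_eq_one_or e with rfl | rfl
  · exact h1
  · exact h2

theorem hx_of_ne (hM : MinRel p η h t x x₁) (hp : Admissible p) (e : ℤˣ) {i j : Fin ℓ}
    (hij : i ≠ j) (r s : ℕ) :
    ⁅hs hp t x i (r + 1), xs hp t x e j s⁆ - ⁅hs hp t x i r, xs hp t x e j (s + 1)⁆ =
      (((e : ℤ) * cartan p i j) • η) •
        (hs hp t x i r * xs hp t x e j s + xs hp t x e j s * hs hp t x i r) := by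
  induction e using units_cases with
  | h1 => rw [Units.val_one, one_mul]; exact hM.hx_pos_of_ne hp hij r s
  | h2 =>
    have := hM.hx_neg_of_ne hp hij r s
    rw [hM.xxBr_self, hM.xxBr_self, zero_add, zero_add] at this
    rw [Units.val_neg, Units.val_one, neg_one_mul]
    exact this

/-- A quadratic relation among the `x_{i,r}` at one vertex holds if it does at level zero. -/
theorem quadratic (hM : MinRel p η h t x x₁) (hp : Admissible p) (e : ℤˣ) (i : Fin ℓ) (α κ : R)
    (h0 : α • (xs hp t x e i 1 * xs hp t x e i 0 - xs hp t x e i 0 * xs hp t x e i 1) -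
      κ • (xs hp t x e i 0 * xs hp t x e i 0) = 0) (r s : ℕ) :
    (α • (xs hp t x e i (r + 1) * xs hp t x e i s - xs hp t x e i r * xs hp t x e i (s + 1)) -
      κ • (xs hp t x e i r * xs hp t x e i s)) +
    (α • (xs hp t x e i (s + 1) * xs hp t x e i r - xs hp t x e i s * xs hp t x e i (r + 1)) -
      κ • (xs hp t x e i s * xs hp t x e i r)) = 0 := by
  set j := hp.nb i
  have hadj : Adjacent j i := hp.nb_adj i
  set c : ℤ := (e : ℤ) * cartan p j i with hcdef
  set X := xs hp t x e i with hX
  -- The current of a neighbouring vertex is used, since its relations with `x_{i,r}` are already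
  -- known. The shifted elements are the ones on which it acts as a twisted derivation.
  set y : ℕ → B := fun a => sh (c • η) X a 0 with hy
  have hc : c ≠ 0 := unit_mul_cartan_ne e (cartan_adjacent_ne hadj)
  have htw := isTwisted_sh η (hM.h0_xs hp e j i) (hM.hx_of_ne hp e hadj.ne)
  have hy1 : ∀ a, y (a + 1) = sh (c • η) X a 1 + (c • η) • y a := fun a => rfl
  set q : ℕ → ℕ → B := fun a b => α • (y (a + 1) * y b - y a * y (b + 1)) - κ • (y a * y b)
    with hq
  have hq0 : q 0 0 = 0 := by
    have e0 : y 0 = X 0 := rfl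
    have e1 : y (0 + 1) = X 1 + (c • η) • X 0 := rfl
    rw [← h0, hq]
    simp only [e0, e1, add_mul, mul_add, smul_mul_assoc, mul_smul_comm]
    module
  have hty : ∀ a, ⁅t j, y a⁆ = c • (y (a + 1) - (c • η) • y a) :=
    fun a => hM.t_sh_zero hp e j i (c • η) a
  simp only [← hcdef, ← hX] at htw
  clear_value c
  -- The extreme entry of each antidiagonal comes from `quadratic_step`. The bracket with `t_j`
  -- relates neighbouring entries, up to a multiple of the relation on the previous antidiagonal.
  have hall : ∀ a b, q a b + q b a = 0 := by
    refine symm_family_eq_zero (Q := fun a b => q a b + q b a) ?_ ?_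
    · intro n hlow
      exact quadratic_step hc htw α κ (fun a b => rfl) hq0 n hlow
    · intro n hlow a b hab
      have h1 := congrArg (fun z => ⁅t j, z⁆) (hlow a b (by omega))
      have h2 := hlow a b (by omega)
      apply eq_zero_of_zsmul hc
      simp only [hq, rlie_add, rlie_sub, lie_smul_right, lie_mul, hty, rlie_zero, mul_sub, sub_mul,
        smul_mul_assoc, mul_smul_comm] at h1 h2 ⊢
      have h3 := congrArg (fun z => (2 * c * c : ℤ) • η • z) h2
      simp only [smul_zero] at h3
      rw [← add_zero (0 : B)]
      nth_rw 1 [← h1]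
      rw [← h3]
      module
  -- the passage from shifted to unshifted sequences
  set F : ℕ → ℕ → ℕ → ℕ → B := fun a r b s =>
    (α • (sh (c • η) X a (r + 1) * sh (c • η) X b s - sh (c • η) X a r * sh (c • η) X b (s + 1)) -
      κ • (sh (c • η) X a r * sh (c • η) X b s)) +
    (α • (sh (c • η) X b (s + 1) * sh (c • η) X a r - sh (c • η) X b s * sh (c • η) X a (r + 1)) -
      κ • (sh (c • η) X b s * sh (c • η) X a r)) with hF
  have hF00 : ∀ a b, F a 0 b 0 = 0 := by
    intro a b
    rw [← hall a b, hq, hF]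
    simp only [hy1, zero_add, add_mul, mul_add, smul_mul_assoc, mul_smul_comm]
    simp only [hy]
    module
  have hF0 : ∀ a r b, F a r b 0 = 0 := by
    intro a r b
    refine shift_eq_zero (κ := c • η) (F := fun a r => F a r b 0) (fun a => hF00 a b) ?_ a r
    intro a r
    simp only [hF, sh, add_mul, mul_add, smul_mul_assoc, mul_smul_comm]
    module
  have hFall : ∀ a r b s, F a r b s = 0 := by
    intro a r b s
    refine shift_eq_zero (κ := c • η) (F := fun b s => F a r b s) (fun b => hF0 a r b) ?_ b s
    intro b s
    simp only [hF, sh, add_mul, mul_add, smul_mul_assoc, mul_smul_comm]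
    module
  exact hFall 0 r 0 s

end Commutativity

end MinRel

/-! ### Relations at a single vertex and the cubic Serre relations -/

namespace MinRel

section OneVertex

variable {ℓ : ℕ} {p : Fin (ℓ + 1) → ZMod 2} {R : Type*} [CommRing R] {B : Type*} [Ring B]
  [Algebra R B] {η : R} {h t : Fin ℓ → B} {x x₁ : ℤˣ → Fin ℓ → B} [IsAddTorsionFree B]

theorem xxs_self (hM : MinRel p η h t x x₁) (hp : Admissible p) (e : ℤˣ) {i : Fin ℓ}
    (hi : vtxParity p i = 0) (r s : ℕ) :
    ⁅xs hp t x e i (r + 1), xs hp t x e i s⁆ - ⁅xs hp t x e i r, xs hp t x e i (s + 1)⁆ =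
      (((e : ℤ) * cartan p i i) • η) •
        (xs hp t x e i r * xs hp t x e i s + xs hp t x e i s * xs hp t x e i r) := by
  have h0 := hM.xxs e i i (fun h => by rw [hi] at h; exact zero_ne_one h.2)
  rw [hi, sbr_zero_left, sbr_zero_left, sabr_zero_left, ← hM.xs_one hp] at h0
  set κ := ((e : ℤ) * cartan p i i) • η
  have h1 : (1 : R) • (xs hp t x e i 1 * xs hp t x e i 0 - xs hp t x e i 0 * xs hp t x e i 1) -
      κ • (xs hp t x e i 0 * xs hp t x e i 0) = 0 := by
    -- At level zero both sides of the given relation are even multiples: it is twice `x_1 x_0 - x_0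
    -- x_1 - κ x_0² = 0`.
    apply eq_zero_of_add_self
    simp only [Ring.lie_def] at h0
    have e0 : xs hp t x e i 0 = x e i := rfl
    rw [e0, ← sub_eq_zero.mpr h0]
    module
  have h2 := hM.quadratic hp e i 1 κ h1 r s
  rw [← sub_eq_zero, ← h2]
  simp only [Ring.lie_def]
  module

/-- The relation `x_{i0}² = 0` is the case `α = 0`, `κ = -1` of `quadratic`. -/
theorem xx_odd (hM : MinRel p η h t x x₁) (hp : Admissible p) (e : ℤˣ) {i : Fin ℓ}
    (hi : vtxParity p i = 1) (r s : ℕ) :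
    xs hp t x e i r * xs hp t x e i s + xs hp t x e i s * xs hp t x e i r = 0 := by
  have h0 := hM.serre_zero e i i (cartan_odd p hi)
  rw [hi, sbr_one_one] at h0
  have h1 : (0 : R) • (xs hp t x e i 1 * xs hp t x e i 0 - xs hp t x e i 0 * xs hp t x e i 1) -
      (-1 : R) • (xs hp t x e i 0 * xs hp t x e i 0) = 0 := by
    have : x e i * x e i = 0 := eq_zero_of_add_self h0
    have e0 : xs hp t x e i 0 = x e i := rfl
    rw [e0, this]; simp
  have h2 := hM.quadratic hp e i 0 (-1) h1 r s
  rw [← h2]; module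

theorem xx_self_even (hM : MinRel p η h t x x₁) (hp : Admissible p) (e : ℤˣ) {i : Fin ℓ}
    (hi : vtxParity p i = 0) (r q : ℕ) :
    ⁅xs hp t x e i r, xs hp t x (-e) i q⁆ = (e : ℤ) • hs hp t x i (r + q) := by
  induction e using units_cases with
  | h1 =>
    have := hM.xxBr_self hp i r q
    rw [xxBr, hi, sbr_zero_left] at this
    rw [this, Units.val_one, one_smul]
  | h2 =>
    have := hM.xxBr_self hp i q r
    rw [xxBr, hi, sbr_zero_left, add_comm] at this
    rw [neg_neg, rlie_skew, this, Units.val_neg, Units.val_one, neg_smul, one_smul]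

theorem xx_self_odd (hM : MinRel p η h t x x₁) (hp : Admissible p) (e : ℤˣ) {i : Fin ℓ}
    (hi : vtxParity p i = 1) (r q : ℕ) :
    xs hp t x e i r * xs hp t x (-e) i q + xs hp t x (-e) i q * xs hp t x e i r =
      hs hp t x i (r + q) := by
  induction e using units_cases with
  | h1 =>
    have := hM.xxBr_self hp i r q
    rwa [xxBr, hi, sbr_one_one] at this
  | h2 =>
    have := hM.xxBr_self hp i q r
    rw [xxBr, hi, sbr_one_one, add_comm q] at this
    rw [neg_neg, add_comm, this]

theorem hx_self (hM : MinRel p η h t x x₁) (hp : Admissible p) (e : ℤˣ) {i : Fin ℓ}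
    (hi : vtxParity p i = 0) (r s : ℕ) :
    ⁅hs hp t x i (r + 1), xs hp t x e i s⁆ - ⁅hs hp t x i r, xs hp t x e i (s + 1)⁆ =
      (((e : ℤ) * cartan p i i) • η) •
        (hs hp t x i r * xs hp t x e i s + xs hp t x e i s * hs hp t x i r) := by
  rw [← sub_eq_zero]
  exact hx_even_of_xx e.ne_zero _ (hM.xx_self_even hp e hi)
    (fun r s => sub_eq_zero.mpr (hM.xxs_self hp e hi r s)) r s

theorem hx_odd (hM : MinRel p η h t x x₁) (hp : Admissible p) (e : ℤˣ) {i : Fin ℓ}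
    (hi : vtxParity p i = 1) (r s : ℕ) : ⁅hs hp t x i r, xs hp t x e i s⁆ = 0 :=
  hx_odd_of_xx (hM.xx_self_odd hp e hi) (hM.xx_odd hp e hi) r s

theorem hx' (hM : MinRel p η h t x x₁) (hp : Admissible p) (e : ℤˣ) {i j : Fin ℓ}
    (hij : ¬ (i = j ∧ vtxParity p i = 1)) (r s : ℕ) :
    ⁅hs hp t x i (r + 1), xs hp t x e j s⁆ - ⁅hs hp t x i r, xs hp t x e j (s + 1)⁆ =
      (((e : ℤ) * cartan p i j) • η) •
        (hs hp t x i r * xs hp t x e j s + xs hp t x e j s * hs hp t x i r) := by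
  by_cases h : i = j
  · subst h
    exact hM.hx_self hp e ((zmod_two_cases _).resolve_right fun h => hij ⟨rfl, h⟩) r s
  · exact hM.hx_of_ne hp e h r s

theorem hs_comm (hM : MinRel p η h t x x₁) (hp : Admissible p) (i j : Fin ℓ)
    (r q : ℕ) : ⁅hs hp t x i r, hs hp t x j q⁆ = 0 := by
  by_cases hij : i = j
  · subst hij
    rcases zmod_two_cases (vtxParity p i) with hi | hi
    · induction r using Nat.strong_induction_on generalizing q with
      | _ n ih =>
        have hG : GoodUpTo hp t x (n + q) := (hM.good_all hp (n + q)).1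
        change ⁅hs hp t x i n, xxBr hp t x i i q 0⁆ = 0
        -- At an even vertex the current of the vertex itself acts on both root vectors. The
        -- commutators needed below are those of `h_{i,r}` with `r < n`, supplied by the induction;
        -- the two shifts agree by `good_all`.
        have h1 := lie_sbr_of_shift η (h := hs hp t x i) (X := xs hp t x 1 i)
          (Y := xs hp t x (-1) i) (c := cartan p i i) (vtxParity p i) (vtxParity p i) n q 0
          (fun s => by rw [hM.h0_xs, Units.val_one, one_mul])
          (fun r s => by simpa using hM.hx_self hp 1 hi r s)
          (fun s => by rw [hM.h0_xs, Units.val_neg, Units.val_one, neg_one_mul])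
          (fun r _ s => by simpa using hM.hx_self hp (-1) hi r s)
          (fun m hm => by
            rw [hG.sbr_sh_left _ i (by omega), hG.sbr_sh_right _ i (by omega)])
          (fun m r hmr => by
            rw [hG.sbr_sh_left _ i (by omega)]
            exact lie_sh_eq_zero fun b h1 h2 => ih r (by omega) b)
        rw [hG.sbr_sh_left _ i (by omega), hG.sbr_sh_right _ i (by omega), sub_self,
          smul_zero] at h1
        exact h1
    · change ⁅hs hp t x i r, sbr (vtxParity p i) (vtxParity p i) _ _⁆ = 0
      rw [lie_sbr, hM.hx_odd hp 1 hi, hM.hx_odd hp (-1) hi, sbr_zero_elt_left,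
        sbr_zero_elt_right, add_zero]
  · exact hM.hs_comm_of_ne hp hij r q

theorem serre_cubic' (hM : MinRel p η h t x x₁) (hp : Admissible p) (e : ℤˣ) {i j : Fin ℓ}
    (hij : Adjacent i j) (hi : vtxParity p i = 0) (r s q : ℕ) :
    ⁅xs hp t x e i r, ⁅xs hp t x e i s, xs hp t x e j q⁆⁆ +
      ⁅xs hp t x e i s, ⁅xs hp t x e i r, xs hp t x e j q⁆⁆ = 0 := by
  set X := xs hp t x e i with hX
  set Y := xs hp t x e j with hY
  have hne := hij.ne
  have hbase : ∀ q, ⁅X 0, ⁅X 0, Y q⁆⁆ = 0 := by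
    intro q
    induction q with
    | zero => exact hM.serre_cubic e i j hij hi
    | succ q ih =>
      -- Independence of columns `i` and `j` separates the term in which `Y` is raised from those in
      -- which a copy of `X` is raised.
      have h1 : (e : ℤ) • (⁅X 1, ⁅X 0, Y q⁆⁆ + ⁅X 0, ⁅X 1, Y q⁆⁆) = 0 ∧
          (e : ℤ) • ⁅X 0, ⁅X 0, Y (q + 1)⁆⁆ = 0 := by
        apply hp.columns_indep hne
        intro a
        have h2 := congrArg (fun z => ⁅t a, z⁆) ih
        have e1 : ∀ u v : B, ⁅t a, ⁅u, v⁆⁆ = ⁅⁅t a, u⁆, v⁆ + ⁅u, ⁅t a, v⁆⁆ := rlie_jacobi (t a)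
        have e2 : ∀ (m : ℤ) (u v : B), ⁅m • u, v⁆ = m • ⁅u, v⁆ := by
          intro m u v; simp only [Ring.lie_def, smul_mul_assoc, mul_smul_comm, smul_sub]
        have e3 : ∀ r, ⁅t a, X r⁆ = ((e : ℤ) * cartan p a i) • X (r + 1) := hM.t_xs hp e a i
        have e4 : ∀ r, ⁅t a, Y r⁆ = ((e : ℤ) * cartan p a j) • Y (r + 1) := hM.t_xs hp e a j
        simp only [e1, e2, e3, e4, rlie_add, lie_zsmul_right, rlie_zero, zero_add] at h2
        rw [← h2]
        module
      exact eq_zero_of_zsmul e.ne_zero h1.2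
  set c : ℤ := (e : ℤ) * cartan p i i with hcdef
  set c' : ℤ := (e : ℤ) * cartan p i j with hc'def
  have hc : c ≠ 0 := unit_mul_cartan_ne e (cartan_even_ne p hi)
  set y : ℕ → B := fun a => sh (c • η) X a 0 with hy
  set z : ℕ → B := fun a => sh (c' • η) Y a 0 with hz
  have hty : ∀ b a, ⁅t b, y a⁆ = ((e : ℤ) * cartan p b i) • (y (a + 1) - (c • η) • y a) :=
    fun b a => hM.t_sh_zero hp e b i (c • η) a
  have htz : ∀ b a, ⁅t b, z a⁆ = ((e : ℤ) * cartan p b j) • (z (a + 1) - (c' • η) • z a) :=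
    fun b a => hM.t_sh_zero hp e b j (c' • η) a
  have htwy := isTwisted_sh η (hM.h0_xs hp e i i) (hM.hx_self hp e hi)
  have htwz := isTwisted_sh η (hM.h0_xs hp e i j) (hM.hx_of_ne hp e hne)
  simp only [← hcdef, ← hX, ← hc'def, ← hY] at htwy htwz
  have hbase' : ∀ q, ⁅y 0, ⁅y 0, z q⁆⁆ = 0 := by
    intro q
    change ⁅X 0, ⁅X 0, sh (c' • η) Y q 0⁆⁆ = 0
    rw [lie_sh]
    exact lie_sh_eq_zero fun b _ _ => hbase b
  clear_value c c'
  have hall : ∀ a b q, ⁅y a, ⁅y b, z q⁆⁆ + ⁅y b, ⁅y a, z q⁆⁆ = 0 := by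
    have key : ∀ n a b, a + b = n → ∀ q, ⁅y a, ⁅y b, z q⁆⁆ + ⁅y b, ⁅y a, z q⁆⁆ = 0 := by
      intro n
      induction n using Nat.strong_induction_on with
      | _ n ih =>
        have hlow : ∀ a b q, a + b < n → ⁅y a, ⁅y b, z q⁆⁆ + ⁅y b, ⁅y a, z q⁆⁆ = 0 :=
          fun a b q hab => ih _ hab a b rfl q
        intro a b
        induction b generalizing a with
        | zero => rintro rfl q; exact cubic_step hc htwy htwz hbase' _ hlow q
        | succ b ihb =>
          intro hab q
          have h1 := hlow a b q (by omega)
          -- The same separation by columns for the shifted elements. The action of `t_d` on these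
          -- has extra unshifted terms, but they add up to multiples of the lower relation `h1`.
          have h2 : (e : ℤ) • ((⁅y (a + 1), ⁅y b, z q⁆⁆ + ⁅y b, ⁅y (a + 1), z q⁆⁆) +
              (⁅y a, ⁅y (b + 1), z q⁆⁆ + ⁅y (b + 1), ⁅y a, z q⁆⁆)) = 0 ∧
              (e : ℤ) • (⁅y a, ⁅y b, z (q + 1)⁆⁆ + ⁅y b, ⁅y a, z (q + 1)⁆⁆) = 0 := by
            apply hp.columns_indep hne
            intro d
            have h3 := congrArg (fun u => ⁅t d, u⁆) h1
            have e1 : ∀ u v : B, ⁅t d, ⁅u, v⁆⁆ = ⁅⁅t d, u⁆, v⁆ + ⁅u, ⁅t d, v⁆⁆ :=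
              rlie_jacobi (t d)
            have e2 : ∀ (m : ℤ) (u v : B), ⁅m • u, v⁆ = m • ⁅u, v⁆ := by
              intro m u v; simp only [Ring.lie_def, smul_mul_assoc, mul_smul_comm, smul_sub]
            have e3 : ∀ (m : R) (u v : B), ⁅m • u, v⁆ = m • ⁅u, v⁆ := by
              intro m u v; simp only [Ring.lie_def, smul_mul_assoc, mul_smul_comm, smul_sub]
            have e4 : ∀ (u u' v : B), ⁅u - u', v⁆ = ⁅u, v⁆ - ⁅u', v⁆ := by
              intro u u' v; simp only [Ring.lie_def, sub_mul, mul_sub]; abel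
            simp only [rlie_add, e1, hty, htz, e2, e3, e4, lie_smul_right,
              rlie_sub, rlie_zero] at h3
            have h4 := congrArg (fun u => ((e : ℤ) * cartan p d i) • (2 * c) • η • u +
              ((e : ℤ) * cartan p d j) • c' • η • u) h1
            simp only [smul_zero, add_zero] at h4
            rw [← add_zero (0 : B)]
            nth_rw 1 [← h3]
            rw [← h4]
            module
          have h5 := eq_zero_of_zsmul e.ne_zero h2.1
          rwa [ihb (a + 1) (by omega), zero_add] at h5
    exact fun a b q => key _ a b rfl q
  -- the passage from shifted to unshifted sequences
  set F : ℕ → ℕ → ℕ → ℕ → ℕ → ℕ → B := fun a r b s m q =>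
    ⁅sh (c • η) X a r, ⁅sh (c • η) X b s, sh (c' • η) Y m q⁆⁆ +
      ⁅sh (c • η) X b s, ⁅sh (c • η) X a r, sh (c' • η) Y m q⁆⁆ with hF
  have e3 : ∀ (m : R) (u v : B), ⁅m • u, v⁆ = m • ⁅u, v⁆ := by
    intro m u v; simp only [Ring.lie_def, smul_mul_assoc, mul_smul_comm, smul_sub]
  have F1 : ∀ a r b m, F a r b 0 m 0 = 0 := by
    intro a r b m
    refine shift_eq_zero (κ := c • η) (F := fun a r => F a r b 0 m 0) (fun a => hall a b m) ?_ a r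
    intro a r
    simp only [hF, sh, rlie_add, add_rlie, lie_smul_right, e3]
    module
  have F2 : ∀ a r b s m, F a r b s m 0 = 0 := by
    intro a r b s m
    refine shift_eq_zero (κ := c • η) (F := fun b s => F a r b s m 0) (fun b => F1 a r b m) ?_ b s
    intro b s
    simp only [hF, sh, rlie_add, add_rlie, lie_smul_right, e3]
    module
  have F3 : ∀ a r b s m q, F a r b s m q = 0 := by
    intro a r b s m q
    refine shift_eq_zero (κ := c' • η) (F := fun m q => F a r b s m q) (fun m => F2 a r b s m)
      ?_ m q
    intro m q
    simp only [hF, sh, rlie_add, lie_smul_right]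
    module
  exact F3 0 r 0 s 0 q

end OneVertex

end MinRel

/-! ### Homomorphisms from the Yangian -/

section Lift

variable {ℓ : ℕ} {p : Fin (ℓ + 1) → ZMod 2} {k : Type*} [Field k]

/-- `ħ / 2`. -/
def halfHbar (k : Type*) [Field k] : PowerSeries k := PowerSeries.C (1 / 2 : k) * PowerSeries.X

theorem coef_eq (e : ℤˣ) (i j : Fin ℓ) :
    coef p k e i j = ((e : ℤ) * cartan p i j) • halfHbar k := by
  rw [coef, halfHbar, ← smul_mul_assoc, ← map_zsmul, zsmul_eq_mul]
  congr 2
  ring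

theorem two_mul_halfHbar [CharZero k] : 2 * halfHbar k = PowerSeries.X := by
  rw [halfHbar, ← mul_assoc, two_mul, ← map_add]
  norm_num

variable {B : Type*} [Ring B] [Algebra (PowerSeries k) B]

/-- Algebras over `k⟦ħ⟧` in characteristic zero are torsion free. -/
theorem isAddTorsionFree_of_algebra (k : Type*) [Field k] [CharZero k] (B : Type*)
    [AddCommGroup B] [Module (PowerSeries k) B] : IsAddTorsionFree B where
  nsmul_right_injective n hn := by
    intro a b hab
    have key : ∀ z : B, PowerSeries.C ((n : k)⁻¹) • (n • z) = z := by
      intro z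
      rw [← Nat.cast_smul_eq_nsmul (PowerSeries k), smul_smul]
      have : (PowerSeries.C ((n : k)⁻¹) : PowerSeries k) * (n : PowerSeries k) = 1 := by
        rw [← map_natCast (PowerSeries.C (R := k)), ← map_mul,
          inv_mul_cancel₀ (by exact_mod_cast hn), map_one]
      rw [this, one_smul]
    have := congrArg (fun z => PowerSeries.C ((n : k)⁻¹) • z) hab
    simp only [key] at this
    exact this

/-- The images of the generators. -/
def genImage (hp : Admissible p) (t : Fin ℓ → B) (x : ℤˣ → Fin ℓ → B) : Gen ℓ → B
  | .h i r => hs hp t x i r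
  | .x e i r => xs hp t x e i r

theorem MinRel.lift_rel [CharZero k] {h t : Fin ℓ → B} {x x₁ : ℤˣ → Fin ℓ → B}
    (hM : MinRel p (halfHbar k) h t x x₁) (hp : Admissible p) (u v : Free k ℓ)
    (huv : Rel p k u v) :
    FreeAlgebra.lift (PowerSeries k) (genImage hp t x) u =
      FreeAlgebra.lift (PowerSeries k) (genImage hp t x) v := by
  have hB : IsAddTorsionFree B := isAddTorsionFree_of_algebra k B
  have e1 : ∀ i r, FreeAlgebra.lift (PowerSeries k) (genImage hp t x) (fh k i r) =
      hs hp t x i r := fun i r => FreeAlgebra.lift_ι_apply _ _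
  have e2 : ∀ e i r, FreeAlgebra.lift (PowerSeries k) (genImage hp t x) (fx k e i r) =
      xs hp t x e i r := fun e i r => FreeAlgebra.lift_ι_apply _ _
  cases huv <;>
    simp only [map_sbr, map_sabr, map_sub, map_add, map_smul, map_zero, e1, e2] <;>
    try simp only [sbr_zero_left, sabr_zero_left, coef_eq]
  case hh i j r s => exact hM.hs_comm hp i j r s
  case h0x e i j s => rw [hM.h0_xs, Int.cast_smul_eq_zsmul]
  case xx i j r s =>
    split_ifs with hij
    · subst hij; rw [e1]; exact hM.xxBr_self hp i r s
    · rw [map_zero]; exact hM.xxBr_of_ne hp hij r s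
  case hx e i j r s hij => exact hM.hx' hp e hij r s
  case xxs e i j r s hij =>
    by_cases h : i = j
    · subst h
      have hi := (zmod_two_cases (vtxParity p i)).resolve_right fun h => hij ⟨rfl, h⟩
      rw [hi, sbr_zero_left, sbr_zero_left, sabr_zero_left]
      exact hM.xxs_self hp e hi r s
    · exact hM.xxs_of_ne hp e h r s
  case hx_odd e i r s hi => exact hM.hx_odd hp e hi r s
  case serre_zero e i j r s hij =>
    by_cases h : i = j
    · subst h
      have hi : vtxParity p i = 1 :=
        (zmod_two_cases (vtxParity p i)).resolve_left fun h => cartan_even_ne p h hij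
      rw [hi, sbr_one_one]
      exact hM.xx_odd hp e hi r s
    · exact hM.serre_zero_of_ne hp e h hij r s
  case serre_cubic e i j r s q hij hi =>
    rw [hi]
    simp only [sbr_zero_left]
    exact hM.serre_cubic' hp e hij hi r s q
  case serre_quartic e i j l r s hij hjl hj => exact hM.serre_quartic' hp e hij hjl hj r s

/-- The homomorphism from the Yangian given by a solution of the minimalistic relations. -/
def MinRel.hom [CharZero k] {h t : Fin ℓ → B} {x x₁ : ℤˣ → Fin ℓ → B}
    (hM : MinRel p (halfHbar k) h t x x₁) (hp : Admissible p) : Y p k →ₐ[PowerSeries k] B :=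
  lift p k (FreeAlgebra.lift (PowerSeries k) (genImage hp t x)) (hM.lift_rel hp)

theorem MinRel.hom_hGen [CharZero k] {h t : Fin ℓ → B} {x x₁ : ℤˣ → Fin ℓ → B}
    (hM : MinRel p (halfHbar k) h t x x₁) (hp : Admissible p) (i : Fin ℓ) (r : ℕ) :
    hM.hom hp (hGen p k i r) = hs hp t x i r := by
  rw [MinRel.hom, hGen, gen, lift_mk, FreeAlgebra.lift_ι_apply]; rfl

theorem MinRel.hom_xGen [CharZero k] {h t : Fin ℓ → B} {x x₁ : ℤˣ → Fin ℓ → B}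
    (hM : MinRel p (halfHbar k) h t x x₁) (hp : Admissible p) (e : ℤˣ) (i : Fin ℓ) (r : ℕ) :
    hM.hom hp (xGen p k e i r) = xs hp t x e i r := by
  rw [MinRel.hom, xGen, gen, lift_mk, FreeAlgebra.lift_ι_apply]; rfl

end Lift

/-! ### Chains of root vectors -/

section Chain

variable {B : Type*} [Ring B]

theorem parity_telescope (a b c : ZMod 2) : (a + b) + (b + c) = a + c := by
  revert a b c; decide

theorem sbr_sbr_eq_zero {a b c : ZMod 2} {z u v : B} (h1 : sbr a b z u = 0)
    (h2 : sbr a c z v = 0) : sbr a (b + c) z (sbr b c u v) = 0 := by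
  rw [sbr_jacobi, h1, h2, sbr_zero_elt_left, sbr_zero_elt_right, smul_zero, add_zero]

theorem sbr_eq_zero_symm {a b : ZMod 2} {u v : B} (h : sbr a b u v = 0) : sbr b a v u = 0 := by
  rw [sbr_skew, h, smul_zero, neg_zero]

/-- Iterated brackets `[...[x_a, x_{a+1}], ..., x_{a+n}]`, where `x_i` has the parity
`π i + π (i + 1)`. -/
def nest (π : ℕ → ZMod 2) (x : ℕ → B) (a : ℕ) : ℕ → B
  | 0 => x a
  | n + 1 => sbr (π a + π (a + n + 1)) (π (a + n + 1) + π (a + n + 2)) (nest π x a n)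
      (x (a + n + 1))

theorem nest_succ (π : ℕ → ZMod 2) (x : ℕ → B) (a n : ℕ) :
    nest π x a (n + 1) = sbr (π a + π (a + n + 1)) (π (a + n + 1) + π (a + n + 2)) (nest π x a n)
      (x (a + n + 1)) := rfl

/-- The relations between the simple root vectors `x_i` and `y_i` of `𝔤𝔩(V)`. -/
structure IsChain (π : ℕ → ZMod 2) (L : ℕ) (x y : ℕ → B) : Prop where
  sq : ∀ i, sbr (π i + π (i + 1)) (π i + π (i + 1)) (x i) (x i) = 0
  far : ∀ i j, i + 1 < j → sbr (π i + π (i + 1)) (π j + π (j + 1)) (x i) (x j) = 0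
  near_left : ∀ i, sbr (π i + π (i + 1)) (π i + π (i + 2)) (x i) (nest π x i 1) = 0
  near_right : ∀ i, sbr (π (i + 1) + π (i + 2)) (π i + π (i + 2)) (x (i + 1)) (nest π x i 1) = 0
  quartic : ∀ i, sbr (π i + π (i + 2)) (π (i + 1) + π (i + 3)) (nest π x i 1)
    (nest π x (i + 1) 1) = 0
  xy : ∀ i j, i ≠ j → sbr (π i + π (i + 1)) (π j + π (j + 1)) (y i) (x j) = 0
  -- For `x_i = E_{i,i+1}` and `y_i = E_{i+1,i}` the bracket is `E_{ii} - (-1)^{π i + π (i+1)}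
  -- E_{i+1,i+1}`, which explains the signs here and below. The bound is there because the sequences
  -- will be continued by zero.
  kx_succ : ∀ i, i + 1 < L → ⁅sbr (π i + π (i + 1)) (π i + π (i + 1)) (x i) (y i), x (i + 1)⁆ =
    -(psign (π i + π (i + 1)) • x (i + 1))
  kx_pred : ∀ i, i + 1 < L →
    ⁅sbr (π (i + 1) + π (i + 2)) (π (i + 1) + π (i + 2)) (x (i + 1)) (y (i + 1)), x i⁆ = -x i
  kx_far : ∀ i j, i + 1 < j ∨ j + 1 < i →
    ⁅sbr (π i + π (i + 1)) (π i + π (i + 1)) (x i) (y i), x j⁆ = 0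

variable {π : ℕ → ZMod 2} {x : ℕ → B}

theorem sbr_nest_eq_zero {c : ZMod 2} {z : B} {a n : ℕ}
    (h : ∀ j, a ≤ j → j ≤ a + n → sbr c (π j + π (j + 1)) z (x j) = 0) :
    sbr c (π a + π (a + n + 1)) z (nest π x a n) = 0 := by
  induction n with
  | zero => exact h a le_rfl le_rfl
  | succ n ih =>
    have := sbr_sbr_eq_zero (ih fun j h1 h2 => h j h1 (by omega))
      (h (a + n + 1) (by omega) (by omega))
    rwa [parity_telescope] at this

theorem sbr_nest_of_even {z : B} {a n : ℕ}
    (h : ∀ j, a ≤ j → j ≤ a + n → ⁅z, x j⁆ = 0) : ⁅z, nest π x a n⁆ = 0 := by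
  rw [← sbr_zero_left (π a + π (a + n + 1))]
  exact sbr_nest_eq_zero fun j h1 h2 => by rw [sbr_zero_left]; exact h j h1 h2

namespace IsChain

variable {L : ℕ} {y : ℕ → B}

theorem far' (hC : IsChain π L x y) {i j : ℕ} (h : i + 1 < j ∨ j + 1 < i) :
    sbr (π i + π (i + 1)) (π j + π (j + 1)) (x i) (x j) = 0 := by
  rcases h with h | h
  · exact hC.far i j h
  · exact sbr_eq_zero_symm (hC.far j i h)

theorem x_nest_far (hC : IsChain π L x y) {i a n : ℕ} (h : i + 1 < a ∨ a + n + 1 < i) :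
    sbr (π i + π (i + 1)) (π a + π (a + n + 1)) (x i) (nest π x a n) = 0 :=
  sbr_nest_eq_zero fun j h1 h2 => hC.far' (by omega)

/-- Adjacent iterated brackets combine. -/
theorem nest_nest (hC : IsChain π L x y) (a n m : ℕ) :
    sbr (π a + π (a + n + 1)) (π (a + n + 1) + π (a + n + m + 2)) (nest π x a n)
      (nest π x (a + n + 1) m) = nest π x a (n + m + 1) := by
  induction m with
  | zero => rfl
  | succ m ih =>
    have h0 : sbr (π a + π (a + n + 1)) (π (a + n + 1 + m + 1) + π (a + n + 1 + m + 2))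
        (nest π x a n) (x (a + n + 1 + m + 1)) = 0 :=
      sbr_eq_zero_symm (hC.x_nest_far (Or.inr (by omega)))
    have h1 := sbr_jacobi (π a + π (a + n + 1)) (π (a + n + 1) + π (a + n + 1 + m + 1))
      (π (a + n + 1 + m + 1) + π (a + n + 1 + m + 2)) (nest π x a n) (nest π x (a + n + 1) m)
      (x (a + n + 1 + m + 1))
    rw [h0, sbr_zero_elt_right, smul_zero, add_zero, parity_telescope, parity_telescope] at h1
    have e : a + n + 1 + m + 1 = a + n + m + 2 := by omega
    rw [e] at h1
    rw [ih] at h1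
    have e2 : a + n + 1 + m + 2 = a + n + (m + 1) + 2 := by omega
    rw [nest]
    rw [← e2, e, h1, show n + (m + 1) + 1 = (n + m + 1) + 1 by omega,
      nest_succ π x a (n + m + 1),
      show a + (n + m + 1) + 1 = a + n + m + 2 by omega,
      show a + (n + m + 1) + 2 = a + n + 1 + m + 2 by omega]

/-- A rewriting of the quartic relation: `x_{i+1}` kills `[x_i, x_{i+1}]`, so by the Jacobi identity
its bracket with `[[x_i, x_{i+1}], x_{i+2}]` is, up to sign, `[[x_i, x_{i+1}], [x_{i+1}, x_{i+2}]]`.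
-/
theorem x_nest_two (hC : IsChain π L x y) (i : ℕ) :
    sbr (π (i + 1) + π (i + 2)) (π i + π (i + 3)) (x (i + 1)) (nest π x i 2) = 0 := by
  have h1 := sbr_jacobi (π (i + 1) + π (i + 2)) (π i + π (i + 2)) (π (i + 2) + π (i + 3))
    (x (i + 1)) (nest π x i 1) (x (i + 2))
  rw [hC.near_right, sbr_zero_elt_left, zero_add, parity_telescope, parity_telescope] at h1
  have h2 := hC.quartic i
  rw [nest] at h2 ⊢
  rw [h1]
  rw [show sbr (π (i + 1) + π (i + 2)) (π (i + 2) + π (i + 3)) (x (i + 1)) (x (i + 2)) =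
    nest π x (i + 1) 1 from rfl]
  have h3 : sbr (π i + π (i + 2)) (π (i + 1) + π (i + 3)) (nest π x i 1)
    (nest π x (i + 1) 1) = 0 := hC.quartic i
  rw [h3, smul_zero]

/-- Trailing factors far from `i` are removed by induction. Then `i` is the last or the last but one
index, and the nested bracket splits into a part far from `i` and a final block of length two or
three, which `x_i` kills by `near_right` or `x_nest_two`. The short brackets are the base cases. -/
theorem x_nest_inside (hC : IsChain π L x y) {i a n : ℕ} (hn : 1 ≤ n) (h1 : a ≤ i)
    (h2 : i ≤ a + n) :
    sbr (π i + π (i + 1)) (π a + π (a + n + 1)) (x i) (nest π x a n) = 0 := by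
  induction n with
  | zero => omega
  | succ n ih =>
    by_cases hlt : i < a + n
    · have e := sbr_sbr_eq_zero (ih (by omega) (by omega))
        (hC.far' (i := i) (j := a + n + 1) (Or.inl (by omega)))
      rwa [parity_telescope] at e
    by_cases hlast : i = a + n + 1
    · subst hlast
      cases n with
      | zero => exact hC.near_right a
      | succ n =>
        have e := sbr_sbr_eq_zero
          (hC.x_nest_far (i := a + (n + 1) + 1) (a := a) (n := n) (Or.inr (by omega)))
          (hC.near_right (a + n + 1))
        rw [parity_telescope] at e
        have e2 := hC.nest_nest a n 1
        rw [show a + n + 1 + 2 = a + n + 1 + 1 + 1 by omega] at e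
        rw [show a + n + 1 + 2 = a + n + 1 + 1 + 1 by omega] at e2
        rw [e2] at e
        exact e
    · have hi : i = a + n := by omega
      subst hi
      match n with
      | 0 => exact hC.near_left a
      | 1 => exact hC.x_nest_two a
      | n + 2 =>
        have e := sbr_sbr_eq_zero
          (hC.x_nest_far (i := a + (n + 2)) (a := a) (n := n) (Or.inr (by omega)))
          (hC.x_nest_two (a + n + 1))
        rw [parity_telescope] at e
        have e2 := hC.nest_nest a n 2
        rw [show a + n + 1 + 3 = a + n + 2 + 2 by omega] at e
        rw [e2] at e
        exact e

theorem x_nest_left (hC : IsChain π L x y) (i n : ℕ) :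
    sbr (π i + π (i + 1)) (π (i + 1) + π (i + n + 2)) (x i) (nest π x (i + 1) n) =
      nest π x i (n + 1) := by
  have := hC.nest_nest i 0 n
  rw [show 0 + n + 1 = n + 1 by omega] at this
  exact this

theorem x_nest_right (π : ℕ → ZMod 2) (x : ℕ → B) (a n : ℕ) :
    sbr (π (a + n + 1) + π (a + n + 2)) (π a + π (a + n + 1)) (x (a + n + 1)) (nest π x a n) =
      -(psign ((π (a + n + 1) + π (a + n + 2)) * (π a + π (a + n + 1))) •
        nest π x a (n + 1)) := by
  rw [sbr_skew, nest]

theorem y_nest_outside (hC : IsChain π L x y) {i a n : ℕ} (h : i < a ∨ a + n < i) :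
    sbr (π i + π (i + 1)) (π a + π (a + n + 1)) (y i) (nest π x a n) = 0 :=
  sbr_nest_eq_zero fun j h1 h2 => hC.xy i j (by omega)

theorem yx_self (π : ℕ → ZMod 2) (x y : ℕ → B) (i : ℕ) :
    sbr (π i + π (i + 1)) (π i + π (i + 1)) (y i) (x i) =
      -(psign (π i + π (i + 1)) •
        sbr (π i + π (i + 1)) (π i + π (i + 1)) (x i) (y i)) := by
  have hsq : ∀ t : ZMod 2, t * t = t := by decide
  rw [sbr_skew, hsq]

theorem k_nest_succ (hC : IsChain π L x y) {i n : ℕ} (hi : i + 1 < L) :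
    ⁅sbr (π i + π (i + 1)) (π i + π (i + 1)) (x i) (y i), nest π x (i + 1) n⁆ =
      -(psign (π i + π (i + 1)) • nest π x (i + 1) n) := by
  induction n with
  | zero => exact hC.kx_succ i hi
  | succ n ih =>
    rw [nest, lie_sbr, ih, hC.kx_far i _ (Or.inl (by omega)), sbr_zero_elt_right, add_zero,
      sbr_neg_left, sbr_zsmul_left]

theorem k_nest_pred (hC : IsChain π L x y) {a n : ℕ} (hi : a + n + 1 < L) :
    ⁅sbr (π (a + n + 1) + π (a + n + 2)) (π (a + n + 1) + π (a + n + 2)) (x (a + n + 1))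
      (y (a + n + 1)), nest π x a n⁆ = -nest π x a n := by
  cases n with
  | zero => exact hC.kx_pred a hi
  | succ n =>
    rw [nest, lie_sbr, sbr_nest_of_even fun j h1 h2 => hC.kx_far _ j (Or.inr (by omega)),
      sbr_zero_elt_left, zero_add]
    have h1 : ⁅sbr (π (a + (n + 1) + 1) + π (a + (n + 1) + 2))
        (π (a + (n + 1) + 1) + π (a + (n + 1) + 2)) (x (a + (n + 1) + 1)) (y (a + (n + 1) + 1)),
        x (a + n + 1)⁆ = -x (a + n + 1) := hC.kx_pred (a + n + 1) (by omega)
    rw [h1, sbr_neg_right]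

/-- Only the first factor `x_a` fails to commute with `y_a`. Their bracket is a Cartan element,
which acts on the rest by a sign. -/
theorem y_nest_left (hC : IsChain π L x y) {a n : ℕ} (ha : a + n + 1 < L) :
    sbr (π a + π (a + 1)) (π a + π (a + n + 2)) (y a) (nest π x a (n + 1)) =
      nest π x (a + 1) n := by
  have h1 := sbr_jacobi (π a + π (a + 1)) (π a + π (a + 1)) (π (a + 1) + π (a + n + 2))
    (y a) (x a) (nest π x (a + 1) n)
  have h2 : sbr (π a + π (a + 1)) (π (a + 1) + π (a + n + 2)) (y a) (nest π x (a + 1) n) = 0 := by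
    have := hC.y_nest_outside (i := a) (a := a + 1) (n := n) (Or.inl (by omega))
    rwa [show a + 1 + n + 1 = a + n + 2 by omega] at this
  have hself : ∀ t : ZMod 2, t + t = 0 := by decide
  rw [h2, sbr_zero_elt_right, smul_zero, add_zero, hC.x_nest_left, parity_telescope, yx_self,
    hself (π a + π (a + 1)), sbr_zero_left] at h1
  rw [h1]
  have e : ∀ (u v : B), ⁅-(psign (π a + π (a + 1)) • u), v⁆ =
      -(psign (π a + π (a + 1)) • ⁅u, v⁆) := by
    intro u v
    simp only [Ring.lie_def, neg_mul, mul_neg, smul_mul_assoc, mul_smul_comm, smul_sub]; abel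
  rw [e, hC.k_nest_succ (by omega), smul_neg, neg_neg, smul_smul, psign_mul_self, one_smul]

theorem y_nest_right (hC : IsChain π L x y) {a n : ℕ} (ha : a + n + 1 < L) :
    sbr (π (a + n + 1) + π (a + n + 2)) (π a + π (a + n + 2)) (y (a + n + 1))
      (nest π x a (n + 1)) =
      -(psign ((π (a + n + 1) + π (a + n + 2)) * (π a + π (a + n + 2))) • nest π x a n) := by
  have h1 := sbr_jacobi (π (a + n + 1) + π (a + n + 2)) (π a + π (a + n + 1))
    (π (a + n + 1) + π (a + n + 2)) (y (a + n + 1)) (nest π x a n) (x (a + n + 1))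
  have hself : ∀ t : ZMod 2, t + t = 0 := by decide
  rw [hC.y_nest_outside (Or.inr (by omega)), sbr_zero_elt_left, zero_add, parity_telescope,
    yx_self, hself (π (a + n + 1) + π (a + n + 2)), sbr_zero_right, rlie_neg, lie_zsmul_right,
    rlie_skew, hC.k_nest_pred ha] at h1
  rw [nest, h1]
  have hs : psign ((π (a + n + 1) + π (a + n + 2)) * (π a + π (a + n + 1))) *
      psign (π (a + n + 1) + π (a + n + 2)) =
      psign ((π (a + n + 1) + π (a + n + 2)) * (π a + π (a + n + 2))) := by
    rw [← psign_add]
    congr 1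
    generalize π (a + n + 1) = u
    generalize π (a + n + 2) = v
    generalize π a = w
    revert u v w
    decide
  rw [← hs]
  module

/-- Split the bracket just before `x_i`. Then `y_i` commutes with the left part and removes `x_i`
from the right one, and the two parts left over are too far apart to have a nonzero bracket. -/
theorem y_nest_inside (hC : IsChain π L x y) {i a n : ℕ} (hn : a + n < L) (h1 : a < i)
    (h2 : i < a + n) :
    sbr (π i + π (i + 1)) (π a + π (a + n + 1)) (y i) (nest π x a n) = 0 := by
  obtain ⟨m, rfl⟩ : ∃ m, i = a + m + 1 := ⟨i - a - 1, by omega⟩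
  obtain ⟨q, rfl⟩ : ∃ q, n = m + (q + 1) + 1 := ⟨n - m - 2, by omega⟩
  have e := hC.nest_nest a m (q + 1)
  have h3 := sbr_jacobi (π (a + m + 1) + π (a + m + 2)) (π a + π (a + m + 1))
    (π (a + m + 1) + π (a + m + (q + 1) + 2)) (y (a + m + 1)) (nest π x a m)
    (nest π x (a + m + 1) (q + 1))
  have h4 := hC.y_nest_left (a := a + m + 1) (n := q) (by omega)
  rw [show a + m + 1 + q + 2 = a + m + (q + 1) + 2 by omega] at h4
  rw [hC.y_nest_outside (Or.inr (by omega)), sbr_zero_elt_left, zero_add, e, parity_telescope,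
    h4] at h3
  have h5 : sbr (π a + π (a + m + 1)) (π (a + m + 1 + 1) + π (a + m + 1 + 1 + q + 1))
      (nest π x a m) (nest π x (a + m + 1 + 1) q) = 0 :=
    sbr_nest_eq_zero fun j _ _ => sbr_eq_zero_symm (hC.x_nest_far (Or.inr (by omega)))
  rw [show a + (m + (q + 1) + 1) + 1 = a + m + (q + 1) + 2 by omega, h3]
  have h6 : (π (a + m + 1) + π (a + m + 2)) + (π (a + m + 1) + π (a + m + (q + 1) + 2)) =
      π (a + m + 1 + 1) + π (a + m + 1 + 1 + q + 1) := by
    rw [show a + m + 1 + 1 + q + 1 = a + m + (q + 1) + 2 by omega,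
      show a + m + 1 + 1 = a + m + 2 by omega]
    generalize π (a + m + 1) = u
    generalize π (a + m + 2) = v
    generalize π (a + m + (q + 1) + 2) = w
    revert u v w
    decide
  rw [h6, h5, smul_zero]

/-- The bracket of a simple root vector with a root vector. -/
theorem x_nest (hC : IsChain π L x y) (i a n : ℕ) :
    sbr (π i + π (i + 1)) (π a + π (a + n + 1)) (x i) (nest π x a n) =
      (if i + 1 = a then nest π x i (n + 1) else 0) -
      psign ((π i + π (i + 1)) * (π a + π (a + n + 1))) •
        (if i = a + n + 1 then nest π x a (n + 1) else 0) := by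
  by_cases h1 : i + 1 = a
  · subst h1
    rw [if_pos rfl, if_neg (by omega), smul_zero, sub_zero,
      show i + 1 + n + 1 = i + n + 2 by omega, hC.x_nest_left]
  by_cases h2 : i = a + n + 1
  · subst h2
    rw [if_neg (by omega), if_pos rfl, zero_sub, x_nest_right]
  rw [if_neg h1, if_neg h2, smul_zero, sub_zero]
  by_cases h3 : i + 1 < a ∨ a + n + 1 < i
  · exact hC.x_nest_far h3
  · rcases Nat.eq_zero_or_pos n with rfl | hn
    · have : i = a := by omega
      subst this
      exact hC.sq i
    · exact hC.x_nest_inside hn (by omega) (by omega)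

/-- The bracket of a simple root vector `y_i` with a root vector that is not opposite to it. -/
theorem y_nest (hC : IsChain π L x y) {i a n : ℕ} (hL : a + n < L) (h : ¬ (i = a ∧ n = 0)) :
    sbr (π i + π (i + 1)) (π a + π (a + n + 1)) (y i) (nest π x a n) =
      (if i = a then nest π x (a + 1) (n - 1) else 0) -
      psign ((π i + π (i + 1)) * (π a + π (a + n + 1))) •
        (if i = a + n then nest π x a (n - 1) else 0) := by
  by_cases h1 : i = a
  · subst h1
    obtain ⟨m, rfl⟩ : ∃ m, n = m + 1 := ⟨n - 1, by omega⟩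
    rw [if_pos rfl, if_neg (by omega), smul_zero, sub_zero]
    exact hC.y_nest_left (by omega)
  by_cases h2 : i = a + n
  · subst h2
    obtain ⟨m, rfl⟩ : ∃ m, n = m + 1 := ⟨n - 1, by omega⟩
    rw [if_neg (by omega), if_pos rfl, zero_sub]
    exact hC.y_nest_right (by omega)
  rw [if_neg h1, if_neg h2, smul_zero, sub_zero]
  by_cases h3 : i < a ∨ a + n < i
  · exact hC.y_nest_outside h3
  · exact hC.y_nest_inside hL (by omega) (by omega)

end IsChain

end Chain

/-! ### Chains from the Serre relations -/

section SerreChain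

variable {B : Type*} [Ring B] [IsAddTorsionFree B]

theorem sbr_sbr_self {a c : ZMod 2} {x z : B} (ha : a = 1) (h : sbr a a x x = 0) :
    sbr a (a + c) x (sbr a c x z) = 0 := by
  have h1 := sbr_jacobi a a c x x z
  subst ha
  rw [h, sbr_zero_elt_left, zero_add, mul_one, psign_one, neg_smul, one_smul] at h1
  exact eq_zero_of_add_self (by nth_rewrite 2 [h1]; exact add_neg_cancel _)

/-- Apply the derivation `ad y` twice to `[x, z] = 0`. Only the mixed term `2 [[y, x], [y, z]]`
survives. -/
theorem sbr_lie_lie_of_even {a c : ZMod 2} {x y z : B} (hxz : sbr a c x z = 0)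
    (hx : ⁅y, ⁅y, x⁆⁆ = 0) (hz : ⁅y, ⁅y, z⁆⁆ = 0) : sbr a c ⁅x, y⁆ ⁅y, z⁆ = 0 := by
  have h1 : ⁅y, ⁅y, sbr a c x z⁆⁆ = 0 := by rw [hxz, rlie_zero, rlie_zero]
  rw [lie_sbr, rlie_add, lie_sbr, lie_sbr, hx, hz, sbr_zero_elt_left, sbr_zero_elt_right, zero_add,
    add_zero] at h1
  rw [rlie_skew x y, sbr_neg_left, eq_zero_of_add_self h1, neg_zero]

/-- The relations with `nest π x i 1` follow from the cubic Serre relation at an even vertex and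
from `x_i² = 0` at an odd one. The quartic relation is an assumption for an odd middle vertex only;
for an even one it is a consequence of the cubic relations. -/
theorem isChain_of_serre {π : ℕ → ZMod 2} {L : ℕ} {x y : ℕ → B}
    (sq : ∀ i, sbr (π i + π (i + 1)) (π i + π (i + 1)) (x i) (x i) = 0)
    (far : ∀ i j, i + 1 < j → sbr (π i + π (i + 1)) (π j + π (j + 1)) (x i) (x j) = 0)
    (cubic : ∀ i j, i + 1 = j ∨ j + 1 = i → π i + π (i + 1) = 0 → ⁅x i, ⁅x i, x j⁆⁆ = 0)
    (quartic : ∀ i, π (i + 1) + π (i + 2) = 1 →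
      sbr (π i + π (i + 2)) (π (i + 1) + π (i + 3)) (nest π x i 1) (nest π x (i + 1) 1) = 0)
    (xy : ∀ i j, i ≠ j → sbr (π i + π (i + 1)) (π j + π (j + 1)) (y i) (x j) = 0)
    (kx_succ : ∀ i, i + 1 < L →
      ⁅sbr (π i + π (i + 1)) (π i + π (i + 1)) (x i) (y i), x (i + 1)⁆ =
      -(psign (π i + π (i + 1)) • x (i + 1)))
    (kx_pred : ∀ i, i + 1 < L →
      ⁅sbr (π (i + 1) + π (i + 2)) (π (i + 1) + π (i + 2)) (x (i + 1)) (y (i + 1)), x i⁆ = -x i)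
    (kx_far : ∀ i j, i + 1 < j ∨ j + 1 < i →
      ⁅sbr (π i + π (i + 1)) (π i + π (i + 1)) (x i) (y i), x j⁆ = 0) :
    IsChain π L x y where
  sq := sq
  far := far
  near_left i := by
    rw [← parity_telescope (π i) (π (i + 1)) (π (i + 2)), nest, nest]
    rcases zmod_two_cases (π i + π (i + 1)) with h | h
    · have := cubic i (i + 1) (Or.inl rfl) h
      simp only [add_zero]
      rw [h, zero_add, sbr_zero_left, sbr_zero_left, this]
    · exact sbr_sbr_self h (sq i)
  near_right i := by
    rw [← parity_telescope (π i) (π (i + 1)) (π (i + 2)), nest, nest]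
    simp only [add_zero]
    rcases zmod_two_cases (π (i + 1) + π (i + 2)) with h | h
    · have := cubic (i + 1) i (Or.inr rfl) h
      rw [h, sbr_zero_left, sbr_zero_right, rlie_skew (x i), rlie_neg, this, neg_zero]
    · rw [sbr_skew (π i + π (i + 1)), sbr_neg_right, sbr_zsmul_right,
        add_comm (π i + π (i + 1)) (π (i + 1) + π (i + 2)), sbr_sbr_self h (sq (i + 1)),
        smul_zero, neg_zero]
  quartic i := by
    rcases zmod_two_cases (π (i + 1) + π (i + 2)) with h | h
    · have h1 := sbr_lie_lie_of_even (far i (i + 2) (by omega))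
        (cubic (i + 1) i (Or.inr rfl) h) (cubic (i + 1) (i + 2) (Or.inl rfl) h)
      rw [← parity_telescope (π i) (π (i + 1)) (π (i + 2)),
        ← parity_telescope (π (i + 1)) (π (i + 2)) (π (i + 3)), h, add_zero, zero_add]
      simp only [nest, add_zero]
      rw [h, sbr_zero_left, sbr_zero_right]
      exact h1
    · exact quartic i h
  xy := xy
  kx_succ := kx_succ
  kx_pred := kx_pred
  kx_far := kx_far

end SerreChain

/-! ### The relations of the Yangian -/

section Relations

variable {ℓ : ℕ} (p : Fin (ℓ + 1) → ZMod 2) (k : Type*) [Field k]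

theorem mk_fh (i : Fin ℓ) (r : ℕ) : mk p k (fh k i r) = hGen p k i r := rfl

theorem mk_fx (e : ℤˣ) (i : Fin ℓ) (r : ℕ) : mk p k (fx k e i r) = xGen p k e i r := rfl

theorem lie_hGen_hGen (i j : Fin ℓ) (r s : ℕ) : ⁅hGen p k i r, hGen p k j s⁆ = 0 := by
  have := mk_rel p k (Rel.hh i j r s)
  rwa [map_sbr, mk_fh, mk_fh, map_zero, sbr_zero_left] at this

theorem lie_hGen_zero_xGen (e : ℤˣ) (i j : Fin ℓ) (s : ℕ) :
    ⁅hGen p k i 0, xGen p k e j s⁆ = ((e : ℤ) * cartan p i j) • xGen p k e j s := by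
  have := mk_rel p k (Rel.h0x e i j s)
  rwa [map_sbr, mk_fh, mk_fx, map_smul, mk_fx, sbr_zero_left, Int.cast_smul_eq_zsmul] at this

theorem sbr_xGen_xGen_neg (i j : Fin ℓ) (r s : ℕ) :
    sbr (vtxParity p i) (vtxParity p j) (xGen p k 1 i r) (xGen p k (-1) j s) =
      if i = j then hGen p k i (r + s) else 0 := by
  have := mk_rel p k (Rel.xx i j r s)
  rwa [map_sbr, mk_fx, mk_fx, apply_ite (mk p k), map_zero, mk_fh] at this

theorem lie_hGen_xGen_succ (e : ℤˣ) (i j : Fin ℓ) (r s : ℕ) (hij : ¬ (i = j ∧ vtxParity p i = 1)) :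
    ⁅hGen p k i (r + 1), xGen p k e j s⁆ - ⁅hGen p k i r, xGen p k e j (s + 1)⁆ =
      (((e : ℤ) * cartan p i j) • halfHbar k) •
        (hGen p k i r * xGen p k e j s + xGen p k e j s * hGen p k i r) := by
  have := mk_rel p k (Rel.hx e i j r s hij)
  rwa [map_sub, map_sbr, map_sbr, map_smul, map_sabr, mk_fh, mk_fh, mk_fx, mk_fx, sbr_zero_left,
    sbr_zero_left, sabr_zero_left, coef_eq] at this

theorem sbr_xGen_xGen_succ (e : ℤˣ) (i j : Fin ℓ) (r s : ℕ)
    (hij : ¬ (i = j ∧ vtxParity p i = 1)) :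
    sbr (vtxParity p i) (vtxParity p j) (xGen p k e i (r + 1)) (xGen p k e j s) -
      sbr (vtxParity p i) (vtxParity p j) (xGen p k e i r) (xGen p k e j (s + 1)) =
      (((e : ℤ) * cartan p i j) • halfHbar k) •
        sabr (vtxParity p i) (vtxParity p j) (xGen p k e i r) (xGen p k e j s) := by
  have := mk_rel p k (Rel.xxs e i j r s hij)
  rwa [map_sub, map_sbr, map_sbr, map_smul, map_sabr, mk_fx, mk_fx, mk_fx, mk_fx, coef_eq] at this

theorem lie_hGen_xGen_of_odd (e : ℤˣ) (i : Fin ℓ) (r s : ℕ) (hi : vtxParity p i = 1) :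
    ⁅hGen p k i r, xGen p k e i s⁆ = 0 := by
  have := mk_rel p k (Rel.hx_odd e i r s hi)
  rwa [map_sbr, mk_fh, mk_fx, map_zero, sbr_zero_left] at this

theorem sbr_xGen_xGen_of_cartan_eq_zero (e : ℤˣ) (i j : Fin ℓ) (r s : ℕ) (hij : cartan p i j = 0) :
    sbr (vtxParity p i) (vtxParity p j) (xGen p k e i r) (xGen p k e j s) = 0 := by
  have := mk_rel p k (Rel.serre_zero e i j r s hij)
  rwa [map_sbr, mk_fx, mk_fx, map_zero] at this

theorem xGen_serre_quartic (e : ℤˣ) (i j l : Fin ℓ) (hij : (i : ℕ) + 1 = j)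
    (hjl : (j : ℕ) + 1 = l) (hj : vtxParity p j = 1) :
    sbr (vtxParity p i + vtxParity p j) (vtxParity p j + vtxParity p l)
      (sbr (vtxParity p i) (vtxParity p j) (xGen p k e i 0) (xGen p k e j 0))
      (sbr (vtxParity p j) (vtxParity p l) (xGen p k e j 0) (xGen p k e l 0)) = 0 := by
  have := mk_rel p k (Rel.serre_quartic e i j l 0 0 hij hjl hj)
  rwa [map_sbr, map_sbr, map_sbr, mk_fx, mk_fx, mk_fx, map_zero] at this

variable [CharZero k]

instance : IsAddTorsionFree (Y p k) := isAddTorsionFree_of_algebra k _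

theorem xGen_serre_cubic (e : ℤˣ) (i j : Fin ℓ) (hij : Adjacent i j) (hi : vtxParity p i = 0) :
    ⁅xGen p k e i 0, ⁅xGen p k e i 0, xGen p k e j 0⁆⁆ = 0 := by
  have := mk_rel p k (Rel.serre_cubic e i j 0 0 0 hij hi)
  rw [map_add, map_sbr, map_sbr, mk_fx, mk_fx, map_zero, hi, sbr_zero_left, sbr_zero_left] at this
  exact eq_zero_of_add_self this

end Relations

/-! ### The root vectors of `𝔤` in the Yangian -/

section RootVectors

variable {ℓ : ℕ} (p : Fin (ℓ + 1) → ZMod 2) (k : Type*) [Field k]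

/-- The parities, extended by zero. -/
def parN (a : ℕ) : ZMod 2 := if h : a < ℓ + 1 then p ⟨a, h⟩ else 0

/-- The generators `x_{i,0}^{±}`, extended by zero. -/
def xN (e : ℤˣ) (i : ℕ) : Y p k := if h : i < ℓ then xGen p k e ⟨i, h⟩ 0 else 0

/-- The generators `h_{i,0}`, extended by zero. -/
def hN (i : ℕ) : Y p k := if h : i < ℓ then hGen p k ⟨i, h⟩ 0 else 0

theorem parN_val (a : Fin (ℓ + 1)) : parN p a = p a := dif_pos a.2

variable {p} in
theorem vtxParity_mk {i : ℕ} (h : i < ℓ) :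
    vtxParity p ⟨i, h⟩ = parN p i + parN p (i + 1) := by
  rw [vtxParity_eq, parN, parN, dif_pos (by omega), dif_pos (by omega)]; rfl

variable {p k} in
theorem xN_of_lt {i : ℕ} (e : ℤˣ) (h : i < ℓ) : xN p k e i = xGen p k e ⟨i, h⟩ 0 := dif_pos h

variable {p k} in
theorem xN_of_le {i : ℕ} (e : ℤˣ) (h : ℓ ≤ i) : xN p k e i = 0 := dif_neg (by omega)

variable {p k} in
theorem hN_of_lt {i : ℕ} (h : i < ℓ) : hN p k i = hGen p k ⟨i, h⟩ 0 := dif_pos h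

variable {p k} in
theorem hN_of_le {i : ℕ} (h : ℓ ≤ i) : hN p k i = 0 := dif_neg (by omega)

/-- The form `(ε_a, α_i)`. -/
def epsForm (a i : ℕ) : ℤ :=
  psign (parN p a) * ((if a = i then 1 else 0) - (if a = i + 1 then 1 else 0))

theorem epsForm_of_ne {a i : ℕ} (h1 : a ≠ i) (h2 : a ≠ i + 1) : epsForm p a i = 0 := by
  rw [epsForm, if_neg h1, if_neg h2]; ring

theorem epsForm_self (a : ℕ) : epsForm p a a = psign (parN p a) := by
  rw [epsForm, if_pos rfl, if_neg (by omega)]; ring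

theorem epsForm_succ (a : ℕ) : epsForm p (a + 1) a = -psign (parN p (a + 1)) := by
  rw [epsForm, if_neg (by omega), if_pos rfl]; ring

theorem cartan_eq_epsForm {i j : ℕ} (hi : i < ℓ) (hj : j < ℓ) :
    cartan p ⟨i, hi⟩ ⟨j, hj⟩ = epsForm p i j - epsForm p (i + 1) j := by
  have hi' : psign (p ⟨i, by omega⟩) = psign (parN p i) := by rw [parN, dif_pos]
  have hi'' : psign (p ⟨i + 1, by omega⟩) = psign (parN p (i + 1)) := by rw [parN, dif_pos]
  rw [cartan, rootForm_eq]
  simp only [simpleRoot, weight, Pi.sub_apply, Pi.single_apply, Fin.castSucc_mk, Fin.succ_mk,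
    Fin.mk.injEq, epsForm, hi', hi'']

theorem lie_hN_xN (e : ℤˣ) {i : ℕ} (hi : i < ℓ) (j : ℕ) :
    ⁅hN p k i, xN p k e j⁆ = ((e : ℤ) * (epsForm p i j - epsForm p (i + 1) j)) • xN p k e j := by
  by_cases hj : j < ℓ
  · rw [hN_of_lt hi, xN_of_lt e hj, lie_hGen_zero_xGen, cartan_eq_epsForm]
  · rw [xN_of_le e (by omega), rlie_zero, smul_zero]

theorem sbr_xN_xN_neg (i j : ℕ) :
    sbr (parN p i + parN p (i + 1)) (parN p j + parN p (j + 1)) (xN p k 1 i) (xN p k (-1) j) =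
      if i = j then hN p k i else 0 := by
  by_cases hi : i < ℓ
  · by_cases hj : j < ℓ
    · rw [xN_of_lt 1 hi, xN_of_lt (-1) hj, hN_of_lt hi, ← vtxParity_mk hi, ← vtxParity_mk hj,
        sbr_xGen_xGen_neg]
      simp only [Fin.mk.injEq]
    · rw [xN_of_le (-1) (by omega), sbr_zero_elt_right, if_neg (by omega)]
  · rw [xN_of_le 1 (by omega), sbr_zero_elt_left, hN_of_le (by omega), ite_self]

theorem sbr_xN_self (e : ℤˣ) (i : ℕ) :
    sbr (parN p i + parN p (i + 1)) (parN p i + parN p (i + 1)) (xN p k e i) (xN p k e i) = 0 := by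
  by_cases hi : i < ℓ
  · rw [xN_of_lt e hi, ← vtxParity_mk hi]
    rcases zmod_two_cases (vtxParity p ⟨i, hi⟩) with h | h
    · rw [h, sbr_zero_left, Ring.lie_def, sub_self]
    · exact sbr_xGen_xGen_of_cartan_eq_zero p k e _ _ 0 0 (cartan_odd p h)
  · rw [xN_of_le e (by omega), sbr_zero_elt_left]

theorem sbr_xN_far (e : ℤˣ) {i j : ℕ} (hij : i + 1 < j) :
    sbr (parN p i + parN p (i + 1)) (parN p j + parN p (j + 1)) (xN p k e i) (xN p k e j) = 0 := by
  by_cases hj : j < ℓ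
  · have hi : i < ℓ := by omega
    rw [xN_of_lt e hi, xN_of_lt e hj, ← vtxParity_mk hi, ← vtxParity_mk hj]
    exact sbr_xGen_xGen_of_cartan_eq_zero p k e _ _ 0 0 (cartan_of_lt p hij)
  · rw [xN_of_le e (by omega : ℓ ≤ j), sbr_zero_elt_right]

theorem sbr_sbr_sbr_reverse {B : Type*} [Ring B] {a b c d e : ZMod 2} {x y z : B}
    (h : sbr d e (sbr a b x y) (sbr b c y z) = 0) :
    sbr e d (sbr c b z y) (sbr b a y x) = 0 := by
  rw [sbr_skew c b, sbr_skew b a, sbr_neg_left, sbr_neg_right, sbr_zsmul_left, sbr_zsmul_right,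
    sbr_eq_zero_symm h]
  simp only [smul_zero, neg_zero]

theorem xN_quartic (e : ℤˣ) {i : ℕ} (h : parN p (i + 1) + parN p (i + 2) = 1) :
    sbr (parN p i + parN p (i + 2)) (parN p (i + 1) + parN p (i + 3))
      (sbr (parN p i + parN p (i + 1)) (parN p (i + 1) + parN p (i + 2)) (xN p k e i)
        (xN p k e (i + 1)))
      (sbr (parN p (i + 1) + parN p (i + 2)) (parN p (i + 2) + parN p (i + 3)) (xN p k e (i + 1))
        (xN p k e (i + 2))) = 0 := by
  by_cases hi : i + 2 < ℓ
  · have h0 : i < ℓ := by omega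
    have h1 : i + 1 < ℓ := by omega
    have := xGen_serre_quartic p k e ⟨i, h0⟩ ⟨i + 1, h1⟩ ⟨i + 2, hi⟩ rfl rfl
      (by rw [vtxParity_mk]; exact h)
    rwa [vtxParity_mk, vtxParity_mk, vtxParity_mk, parity_telescope, parity_telescope,
      ← xN_of_lt e h0, ← xN_of_lt e h1, ← xN_of_lt e hi] at this
  · rw [xN_of_le e (by omega : ℓ ≤ i + 2), sbr_zero_elt_right, sbr_zero_elt_right]

theorem xN_cubic [CharZero k] (e : ℤˣ) {i j : ℕ} (hij : i + 1 = j ∨ j + 1 = i)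
    (h : parN p i + parN p (i + 1) = 0) : ⁅xN p k e i, ⁅xN p k e i, xN p k e j⁆⁆ = 0 := by
  by_cases hi : i < ℓ
  · by_cases hj : j < ℓ
    · rw [xN_of_lt e hi, xN_of_lt e hj]
      exact xGen_serre_cubic p k e _ _ hij (by rw [vtxParity_mk]; exact h)
    · rw [xN_of_le e (by omega : ℓ ≤ j), rlie_zero, rlie_zero]
  · rw [xN_of_le e (by omega : ℓ ≤ i), Ring.lie_def, zero_mul, mul_zero, sub_zero]

/-- The matrix units `E_{i+1,i}` in the Yangian. -/
def yN (i : ℕ) : Y p k := psign (parN p i) • xN p k (-1) i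

theorem sbr_xN_yN (i : ℕ) :
    sbr (parN p i + parN p (i + 1)) (parN p i + parN p (i + 1)) (xN p k 1 i) (yN p k i) =
      psign (parN p i) • hN p k i := by
  rw [yN, sbr_zsmul_right, sbr_xN_xN_neg, if_pos rfl]

theorem sbr_yN_xN (i : ℕ) :
    sbr (parN p i + parN p (i + 1)) (parN p i + parN p (i + 1)) (yN p k i) (xN p k 1 i) =
      -(psign (parN p (i + 1)) • hN p k i) := by
  have h : ∀ a b : ZMod 2, (a + b) * (a + b) = a + b := by decide
  rw [sbr_skew, sbr_xN_yN, h, psign_add, smul_smul, mul_right_comm, psign_mul_self, one_mul]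

theorem sbr_yN_xN_of_ne {i j : ℕ} (hij : i ≠ j) :
    sbr (parN p i + parN p (i + 1)) (parN p j + parN p (j + 1)) (yN p k i) (xN p k 1 j) = 0 := by
  rw [yN, sbr_zsmul_left, sbr_eq_zero_symm, smul_zero]
  rw [sbr_xN_xN_neg, if_neg hij.symm]

theorem zsmul_rlie {B : Type*} [Ring B] (n : ℤ) (x y : B) : ⁅n • x, y⁆ = n • ⁅x, y⁆ := by
  simp only [Ring.lie_def, mul_smul_comm, smul_mul_assoc, smul_sub]

theorem neg_rlie {B : Type*} [Ring B] (x y : B) : ⁅-x, y⁆ = -⁅x, y⁆ := by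
  simp only [Ring.lie_def, neg_mul, mul_neg, neg_sub]; abel

theorem zero_rlie {B : Type*} [Ring B] (y : B) : ⁅(0 : B), y⁆ = 0 := by
  simp only [Ring.lie_def, zero_mul, mul_zero, sub_zero]

theorem isChain_pos [CharZero k] : IsChain (parN p) ℓ (xN p k 1) (yN p k) := by
  refine isChain_of_serre (sbr_xN_self p k 1) (fun i j => sbr_xN_far p k 1)
    (fun i j => xN_cubic p k 1) (fun i => xN_quartic p k 1) (fun i j => sbr_yN_xN_of_ne p k)
    ?_ ?_ ?_
  · intro i hi
    rw [sbr_xN_yN, zsmul_rlie, lie_hN_xN p k 1 (by omega), epsForm_of_ne p (by omega) (by omega),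
      epsForm_self, smul_smul, psign_add, ← neg_smul]
    congr 1
    simp
  · intro i hi
    rw [sbr_xN_yN, zsmul_rlie, lie_hN_xN p k 1 (by omega), epsForm_succ,
      epsForm_of_ne p (by omega) (by omega), smul_smul, ← neg_one_smul ℤ (xN p k 1 i)]
    congr 1
    simp [psign_mul_self]
  · intro i j hij
    rw [sbr_xN_yN, zsmul_rlie]
    by_cases hi : i < ℓ
    · rw [lie_hN_xN p k 1 hi, epsForm_of_ne p (by omega) (by omega),
        epsForm_of_ne p (by omega) (by omega), sub_zero, mul_zero, zero_smul, smul_zero]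
    · rw [hN_of_le (by omega), zero_rlie, smul_zero]

/-- The parities in the opposite order. -/
def parRev (a : ℕ) : ZMod 2 := parN p (ℓ - a)

/-- The matrix units `E_{i+1,i}` in the opposite order. -/
def yRev (i : ℕ) : Y p k := if i < ℓ then yN p k (ℓ - 1 - i) else 0

/-- The matrix units `E_{i,i+1}` in the opposite order. -/
def xRev (i : ℕ) : Y p k := if i < ℓ then xN p k 1 (ℓ - 1 - i) else 0

variable {p} in
theorem parRev_eq {a b : ℕ} (h : a + b = ℓ) : parRev p a = parN p b := by
  rw [parRev, show ℓ - a = b by omega]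

variable {p k} in
theorem yRev_eq {i j : ℕ} (h : i + j + 1 = ℓ) : yRev p k i = yN p k j := by
  rw [yRev, if_pos (by omega), show ℓ - 1 - i = j by omega]

variable {p k} in
theorem yRev_of_le {i : ℕ} (h : ℓ ≤ i) : yRev p k i = 0 := if_neg (by omega)

variable {p k} in
theorem xRev_eq {i j : ℕ} (h : i + j + 1 = ℓ) : xRev p k i = xN p k 1 j := by
  rw [xRev, if_pos (by omega), show ℓ - 1 - i = j by omega]

variable {p k} in
theorem xRev_of_le {i : ℕ} (h : ℓ ≤ i) : xRev p k i = 0 := if_neg (by omega)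

theorem parRev_add {i j : ℕ} (h : i + j + 1 = ℓ) :
    parRev p i + parRev p (i + 1) = parN p j + parN p (j + 1) := by
  rw [parRev_eq (b := j + 1) (by omega), parRev_eq (b := j) (by omega), add_comm]

/-- Reading the basis of `V` backwards makes `E_{i+1,i}` a positive simple root vector and
`E_{i,i+1}` its opposite, so everything proved for chains also applies to the lower triangle. -/
theorem isChain_neg [CharZero k] : IsChain (parRev p) ℓ (yRev p k) (xRev p k) := by
  have hbr : ∀ i, i < ℓ → ∃ j, i + j + 1 = ℓ := fun i hi => ⟨ℓ - 1 - i, by omega⟩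
  have hk : ∀ {i j}, i + j + 1 = ℓ →
      sbr (parRev p i + parRev p (i + 1)) (parRev p i + parRev p (i + 1)) (yRev p k i)
        (xRev p k i) = -(psign (parN p (j + 1)) • hN p k j) := by
    intro i j h
    rw [parRev_add p h, yRev_eq h, xRev_eq h, sbr_yN_xN]
  refine isChain_of_serre ?_ ?_ ?_ ?_ ?_ ?_ ?_ ?_
  · intro i
    by_cases hi : i < ℓ
    · obtain ⟨j, hj⟩ := hbr i hi
      rw [parRev_add p hj, yRev_eq hj, yN, sbr_zsmul_left, sbr_zsmul_right, sbr_xN_self, smul_zero,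
        smul_zero]
    · rw [yRev_of_le (by omega), sbr_zero_elt_left]
  · intro i j hij
    by_cases hi : j < ℓ
    · obtain ⟨b, hb⟩ := hbr j hi
      obtain ⟨a, ha⟩ := hbr i (by omega)
      rw [parRev_add p ha, parRev_add p hb, yRev_eq ha, yRev_eq hb, yN, yN, sbr_zsmul_left,
        sbr_zsmul_right, sbr_eq_zero_symm (sbr_xN_far p k (-1) (by omega)), smul_zero, smul_zero]
    · rw [yRev_of_le (by omega : ℓ ≤ j), sbr_zero_elt_right]
  · intro i j hij h
    by_cases hi : i < ℓ
    · by_cases hj : j < ℓ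
      · obtain ⟨b, hb⟩ := hbr j hj
        obtain ⟨a, ha⟩ := hbr i hi
        rw [parRev_add p ha] at h
        rw [yRev_eq ha, yRev_eq hb, yN, yN]
        simp only [zsmul_rlie, lie_zsmul_right]
        rw [xN_cubic p k (-1) (by omega) h]
        simp only [smul_zero]
      · rw [yRev_of_le (by omega : ℓ ≤ j), rlie_zero, rlie_zero]
    · rw [yRev_of_le (by omega : ℓ ≤ i), zero_rlie]
  · intro i h
    simp only [nest, add_zero]
    by_cases hi : i + 2 < ℓ
    · obtain ⟨j, hj⟩ := hbr (i + 2) hi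
      have e0 : parRev p i = parN p (j + 3) := parRev_eq (by omega)
      have e1 : parRev p (i + 1) = parN p (j + 2) := parRev_eq (by omega)
      have e2 : parRev p (i + 2) = parN p (j + 1) := parRev_eq (by omega)
      have e3 : parRev p (i + 3) = parN p j := parRev_eq (by omega)
      have y0 : yRev p k i = yN p k (j + 2) := yRev_eq (by omega)
      have y1 : yRev p k (i + 1) = yN p k (j + 1) := yRev_eq (by omega)
      have y2 : yRev p k (i + 2) = yN p k j := yRev_eq (by omega)
      rw [e1, e2, add_comm] at h
      rw [e0, e1, e2, e3, y0, y1, y2, add_comm (parN p (j + 3)) (parN p (j + 1)),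
        add_comm (parN p (j + 2)) (parN p j), add_comm (parN p (j + 3)) (parN p (j + 2)),
        add_comm (parN p (j + 2)) (parN p (j + 1)), add_comm (parN p (j + 1)) (parN p j)]
      simp only [yN, sbr_zsmul_left, sbr_zsmul_right]
      rw [sbr_sbr_sbr_reverse (xN_quartic p k (-1) h)]
      simp only [smul_zero]
    · rw [yRev_of_le (by omega : ℓ ≤ i + 1 + 1), sbr_zero_elt_right, sbr_zero_elt_right]
  · intro i j hij
    by_cases hi : i < ℓ
    · by_cases hj : j < ℓ
      · obtain ⟨b, hb⟩ := hbr j hj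
        obtain ⟨a, ha⟩ := hbr i hi
        rw [parRev_add p ha, parRev_add p hb, xRev_eq ha, yRev_eq hb,
          sbr_eq_zero_symm (sbr_yN_xN_of_ne p k (by omega))]
      · rw [yRev_of_le (by omega : ℓ ≤ j), sbr_zero_elt_right]
    · rw [xRev_of_le (by omega : ℓ ≤ i), sbr_zero_elt_left]
  · intro i hi
    obtain ⟨j, hj⟩ := hbr (i + 1) hi
    rw [hk (j := j + 1) (by omega), yRev_eq hj, parRev_add p (j := j + 1) (by omega), neg_rlie,
      zsmul_rlie, yN, lie_zsmul_right, lie_hN_xN p k (-1) (by omega), epsForm_succ,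
      epsForm_of_ne p (by omega) (by omega), smul_smul, smul_smul, smul_smul, psign_add]
    congr 2
    simp
    ring
  · intro i hi
    obtain ⟨j, hj⟩ := hbr (i + 1) hi
    have := hk (i := i + 1) (j := j) (by omega)
    rw [show i + 2 = i + 1 + 1 from rfl, this, yRev_eq (j := j + 1) (by omega), neg_rlie,
      zsmul_rlie, yN, lie_zsmul_right, lie_hN_xN p k (-1) (by omega), epsForm_self,
      epsForm_of_ne p (by omega) (by omega), smul_smul, smul_smul]
    congr 2
    have := psign_mul_self (parN p (j + 1))
    simp
    linear_combination (psign (parN p (j + 1))) * this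
  · intro i j hij
    by_cases hi : i < ℓ
    · obtain ⟨a, ha⟩ := hbr i hi
      rw [hk ha]
      by_cases hj : j < ℓ
      · obtain ⟨b, hb⟩ := hbr j hj
        rw [yRev_eq hb, neg_rlie, zsmul_rlie, yN, lie_zsmul_right, lie_hN_xN p k (-1) (by omega),
          epsForm_of_ne p (by omega) (by omega), epsForm_of_ne p (by omega) (by omega), sub_zero,
          mul_zero, zero_smul, smul_zero, smul_zero, neg_zero]
      · rw [yRev_of_le (by omega : ℓ ≤ j), rlie_zero]
    · rw [yRev_of_le (by omega : ℓ ≤ i), sbr_zero_elt_left, zero_rlie]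

end RootVectors

/-! ### Brackets of the simple root vectors with all matrix units -/

section RootVectors

variable {ℓ : ℕ} (p : Fin (ℓ + 1) → ZMod 2) (k : Type*) [Field k]

/-- The images of the matrix units in the Yangian; on the diagonal they are determined only
up to multiples of a central element of `𝔤𝔩(V)`. -/
def rootN (a b : ℕ) : Y p k :=
  if a < b then nest (parN p) (xN p k 1) a (b - a - 1)
  else if b < a then nest (parRev p) (yRev p k) (ℓ - a) (a - b - 1)
  -- The sum telescopes to `E_{aa}` minus the multiple of `E_{ℓℓ}` that makes the supertrace zero:
  -- the projection to `𝔰𝔩(V)` along the last diagonal matrix unit.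
  else psign (parN p a) • ∑ j ∈ Finset.Ico a ℓ, hN p k j

variable {p k}

theorem rootN_of_lt {a b n : ℕ} (h : a + n + 1 = b) :
    rootN p k a b = nest (parN p) (xN p k 1) a n := by
  rw [rootN, if_pos (by omega), show b - a - 1 = n by omega]

theorem rootN_of_gt {a b n a' : ℕ} (h : b + n + 1 = a) (h' : a' + a = ℓ) :
    rootN p k a b = nest (parRev p) (yRev p k) a' n := by
  rw [rootN, if_neg (by omega), if_pos (by omega), show a - b - 1 = n by omega,
    show ℓ - a = a' by omega]

variable (p k)

theorem rootN_self (a : ℕ) :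
    rootN p k a a = psign (parN p a) • ∑ j ∈ Finset.Ico a ℓ, hN p k j := by
  rw [rootN, if_neg (by omega), if_neg (by omega)]

theorem rootN_succ (a : ℕ) : rootN p k a (a + 1) = xN p k 1 a := rootN_of_lt (n := 0) rfl

theorem rootN_pred {a : ℕ} (h : a < ℓ) : rootN p k (a + 1) a = yN p k a := by
  rw [rootN_of_gt (n := 0) (a' := ℓ - (a + 1)) rfl (by omega), nest, yRev_eq (j := a) (by omega)]

theorem sum_rlie {ι B : Type*} [Ring B] (s : Finset ι) (f : ι → B) (y : B) :
    ⁅∑ i ∈ s, f i, y⁆ = ∑ i ∈ s, ⁅f i, y⁆ := by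
  simp only [Ring.lie_def, Finset.sum_mul, Finset.mul_sum, Finset.sum_sub_distrib]

theorem sum_epsForm {a : ℕ} (ha : a ≤ ℓ) (i : ℕ) :
    ∑ j ∈ Finset.Ico a ℓ, (epsForm p j i - epsForm p (j + 1) i) =
      epsForm p a i - epsForm p ℓ i := by
  rw [Finset.sum_Ico_eq_sum_range]
  refine (Finset.sum_range_sub' (fun j => epsForm p (a + j) i) _).trans ?_
  rw [Nat.add_sub_cancel' ha, add_zero]

theorem lie_rootN_self_xN (e : ℤˣ) {a : ℕ} (ha : a ≤ ℓ) (i : ℕ) :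
    ⁅rootN p k a a, xN p k e i⁆ =
      ((e : ℤ) * (psign (parN p a) * (epsForm p a i - epsForm p ℓ i))) • xN p k e i := by
  rw [rootN_self, zsmul_rlie, sum_rlie, Finset.sum_congr rfl fun j hj =>
    lie_hN_xN p k e (Finset.mem_Ico.1 hj).2 i, ← Finset.sum_smul, ← Finset.mul_sum,
    sum_epsForm p ha, smul_smul]
  congr 1
  ring

theorem psign_mul_epsForm (a i : ℕ) :
    psign (parN p a) * epsForm p a i = (if a = i then 1 else 0) - (if a = i + 1 then 1 else 0) := by
  rw [epsForm, ← mul_assoc, psign_mul_self, one_mul]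

theorem ite_smul_one {M : Type*} [AddCommGroup M] (P : Prop) [Decidable P] (x : M) :
    (if P then (1 : ℤ) else 0) • x = if P then x else 0 := by
  split_ifs <;> simp

variable [CharZero k]

/-- The bracket of `E_{i,i+1}` with the matrix units. -/
theorem sbr_xN_rootN {i a b : ℕ} (hi : i < ℓ) (ha : a ≤ ℓ) (hb : b ≤ ℓ) :
    sbr (parN p i + parN p (i + 1)) (parN p a + parN p b) (xN p k 1 i) (rootN p k a b) =
      (if i + 1 = a then rootN p k i b else 0) -
        psign ((parN p i + parN p (i + 1)) * (parN p a + parN p b)) •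
          (if b = i then rootN p k a (i + 1) else 0) +
      (if a = b then (psign (parN p a) * epsForm p ℓ i) • xN p k 1 i else 0) := by
  rcases lt_trichotomy a b with hab | hab | hab
  · obtain ⟨n, rfl⟩ : ∃ n, b = a + n + 1 := ⟨b - a - 1, by omega⟩
    rw [rootN_of_lt rfl, (isChain_pos p k).x_nest, if_neg hab.ne, add_zero]
    congr 1
    · split_ifs with h
      · rw [rootN_of_lt (n := n + 1) (by omega)]
      · rfl
    · congr 1
      by_cases h : i = a + n + 1
      · rw [if_pos h, if_pos h.symm, rootN_of_lt (n := n + 1) (by omega)]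
      · rw [if_neg h, if_neg (Ne.symm h)]
  -- The third summand occurs only here and corrects for the multiple of `E_{ℓℓ}` in the diagonal
  -- representative. It is `(-1)^{p a}` times something independent of `a`, that is, proportional to
  -- the supertrace of `E_{aa}`.
  · subst hab
    have hself : ∀ t : ZMod 2, t + t = 0 := by decide
    rw [hself (parN p a), sbr_zero_right, rlie_skew, lie_rootN_self_xN p k 1 ha, if_pos rfl,
      mul_zero, psign_zero, one_smul, Units.val_one, one_mul, mul_sub, psign_mul_epsForm, sub_smul,
      sub_smul, ite_smul_one, ite_smul_one]
    by_cases h1 : a = i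
    · subst h1
      rw [if_pos rfl, if_pos rfl, if_neg (by omega), if_neg (by omega), rootN_succ]
      abel
    · rw [if_neg h1, if_neg h1]
      by_cases h2 : a = i + 1
      · rw [if_pos h2, if_pos h2.symm, h2, rootN_succ]
        abel
      · rw [if_neg h2, if_neg (Ne.symm h2)]
        abel
  · rw [if_neg hab.ne', add_zero]
    obtain ⟨n, rfl⟩ : ∃ n, a = b + n + 1 := ⟨a - b - 1, by omega⟩
    obtain ⟨a', ha'⟩ : ∃ a', a' + (b + n + 1) = ℓ := ⟨ℓ - (b + n + 1), by omega⟩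
    obtain ⟨i', hi'⟩ : ∃ i', i' + i + 1 = ℓ := ⟨ℓ - 1 - i, by omega⟩
    by_cases hopp : i' = a' ∧ n = 0
    -- For opposite root vectors the right-hand side is a difference of two telescoping sums that
    -- differ only in the term `h_i`.
    · obtain ⟨rfl, rfl⟩ := hopp
      have : i = b := by omega
      subst this
      have hsq : ∀ s t : ZMod 2, (s + t) * (s + t) = s + t := by decide
      rw [if_pos rfl, if_pos rfl, show i + 0 + 1 = i + 1 from rfl, rootN_pred p k hi,
        add_comm (parN p (i + 1)) (parN p i), sbr_xN_yN, rootN_self, rootN_self, smul_smul,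
        hsq, psign_add, mul_assoc, psign_mul_self,
        mul_one, ← smul_sub, Finset.sum_eq_sum_Ico_succ_bot hi, add_sub_cancel_right]
    · have h1 := (isChain_neg p k).y_nest (i := i') (a := a') (n := n) (by omega) hopp
      rw [parRev_add p hi', parRev_eq ha', parRev_eq (a := a' + n + 1) (b := b) (by omega),
        xRev_eq hi'] at h1
      rw [rootN_of_gt rfl ha', h1]
      congr 1
      · by_cases h2 : i' = a'
        · rw [if_pos h2, if_pos (by omega), rootN_of_gt (a' := a' + 1) (n := n - 1) (by omega)
            (by omega)]
        · rw [if_neg h2, if_neg (by omega)]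
      · congr 1
        by_cases h2 : i' = a' + n
        · rw [if_pos h2, if_pos (by omega), rootN_of_gt (a' := a') (n := n - 1) (by omega)
            (by omega)]
        · rw [if_neg h2, if_neg (by omega)]

/-- The bracket of `E_{i+1,i}` with the matrix units. -/
theorem sbr_yN_rootN {i a b : ℕ} (hi : i < ℓ) (ha : a ≤ ℓ) (hb : b ≤ ℓ) :
    sbr (parN p i + parN p (i + 1)) (parN p a + parN p b) (yN p k i) (rootN p k a b) =
      (if i = a then rootN p k (i + 1) b else 0) -
        psign ((parN p i + parN p (i + 1)) * (parN p a + parN p b)) •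
          (if b = i + 1 then rootN p k a i else 0) +
      (if a = b then (psign (parN p a) * -epsForm p ℓ i) • yN p k i else 0) := by
  rcases lt_trichotomy a b with hab | hab | hab
  · rw [if_neg hab.ne, add_zero]
    obtain ⟨n, rfl⟩ : ∃ n, b = a + n + 1 := ⟨b - a - 1, by omega⟩
    by_cases hopp : i = a ∧ n = 0
    · obtain ⟨rfl, rfl⟩ := hopp
      have hsq : ∀ s t : ZMod 2, (s + t) * (s + t) = s + t := by decide
      rw [if_pos rfl, if_pos rfl, show i + 0 + 1 = i + 1 from rfl, rootN_succ, sbr_yN_xN,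
        rootN_self, rootN_self, smul_smul, hsq, psign_add, mul_right_comm, psign_mul_self,
        one_mul, ← smul_sub, ← smul_neg, Finset.sum_eq_sum_Ico_succ_bot hi]
      congr 1
      abel
    · rw [rootN_of_lt rfl, (isChain_pos p k).y_nest (by omega) hopp]
      congr 1
      · by_cases h2 : i = a
        · rw [if_pos h2, if_pos h2, rootN_of_lt (n := n - 1) (by omega), h2]
        · rw [if_neg h2, if_neg h2]
      · congr 1
        by_cases h2 : i = a + n
        · rw [if_pos h2, if_pos (by omega), rootN_of_lt (n := n - 1) (by omega)]
        · rw [if_neg h2, if_neg (by omega)]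
  · subst hab
    have hself : ∀ t : ZMod 2, t + t = 0 := by decide
    have hl : ⁅rootN p k a a, yN p k i⁆ =
        (-(psign (parN p a) * (epsForm p a i - epsForm p ℓ i))) • yN p k i := by
      rw [yN, lie_zsmul_right, lie_rootN_self_xN p k (-1) ha, smul_comm, Units.val_neg,
        Units.val_one, neg_one_mul]
    rw [hself (parN p a), sbr_zero_right, rlie_skew, hl, if_pos rfl,
      mul_zero, psign_zero, one_smul, mul_sub, psign_mul_epsForm, neg_smul, sub_smul,
      sub_smul, ite_smul_one, ite_smul_one, mul_neg, neg_smul]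
    by_cases h1 : a = i
    · subst h1
      rw [if_pos rfl, if_pos rfl, if_neg (by omega), if_neg (by omega), rootN_pred p k hi]
      abel
    · rw [if_neg h1, if_neg (Ne.symm h1)]
      by_cases h2 : a = i + 1
      · rw [if_pos h2, if_pos h2, h2, rootN_pred p k hi]
        abel
      · rw [if_neg h2, if_neg h2]
        abel
  · rw [if_neg hab.ne', add_zero]
    obtain ⟨n, rfl⟩ : ∃ n, a = b + n + 1 := ⟨a - b - 1, by omega⟩
    obtain ⟨a', ha'⟩ : ∃ a', a' + (b + n + 1) = ℓ := ⟨ℓ - (b + n + 1), by omega⟩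
    obtain ⟨i', hi'⟩ : ∃ i', i' + i + 1 = ℓ := ⟨ℓ - 1 - i, by omega⟩
    have h1 := (isChain_neg p k).x_nest i' a' n
    rw [parRev_add p hi', parRev_eq ha', parRev_eq (a := a' + n + 1) (b := b) (by omega),
      yRev_eq hi'] at h1
    rw [rootN_of_gt rfl ha', h1]
    congr 1
    · by_cases h2 : i' + 1 = a'
      · rw [if_pos h2, if_pos (by omega), rootN_of_gt (a' := i') (n := n + 1) (by omega)
          (by omega)]
      · rw [if_neg h2, if_neg (by omega)]
    · congr 1
      by_cases h2 : i' = a' + n + 1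
      · rw [if_pos h2, if_pos (by omega), rootN_of_gt (a' := a') (n := n + 1) (by omega)
          (by omega)]
      · rw [if_neg h2, if_neg (by omega)]

end RootVectors

/-! ### Generation of `𝔰𝔩(V)` -/

section SpecialLinearGen

variable {ℓ : ℕ} (p : Fin (ℓ + 1) → ZMod 2) {k : Type*} [Field k]

theorem isHomog_single (a b : Fin (ℓ + 1)) (c : k) :
    IsHomog p (p a + p b) (Matrix.single a b c) := by
  intro a' b' h
  apply Matrix.single_apply_of_ne
  rintro ⟨rfl, rfl⟩
  exact h rfl

theorem single_mem_sl {a b : Fin (ℓ + 1)} (h : a ≠ b) (c : k) : Matrix.single a b c ∈ sl p k := by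
  rw [sl, LinearMap.mem_ker]
  change ∑ d, psign (p d) • Matrix.single _ _ _ d d = (0 : k)
  refine Finset.sum_eq_zero fun d _ => ?_
  rw [Matrix.single_apply_of_ne, smul_zero]
  rintro ⟨h1, h2⟩
  exact h (h1.trans h2.symm)

variable {p} in
theorem IsHomog.mul {a b : ZMod 2} {A B : Matrix (Fin (ℓ + 1)) (Fin (ℓ + 1)) k}
    (hA : IsHomog p a A) (hB : IsHomog p b B) : IsHomog p (a + b) (A * B) := by
  intro i j hij
  rw [Matrix.mul_apply]
  refine Finset.sum_eq_zero fun c _ => ?_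
  by_cases h : p i + p c = a
  · rw [hB c j, mul_zero]
    rintro rfl
    exact hij (by rw [← h, parity_telescope])
  · rw [hA i c h, zero_mul]

variable {p} in
theorem IsHomog.sbr {a b : ZMod 2} {A B : Matrix (Fin (ℓ + 1)) (Fin (ℓ + 1)) k}
    (hA : IsHomog p a A) (hB : IsHomog p b B) : IsHomog p (a + b) (sbr a b A B) := by
  intro i j hij
  rw [SuperYangian.sbr, Matrix.sub_apply, Matrix.smul_apply, hA.mul hB i j hij,
    hB.mul hA i j (by rwa [add_comm b a]), smul_zero, sub_zero]

theorem rootE_val (α : PosRoot ℓ) :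
    (rootE p k α : Matrix (Fin (ℓ + 1)) (Fin (ℓ + 1)) k) = Matrix.single α.1.1 α.1.2 1 := rfl

theorem rootF_val (α : PosRoot ℓ) :
    (rootF p k α : Matrix (Fin (ℓ + 1)) (Fin (ℓ + 1)) k) =
      psign (p α.1.1) • Matrix.single α.1.2 α.1.1 1 := by
  rw [Matrix.smul_single, zsmul_one]; rfl

theorem cartanH_val (i : Fin ℓ) :
    (cartanH p k i : Matrix (Fin (ℓ + 1)) (Fin (ℓ + 1)) k) =
      psign (p i.castSucc) • Matrix.single i.castSucc i.castSucc 1 -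
        psign (p i.succ) • Matrix.single i.succ i.succ 1 := by
  have hsq : ∀ s t : ZMod 2, (s + t) * (s + t) = s + t := by decide
  change sbr _ _ (rootE p k (simpleRoot i) : Matrix (Fin (ℓ + 1)) (Fin (ℓ + 1)) k)
    (rootF p k (simpleRoot i) : Matrix (Fin (ℓ + 1)) (Fin (ℓ + 1)) k) = _
  rw [rootE_val, rootF_val, sbr_zsmul_right, sbr, Matrix.single_mul_single_same,
    Matrix.single_mul_single_same, mul_one, vtxParity_eq, hsq, psign_add, smul_sub, smul_smul]
  simp only [simpleRoot]
  rw [← mul_assoc, psign_mul_self, one_mul]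

/-- The matrices in `𝔰𝔩(V)` are spanned by the matrix units off the diagonal and the `h_i`. -/
theorem mem_of_mem_sl {S : Submodule k (Matrix (Fin (ℓ + 1)) (Fin (ℓ + 1)) k)}
    {A : Matrix (Fin (ℓ + 1)) (Fin (ℓ + 1)) k} (hA : A ∈ sl p k)
    (h1 : ∀ a b, a ≠ b → A a b ≠ 0 → Matrix.single a b 1 ∈ S)
    (h2 : (∃ a, A a a ≠ 0) → ∀ i, (cartanH p k i : Matrix _ _ k) ∈ S) : A ∈ S := by
  have hoff : ∀ a b, a ≠ b → Matrix.single a b (A a b) ∈ S := by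
    intro a b hab
    by_cases h0 : A a b = 0
    · rw [h0, Matrix.single_zero]; exact S.zero_mem
    · have := S.smul_mem (A a b) (h1 a b hab h0)
      rwa [Matrix.smul_single, smul_eq_mul, mul_one] at this
  by_cases hd : ∃ a, A a a ≠ 0
  · let z : Matrix (Fin (ℓ + 1)) (Fin (ℓ + 1)) k :=
      psign (p (Fin.last ℓ)) • Matrix.single (Fin.last ℓ) (Fin.last ℓ) 1
    -- Downward induction from the last index, adding one `h_i` at a time.
    have hz : ∀ a, psign (p a) • Matrix.single a a 1 - z ∈ S := by
      intro a
      induction a using Fin.reverseInduction with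
      | last => rw [sub_self]; exact S.zero_mem
      | cast i ih =>
        have := S.add_mem (h2 hd i) ih
        rwa [cartanH_val, sub_add_sub_cancel] at this
    -- Since the supertrace of `A` is zero, subtracting the matching multiple of `z` from each
    -- diagonal term leaves `A` unchanged and places every term in `S`.
    have hs : ∑ a, ∑ b, (if a = b then (psign (p a) • A a a) • z else 0) = 0 := by
      have : ∑ a, psign (p a) • A a a = 0 := hA
      simp only [Finset.sum_ite_eq, Finset.mem_univ, if_true]
      rw [← Finset.sum_smul, this, zero_smul]
    rw [Matrix.matrix_eq_sum_single A, ← sub_zero (∑ a, ∑ b, Matrix.single a b (A a b)), ← hs,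
      ← Finset.sum_sub_distrib]
    refine S.sum_mem fun a _ => ?_
    rw [← Finset.sum_sub_distrib]
    refine S.sum_mem fun b _ => ?_
    by_cases hab : a = b
    · subst hab
      rw [if_pos rfl]
      have := S.smul_mem (psign (p a) • A a a) (hz a)
      rw [smul_sub, smul_assoc (psign (p a)) (A a a), smul_comm (A a a), smul_smul, psign_mul_self,
        one_smul, Matrix.smul_single, smul_eq_mul, mul_one] at this
      exact this
    · rw [if_neg hab, sub_zero]
      exact hoff a b hab
  · push Not at hd
    rw [Matrix.matrix_eq_sum_single A]
    refine S.sum_mem fun a _ => S.sum_mem fun b _ => ?_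
    by_cases hab : a = b
    · subst hab
      rw [hd, Matrix.single_zero]; exact S.zero_mem
    · exact hoff a b hab

theorem sbr_single_single {a b c : Fin (ℓ + 1)} (h : a ≠ c) (s t : ZMod 2) :
    sbr s t (Matrix.single a b (1 : k)) (Matrix.single b c 1) = Matrix.single a c 1 := by
  rw [sbr, Matrix.single_mul_single_same, Matrix.single_mul_single_of_ne _ _ _ _ h.symm, smul_zero,
    sub_zero, mul_one]

/-- A property of matrix units off the diagonal that holds for those next to the diagonal and is
preserved by brackets holds in general. -/
theorem matrixUnit_induction {Q : Fin (ℓ + 1) → Fin (ℓ + 1) → Prop}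
    (hpos : ∀ i : Fin ℓ, Q i.castSucc i.succ) (hneg : ∀ i : Fin ℓ, Q i.succ i.castSucc)
    (hmul : ∀ a b c, a ≠ b → b ≠ c → a ≠ c → Q a b → Q b c → Q a c) (a b : Fin (ℓ + 1))
    (hab : a ≠ b) : Q a b := by
  have h1 : ∀ n (a b : Fin (ℓ + 1)), (a : ℕ) + n + 1 = b → Q a b ∧ Q b a := by
    intro n
    induction n with
    | zero =>
      intro a b h
      have hb : b = Fin.succ ⟨a, by omega⟩ := Fin.ext (by simp; omega)
      have r1 := hpos ⟨a, by omega⟩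
      have r2 := hneg ⟨a, by omega⟩
      rw [← hb] at r1 r2
      exact ⟨r1, r2⟩
    | succ n ih =>
      intro a b h
      obtain ⟨q1, q2⟩ := ih a ⟨a + n + 1, by omega⟩ rfl
      have hb : b = Fin.succ ⟨a + n + 1, by omega⟩ := Fin.ext (by simp; omega)
      have hc : (⟨a + n + 1, by omega⟩ : Fin (ℓ + 1)) = Fin.castSucc ⟨a + n + 1, by omega⟩ := rfl
      have n1 : a ≠ ⟨a + n + 1, by omega⟩ := fun h => by simp [Fin.ext_iff] at h; omega
      have n2 : (⟨a + n + 1, by omega⟩ : Fin (ℓ + 1)) ≠ b := fun h => by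
        simp [Fin.ext_iff] at h; omega
      have n3 : a ≠ b := fun h => by simp [Fin.ext_iff] at h; omega
      have r1 := hpos ⟨a + n + 1, by omega⟩
      have r2 := hneg ⟨a + n + 1, by omega⟩
      rw [← hb, ← hc] at r1 r2
      exact ⟨hmul a _ b n1 n2 n3 q1 r1, hmul b _ a n2.symm n1.symm n3.symm r2 q2⟩
  rcases lt_or_gt_of_ne (Fin.val_ne_of_ne hab) with h | h
  · exact (h1 (b - a - 1) a b (by omega)).1
  · exact (h1 (a - b - 1) b a (by omega)).2

end SpecialLinearGen

/-! ### The homomorphism from `𝔰𝔩(V)` to the Yangian -/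

section CanonicalMap

variable {ℓ : ℕ} (p : Fin (ℓ + 1) → ZMod 2) (k : Type*) [Field k]

variable {p k} in
theorem sbr_mem_grading {a b : ZMod 2} {x y : Y p k} (hx : x ∈ grading p k a)
    (hy : y ∈ grading p k b) : sbr a b x y ∈ grading p k (a + b) := by
  have h1 : x * y ∈ grading p k (a + b) := SetLike.mul_mem_graded hx hy
  have h2 : y * x ∈ grading p k (a + b) := by
    rw [add_comm]; exact SetLike.mul_mem_graded hy hx
  exact Submodule.sub_mem _ h1 (zsmul_mem h2 _)

theorem xGen_mem_grading (e : ℤˣ) (i : Fin ℓ) (r : ℕ) :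
    xGen p k e i r ∈ grading p k (vtxParity p i) := gen_mem_grading p k (.x e i r)

theorem hGen_mem_grading (i : Fin ℓ) (r : ℕ) : hGen p k i r ∈ grading p k 0 :=
  gen_mem_grading p k (.h i r)

variable {p k} in
theorem nest_mem_grading {π : ℕ → ZMod 2} {x : ℕ → Y p k} {a n : ℕ}
    (h : ∀ i, i ≤ a + n → x i ∈ grading p k (π i + π (i + 1))) :
    nest π x a n ∈ grading p k (π a + π (a + n + 1)) := by
  induction n with
  | zero => exact h a le_rfl
  | succ n ih =>
    have := sbr_mem_grading (ih fun i hi => h i (by omega)) (h (a + n + 1) (by omega))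
    rwa [parity_telescope] at this

theorem xN_mem_grading (e : ℤˣ) (i : ℕ) : xN p k e i ∈ grading p k (parN p i + parN p (i + 1)) := by
  by_cases hi : i < ℓ
  · rw [xN_of_lt e hi, ← vtxParity_mk hi]
    exact xGen_mem_grading p k e _ 0
  · rw [xN_of_le e (by omega)]
    exact zero_mem _

theorem rootN_mem_grading (a b : Fin (ℓ + 1)) : rootN p k a b ∈ grading p k (p a + p b) := by
  rw [← parN_val p a, ← parN_val p b]
  rcases lt_trichotomy (a : ℕ) b with hab | hab | hab
  · have := nest_mem_grading (π := parN p) (x := xN p k 1) (a := a) (n := b - a - 1)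
      fun i _ => xN_mem_grading p k 1 i
    rwa [← rootN_of_lt (b := b) (by omega), show (a : ℕ) + (b - a - 1) + 1 = b by omega] at this
  · have hself : ∀ t : ZMod 2, t + t = 0 := by decide
    rw [hab, rootN_self, hself]
    refine zsmul_mem (sum_mem fun j hj => ?_) _
    rw [hN_of_lt (Finset.mem_Ico.1 hj).2]
    exact hGen_mem_grading p k _ 0
  · have := nest_mem_grading (π := parRev p) (x := yRev p k) (a := ℓ - a) (n := a - b - 1)
      fun i hi => by
        rw [parRev_add p (j := ℓ - 1 - i) (by omega), yRev_eq (j := ℓ - 1 - i) (by omega)]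
        exact zsmul_mem (xN_mem_grading p k (-1) _) _
    rwa [← rootN_of_gt (a := a) (b := b) (by omega) (by omega), parRev_eq (b := a) (by omega),
      parRev_eq (b := b) (by omega)] at this

/-- The linear map with `E_{ab} ↦ rootN a b`. -/
def matMap : Matrix (Fin (ℓ + 1)) (Fin (ℓ + 1)) k →ₗ[k] Y p k where
  toFun A := ∑ a, ∑ b, A a b • rootN p k a b
  map_add' A B := by simp only [Matrix.add_apply, add_smul, Finset.sum_add_distrib]
  map_smul' t A := by
    simp only [Matrix.smul_apply, smul_assoc, Finset.smul_sum, RingHom.id_apply]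

theorem matMap_single (a b : Fin (ℓ + 1)) :
    matMap p k (Matrix.single a b 1) = rootN p k a b := by
  change ∑ a', ∑ b', Matrix.single a b (1 : k) a' b' • rootN p k a' b' = _
  rw [Finset.sum_eq_single a, Finset.sum_eq_single b, Matrix.single_apply_same, one_smul]
  · intro b' _ h
    rw [Matrix.single_apply_of_ne _ _ _ _ _ (fun h' => h h'.2.symm), zero_smul]
  · simp
  · intro a' _ h
    refine Finset.sum_eq_zero fun b' _ => ?_
    rw [Matrix.single_apply_of_ne _ _ _ _ _ (fun h' => h h'.1.symm), zero_smul]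
  · simp

/-- The matrices whose bracket with `B` is respected by `matMap`. -/
def compatible (c b : ZMod 2) (B : Matrix (Fin (ℓ + 1)) (Fin (ℓ + 1)) k) :
    Submodule k (Matrix (Fin (ℓ + 1)) (Fin (ℓ + 1)) k) where
  carrier := {A | matMap p k (sbr c b A B) = sbr c b (matMap p k A) (matMap p k B)}
  add_mem' := by
    intro A A' h h'
    simp only [Set.mem_ofPred_eq] at *
    rw [sbr_add_left, map_add, h, h', map_add, sbr_add_left]
  zero_mem' := by simp [sbr_zero_elt_left]
  smul_mem' := by
    intro t A h
    simp only [Set.mem_ofPred_eq] at *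
    rw [sbr_smul_left, map_smul, h, map_smul, sbr_smul_left]

variable {k} in
/-- Compatibility of `matMap` with the bracket by a fixed matrix can be checked on matrix units,
where an error by a multiple of the supertrace is allowed. -/
theorem mem_compatible_of_single {v b : ZMod 2} {E B : Matrix (Fin (ℓ + 1)) (Fin (ℓ + 1)) k}
    (hB : B ∈ sl p k) (hb : IsHomog p b B) (m : ℤ) (u : Y p k) (hu : matMap p k E = u)
    (h : ∀ c d : Fin (ℓ + 1), sbr v (p c + p d) u (rootN p k c d) =
      matMap p k (sbr v (p c + p d) E (Matrix.single c d 1)) +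
        if c = d then (psign (p c) * m) • u else 0) : E ∈ compatible p k v b B := by
  change matMap p k (sbr v b E B) = sbr v b (matMap p k E) (matMap p k B)
  have hB' : B = ∑ c, ∑ d, B c d • Matrix.single c d 1 := by
    conv_lhs => rw [Matrix.matrix_eq_sum_single B]
    simp only [Matrix.smul_single, smul_eq_mul, mul_one]
  have e1 : sbr v b u (matMap p k B) - matMap p k (sbr v b E B) =
      ∑ c, ∑ d, B c d • (sbr v b u (rootN p k c d) -
        matMap p k (sbr v b E (Matrix.single c d 1))) := by
    conv_lhs => rw [hB']
    simp only [map_sum, map_smul, sbr_sum_right, sbr_smul_right, matMap_single, smul_sub,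
      Finset.sum_sub_distrib]
  have e2 : ∑ c, ∑ d, B c d • (sbr v b u (rootN p k c d) -
        matMap p k (sbr v b E (Matrix.single c d 1))) =
      ∑ c, ∑ d, if c = d then (psign (p c) • B c c) • m • u else 0 := by
    refine Finset.sum_congr rfl fun c _ => Finset.sum_congr rfl fun d _ => ?_
    by_cases hcd : p c + p d = b
    · rw [← hcd, h, add_sub_cancel_left]
      split_ifs with hd
      · subst hd
        rw [mul_smul, smul_comm (B c c), smul_assoc]
      · rw [smul_zero]
    · rw [hb c d hcd, zero_smul]
      split_ifs with hd
      · subst hd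
        rw [hb c c hcd, smul_zero, zero_smul]
      · rfl
  -- The errors on the matrix units add up to the supertrace of `B` times a fixed element.
  have e3 : ∑ a, psign (p a) • B a a = 0 := hB
  rw [e2] at e1
  simp only [Finset.sum_ite_eq, Finset.mem_univ, if_true] at e1
  rw [← Finset.sum_smul, e3, zero_smul] at e1
  rw [hu]
  exact (sub_eq_zero.1 e1).symm

variable {k} in
theorem matMap_sbr_single_single (v : ZMod 2) (a b c d : Fin (ℓ + 1)) :
    matMap p k (sbr v (p c + p d) (Matrix.single a b 1) (Matrix.single c d 1)) =
      (if b = c then rootN p k a d else 0) -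
        psign (v * (p c + p d)) • (if d = a then rootN p k c b else 0) := by
  have key : ∀ a b c d : Fin (ℓ + 1), matMap p k (Matrix.single a b 1 * Matrix.single c d 1) =
      if b = c then rootN p k a d else 0 := by
    intro a b c d
    split_ifs with h
    · subst h
      rw [Matrix.single_mul_single_same, mul_one, matMap_single]
    · rw [Matrix.single_mul_single_of_ne _ _ _ _ h, map_zero]
  rw [sbr, map_sub, map_zsmul, key, key]

variable {k} in
-- By the Jacobi identity on both sides. The two hypotheses are required for all `B`, since they are
-- also applied to `A₂` and to the brackets of `B` with `A₁` and `A₂`, all of which lie in `𝔰𝔩(V)`.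
theorem sbr_mem_compatible {a₁ a₂ b : ZMod 2} {A₁ A₂ B : Matrix (Fin (ℓ + 1)) (Fin (ℓ + 1)) k}
    (hom₁ : IsHomog p a₁ A₁) (hom₂ : IsHomog p a₂ A₂) (mem₂ : A₂ ∈ sl p k)
    (h₁ : ∀ {b : ZMod 2} {B : Matrix (Fin (ℓ + 1)) (Fin (ℓ + 1)) k}, B ∈ sl p k → IsHomog p b B →
      A₁ ∈ compatible p k a₁ b B)
    (h₂ : ∀ {b : ZMod 2} {B : Matrix (Fin (ℓ + 1)) (Fin (ℓ + 1)) k}, B ∈ sl p k → IsHomog p b B →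
      A₂ ∈ compatible p k a₂ b B)
    (hB : B ∈ sl p k) (hb : IsHomog p b B) : sbr a₁ a₂ A₁ A₂ ∈ compatible p k (a₁ + a₂) b B := by
  have i0 := h₁ mem₂ hom₂
  have i1 := h₁ hB hb
  have i2 := h₂ hB hb
  have j1 := h₁ (sbr_mem_sl p hom₂ hb) (hom₂.sbr hb)
  have j2 := h₂ (sbr_mem_sl p hom₁ hb) (hom₁.sbr hb)
  change matMap p k (sbr _ _ _ _) = sbr _ _ _ _ at i0 i1 i2 j1 j2 ⊢
  rw [i0, sbr_jacobi_left, sbr_jacobi_left, ← i1, ← i2, ← j1, ← j2, map_sub, map_zsmul]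

theorem isHomog_rootE (α : PosRoot ℓ) : IsHomog p (rootParity p α) (rootE p k α : Matrix _ _ k) :=
  isHomog_single p _ _ _

theorem isHomog_rootF (α : PosRoot ℓ) :
    IsHomog p (rootParity p α) (rootF p k α : Matrix _ _ k) := by
  rw [rootParity, add_comm (p α.1.1)]
  exact isHomog_single p _ _ _

theorem matMap_rootE (i : Fin ℓ) :
    matMap p k (rootE p k (simpleRoot i) : Matrix _ _ k) = xGen p k 1 i 0 := by
  rw [rootE_val, matMap_single]
  exact (rootN_succ p k i).trans (xN_of_lt 1 i.2)

theorem matMap_rootF (i : Fin ℓ) :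
    matMap p k (rootF p k (simpleRoot i) : Matrix _ _ k) = xGen p k (-1) i 0 := by
  rw [rootF_val, map_zsmul, matMap_single]
  refine (congrArg _ (rootN_pred p k i.2)).trans ?_
  rw [yN, smul_smul, show (simpleRoot i).1.1 = i.castSucc from rfl, ← parN_val p i.castSucc,
    Fin.val_castSucc,
    psign_mul_self, one_smul, xN_of_lt (-1) i.2]

variable {p k} in
-- The locus where the two maps agree contains the simple root vectors and the `h_i`. Preservation
-- of brackets adds the remaining matrix units off the diagonal, and together these span.
theorem IsCanonicalMap.eq {φ φ' : sl p k →ₗ[k] Y p k} (h : IsCanonicalMap p k φ)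
    (h' : IsCanonicalMap p k φ') : φ = φ' := by
  have hmem : ∀ (A : sl p k), φ A = φ' A →
      (A : Matrix _ _ k) ∈ Submodule.map (sl p k).subtype (LinearMap.eqLocus φ φ') :=
    fun A hA => ⟨A, hA, rfl⟩
  have hsingle : ∀ a b : Fin (ℓ + 1), a ≠ b → Matrix.single a b 1 ∈
      Submodule.map (sl p k).subtype (LinearMap.eqLocus φ φ') := by
    refine matrixUnit_induction (fun i => hmem (rootE p k (simpleRoot i)) ?_) (fun i => ?_) ?_
    · rw [h.map_e, h'.map_e]
    · have := zsmul_mem (hmem (rootF p k (simpleRoot i)) (by rw [h.map_f, h'.map_f]))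
        (psign (p i.castSucc))
      rw [rootF_val, smul_smul, show (simpleRoot i).1.1 = i.castSucc from rfl, psign_mul_self,
        one_smul] at this
      exact this
    · rintro a b c - - hac ⟨A, hA, eA⟩ ⟨B, hB, eB⟩
      change (A : Matrix (Fin (ℓ + 1)) (Fin (ℓ + 1)) k) = _ at eA
      change (B : Matrix (Fin (ℓ + 1)) (Fin (ℓ + 1)) k) = _ at eB
      have homA : IsHomog p (p a + p b) (A : Matrix _ _ k) := by
        rw [eA]; exact isHomog_single p a b 1
      have homB : IsHomog p (p b + p c) (B : Matrix _ _ k) := by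
        rw [eB]; exact isHomog_single p b c 1
      have := hmem ⟨_, sbr_mem_sl p homA homB⟩ (by
        rw [h.bracket _ _ A B homA homB, h'.bracket _ _ A B homA homB, hA, hB])
      change sbr (p a + p b) (p b + p c) (A : Matrix (Fin (ℓ + 1)) (Fin (ℓ + 1)) k)
        (B : Matrix (Fin (ℓ + 1)) (Fin (ℓ + 1)) k) ∈ _ at this
      rwa [eA, eB, sbr_single_single hac] at this
  ext A
  obtain ⟨A', hA', e⟩ := mem_of_mem_sl p
    (S := Submodule.map (sl p k).subtype (LinearMap.eqLocus φ φ')) A.2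
    (fun a b hab _ => hsingle a b hab)
    (fun _ i => hmem (cartanH p k i) (by rw [h.map_h, h'.map_h]))
  have : A' = A := Subtype.ext e
  rw [← this]
  exact hA'

variable [CharZero k]

/-- Next to the diagonal this is the computation of `sbr_xN_rootN` and `sbr_yN_rootN`, whose error
is a multiple of the supertrace with factor `± (ε_ℓ, α_i)`. Brackets reach the other matrix units.
-/
theorem single_mem_compatible {b : ZMod 2} {B : Matrix (Fin (ℓ + 1)) (Fin (ℓ + 1)) k}
    (hB : B ∈ sl p k) (hb : IsHomog p b B) (c d : Fin (ℓ + 1)) (hcd : c ≠ d) :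
    Matrix.single c d 1 ∈ compatible p k (p c + p d) b B := by
  revert b B
  refine matrixUnit_induction (Q := fun c d => ∀ {b : ZMod 2}
    {B : Matrix (Fin (ℓ + 1)) (Fin (ℓ + 1)) k}, B ∈ sl p k → IsHomog p b B →
    Matrix.single c d 1 ∈ compatible p k (p c + p d) b B) ?_ ?_ ?_ c d hcd
  · intro i b B hB hb
    refine mem_compatible_of_single p hB hb (epsForm p ℓ i) (xN p k 1 i)
      ((matMap_single _ _ _ _).trans (rootN_succ p k i)) fun c d => ?_
    have := sbr_xN_rootN p k i.2 (Fin.is_le c) (Fin.is_le d)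
    simp only [matMap_sbr_single_single, Fin.ext_iff, Fin.val_succ, Fin.val_castSucc]
    rw [show p i.castSucc + p i.succ = vtxParity p ⟨i, i.2⟩ from rfl, vtxParity_mk]
    simp only [parN_val] at this
    exact this
  · intro i b B hB hb
    refine mem_compatible_of_single p hB hb (-epsForm p ℓ i) (yN p k i)
      ((matMap_single _ _ _ _).trans (rootN_pred p k i.2)) fun c d => ?_
    have := sbr_yN_rootN p k i.2 (Fin.is_le c) (Fin.is_le d)
    simp only [matMap_sbr_single_single, Fin.ext_iff, Fin.val_succ, Fin.val_castSucc]
    rw [add_comm (p i.succ), show p i.castSucc + p i.succ = vtxParity p ⟨i, i.2⟩ from rfl,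
      vtxParity_mk]
    simp only [parN_val] at this
    exact this
  · intro c e d hce hed hcd h1 h2 b B hB hb
    have := sbr_mem_compatible p (isHomog_single p c e (1 : k)) (isHomog_single p e d 1)
      (single_mem_sl p hed 1) h1 h2 hB hb
    rwa [parity_telescope, sbr_single_single hcd] at this

theorem rootF_mem_compatible {b : ZMod 2} {B : Matrix (Fin (ℓ + 1)) (Fin (ℓ + 1)) k}
    (hB : B ∈ sl p k) (hb : IsHomog p b B) (α : PosRoot ℓ) :
    (rootF p k α : Matrix _ _ k) ∈ compatible p k (rootParity p α) b B := by
  rw [rootF_val, rootParity, add_comm (p α.1.1)]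
  exact zsmul_mem (single_mem_compatible p k hB hb _ _ α.2.ne') _

theorem cartanH_mem_compatible {b : ZMod 2} {B : Matrix (Fin (ℓ + 1)) (Fin (ℓ + 1)) k}
    (hB : B ∈ sl p k) (hb : IsHomog p b B) (i : Fin ℓ) :
    (cartanH p k i : Matrix _ _ k) ∈ compatible p k 0 b B := by
  have hself : ∀ t : ZMod 2, t + t = 0 := by decide
  rw [← hself (vtxParity p i)]
  exact sbr_mem_compatible p (isHomog_rootE p k (simpleRoot i)) (isHomog_rootF p k (simpleRoot i))
    (rootF p k (simpleRoot i)).2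
    (fun hB hb => single_mem_compatible p k hB hb _ _ (simpleRoot i).2.ne)
    (fun hB hb => rootF_mem_compatible p k hB hb _) hB hb

/-- The homomorphism of Lie superalgebras `𝔰𝔩(V) → Y_ħ(𝔤)`. -/
def canonicalMap : sl p k →ₗ[k] Y p k := (matMap p k).comp (sl p k).subtype

theorem canonicalMap_bracket {a b : ZMod 2} {A B : Matrix (Fin (ℓ + 1)) (Fin (ℓ + 1)) k}
    (hA : A ∈ sl p k) (ha : IsHomog p a A) (hB : B ∈ sl p k) (hb : IsHomog p b B) :
    matMap p k (sbr a b A B) = sbr a b (matMap p k A) (matMap p k B) := by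
  have hself : ∀ t : ZMod 2, t + t = 0 := by decide
  -- The subspace depends on the parity `a`, so only matrix units of that parity may be used. Those
  -- at nonzero entries of `A` are of this kind, and a nonzero diagonal entry forces `a = 0`.
  refine mem_of_mem_sl p (S := compatible p k a b B) hA (fun c d hcd h0 => ?_) fun ⟨c, h0⟩ i => ?_
  · have : p c + p d = a := by_contra fun h => h0 (ha c d h)
    rw [← this]
    exact single_mem_compatible p k hB hb c d hcd
  · have : p c + p c = a := by_contra fun h => h0 (ha c c h)
    rw [← this, hself]
    exact cartanH_mem_compatible p k hB hb i

theorem isCanonicalMap_canonicalMap : IsCanonicalMap p k (canonicalMap p k) where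
  even c A hA := by
    refine mem_of_mem_sl p (S := (((grading p k c).restrictScalars k).comap (matMap p k))) A.2
      (fun a b hab h0 => ?_) fun ⟨a, h0⟩ i => ?_
    · have : p a + p b = c := by_contra fun h => h0 (hA a b h)
      rw [← this]
      change matMap p k _ ∈ grading p k _
      rw [matMap_single]
      exact rootN_mem_grading p k a b
    · have hself : ∀ t : ZMod 2, t + t = 0 := by decide
      have hc : p a + p a = c := by_contra fun h => h0 (hA a a h)
      rw [← hc]
      change matMap p k _ ∈ grading p k _
      rw [cartanH_val, map_sub, map_zsmul, map_zsmul, matMap_single, matMap_single, hself (p a)]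
      have m := fun d => rootN_mem_grading p k d d
      simp only [hself] at m
      exact sub_mem (zsmul_mem (m _) _) (zsmul_mem (m _) _)
  bracket a b A B hA hB := canonicalMap_bracket p k A.2 hA B.2 hB
  map_h i := by
    refine (canonicalMap_bracket p k (rootE p k (simpleRoot i)).2 (isHomog_rootE p k _)
      (rootF p k (simpleRoot i)).2 (isHomog_rootF p k _)).trans ?_
    rw [matMap_rootE, matMap_rootF]
    exact (sbr_xGen_xGen_neg p k i i 0 0).trans (if_pos rfl)
  map_e i := matMap_rootE p k i
  map_f i := matMap_rootF p k i

end CanonicalMap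

/-! ### Two supercommuting copies of a superalgebra -/

section TwoCopies

variable {ℓ : ℕ} {p : Fin (ℓ + 1) → ZMod 2} {k : Type*} [Field k]
variable {C : Type*} [Ring C] [Algebra (PowerSeries k) C]

/-- The images of `ι₁` and `ι₂` supercommute. -/
def SuperCommute (ι₁ ι₂ : Y p k →ₐ[PowerSeries k] C) : Prop :=
  ∀ ⦃a b : ZMod 2⦄ ⦃x y : Y p k⦄, x ∈ grading p k a → y ∈ grading p k b →
    ι₂ y * ι₁ x = psign (a * b) • (ι₁ x * ι₂ y)

namespace SuperCommute

variable {ι₁ ι₂ : Y p k →ₐ[PowerSeries k] C}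

theorem mul_mul (hc : SuperCommute ι₁ ι₂) {a b : ZMod 2} {u v u' v' : Y p k}
    (hv : v ∈ grading p k b) (hu' : u' ∈ grading p k a) :
    (ι₁ u * ι₂ v) * (ι₁ u' * ι₂ v') = psign (a * b) • (ι₁ (u * u') * ι₂ (v * v')) := by
  rw [mul_assoc, ← mul_assoc (ι₂ v), hc hu' hv, map_mul, map_mul, smul_mul_assoc, mul_smul_comm]
  simp only [mul_assoc]

theorem sbr_box (hc : SuperCommute ι₁ ι₂) {a b : ZMod 2} {x y : Y p k} (hx : x ∈ grading p k a)
    (hy : y ∈ grading p k b) :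
    sbr a b (ι₁ x + ι₂ x) (ι₁ y + ι₂ y) = ι₁ (sbr a b x y) + ι₂ (sbr a b x y) := by
  rw [map_sbr, map_sbr]
  simp only [sbr, add_mul, mul_add, smul_add, hc hx hy, hc hy hx, smul_smul, mul_comm b a,
    psign_mul_self, one_smul]
  abel

theorem sabr_box (hc : SuperCommute ι₁ ι₂) {a b : ZMod 2} {x y : Y p k} (hx : x ∈ grading p k a)
    (hy : y ∈ grading p k b) :
    sabr a b (ι₁ x + ι₂ x) (ι₁ y + ι₂ y) = ι₁ (sabr a b x y) + ι₂ (sabr a b x y) +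
      (2 : ℤ) • (ι₁ x * ι₂ y + psign (a * b) • (ι₁ y * ι₂ x)) := by
  rw [map_sabr, map_sabr]
  simp only [sabr, add_mul, mul_add, smul_add, hc hx hy, hc hy hx, smul_smul, mul_comm b a,
    psign_mul_self, one_smul]
  module

/-- The bracket of an even pure tensor with a primitive element. -/
theorem lie_mul_box (hc : SuperCommute ι₁ ι₂) {a c : ZMod 2} {u v z : Y p k}
    (hu : u ∈ grading p k a) (hv : v ∈ grading p k a) (hz : z ∈ grading p k c) :
    ⁅ι₁ u * ι₂ v, ι₁ z + ι₂ z⁆ =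
      psign (a * c) • (ι₁ (sbr a c u z) * ι₂ v) + ι₁ u * ι₂ (sbr a c v z) := by
  have h1 : ι₁ u * ι₂ v * ι₁ z = psign (a * c) • (ι₁ u * ι₁ z * ι₂ v) := by
    rw [mul_assoc, hc hz hv, mul_smul_comm, mul_assoc, mul_comm c]
  have h2 : ι₂ z * (ι₁ u * ι₂ v) = psign (a * c) • (ι₁ u * (ι₂ z * ι₂ v)) := by
    rw [← mul_assoc, hc hu hz, smul_mul_assoc, mul_assoc]
  rw [map_sbr, map_sbr]
  simp only [sbr, Ring.lie_def, mul_add, add_mul, sub_mul, mul_sub, smul_sub, smul_mul_assoc,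
    mul_smul_comm, smul_smul, h1, h2, psign_mul_self, one_smul, mul_assoc]
  abel

theorem lie_left_mul (hc : SuperCommute ι₁ ι₂) {c : ZMod 2} {y u v : Y p k}
    (hy : y ∈ grading p k 0) (hv : v ∈ grading p k c) :
    ⁅ι₁ y, ι₁ u * ι₂ v⁆ = ι₁ ⁅y, u⁆ * ι₂ v := by
  have h1 := hc hy hv
  rw [zero_mul, psign_zero, one_smul] at h1
  rw [Ring.lie_def, Ring.lie_def, mul_assoc, h1, map_sub, map_mul, map_mul, sub_mul]
  simp only [mul_assoc]

theorem lie_right_mul (hc : SuperCommute ι₁ ι₂) {c : ZMod 2} {y u v : Y p k}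
    (hy : y ∈ grading p k 0) (hu : u ∈ grading p k c) :
    ⁅ι₂ y, ι₁ u * ι₂ v⁆ = ι₁ u * ι₂ ⁅y, v⁆ := by
  have h1 := hc hu hy
  rw [mul_zero, psign_zero, one_smul] at h1
  rw [Ring.lie_def, Ring.lie_def, ← mul_assoc, h1, map_sub, map_mul, map_mul, mul_sub]
  simp only [mul_assoc]

/-- The bracket of an even primitive element with a pure tensor. -/
theorem lie_box_mul (hc : SuperCommute ι₁ ι₂) {c d : ZMod 2} {y u v : Y p k}
    (hy : y ∈ grading p k 0) (hu : u ∈ grading p k c) (hv : v ∈ grading p k d) :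
    ⁅ι₁ y + ι₂ y, ι₁ u * ι₂ v⁆ = ι₁ ⁅y, u⁆ * ι₂ v + ι₁ u * ι₂ ⁅y, v⁆ := by
  rw [add_rlie, hc.lie_left_mul hy hv, hc.lie_right_mul hy hu]

theorem sbr_left_mul (hc : SuperCommute ι₁ ι₂) {a b : ZMod 2} {x u v : Y p k}
    (hx : x ∈ grading p k a) (hv : v ∈ grading p k b) :
    sbr a b (ι₁ x) (ι₁ u * ι₂ v) = ι₁ ⁅x, u⁆ * ι₂ v := by
  rw [sbr, mul_assoc (ι₁ u), hc hx hv, mul_smul_comm, smul_smul, psign_mul_self, one_smul,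
    Ring.lie_def, map_sub, map_mul, map_mul, sub_mul]
  simp only [mul_assoc]

theorem sbr_mul_left (hc : SuperCommute ι₁ ι₂) {a b : ZMod 2} {y u v : Y p k}
    (hv : v ∈ grading p k a) (hy : y ∈ grading p k b) :
    sbr a b (ι₁ u * ι₂ v) (ι₁ y) = psign (a * b) • (ι₁ ⁅u, y⁆ * ι₂ v) := by
  rw [sbr, mul_assoc (ι₁ u), hc hy hv, mul_comm b, mul_smul_comm, ← smul_sub,
    Ring.lie_def, map_sub, map_mul, map_mul, sub_mul]
  simp only [mul_assoc]

theorem sbr_mul_right (hc : SuperCommute ι₁ ι₂) {a b : ZMod 2} {y u v : Y p k}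
    (hu : u ∈ grading p k a) (hy : y ∈ grading p k b) :
    sbr a b (ι₁ u * ι₂ v) (ι₂ y) = ι₁ u * ι₂ ⁅v, y⁆ := by
  rw [sbr, ← mul_assoc, hc hu hy, smul_mul_assoc, smul_smul, psign_mul_self, one_smul,
    Ring.lie_def, map_sub, map_mul, map_mul, mul_sub]
  simp only [mul_assoc]

theorem sbr_right_mul (hc : SuperCommute ι₁ ι₂) {a b : ZMod 2} {x u v : Y p k}
    (hx : x ∈ grading p k a) (hu : u ∈ grading p k b) :
    sbr a b (ι₂ x) (ι₁ u * ι₂ v) = psign (a * b) • (ι₁ u * ι₂ ⁅x, v⁆) := by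
  rw [sbr, ← mul_assoc, hc hu hx, mul_comm b, smul_mul_assoc, ← smul_sub,
    Ring.lie_def, map_sub, map_mul, map_mul, mul_sub]
  simp only [mul_assoc]

theorem sbr_left_box (hc : SuperCommute ι₁ ι₂) {a b : ZMod 2} {x y : Y p k}
    (hx : x ∈ grading p k a) (hy : y ∈ grading p k b) :
    sbr a b (ι₁ x) (ι₁ y + ι₂ y) = ι₁ (sbr a b x y) := by
  rw [map_sbr]
  simp only [sbr, add_mul, mul_add, smul_add, hc hx hy, smul_smul, psign_mul_self, one_smul]
  abel

theorem sbr_box_left (hc : SuperCommute ι₁ ι₂) {a b : ZMod 2} {x y : Y p k}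
    (hx : x ∈ grading p k a) (hy : y ∈ grading p k b) :
    sbr a b (ι₁ x + ι₂ x) (ι₁ y) = ι₁ (sbr a b x y) := by
  rw [map_sbr]
  simp only [sbr, add_mul, mul_add, smul_add, hc hy hx, mul_comm b a]
  abel

theorem sbr_right_box (hc : SuperCommute ι₁ ι₂) {a b : ZMod 2} {x y : Y p k}
    (hx : x ∈ grading p k a) (hy : y ∈ grading p k b) :
    sbr a b (ι₂ x) (ι₁ y + ι₂ y) = ι₂ (sbr a b x y) := by
  rw [map_sbr]
  simp only [sbr, add_mul, mul_add, smul_add, hc hy hx, mul_comm b a]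
  abel

theorem sbr_box_right (hc : SuperCommute ι₁ ι₂) {a b : ZMod 2} {x y : Y p k}
    (hx : x ∈ grading p k a) (hy : y ∈ grading p k b) :
    sbr a b (ι₁ x + ι₂ x) (ι₂ y) = ι₂ (sbr a b x y) := by
  rw [map_sbr]
  simp only [sbr, add_mul, mul_add, smul_add, hc hx hy, smul_smul, psign_mul_self, one_smul]
  abel

/-- Twice the commutator of two even pure tensors. -/
theorem two_lie_mul_mul (hc : SuperCommute ι₁ ι₂) {a b : ZMod 2} {u v u' v' : Y p k}
    (hu : u ∈ grading p k a) (hv : v ∈ grading p k a) (hu' : u' ∈ grading p k b)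
    (hv' : v' ∈ grading p k b) :
    (2 : ℤ) • ⁅ι₁ u * ι₂ v, ι₁ u' * ι₂ v'⁆ = psign (a * b) •
      (ι₁ (sabr a b u u') * ι₂ (sbr a b v v') + ι₁ (sbr a b u u') * ι₂ (sabr a b v v')) := by
  rw [Ring.lie_def, hc.mul_mul hv hu', hc.mul_mul hv' hu]
  simp only [sbr, sabr, map_add, map_sub, map_zsmul, mul_add, add_mul, sub_mul, mul_sub,
    smul_mul_assoc, mul_smul_comm, mul_comm b a]
  rcases psign_eq_one_or (a * b) with h | h <;> rw [h] <;> simp only [one_smul, neg_smul] <;>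
    module

end SuperCommute

end TwoCopies

/-! ### Root vectors and the action of the elements `t_i` on them -/

section RootFamily

variable {ℓ : ℕ} (p : Fin (ℓ + 1) → ZMod 2) (k : Type*) [Field k]

/-- The element `t_i = h_{i,1} - (ħ/2) h_{i,0}²`. -/
def tGen (i : Fin ℓ) : Y p k := hGen p k i 1 - halfHbar k • (hGen p k i 0 * hGen p k i 0)

/-- The form `(α_i, ε_a)`. -/
def rootEps (i : Fin ℓ) (a : Fin (ℓ + 1)) : ℤ := psign (p a) * weight (simpleRoot i) a

theorem rootForm_eq_rootEps (i : Fin ℓ) (α : PosRoot ℓ) :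
    rootForm p (simpleRoot i) α = rootEps p i α.1.1 - rootEps p i α.1.2 := by
  rw [rootForm_comm, rootForm_eq]; rfl

theorem cartan_eq_rootEps (i j : Fin ℓ) :
    cartan p i j = rootEps p i j.castSucc - rootEps p i j.succ := rootForm_eq_rootEps p i _

theorem lie_tGen_tGen (i j : Fin ℓ) : ⁅tGen p k i, tGen p k j⁆ = 0 := by
  have h := fun r s => lie_hGen_hGen p k i j r s
  simp only [Ring.lie_def, sub_eq_zero] at h ⊢
  have hc : ∀ r s, Commute (hGen p k i r) (hGen p k j s) := fun r s => h r s
  exact ((hc 1 1).sub_right (((hc 1 0).mul_right (hc 1 0)).smul_right _)).sub_left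
    ((((hc 0 1).mul_left (hc 0 1)).smul_left _).sub_right
      ((((hc 0 0).mul_left (hc 0 0)).mul_right ((hc 0 0).mul_left (hc 0 0))).smul_left _
        |>.smul_right _))

theorem lie_tGen_hGen (i j : Fin ℓ) : ⁅tGen p k i, hGen p k j 0⁆ = 0 := by
  have h := fun r => lie_hGen_hGen p k i j r 0
  simp only [Ring.lie_def, sub_eq_zero] at h ⊢
  have hc : ∀ r, Commute (hGen p k i r) (hGen p k j 0) := fun r => h r
  exact (hc 1).sub_left (((hc 0).mul_left (hc 0)).smul_left _)

theorem smul_rlie {R B : Type*} [CommRing R] [Ring B] [Algebra R B] (r : R) (x y : B) :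
    ⁅r • x, y⁆ = r • ⁅x, y⁆ := by
  simp only [Ring.lie_def, mul_smul_comm, smul_mul_assoc, smul_sub]

theorem sub_rlie {B : Type*} [Ring B] (x x' y : B) : ⁅x - x', y⁆ = ⁅x, y⁆ - ⁅x', y⁆ := by
  simp only [Ring.lie_def, mul_sub, sub_mul]; abel

theorem mul_rlie {B : Type*} [Ring B] (x x' y : B) : ⁅x * x', y⁆ = x * ⁅x', y⁆ + ⁅x, y⁆ * x' := by
  simp only [Ring.lie_def]; noncomm_ring

/-- The square in `t_i` is chosen so that `[h_{i0}², x] = ± c_ij (h_{i0} x + x h_{i0})` cancels the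
anticommutator in the relation for `h_{i1}`. At an odd vertex with `i = j` both sides vanish. -/
theorem lie_tGen_xGen (e : ℤˣ) (i j : Fin ℓ) (s : ℕ) :
    ⁅tGen p k i, xGen p k e j s⁆ = ((e : ℤ) * cartan p i j) • xGen p k e j (s + 1) := by
  rw [tGen, sub_rlie, smul_rlie, mul_rlie, lie_hGen_zero_xGen]
  by_cases hij : i = j ∧ vtxParity p i = 1
  · obtain ⟨rfl, hi⟩ := hij
    rw [lie_hGen_xGen_of_odd p k e i 1 s hi, cartan_odd p hi]
    simp
  · have h := lie_hGen_xGen_succ p k e i j 0 s hij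
    rw [zero_add, sub_eq_iff_eq_add, lie_hGen_zero_xGen] at h
    rw [h, mul_smul_comm, smul_mul_assoc, ← smul_add, smul_assoc, smul_comm (halfHbar k)]
    abel

/-- A family of root vectors for the positive (`e = 1`) or the negative (`e = -1`) roots
`ε_a - ε_b`, with structure constants `γ = ± 1`. -/
structure IsRootFamily (e : ℤˣ) (Z : Fin (ℓ + 1) → Fin (ℓ + 1) → Y p k)
    (γ : Fin (ℓ + 1) → Fin (ℓ + 1) → Fin (ℓ + 1) → ℤ) : Prop where
  simple : ∀ j : Fin ℓ, Z j.castSucc j.succ = xGen p k e j 0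
  zero : ∀ a b, ¬ a < b → Z a b = 0
  mul : ∀ a c b, a < c → c < b →
    sbr (p a + p c) (p c + p b) (Z a c) (Z c b) = γ a c b • Z a b
  sq : ∀ a c b, γ a c b * γ a c b = 1
  cocycle : ∀ a c b d, γ a c d * γ c b d = γ a b d * γ a c b

/-- The root vectors `[Z_{a,b-1}, x_{b-1,1}]`. -/
def primed (e : ℤˣ) (Z : Fin (ℓ + 1) → Fin (ℓ + 1) → Y p k)
    (γ : Fin (ℓ + 1) → Fin (ℓ + 1) → Fin (ℓ + 1) → ℤ) (a b : Fin (ℓ + 1)) : Y p k :=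
  -- For a root family the bracket is zero when `a = b - 1`, since `Z a a = 0`; the second summand
  -- then supplies the simple root vector of level one. No positive root ends at index zero, hence
  -- the default value.
  Fin.cases 0 (fun j => γ a j.castSucc j.succ • sbr (p a + p j.castSucc) (vtxParity p j)
    (Z a j.castSucc) (xGen p k e j 1) + if a = j.castSucc then xGen p k e j 1 else 0) b

variable {p k} {e : ℤˣ} {Z : Fin (ℓ + 1) → Fin (ℓ + 1) → Y p k}
  {γ : Fin (ℓ + 1) → Fin (ℓ + 1) → Fin (ℓ + 1) → ℤ}

theorem primed_succ (e : ℤˣ) (Z : Fin (ℓ + 1) → Fin (ℓ + 1) → Y p k)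
    (γ : Fin (ℓ + 1) → Fin (ℓ + 1) → Fin (ℓ + 1) → ℤ) (a : Fin (ℓ + 1)) (j : Fin ℓ) :
    primed p k e Z γ a j.succ = γ a j.castSucc j.succ • sbr (p a + p j.castSucc) (vtxParity p j)
      (Z a j.castSucc) (xGen p k e j 1) + if a = j.castSucc then xGen p k e j 1 else 0 := rfl

theorem IsRootFamily.succ (hZ : IsRootFamily p k e Z γ) (a : Fin (ℓ + 1)) (j : Fin ℓ) :
    Z a j.succ = γ a j.castSucc j.succ • sbr (p a + p j.castSucc) (vtxParity p j)
      (Z a j.castSucc) (xGen p k e j 0) + if a = j.castSucc then xGen p k e j 0 else 0 := by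
  rcases lt_trichotomy a j.castSucc with h | h | h
  · rw [if_neg h.ne, add_zero, ← hZ.simple, vtxParity_eq, hZ.mul _ _ _ h Fin.castSucc_lt_succ,
      smul_smul, hZ.sq, one_smul]
  · subst h
    rw [if_pos rfl, hZ.zero _ _ (lt_irrefl _), sbr_zero_elt_left, smul_zero, zero_add, hZ.simple]
  · rw [if_neg h.ne', hZ.zero _ _ h.not_gt, sbr_zero_elt_left, smul_zero, zero_add,
      hZ.zero _ _ (by rw [Fin.lt_def] at *; simp at *; omega)]

theorem IsRootFamily.far (hZ : IsRootFamily p k e Z γ) {j : Fin ℓ} {b : Fin (ℓ + 1)} (r : ℕ)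
    (hb : b < j.castSucc) (a : Fin (ℓ + 1)) :
    sbr (p a + p b) (vtxParity p j) (Z a b) (xGen p k e j r) = 0 := by
  induction b using Fin.induction generalizing a with
  | zero => rw [hZ.zero _ _ (by simp), sbr_zero_elt_left]
  | succ i ih =>
    have hi : i.castSucc < j.castSucc := lt_trans Fin.castSucc_lt_succ hb
    have hij : (i : ℕ) + 1 < j := by simpa [Fin.lt_def] using hb
    have h0 := sbr_xGen_xGen_of_cartan_eq_zero p k e i j 0 r (cartan_of_lt p hij)
    rw [hZ.succ, sbr_add_left, sbr_zsmul_left]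
    have h1 : sbr (p a + p i.succ) (vtxParity p j) (sbr (p a + p i.castSucc) (vtxParity p i)
        (Z a i.castSucc) (xGen p k e i 0)) (xGen p k e j r) = 0 := by
      rw [← parity_telescope (p a) (p i.castSucc) (p i.succ), ← vtxParity_eq, sbr_jacobi_left,
        ih hi a, h0, sbr_zero_elt_right, sbr_zero_elt_right, smul_zero, sub_zero]
    rw [h1, smul_zero, zero_add]
    split_ifs with h
    · rw [h, ← vtxParity_eq, h0]
    · rw [sbr_zero_elt_left]

theorem sabr_sbr_of_sbr_eq_zero {B : Type*} [Ring B] {a b c : ZMod 2} {u v z : B}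
    (h : sbr a c u z = 0) :
    sbr (a + b) c (sabr a b u v) z = sabr a (b + c) u (sbr b c v z) := by
  rcases zmod_two_cases a with rfl | rfl <;> rcases zmod_two_cases b with rfl | rfl <;>
    rcases zmod_two_cases c with rfl | rfl <;>
    simp only [sbr, sabr, psign_zero, psign_one, mul_one, mul_zero, one_smul, neg_smul,
      zmod_two_one_add_one, zero_add, add_zero, sub_eq_zero, sub_neg_eq_add,
      add_eq_zero_iff_eq_neg] at h ⊢ <;>
    simp only [mul_add, add_mul, mul_sub, sub_mul, mul_neg, neg_mul, mul_assoc, h] <;>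
    simp only [← mul_assoc, h] <;> noncomm_ring

theorem exists_smul_eq_addMonoidHom {R : Type*} [Ring R] (r : R) (M : Type*) [AddCommGroup M]
    [Module R M] : ∃ H : M →+ M, ∀ x, r • x = H x :=
  ⟨DistribSMul.toAddMonoidHom M r, fun _ => rfl⟩

/-- The level one is moved from the last factor of the root vector to the next simple one by the
relation between neighbouring generators. This costs an anticommutator, whose coefficient comes from
`c_{j-1,j} = -(-1)^{p j}`; the earlier factors commute with `x_j` at every level. -/
theorem IsRootFamily.sbr_primed (hZ : IsRootFamily p k e Z γ) (a : Fin (ℓ + 1)) (j : Fin ℓ) :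
    sbr (p a + p j.castSucc) (vtxParity p j) (primed p k e Z γ a j.castSucc) (xGen p k e j 0) =
      sbr (p a + p j.castSucc) (vtxParity p j) (Z a j.castSucc) (xGen p k e j 1) -
        (((e : ℤ) * psign (p j.castSucc)) • halfHbar k) •
          sabr (p a + p j.castSucc) (vtxParity p j) (Z a j.castSucc) (xGen p k e j 0) := by
  rcases Nat.eq_zero_or_pos (j : ℕ) with h0 | h0
  · have hj : j.castSucc = 0 := Fin.ext (by simpa using h0)
    rw [hj, hZ.zero a 0 (by simp)]
    change sbr _ _ 0 _ = _
    rw [sbr_zero_elt_left, sbr_zero_elt_left, sabr_zero_elt_left, smul_zero, sub_zero]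
  · obtain ⟨i, hi⟩ : ∃ i : Fin ℓ, i.succ = j.castSucc :=
      ⟨⟨j - 1, by omega⟩, Fin.ext (by simp; omega)⟩
    have hij : (i : ℕ) + 1 = j := by simpa [Fin.ext_iff] using hi
    have hc := cartan_succ p hij
    have hne : i ≠ j := fun h => by simp [h] at hij
    have hx := sbr_xGen_xGen_succ p k e i j 0 0 fun h => hne h.1
    rw [zero_add, hc, mul_neg, neg_smul, neg_smul, sub_eq_iff_eq_add] at hx
    have hl : i.castSucc < j.castSucc := by
      rw [Fin.lt_def, Fin.val_castSucc, Fin.val_castSucc]; omega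
    have f0 := hZ.far 0 hl a
    have f1 := hZ.far 1 hl a
    rw [← hi, primed_succ, hZ.succ]
    rw [← hi] at hx
    have hP : p a + p i.succ = (p a + p i.castSucc) + vtxParity p i := by
      rw [vtxParity_eq, parity_telescope]
    have k1 : sbr (p a + p i.succ) (vtxParity p j) (sbr (p a + p i.castSucc) (vtxParity p i)
        (Z a i.castSucc) (xGen p k e i 1)) (xGen p k e j 0) =
        sbr (p a + p i.castSucc) (vtxParity p i + vtxParity p j) (Z a i.castSucc)
          (sbr (vtxParity p i) (vtxParity p j) (xGen p k e i 1) (xGen p k e j 0)) := by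
      rw [hP, sbr_jacobi_left, f0, sbr_zero_elt_right, smul_zero, sub_zero]
    have k2 : sbr (p a + p i.succ) (vtxParity p j) (sbr (p a + p i.castSucc) (vtxParity p i)
        (Z a i.castSucc) (xGen p k e i 0)) (xGen p k e j 1) =
        sbr (p a + p i.castSucc) (vtxParity p i + vtxParity p j) (Z a i.castSucc)
          (sbr (vtxParity p i) (vtxParity p j) (xGen p k e i 0) (xGen p k e j 1)) := by
      rw [hP, sbr_jacobi_left, f1, sbr_zero_elt_right, smul_zero, sub_zero]
    have k3 : sabr (p a + p i.succ) (vtxParity p j) (sbr (p a + p i.castSucc) (vtxParity p i)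
        (Z a i.castSucc) (xGen p k e i 0)) (xGen p k e j 0) =
        sbr (p a + p i.castSucc) (vtxParity p i + vtxParity p j) (Z a i.castSucc)
          (sabr (vtxParity p i) (vtxParity p j) (xGen p k e i 0) (xGen p k e j 0)) := by
      rw [hP, sbr_sabr, f0, sabr_zero_elt_right, smul_zero, add_zero]
    simp only [sbr_add_left, sabr_add_left, sbr_zsmul_left, sabr_zsmul_left, k1, k2, k3, hx,
      sbr_add_right, sbr_neg_right, sbr_smul_right]
    obtain ⟨H, hH⟩ := exists_smul_eq_addMonoidHom (halfHbar k) (Y p k)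
    split_ifs with ha
    · rw [ha, ← vtxParity_eq, hx]
      simp only [smul_assoc, hH, map_zsmul, map_add]
      module
    · simp only [sbr_zero_elt_left, sabr_zero_elt_left, smul_assoc, hH, map_zsmul, map_add,
        map_zero]
      module

/-- The action of `t_i` on the root vectors. -/
theorem IsRootFamily.lie_tGen (hZ : IsRootFamily p k e Z γ) (i : Fin ℓ) (a b : Fin (ℓ + 1)) :
    ⁅tGen p k i, Z a b⁆ =
      ((e : ℤ) * (rootEps p i a - rootEps p i b)) • primed p k e Z γ a b -
        halfHbar k • ∑ c, ((rootEps p i a - rootEps p i c) * psign (p c) * γ a c b) •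
          sabr (p a + p c) (p c + p b) (Z a c) (Z c b) := by
  induction b using Fin.induction generalizing a with
  | zero =>
    have h0 : ∀ a, Z a 0 = 0 := fun a => hZ.zero _ _ (by simp)
    simp only [h0, sabr_zero_elt_right, smul_zero, Finset.sum_const_zero, sub_zero, rlie_zero]
    change _ = _ • (0 : Y p k)
    rw [smul_zero]
  | succ j ih =>
    -- For the longer root the sum over intermediate indices is the bracket of the old sum with
    -- `x_j`, plus the term of the new intermediate index `j.castSucc`. The cocycle condition
    -- matches the structure constants.
    have hs : ∑ c, ((rootEps p i a - rootEps p i c) * psign (p c) * γ a c j.succ) •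
          sabr (p a + p c) (p c + p j.succ) (Z a c) (Z c j.succ) =
        γ a j.castSucc j.succ • ∑ c, ((rootEps p i a - rootEps p i c) * psign (p c) *
          γ a c j.castSucc) • sbr (p a + p j.castSucc) (vtxParity p j)
            (sabr (p a + p c) (p c + p j.castSucc) (Z a c) (Z c j.castSucc)) (xGen p k e j 0) +
        ((rootEps p i a - rootEps p i j.castSucc) * psign (p j.castSucc) *
          γ a j.castSucc j.succ) •
          sabr (p a + p j.castSucc) (vtxParity p j) (Z a j.castSucc) (xGen p k e j 0) := by
      have h1 : ∀ c, ((rootEps p i a - rootEps p i c) * psign (p c) * γ a c j.succ) •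
          sabr (p a + p c) (p c + p j.succ) (Z a c) (Z c j.succ) =
          γ a j.castSucc j.succ • (((rootEps p i a - rootEps p i c) * psign (p c) *
          γ a c j.castSucc) • sbr (p a + p j.castSucc) (vtxParity p j)
            (sabr (p a + p c) (p c + p j.castSucc) (Z a c) (Z c j.castSucc)) (xGen p k e j 0)) +
          if c = j.castSucc then ((rootEps p i a - rootEps p i j.castSucc) * psign (p j.castSucc) *
          γ a j.castSucc j.succ) • sabr (p a + p j.castSucc) (vtxParity p j) (Z a j.castSucc)
            (xGen p k e j 0) else 0 := by
        intro c
        have h2 : sbr (p a + p j.castSucc) (vtxParity p j)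
            (sabr (p a + p c) (p c + p j.castSucc) (Z a c) (Z c j.castSucc)) (xGen p k e j 0) =
            sabr (p a + p c) (p c + p j.succ) (Z a c)
              (sbr (p c + p j.castSucc) (vtxParity p j) (Z c j.castSucc) (xGen p k e j 0)) := by
          by_cases hcj : c < j.castSucc
          · rw [← parity_telescope (p a) (p c) (p j.castSucc),
              sabr_sbr_of_sbr_eq_zero (hZ.far 0 hcj a), vtxParity_eq, parity_telescope]
          · rw [hZ.zero c _ hcj, sabr_zero_elt_right, sbr_zero_elt_left, sbr_zero_elt_left,
              sabr_zero_elt_right]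
        rw [h2, hZ.succ c j, sabr_add_right, sabr_zsmul_right, smul_add, smul_smul, smul_smul]
        congr 1
        · congr 1
          linear_combination ((rootEps p i a - rootEps p i c) * psign (p c)) *
            hZ.cocycle a c j.castSucc j.succ
        · split_ifs with hcj
          · rw [hcj, vtxParity_eq]
          · rw [sabr_zero_elt_right, smul_zero]
      rw [Finset.sum_congr rfl fun c _ => h1 c, Finset.sum_add_distrib, ← Finset.smul_sum,
        Finset.sum_ite_eq' Finset.univ, if_pos (Finset.mem_univ _)]
    rw [hs, hZ.succ, rlie_add, lie_zsmul_right, lie_sbr, ih, lie_tGen_xGen, sbr_sub_left,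
      sbr_zsmul_left, sbr_smul_left, sbr_sum_left, hZ.sbr_primed, sbr_zsmul_right, primed_succ,
      cartan_eq_rootEps]
    simp only [sbr_zsmul_left]
    have he : (e : ℤ) * e = 1 := by rw [← Units.val_mul, Int.units_mul_self]; rfl
    obtain ⟨H, hH⟩ := exists_smul_eq_addMonoidHom (halfHbar k) (Y p k)
    generalize ∑ c, ((rootEps p i a - rootEps p i c) * psign (p c) * γ a c j.castSucc) •
      sbr (p a + p j.castSucc) (vtxParity p j) (sabr (p a + p c) (p c + p j.castSucc) (Z a c)
        (Z c j.castSucc)) (xGen p k e j 0) = S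
    -- This coefficient turns the anticommutator from `sbr_primed` into the new term of the sum.
    have h3 : ((e : ℤ) * (rootEps p i a - rootEps p i j.castSucc)) *
        ((e : ℤ) * psign (p j.castSucc)) =
        (rootEps p i a - rootEps p i j.castSucc) * psign (p j.castSucc) := by
      linear_combination ((rootEps p i a - rootEps p i j.castSucc) * psign (p j.castSucc)) * he
    rw [smul_sub, smul_assoc ((e : ℤ) * psign (p j.castSucc)), smul_smul _ ((e : ℤ) * psign _), h3]
    split_ifs with ha
    · rw [ha, lie_tGen_xGen, hZ.zero _ _ (lt_irrefl _), cartan_eq_rootEps]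
      simp only [hH, map_zsmul, map_add, sbr_zero_elt_left, sabr_zero_elt_left,
        map_zero, sub_self]
      module
    · rw [rlie_zero]
      simp only [hH, map_zsmul, map_add]
      module

end RootFamily

/-! ### The root vectors of `𝔤` -/

section RootImages

variable {ℓ : ℕ} {p : Fin (ℓ + 1) → ZMod 2} {k : Type*} [Field k]

/-- The image of the matrix unit `E_{ab}` off the diagonal; zero on the diagonal. -/
def unitImage (φ : sl p k →ₗ[k] Y p k) (a b : Fin (ℓ + 1)) : Y p k :=
  if h : a ≠ b then φ ⟨Matrix.single a b 1, single_mem_sl p h 1⟩ else 0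

/-- The root vector `e_α` for `α = ε_a - ε_b`; zero unless `a < b`. -/
def eRoot (φ : sl p k →ₗ[k] Y p k) (a b : Fin (ℓ + 1)) : Y p k :=
  if a < b then unitImage φ a b else 0

/-- The root vector `f_α` for `α = ε_a - ε_b`; zero unless `a < b`. -/
def fRoot (φ : sl p k →ₗ[k] Y p k) (a b : Fin (ℓ + 1)) : Y p k :=
  if a < b then psign (p a) • unitImage φ b a else 0

variable {φ : sl p k →ₗ[k] Y p k}

theorem unitImage_of_ne {a b : Fin (ℓ + 1)} (h : a ≠ b) :
    unitImage φ a b = φ ⟨Matrix.single a b 1, single_mem_sl p h 1⟩ := dif_pos h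

theorem eRoot_of_lt {a b : Fin (ℓ + 1)} (h : a < b) : eRoot φ a b = unitImage φ a b := if_pos h

theorem fRoot_of_lt {a b : Fin (ℓ + 1)} (h : a < b) :
    fRoot φ a b = psign (p a) • unitImage φ b a := if_pos h

theorem eRoot_of_not_lt {a b : Fin (ℓ + 1)} (h : ¬ a < b) : eRoot φ a b = 0 := if_neg h

theorem fRoot_of_not_lt {a b : Fin (ℓ + 1)} (h : ¬ a < b) : fRoot φ a b = 0 := if_neg h

theorem unitImage_of_gt {a b : Fin (ℓ + 1)} (h : b < a) :
    unitImage φ a b = psign (p b) • fRoot φ b a := by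
  rw [fRoot_of_lt h, smul_smul, psign_mul_self, one_smul]

theorem map_rootE (α : PosRoot ℓ) : φ (rootE p k α) = eRoot φ α.1.1 α.1.2 := by
  rw [eRoot_of_lt α.2, unitImage_of_ne α.2.ne]
  rfl

theorem map_rootF (α : PosRoot ℓ) : φ (rootF p k α) = fRoot φ α.1.1 α.1.2 := by
  rw [fRoot_of_lt α.2, unitImage_of_ne α.2.ne', ← map_zsmul]
  congr 1
  exact Subtype.ext (rootF_val p α)

/-- A sum over the positive roots. -/
theorem sum_posRoot {M : Type*} [AddCommMonoid M] (g : Fin (ℓ + 1) → Fin (ℓ + 1) → M)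
    (hg : ∀ a b, ¬ a < b → g a b = 0) : ∑ α : PosRoot ℓ, g α.1.1 α.1.2 = ∑ a, ∑ b, g a b := by
  rw [← Fintype.sum_prod_type' (f := g), ← Finset.sum_subtype
    (Finset.univ.filter fun ab : Fin (ℓ + 1) × Fin (ℓ + 1) => ab.1 < ab.2) (by simp)
    (fun ab => g ab.1 ab.2)]
  refine Finset.sum_subset (Finset.filter_subset _ _) fun ab _ h => hg _ _ ?_
  simpa using h

namespace IsCanonicalMap

theorem unitImage_mem (hφ : IsCanonicalMap p k φ) (a b : Fin (ℓ + 1)) :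
    unitImage φ a b ∈ grading p k (p a + p b) := by
  by_cases h : a = b
  · rw [unitImage, dif_neg (by simpa using h)]; exact zero_mem _
  · rw [unitImage_of_ne h]
    exact hφ.even _ _ (isHomog_single p a b 1)

theorem eRoot_mem (hφ : IsCanonicalMap p k φ) (a b : Fin (ℓ + 1)) :
    eRoot φ a b ∈ grading p k (p a + p b) := by
  rw [eRoot]
  split_ifs
  · exact hφ.unitImage_mem a b
  · exact zero_mem _

theorem fRoot_mem (hφ : IsCanonicalMap p k φ) (a b : Fin (ℓ + 1)) :
    fRoot φ a b ∈ grading p k (p a + p b) := by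
  rw [fRoot]
  split_ifs
  · rw [add_comm]; exact zsmul_mem (hφ.unitImage_mem b a) _
  · exact zero_mem _

/-- The brackets of matrix units that are not opposite to each other. -/
theorem sbr_unitImage (hφ : IsCanonicalMap p k φ) {a b c d : Fin (ℓ + 1)} (hab : a ≠ b)
    (hcd : c ≠ d) (h : ¬ (b = c ∧ d = a)) :
    sbr (p a + p b) (p c + p d) (unitImage φ a b) (unitImage φ c d) =
      (if b = c then unitImage φ a d else 0) -
        psign ((p a + p b) * (p c + p d)) • (if d = a then unitImage φ c b else 0) := by
  have hm : sbr (p a + p b) (p c + p d) (Matrix.single a b (1 : k)) (Matrix.single c d 1) ∈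
      sl p k :=
    sbr_mem_sl p (isHomog_single p a b 1) (isHomog_single p c d 1)
  have hbr : sbr (p a + p b) (p c + p d) (unitImage φ a b) (unitImage φ c d) = φ ⟨_, hm⟩ := by
    rw [unitImage_of_ne hab, unitImage_of_ne hcd]
    exact (hφ.bracket _ _ ⟨_, single_mem_sl p hab 1⟩ ⟨_, single_mem_sl p hcd 1⟩
      (isHomog_single p a b 1) (isHomog_single p c d 1)).symm
  rw [hbr]
  by_cases h1 : b = c
  · subst h1
    have h2 : d ≠ a := fun h' => h ⟨rfl, h'⟩
    rw [if_pos rfl, if_neg h2, smul_zero, sub_zero, unitImage_of_ne h2.symm]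
    congr 1
    exact Subtype.ext (sbr_single_single h2.symm _ _)
  · rw [if_neg h1, zero_sub]
    by_cases h2 : d = a
    · subst h2
      rw [if_pos rfl, unitImage_of_ne (Ne.symm h1), ← map_zsmul, ← map_neg]
      congr 1
      refine Subtype.ext ?_
      change sbr _ _ _ _ = -(_ • _)
      rw [sbr_skew, sbr_single_single (Ne.symm h1)]
    · rw [if_neg h2, smul_zero, neg_zero, ← map_zero φ]
      congr 1
      refine Subtype.ext ?_
      change sbr _ _ _ _ = 0
      rw [sbr, Matrix.single_mul_single_of_ne _ _ _ _ h1, Matrix.single_mul_single_of_ne _ _ _ _ h2,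
        smul_zero, sub_zero]

theorem eRoot_simple (hφ : IsCanonicalMap p k φ) (j : Fin ℓ) :
    eRoot φ j.castSucc j.succ = xGen p k 1 j 0 := by
  rw [← hφ.map_e, map_rootE]; rfl

theorem fRoot_simple (hφ : IsCanonicalMap p k φ) (j : Fin ℓ) :
    fRoot φ j.castSucc j.succ = xGen p k (-1) j 0 := by
  rw [← hφ.map_f, map_rootF]; rfl

theorem unitImage_simple (hφ : IsCanonicalMap p k φ) (j : Fin ℓ) :
    unitImage φ j.castSucc j.succ = xGen p k 1 j 0 := by
  rw [← hφ.eRoot_simple, eRoot_of_lt Fin.castSucc_lt_succ]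

theorem unitImage_simple_neg (hφ : IsCanonicalMap p k φ) (j : Fin ℓ) :
    unitImage φ j.succ j.castSucc = psign (p j.castSucc) • xGen p k (-1) j 0 := by
  rw [← hφ.fRoot_simple, unitImage_of_gt Fin.castSucc_lt_succ]

/-- The structure constants of the negative root vectors. -/
def negConst (p : Fin (ℓ + 1) → ZMod 2) (a c b : Fin (ℓ + 1)) : ℤ :=
  psign (1 + p c + (p a + p c) * (p c + p b))

theorem negConst_eq (a c b : Fin (ℓ + 1)) :
    negConst p a c b = -(psign (p c) * psign ((p a + p c) * (p c + p b))) := by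
  rw [negConst, psign_add, psign_add, psign_one]; ring

theorem isRootFamily_eRoot (hφ : IsCanonicalMap p k φ) :
    IsRootFamily p k 1 (eRoot φ) fun _ _ _ => 1 where
  simple := hφ.eRoot_simple
  zero _ _ h := eRoot_of_not_lt h
  mul a c b hac hcb := by
    have hab := hac.trans hcb
    rw [eRoot_of_lt hac, eRoot_of_lt hcb, eRoot_of_lt hab,
      hφ.sbr_unitImage hac.ne hcb.ne (fun h => hab.ne' h.2), if_pos rfl, if_neg hab.ne', smul_zero,
      sub_zero, one_smul]
  sq _ _ _ := rfl
  cocycle _ _ _ _ := rfl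

theorem isRootFamily_fRoot (hφ : IsCanonicalMap p k φ) :
    IsRootFamily p k (-1) (fRoot φ) (negConst p) where
  simple := hφ.fRoot_simple
  zero _ _ h := fRoot_of_not_lt h
  mul a c b hac hcb := by
    have hab := hac.trans hcb
    rw [fRoot_of_lt hac, fRoot_of_lt hcb, fRoot_of_lt hab, sbr_zsmul_left, sbr_zsmul_right,
      add_comm (p a) (p c), add_comm (p c) (p b),
      hφ.sbr_unitImage hac.ne' hcb.ne' (fun h => hab.ne h.1), if_neg hab.ne, if_pos rfl,
      negConst_eq, add_comm (p a) (p c), add_comm (p c) (p b)]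
    module
  sq _ _ _ := psign_mul_self _
  cocycle a c b d := by
    simp only [negConst, ← psign_add]
    congr 1
    generalize p a = s
    generalize p b = t
    generalize p c = u
    generalize p d = v
    revert s t u v
    decide

theorem lie_hGen_unitImage (hφ : IsCanonicalMap p k φ) (i : Fin ℓ) (a b : Fin (ℓ + 1))
    (hab : a ≠ b) : ⁅hGen p k i 0, unitImage φ a b⁆ =
      (rootEps p i a - rootEps p i b) • unitImage φ a b := by
  refine matrixUnit_induction (Q := fun a b => ⁅hGen p k i 0, unitImage φ a b⁆ =
      (rootEps p i a - rootEps p i b) • unitImage φ a b) ?_ ?_ ?_ a b hab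
  · intro j
    rw [hφ.unitImage_simple, lie_hGen_zero_xGen, cartan_eq_rootEps, Units.val_one, one_mul]
  · intro j
    rw [hφ.unitImage_simple_neg, lie_zsmul_right, lie_hGen_zero_xGen, cartan_eq_rootEps,
      Units.val_neg, Units.val_one, neg_one_mul, neg_sub, smul_comm]
  · intro a c b hac hcb hab h1 h2
    have := hφ.sbr_unitImage hac hcb (fun h => hab h.2.symm)
    rw [if_pos rfl, if_neg hab.symm, smul_zero, sub_zero] at this
    rw [← this, lie_sbr, h1, h2, sbr_zsmul_left, sbr_zsmul_right, ← add_smul]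
    congr 1
    ring

theorem lie_hGen_eRoot (hφ : IsCanonicalMap p k φ) (i : Fin ℓ) (a b : Fin (ℓ + 1)) :
    ⁅hGen p k i 0, eRoot φ a b⁆ = (rootEps p i a - rootEps p i b) • eRoot φ a b := by
  by_cases h : a < b
  · rw [eRoot_of_lt h, hφ.lie_hGen_unitImage i a b h.ne]
  · rw [eRoot_of_not_lt h, rlie_zero, smul_zero]

theorem lie_hGen_fRoot (hφ : IsCanonicalMap p k φ) (i : Fin ℓ) (a b : Fin (ℓ + 1)) :
    ⁅hGen p k i 0, fRoot φ a b⁆ = -((rootEps p i a - rootEps p i b) • fRoot φ a b) := by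
  by_cases h : a < b
  · rw [fRoot_of_lt h, lie_zsmul_right, hφ.lie_hGen_unitImage i b a h.ne', smul_comm, ← neg_smul,
      neg_sub]
  · rw [fRoot_of_not_lt h, rlie_zero, smul_zero, neg_zero]

end IsCanonicalMap

end RootImages

/-! ### Half of the Casimir element -/

section Casimir

variable {ℓ : ℕ} {p : Fin (ℓ + 1) → ZMod 2} {k : Type*} [Field k] {φ : sl p k →ₗ[k] Y p k}

namespace IsCanonicalMap

theorem sbr_eRoot_xGen (hφ : IsCanonicalMap p k φ) {a b : Fin (ℓ + 1)} (hab : a < b) (j : Fin ℓ) :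
    sbr (p a + p b) (vtxParity p j) (eRoot φ a b) (xGen p k 1 j 0) =
      (if b = j.castSucc then eRoot φ a j.succ else 0) -
        psign ((p a + p b) * vtxParity p j) •
          (if a = j.succ then eRoot φ j.castSucc b else 0) := by
  have hj : j.castSucc < j.succ := Fin.castSucc_lt_succ
  rw [eRoot_of_lt hab, ← hφ.unitImage_simple, vtxParity_eq,
    hφ.sbr_unitImage hab.ne hj.ne fun h => (hab.trans (h.1.trans_lt hj)).ne' h.2]
  congr 1
  · split_ifs with h
    · rw [eRoot_of_lt (hab.trans (h.trans_lt hj))]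
    · rfl
  · congr 1
    by_cases h : a = j.succ
    · rw [if_pos h, if_pos h.symm, eRoot_of_lt (hj.trans (h.symm.trans_lt hab))]
    · rw [if_neg h, if_neg (Ne.symm h)]

theorem sbr_fRoot_xGen_neg (hφ : IsCanonicalMap p k φ) {a b : Fin (ℓ + 1)} (hab : a < b)
    (j : Fin ℓ) :
    sbr (p a + p b) (vtxParity p j) (fRoot φ a b) (xGen p k (-1) j 0) =
      psign (p j.succ) • (if a = j.succ then fRoot φ j.castSucc b else 0) -
        psign ((p a + p b) * vtxParity p j) • psign (p j.castSucc) •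
          (if b = j.castSucc then fRoot φ a j.succ else 0) := by
  have hj : j.castSucc < j.succ := Fin.castSucc_lt_succ
  have hx : xGen p k (-1) j 0 = psign (p j.castSucc) • unitImage φ j.succ j.castSucc := by
    rw [hφ.unitImage_simple_neg, smul_smul, psign_mul_self, one_smul]
  have key := hφ.sbr_unitImage hab.ne' hj.ne'
    fun h => (hj.trans (h.1.symm.trans_lt hab)).ne h.2
  rw [add_comm (p b) (p a), add_comm (p j.succ) (p j.castSucc), ← vtxParity_eq] at key
  rw [fRoot_of_lt hab, hx, sbr_zsmul_left, sbr_zsmul_right, key]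
  by_cases h1 : a = j.succ
  · have hb : j.castSucc < b := hj.trans (h1.symm.trans_lt hab)
    rw [if_pos h1, if_pos h1, if_neg hb.ne, if_neg hb.ne', fRoot_of_lt hb, h1]
    module
  · rw [if_neg h1, if_neg h1]
    by_cases h2 : b = j.castSucc
    · have ha : a < j.succ := hab.trans (h2.trans_lt hj)
      rw [if_pos h2, if_pos h2.symm, fRoot_of_lt ha]
      module
    · rw [if_neg h2, if_neg (Ne.symm h2)]
      simp only [smul_zero, sub_zero]

theorem sbr_eRoot_xGen_neg (hφ : IsCanonicalMap p k φ) {a b : Fin (ℓ + 1)} (hab : a < b)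
    (j : Fin ℓ) (h : ¬ (a = j.castSucc ∧ b = j.succ)) :
    sbr (p a + p b) (vtxParity p j) (eRoot φ a b) (xGen p k (-1) j 0) =
      psign (p j.castSucc) • (if b = j.succ then eRoot φ a j.castSucc else 0) -
        psign ((p a + p b) * vtxParity p j) • psign (p j.castSucc) •
          (if a = j.castSucc then eRoot φ j.succ b else 0) := by
  have hj : j.castSucc < j.succ := Fin.castSucc_lt_succ
  have hx : xGen p k (-1) j 0 = psign (p j.castSucc) • unitImage φ j.succ j.castSucc := by
    rw [hφ.unitImage_simple_neg, smul_smul, psign_mul_self, one_smul]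
  have key := hφ.sbr_unitImage hab.ne hj.ne' fun h' => h ⟨h'.2.symm, h'.1⟩
  rw [add_comm (p j.succ) (p j.castSucc), ← vtxParity_eq] at key
  rw [eRoot_of_lt hab, hx, sbr_zsmul_right, key]
  by_cases h1 : b = j.succ
  · have ha : a < j.castSucc := by
      refine lt_of_le_of_ne ?_ fun h' => h ⟨h', h1⟩
      rw [h1] at hab
      exact Fin.le_castSucc_iff.2 hab
    rw [if_pos h1, if_pos h1, if_neg ha.ne, if_neg ha.ne', eRoot_of_lt ha]
    simp only [smul_zero, sub_zero]
  · rw [if_neg h1, if_neg h1]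
    by_cases h2 : a = j.castSucc
    · have hb : j.succ < b := by
        refine lt_of_le_of_ne ?_ (Ne.symm h1)
        rw [h2] at hab
        exact Fin.castSucc_lt_iff_succ_le.1 hab
      rw [if_pos h2, if_pos h2.symm, eRoot_of_lt hb]
      module
    · rw [if_neg h2, if_neg (Ne.symm h2)]
      simp only [smul_zero, sub_zero]

theorem sbr_fRoot_xGen (hφ : IsCanonicalMap p k φ) {a b : Fin (ℓ + 1)} (hab : a < b)
    (j : Fin ℓ) (h : ¬ (a = j.castSucc ∧ b = j.succ)) :
    sbr (p a + p b) (vtxParity p j) (fRoot φ a b) (xGen p k 1 j 0) =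
      psign (vtxParity p j) • (if a = j.castSucc then fRoot φ j.succ b else 0) -
        psign ((p a + p b) * vtxParity p j) •
          (if b = j.succ then fRoot φ a j.castSucc else 0) := by
  have hj : j.castSucc < j.succ := Fin.castSucc_lt_succ
  have key := hφ.sbr_unitImage hab.ne' hj.ne fun h' => h ⟨h'.1, h'.2.symm⟩
  rw [add_comm (p b) (p a), ← vtxParity_eq] at key
  rw [fRoot_of_lt hab, ← hφ.unitImage_simple, sbr_zsmul_left, key]
  by_cases h1 : a = j.castSucc
  · have hb : j.succ < b := by
      refine lt_of_le_of_ne ?_ fun h' => h ⟨h1, h'.symm⟩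
      rw [h1] at hab
      exact Fin.castSucc_lt_iff_succ_le.1 hab
    rw [if_pos h1, if_pos h1, if_neg hb.ne, if_neg hb.ne', fRoot_of_lt hb, h1, smul_smul,
      vtxParity_eq, psign_add, mul_assoc, psign_mul_self, mul_one]
    simp only [smul_zero, sub_zero]
  · rw [if_neg h1, if_neg h1]
    by_cases h2 : b = j.succ
    · have ha : a < j.castSucc := by
        refine lt_of_le_of_ne ?_ h1
        rw [h2] at hab
        exact Fin.le_castSucc_iff.2 hab
      rw [if_pos h2, if_pos h2.symm, fRoot_of_lt ha]
      module
    · rw [if_neg h2, if_neg (Ne.symm h2)]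
      simp only [smul_zero, sub_zero]

end IsCanonicalMap

/-- Bookkeeping for the bracket of the Casimir sum with a simple root vector. Moving `e_α` of one
root gives the same tensor as moving `f_β` of a neighbouring root, with opposite sign, so the four
kinds of terms cancel in pairs. Only the contribution `K` of the simple root itself is left. -/
theorem sum_sum_cancel {M : Type*} [AddCommGroup M] (F G : Fin (ℓ + 1) → M) (K : M)
    (c d : Fin (ℓ + 1) → Fin (ℓ + 1) → ℤ) (α α' β β' α₀ β₀ : Fin (ℓ + 1))
    (h : ∀ b, c α b = d α' b) :
    ∑ a, ∑ b, ((if b = β then F a else 0) - c a b • (if a = α then G b else 0) +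
      d a b • (if a = α' then G b else 0) - (if b = β' then F a else 0) +
      (if a = α₀ then if b = β₀ then K else 0 else 0)) = K := by
  have h1 : ∀ (α : Fin (ℓ + 1)) (c : Fin (ℓ + 1) → Fin (ℓ + 1) → ℤ),
      ∑ a, ∑ b, c a b • (if a = α then G b else 0) = ∑ b, c α b • G b := by
    intro α c
    rw [Finset.sum_comm]
    refine Finset.sum_congr rfl fun b _ => ?_
    rw [Finset.sum_eq_single α]
    · rw [if_pos rfl]
    · intro a _ ha
      rw [if_neg ha, smul_zero]
    · simp
  simp only [Finset.sum_add_distrib, Finset.sum_sub_distrib, h1]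
  simp only [Finset.sum_ite_eq', Finset.mem_univ, if_true]
  have h2 : ∀ a, (∑ b, if a = α₀ then if b = β₀ then K else 0 else 0) =
      if a = α₀ then K else 0 := by
    intro a
    split_ifs
    · simp
    · simp
  simp only [h2, Finset.sum_ite_eq', Finset.mem_univ, if_true, h]
  abel

variable {C : Type*} [Ring C] [Algebra (PowerSeries k) C]

/-- The pure tensors `f_α ⊗ e_α`, for two maps to a common algebra. -/
def rootTensor (φ : sl p k →ₗ[k] Y p k) (ι₁ ι₂ : Y p k →ₐ[PowerSeries k] C) (a b : Fin (ℓ + 1)) :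
    C := ι₁ (fRoot φ a b) * ι₂ (eRoot φ a b)

/-- The part `∑ f_α ⊗ e_α` of half of the Casimir element. -/
def casimirPart (φ : sl p k →ₗ[k] Y p k) (ι₁ ι₂ : Y p k →ₐ[PowerSeries k] C) : C :=
  ∑ a, ∑ b, rootTensor φ ι₁ ι₂ a b

variable {ι₁ ι₂ : Y p k →ₐ[PowerSeries k] C}

theorem rootTensor_of_not_lt {a b : Fin (ℓ + 1)} (h : ¬ a < b) : rootTensor φ ι₁ ι₂ a b = 0 := by
  rw [rootTensor, fRoot_of_not_lt h, map_zero, zero_mul]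

/-- The terms of different roots cancel in pairs, as in the proof that the Casimir element is
invariant. The exception is `α = α_j`, where `[f_j, e_j]` is a Cartan element and no root is
available as partner. -/
theorem lie_casimirPart_e (hφ : IsCanonicalMap p k φ) (hc : SuperCommute ι₁ ι₂) (j : Fin ℓ) :
    ⁅casimirPart φ ι₁ ι₂, ι₁ (xGen p k 1 j 0) + ι₂ (xGen p k 1 j 0)⁆ =
      -(ι₁ (hGen p k j 0) * ι₂ (xGen p k 1 j 0)) := by
  have hj : j.castSucc < j.succ := Fin.castSucc_lt_succ
  have hsq : ∀ s : ZMod 2, s * s = s := by decide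
  refine Eq.trans ?_ (sum_sum_cancel
    (fun a => ι₁ (fRoot φ a j.castSucc) * ι₂ (eRoot φ a j.succ))
    (fun b => ι₁ (fRoot φ j.succ b) * ι₂ (eRoot φ j.castSucc b))
    (-(ι₁ (hGen p k j 0) * ι₂ (xGen p k 1 j 0)))
    (fun a b => psign ((p a + p b) * vtxParity p j))
    (fun a b => psign ((p a + p b) * vtxParity p j) * psign (vtxParity p j))
    j.succ j.castSucc j.castSucc j.succ j.castSucc j.succ fun b => ?_)
  · rw [casimirPart, sum_rlie]
    refine Finset.sum_congr rfl fun a _ => ?_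
    rw [sum_rlie]
    refine Finset.sum_congr rfl fun b _ => ?_
    by_cases hab : a < b
    · rw [rootTensor, hc.lie_mul_box (hφ.fRoot_mem a b) (hφ.eRoot_mem a b)
        (xGen_mem_grading p k 1 j 0)]
      by_cases hab' : a = j.castSucc ∧ b = j.succ
      · obtain ⟨rfl, rfl⟩ := hab'
        have h1 := sbr_xGen_xGen_neg p k j j 0 0
        rw [if_pos rfl] at h1
        rw [hφ.fRoot_simple, hφ.eRoot_simple, ← vtxParity_eq, sbr_skew, h1, hsq]
        have h2 : sbr (vtxParity p j) (vtxParity p j) (xGen p k 1 j 0) (xGen p k 1 j 0) = 0 := by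
          rcases zmod_two_cases (vtxParity p j) with h | h
          · rw [h, sbr_zero_left, Ring.lie_def, sub_self]
          · exact sbr_xGen_xGen_of_cartan_eq_zero p k 1 _ _ 0 0 (cartan_odd p h)
        rw [h2, if_neg hj.ne', if_neg hj.ne, if_pos rfl, if_pos rfl, if_pos rfl, if_pos rfl,
          fRoot_of_not_lt (lt_irrefl _), fRoot_of_not_lt (lt_irrefl _)]
        simp only [map_zero, zero_mul, mul_zero, smul_zero, map_neg, map_zsmul, neg_mul, smul_neg,
          smul_mul_assoc, smul_smul, psign_mul_self, one_smul]
        abel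
      · rw [hφ.sbr_fRoot_xGen hab j hab', hφ.sbr_eRoot_xGen hab j]
        have h3 : (if a = j.castSucc then if b = j.succ then
            -(ι₁ (hGen p k j 0) * ι₂ (xGen p k 1 j 0)) else 0 else 0) = 0 := by
          rw [← ite_and, if_neg hab']
        rw [h3]
        have e1 : ι₁ (fRoot φ a b) * ι₂ (if b = j.castSucc then eRoot φ a j.succ else 0) =
            if b = j.castSucc then ι₁ (fRoot φ a j.castSucc) * ι₂ (eRoot φ a j.succ) else 0 := by
          split_ifs with h
          · rw [h]
          · rw [map_zero, mul_zero]
        have e2 : ι₁ (fRoot φ a b) * ι₂ (if a = j.succ then eRoot φ j.castSucc b else 0) =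
            if a = j.succ then ι₁ (fRoot φ j.succ b) * ι₂ (eRoot φ j.castSucc b) else 0 := by
          split_ifs with h
          · rw [h]
          · rw [map_zero, mul_zero]
        have e3 : ι₁ (if a = j.castSucc then fRoot φ j.succ b else 0) * ι₂ (eRoot φ a b) =
            if a = j.castSucc then ι₁ (fRoot φ j.succ b) * ι₂ (eRoot φ j.castSucc b) else 0 := by
          split_ifs with h
          · rw [h]
          · rw [map_zero, zero_mul]
        have e4 : ι₁ (if b = j.succ then fRoot φ a j.castSucc else 0) * ι₂ (eRoot φ a b) =
            if b = j.succ then ι₁ (fRoot φ a j.castSucc) * ι₂ (eRoot φ a j.succ) else 0 := by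
          split_ifs with h
          · rw [h]
          · rw [map_zero, zero_mul]
        simp only [map_sub, map_zsmul, sub_mul, mul_sub, smul_mul_assoc, mul_smul_comm, e1, e2, e3,
          e4, smul_sub, smul_smul, psign_mul_self, one_smul]
        abel
    · rw [rootTensor_of_not_lt hab, zero_rlie]
      symm
      -- Outside the positive roots an indicator may still hold, but it then selects a root vector
      -- that is zero by default.
      have h1 : b = j.castSucc → fRoot φ a j.castSucc = 0 := fun h =>
        fRoot_of_not_lt (h ▸ hab)
      have h2 : a = j.succ → fRoot φ j.succ b = 0 := fun h => fRoot_of_not_lt (h ▸ hab)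
      have h3 : a = j.castSucc → fRoot φ j.succ b = 0 := fun h =>
        fRoot_of_not_lt fun h' => hab (h ▸ hj.trans h')
      have h4 : b = j.succ → fRoot φ a j.castSucc = 0 := fun h =>
        fRoot_of_not_lt fun h' => hab (h ▸ h'.trans hj)
      have h5 : ¬ (a = j.castSucc ∧ b = j.succ) := fun h => hab (h.1 ▸ h.2 ▸ hj)
      rw [← ite_and, if_neg h5]
      have z : ∀ {P : Prop} [Decidable P] {u v : Y p k}, (P → u = 0) →
          (if P then ι₁ u * ι₂ v else 0) = 0 := by
        intro P _ u v h
        split_ifs with hP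
        · rw [h hP, map_zero, zero_mul]
        · rfl
      rw [z h1, z h2, z h3, z h4]
      simp only [smul_zero, sub_zero, add_zero]
  · rw [← psign_add]
    congr 1
    rw [vtxParity_eq]
    generalize p j.succ = s
    generalize p j.castSucc = t
    generalize p b = u
    revert s t u
    decide

/-- The same cancellation; now the unpaired Cartan element appears in the second tensor factor, from
`[e_j, f_j]`. -/
theorem lie_casimirPart_f (hφ : IsCanonicalMap p k φ) (hc : SuperCommute ι₁ ι₂) (j : Fin ℓ) :
    ⁅casimirPart φ ι₁ ι₂, ι₁ (xGen p k (-1) j 0) + ι₂ (xGen p k (-1) j 0)⁆ =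
      ι₁ (xGen p k (-1) j 0) * ι₂ (hGen p k j 0) := by
  have hj : j.castSucc < j.succ := Fin.castSucc_lt_succ
  have hsq : ∀ s : ZMod 2, s * s = s := by decide
  refine Eq.trans ?_ (sum_sum_cancel
    (fun a => psign (p j.castSucc) • (ι₁ (fRoot φ a j.succ) * ι₂ (eRoot φ a j.castSucc)))
    (fun b => ι₁ (fRoot φ j.castSucc b) * ι₂ (eRoot φ j.succ b))
    (ι₁ (xGen p k (-1) j 0) * ι₂ (hGen p k j 0))
    (fun a b => psign ((p a + p b) * vtxParity p j) * psign (p j.castSucc))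
    (fun a b => psign ((p a + p b) * vtxParity p j) * psign (p j.succ))
    j.castSucc j.succ j.succ j.castSucc j.castSucc j.succ fun b => ?_)
  · rw [casimirPart, sum_rlie]
    refine Finset.sum_congr rfl fun a _ => ?_
    rw [sum_rlie]
    refine Finset.sum_congr rfl fun b _ => ?_
    by_cases hab : a < b
    · rw [rootTensor, hc.lie_mul_box (hφ.fRoot_mem a b) (hφ.eRoot_mem a b)
        (xGen_mem_grading p k (-1) j 0)]
      by_cases hab' : a = j.castSucc ∧ b = j.succ
      · obtain ⟨rfl, rfl⟩ := hab'
        have h1 := sbr_xGen_xGen_neg p k j j 0 0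
        rw [if_pos rfl] at h1
        rw [hφ.fRoot_simple, hφ.eRoot_simple, ← vtxParity_eq, h1, hsq]
        have h2 : sbr (vtxParity p j) (vtxParity p j) (xGen p k (-1) j 0) (xGen p k (-1) j 0) =
            0 := by
          rcases zmod_two_cases (vtxParity p j) with h | h
          · rw [h, sbr_zero_left, Ring.lie_def, sub_self]
          · exact sbr_xGen_xGen_of_cartan_eq_zero p k (-1) _ _ 0 0 (cartan_odd p h)
        rw [h2, if_neg hj.ne', if_neg hj.ne, if_pos rfl, if_pos rfl, if_pos rfl, if_pos rfl,
          eRoot_of_not_lt (lt_irrefl _), eRoot_of_not_lt (lt_irrefl _)]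
        simp only [map_zero, zero_mul, mul_zero, smul_zero]
        abel
      · rw [hφ.sbr_fRoot_xGen_neg hab j, hφ.sbr_eRoot_xGen_neg hab j hab']
        have h3 : (if a = j.castSucc then if b = j.succ then
            (ι₁ (xGen p k (-1) j 0) * ι₂ (hGen p k j 0)) else 0 else 0) = 0 := by
          rw [← ite_and, if_neg hab']
        rw [h3]
        have e1 : ι₁ (fRoot φ a b) * ι₂ (if b = j.succ then eRoot φ a j.castSucc else 0) =
            if b = j.succ then ι₁ (fRoot φ a j.succ) * ι₂ (eRoot φ a j.castSucc) else 0 := by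
          split_ifs with h
          · rw [h]
          · rw [map_zero, mul_zero]
        have e2 : ι₁ (fRoot φ a b) * ι₂ (if a = j.castSucc then eRoot φ j.succ b else 0) =
            if a = j.castSucc then ι₁ (fRoot φ j.castSucc b) * ι₂ (eRoot φ j.succ b) else 0 := by
          split_ifs with h
          · rw [h]
          · rw [map_zero, mul_zero]
        have e3 : ι₁ (if a = j.succ then fRoot φ j.castSucc b else 0) * ι₂ (eRoot φ a b) =
            if a = j.succ then ι₁ (fRoot φ j.castSucc b) * ι₂ (eRoot φ j.succ b) else 0 := by
          split_ifs with h
          · rw [h]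
          · rw [map_zero, zero_mul]
        have e4 : ι₁ (if b = j.castSucc then fRoot φ a j.succ else 0) * ι₂ (eRoot φ a b) =
            if b = j.castSucc then ι₁ (fRoot φ a j.succ) * ι₂ (eRoot φ a j.castSucc) else 0 := by
          split_ifs with h
          · rw [h]
          · rw [map_zero, zero_mul]
        have hs : ∀ {P : Prop} [Decidable P] (n : ℤ) (u : C),
            (if P then n • u else 0) = n • (if P then u else 0) := by
          intro P _ n u
          split_ifs
          · rfl
          · rw [smul_zero]
        simp only [map_sub, map_zsmul, sub_mul, mul_sub, smul_mul_assoc, mul_smul_comm, e1, e2, e3,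
          e4, hs, smul_sub, smul_smul, psign_mul_self, one_mul, ← mul_assoc]
        abel
    · rw [rootTensor_of_not_lt hab, zero_rlie]
      symm
      have h1 : b = j.succ → eRoot φ a j.castSucc = 0 := fun h =>
        eRoot_of_not_lt fun h' => hab (h ▸ h'.trans hj)
      have h2 : a = j.castSucc → eRoot φ j.succ b = 0 := fun h =>
        eRoot_of_not_lt fun h' => hab (h ▸ hj.trans h')
      have h3 : a = j.succ → eRoot φ j.succ b = 0 := fun h => eRoot_of_not_lt (h ▸ hab)
      have h4 : b = j.castSucc → eRoot φ a j.castSucc = 0 := fun h => eRoot_of_not_lt (h ▸ hab)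
      have h5 : ¬ (a = j.castSucc ∧ b = j.succ) := fun h => hab (h.1 ▸ h.2 ▸ hj)
      rw [← ite_and, if_neg h5]
      have z : ∀ {P : Prop} [Decidable P] {u v : Y p k}, (P → v = 0) →
          (if P then ι₁ u * ι₂ v else 0) = 0 := by
        intro P _ u v h
        split_ifs with hP
        · rw [h hP, map_zero, mul_zero]
        · rfl
      have z' : ∀ {P : Prop} [Decidable P] {u v : Y p k} (n : ℤ), (P → v = 0) →
          (if P then n • (ι₁ u * ι₂ v) else 0) = 0 := by
        intro P _ u v n h
        split_ifs with hP
        · rw [h hP, map_zero, mul_zero, smul_zero]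
        · rfl
      rw [z' _ h1, z h2, z h3, z' _ h4]
      simp only [smul_zero, sub_zero, add_zero]
  · rw [← psign_add, ← psign_add]
    congr 1
    rw [vtxParity_eq]
    generalize p j.succ = s
    generalize p j.castSucc = t
    generalize p b = u
    revert s t u
    decide

end Casimir

/-! ### The solution of the minimalistic relations that defines the coproduct -/

section Coproduct

variable {ℓ : ℕ} {p : Fin (ℓ + 1) → ZMod 2} {k : Type*} [Field k] {φ : sl p k →ₗ[k] Y p k}
variable {C : Type*} [Ring C] [Algebra (PowerSeries k) C] {ι₁ ι₂ : Y p k →ₐ[PowerSeries k] C}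

/-- The element `-∑ (α_i, α) f_α ⊗ e_α`. -/
def omegaPart (φ : sl p k →ₗ[k] Y p k) (ι₁ ι₂ : Y p k →ₐ[PowerSeries k] C) (i : Fin ℓ) : C :=
  -∑ a, ∑ b, (rootEps p i a - rootEps p i b) • rootTensor φ ι₁ ι₂ a b

/-- Each `f_α` has weight `-α`. Presenting `ω_i` as a commutator makes the Jacobi identity available
for all brackets with it. -/
theorem lie_left_casimirPart (hφ : IsCanonicalMap p k φ) (hc : SuperCommute ι₁ ι₂) (i : Fin ℓ) :
    ⁅ι₁ (hGen p k i 0), casimirPart φ ι₁ ι₂⁆ = omegaPart φ ι₁ ι₂ i := by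
  simp only [casimirPart, omegaPart, rlie_sum, ← Finset.sum_neg_distrib]
  refine Finset.sum_congr rfl fun a _ => Finset.sum_congr rfl fun b _ => ?_
  rw [rootTensor, hc.lie_left_mul (hGen_mem_grading p k i 0) (hφ.eRoot_mem a b),
    hφ.lie_hGen_fRoot, map_neg, map_zsmul, neg_mul, smul_mul_assoc]

theorem lie_box_omegaPart (hφ : IsCanonicalMap p k φ) (hc : SuperCommute ι₁ ι₂) (i j : Fin ℓ) :
    ⁅ι₁ (hGen p k j 0) + ι₂ (hGen p k j 0), omegaPart φ ι₁ ι₂ i⁆ = 0 := by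
  simp only [omegaPart, rlie_sum, rlie_neg, lie_zsmul_right]
  refine neg_eq_zero.2 (Finset.sum_eq_zero fun a _ => Finset.sum_eq_zero fun b _ => ?_)
  rw [rootTensor, hc.lie_box_mul (hGen_mem_grading p k j 0) (hφ.fRoot_mem a b) (hφ.eRoot_mem a b),
    hφ.lie_hGen_fRoot, hφ.lie_hGen_eRoot]
  simp only [map_neg, map_zsmul, neg_mul, smul_mul_assoc, mul_smul_comm, neg_add_cancel, smul_zero]

theorem tGen_mem_grading (i : Fin ℓ) : tGen p k i ∈ grading p k 0 := by
  refine sub_mem (hGen_mem_grading p k i 1) (Submodule.smul_mem _ _ ?_)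
  have := SetLike.mul_mem_graded (hGen_mem_grading p k i 0) (hGen_mem_grading p k i 0)
  rwa [add_zero] at this

/-- Since `e_{ab}` and `f_{ab}` are, up to sign, the brackets of their parts `ac` and `cb`, the two
kinds of tensors, anticommutator with bracket and bracket with anticommutator, are the two halves of
twice a commutator of pure tensors. -/
theorem two_lie_rootTensor (hφ : IsCanonicalMap p k φ) (hc : SuperCommute ι₁ ι₂)
    (a c b : Fin (ℓ + 1)) :
    (psign (p c) * IsCanonicalMap.negConst p a c b) •
      (ι₁ (sabr (p a + p c) (p c + p b) (fRoot φ a c) (fRoot φ c b)) * ι₂ (eRoot φ a b)) +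
      psign (p c) • (ι₁ (fRoot φ a b) *
        ι₂ (sabr (p a + p c) (p c + p b) (eRoot φ a c) (eRoot φ c b))) =
    -((2 : ℤ) • ⁅rootTensor φ ι₁ ι₂ a c, rootTensor φ ι₁ ι₂ c b⁆) := by
  by_cases hac : a < c
  · by_cases hcb : c < b
    · rw [rootTensor, rootTensor, hc.two_lie_mul_mul (hφ.fRoot_mem a c) (hφ.eRoot_mem a c)
        (hφ.fRoot_mem c b) (hφ.eRoot_mem c b), hφ.isRootFamily_eRoot.mul a c b hac hcb,
        hφ.isRootFamily_fRoot.mul a c b hac hcb, one_smul, map_zsmul, smul_mul_assoc,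
        IsCanonicalMap.negConst_eq]
      have h1 := psign_mul_self (p c)
      have h2 := psign_mul_self ((p a + p c) * (p c + p b))
      generalize psign ((p a + p c) * (p c + p b)) = σ at *
      rw [show psign (p c) * -(psign (p c) * σ) = -σ by linear_combination (-σ) * h1]
      have h3 : psign (p c) = σ * (psign (p c) * σ) := by linear_combination -psign (p c) * h2
      generalize psign (p c) = s at *
      nth_rewrite 1 [h3]
      module
    · rw [rootTensor_of_not_lt hcb, fRoot_of_not_lt hcb, eRoot_of_not_lt hcb]
      simp only [sabr_zero_elt_right, map_zero, zero_mul, mul_zero, smul_zero, add_zero, rlie_zero,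
        neg_zero]
  · rw [rootTensor_of_not_lt hac, fRoot_of_not_lt hac, eRoot_of_not_lt hac]
    simp only [sabr_zero_elt_left, map_zero, zero_mul, mul_zero, smul_zero, add_zero, zero_rlie,
      neg_zero]

/-- The part of `[□(t_i), f_α ⊗ e_α]` that is symmetric in the two roots. -/
def symPart (φ : sl p k →ₗ[k] Y p k) (ι₁ ι₂ : Y p k →ₐ[PowerSeries k] C) (a b : Fin (ℓ + 1)) : C :=
  ι₁ (fRoot φ a b) * ι₂ (primed p k 1 (eRoot φ) (fun _ _ _ => 1) a b) -
    ι₁ (primed p k (-1) (fRoot φ) (IsCanonicalMap.negConst p) a b) * ι₂ (eRoot φ a b)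

/-- Apply `IsRootFamily.lie_tGen` in both tensor factors. The terms of level one form `symPart`,
which does not depend on `i`, and the anticommutators become commutators of the `f_β ⊗ e_β` with `α`
split into two roots. -/
theorem lie_box_tGen_rootTensor (hφ : IsCanonicalMap p k φ) (hc : SuperCommute ι₁ ι₂) (i : Fin ℓ)
    (a b : Fin (ℓ + 1)) :
    ⁅ι₁ (tGen p k i) + ι₂ (tGen p k i), rootTensor φ ι₁ ι₂ a b⁆ =
      (rootEps p i a - rootEps p i b) • symPart φ ι₁ ι₂ a b +
        halfHbar k • ∑ c, (rootEps p i a - rootEps p i c) •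
          (2 : ℤ) • ⁅rootTensor φ ι₁ ι₂ a c, rootTensor φ ι₁ ι₂ c b⁆ := by
  rw [rootTensor, hc.lie_box_mul (tGen_mem_grading i) (hφ.fRoot_mem a b) (hφ.eRoot_mem a b),
    hφ.isRootFamily_eRoot.lie_tGen, hφ.isRootFamily_fRoot.lie_tGen]
  have h : ∑ c, (rootEps p i a - rootEps p i c) •
      (2 : ℤ) • ⁅rootTensor φ ι₁ ι₂ a c, rootTensor φ ι₁ ι₂ c b⁆ =
      -∑ c, (((rootEps p i a - rootEps p i c) * psign (p c) * IsCanonicalMap.negConst p a c b) •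
      (ι₁ (sabr (p a + p c) (p c + p b) (fRoot φ a c) (fRoot φ c b)) * ι₂ (eRoot φ a b)) +
      ((rootEps p i a - rootEps p i c) * psign (p c) * 1) • (ι₁ (fRoot φ a b) *
        ι₂ (sabr (p a + p c) (p c + p b) (eRoot φ a c) (eRoot φ c b)))) := by
    rw [← Finset.sum_neg_distrib]
    refine Finset.sum_congr rfl fun c _ => ?_
    have := two_lie_rootTensor hφ hc a c b
    rw [← neg_eq_iff_eq_neg] at this
    rw [← this]
    module
  rw [h, Finset.sum_add_distrib]
  simp only [map_sub, map_zsmul, map_smul, map_sum, sub_mul, mul_sub, smul_mul_assoc,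
    mul_smul_comm, Finset.sum_mul, Finset.mul_sum, symPart]
  generalize ∑ c, ((rootEps p i a - rootEps p i c) * psign (p c) *
    IsCanonicalMap.negConst p a c b) • (ι₁ (sabr (p a + p c) (p c + p b) (fRoot φ a c)
      (fRoot φ c b)) * ι₂ (eRoot φ a b)) = S
  generalize ∑ c, ((rootEps p i a - rootEps p i c) * psign (p c) * 1) • (ι₁ (fRoot φ a b) *
        ι₂ (sabr (p a + p c) (p c + p b) (eRoot φ a c) (eRoot φ c b))) = S'
  obtain ⟨H, hH⟩ := exists_smul_eq_addMonoidHom (halfHbar k) C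
  simp only [hH, map_neg, map_add, Units.val_neg, Units.val_one]
  module

variable [CharZero k]

/-- Neither the `e` nor the `f` parts have a nonzero bracket unless one root ends where the other
begins. -/
theorem lie_rootTensor_rootTensor (hφ : IsCanonicalMap p k φ) (hc : SuperCommute ι₁ ι₂)
    {a b c d : Fin (ℓ + 1)} (hbc : b ≠ c) (hda : d ≠ a) :
    ⁅rootTensor φ ι₁ ι₂ a b, rootTensor φ ι₁ ι₂ c d⁆ = 0 := by
  have hC : IsAddTorsionFree C := isAddTorsionFree_of_algebra k C
  by_cases hab : a < b
  · by_cases hcd : c < d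
    · apply eq_zero_of_add_self
      rw [← two_smul ℤ, rootTensor, rootTensor, hc.two_lie_mul_mul (hφ.fRoot_mem a b)
        (hφ.eRoot_mem a b) (hφ.fRoot_mem c d) (hφ.eRoot_mem c d)]
      have h1 : sbr (p a + p b) (p c + p d) (eRoot φ a b) (eRoot φ c d) = 0 := by
        rw [eRoot_of_lt hab, eRoot_of_lt hcd, hφ.sbr_unitImage hab.ne hcd.ne fun h => hbc h.1,
          if_neg hbc, if_neg hda, smul_zero, sub_zero]
      have h2 : sbr (p a + p b) (p c + p d) (fRoot φ a b) (fRoot φ c d) = 0 := by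
        rw [fRoot_of_lt hab, fRoot_of_lt hcd, sbr_zsmul_left, sbr_zsmul_right, add_comm (p a),
          add_comm (p c), hφ.sbr_unitImage hab.ne' hcd.ne' fun h => hda h.1.symm,
          if_neg hda.symm, if_neg hbc.symm]
        simp only [smul_zero, sub_zero]
      rw [h1, h2, map_zero, map_zero, mul_zero, zero_mul, add_zero, smul_zero]
    · rw [rootTensor_of_not_lt hcd, rlie_zero]
  · rw [rootTensor_of_not_lt hab, zero_rlie]

/-- Only concatenable pairs of roots contribute. Each such pair occurs in both orders, whence the
antisymmetric coefficient. -/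
theorem lie_omegaPart_omegaPart (hφ : IsCanonicalMap p k φ) (hc : SuperCommute ι₁ ι₂)
    (i j : Fin ℓ) :
    ⁅omegaPart φ ι₁ ι₂ i, omegaPart φ ι₁ ι₂ j⁆ = ∑ a, ∑ c, ∑ b,
      ((rootEps p i a - rootEps p i c) * (rootEps p j c - rootEps p j b) -
        (rootEps p i c - rootEps p i b) * (rootEps p j a - rootEps p j c)) •
        ⁅rootTensor φ ι₁ ι₂ a c, rootTensor φ ι₁ ι₂ c b⁆ := by
  set X := rootTensor φ ι₁ ι₂ with hX
  have h1 : ∀ a b c d, ((rootEps p i a - rootEps p i b) * (rootEps p j c - rootEps p j d)) •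
      ⁅X a b, X c d⁆ =
      (if c = b then ((rootEps p i a - rootEps p i b) * (rootEps p j b - rootEps p j d)) •
        ⁅X a b, X b d⁆ else 0) -
      (if d = a then ((rootEps p i a - rootEps p i b) * (rootEps p j c - rootEps p j a)) •
        ⁅X c a, X a b⁆ else 0) := by
    intro a b c d
    by_cases hcb : c = b
    · subst hcb
      rw [if_pos rfl]
      split_ifs with hda
      · subst hda
        by_cases hdc : d < c
        · rw [hX, rootTensor_of_not_lt hdc.not_gt, rlie_zero, zero_rlie, smul_zero, sub_zero]
        · rw [hX, rootTensor_of_not_lt hdc, zero_rlie, rlie_zero, smul_zero, sub_zero]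
      · rw [sub_zero]
    · rw [if_neg hcb, zero_sub]
      split_ifs with hda
      · subst hda
        rw [rlie_skew, smul_neg]
      · rw [hX, lie_rootTensor_rootTensor hφ hc (Ne.symm hcb) hda, smul_zero, neg_zero]
  have h2 : ⁅omegaPart φ ι₁ ι₂ i, omegaPart φ ι₁ ι₂ j⁆ = ∑ a, ∑ b, ∑ c, ∑ d,
      ((rootEps p i a - rootEps p i b) * (rootEps p j c - rootEps p j d)) • ⁅X a b, X c d⁆ := by
    rw [omegaPart, omegaPart, neg_rlie, rlie_neg, neg_neg]
    simp only [sum_rlie, zsmul_rlie]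
    simp only [rlie_sum, lie_zsmul_right, Finset.smul_sum, smul_smul, ← hX]
  rw [h2]
  refine (Finset.sum_congr rfl fun a _ => Finset.sum_congr rfl fun b _ => Finset.sum_congr rfl
    fun c _ => Finset.sum_congr rfl fun d _ => h1 a b c d).trans ?_
  simp only [Finset.sum_sub_distrib]
  have h3 : ∀ a b, ∑ c, ∑ d, (if c = b then ((rootEps p i a - rootEps p i b) *
      (rootEps p j b - rootEps p j d)) • ⁅X a b, X b d⁆ else 0) =
      ∑ d, ((rootEps p i a - rootEps p i b) * (rootEps p j b - rootEps p j d)) •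
        ⁅X a b, X b d⁆ := by
    intro a b
    rw [Finset.sum_comm]
    simp only [Finset.sum_ite_eq', Finset.mem_univ, if_true]
  simp only [h3, Finset.sum_ite_eq', Finset.mem_univ, if_true, sub_smul, Finset.sum_sub_distrib]
  congr 1
  have h4 : ∀ g : Fin (ℓ + 1) → Fin (ℓ + 1) → Fin (ℓ + 1) → C,
      ∑ a, ∑ b, ∑ c, g a b c = ∑ a, ∑ c, ∑ b, g c b a := by
    intro g
    rw [Finset.sum_comm]
    conv_lhs => enter [2, b]; rw [Finset.sum_comm]
    rw [Finset.sum_comm]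
    exact Finset.sum_congr rfl fun a _ => Finset.sum_comm
  exact h4 _

/-- Weighted with `(α_j, α)`, the terms with `symPart` have coefficients symmetric in `i` and `j`
and disappear from the difference. For `α = β + γ` the remaining coefficients satisfy `(α_j, α)(α_i,
β) - (α_i, α)(α_j, β) = (α_j, γ)(α_i, β) - (α_i, γ)(α_j, β)`, which is the coefficient in `[ω_i,
ω_j]`. -/
theorem lie_box_tGen_omegaPart (hφ : IsCanonicalMap p k φ) (hc : SuperCommute ι₁ ι₂)
    (i j : Fin ℓ) :
    ⁅ι₁ (tGen p k i) + ι₂ (tGen p k i), omegaPart φ ι₁ ι₂ j⁆ -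
      ⁅ι₁ (tGen p k j) + ι₂ (tGen p k j), omegaPart φ ι₁ ι₂ i⁆ =
      -(halfHbar k • (2 : ℤ) • ⁅omegaPart φ ι₁ ι₂ i, omegaPart φ ι₁ ι₂ j⁆) := by
  have h1 : ∀ i j : Fin ℓ, ⁅ι₁ (tGen p k i) + ι₂ (tGen p k i), omegaPart φ ι₁ ι₂ j⁆ =
      -∑ a, ∑ b, ((rootEps p j a - rootEps p j b) * (rootEps p i a - rootEps p i b)) •
        symPart φ ι₁ ι₂ a b -
      halfHbar k • (2 : ℤ) • ∑ a, ∑ c, ∑ b,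
        ((rootEps p j a - rootEps p j b) * (rootEps p i a - rootEps p i c)) •
          ⁅rootTensor φ ι₁ ι₂ a c, rootTensor φ ι₁ ι₂ c b⁆ := by
    intro i j
    rw [omegaPart, rlie_neg, ← neg_add']
    congr 1
    simp only [rlie_sum, lie_zsmul_right, lie_box_tGen_rootTensor hφ hc, smul_add,
      Finset.sum_add_distrib, smul_smul]
    congr 1
    simp only [Finset.smul_sum]
    refine Finset.sum_congr rfl fun a _ => ?_
    rw [Finset.sum_comm]
    refine Finset.sum_congr rfl fun c _ => Finset.sum_congr rfl fun b _ => ?_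
    obtain ⟨H, hH⟩ := exists_smul_eq_addMonoidHom (halfHbar k) C
    simp only [hH, map_zsmul]
    module
  rw [h1, h1, lie_omegaPart_omegaPart hφ hc]
  have h2 : ∑ a, ∑ b, ((rootEps p j a - rootEps p j b) * (rootEps p i a - rootEps p i b)) •
        symPart φ ι₁ ι₂ a b = ∑ a, ∑ b, ((rootEps p i a - rootEps p i b) *
          (rootEps p j a - rootEps p j b)) • symPart φ ι₁ ι₂ a b := by
    simp only [mul_comm]
  rw [h2, sub_sub_sub_cancel_left, ← smul_sub, ← smul_sub, ← smul_neg, ← smul_neg]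
  congr 2
  simp only [← Finset.sum_sub_distrib, ← Finset.sum_neg_distrib]
  refine Finset.sum_congr rfl fun a _ => Finset.sum_congr rfl fun c _ =>
    Finset.sum_congr rfl fun b _ => ?_
  module

end Coproduct

/-! ### The minimalistic relations for the images of the generators -/

section Coproduct

variable {ℓ : ℕ} {p : Fin (ℓ + 1) → ZMod 2} {k : Type*} [Field k] {φ : sl p k →ₗ[k] Y p k}
variable {C : Type*} [Ring C] [Algebra (PowerSeries k) C] {ι₁ ι₂ : Y p k →ₐ[PowerSeries k] C}

/-- The image of `t_i` under the coproduct. -/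
def tImage (φ : sl p k →ₗ[k] Y p k) (ι₁ ι₂ : Y p k →ₐ[PowerSeries k] C) (i : Fin ℓ) : C :=
  ι₁ (tGen p k i) + ι₂ (tGen p k i) + halfHbar k • (2 : ℤ) • omegaPart φ ι₁ ι₂ i

/-- The image of `x_{j,1}^{±}` under the coproduct. -/
def xOneImage (φ : sl p k →ₗ[k] Y p k) (ι₁ ι₂ : Y p k →ₐ[PowerSeries k] C) (e : ℤˣ) (j : Fin ℓ) :
    C :=
  ι₁ (xGen p k e j 1) + ι₂ (xGen p k e j 1) + halfHbar k • (2 : ℤ) •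
    -- The corrections are dictated by `[T_i, □(x_j^±)] = ± c_ij Δ(x_{j1}^±)`. The different tensor
    -- factors reflect where the Cartan element sits in `lie_casimirPart_e` and `lie_casimirPart_f`.
    if e = 1 then -⁅casimirPart φ ι₁ ι₂, ι₁ (xGen p k e j 0)⁆
    else ⁅casimirPart φ ι₁ ι₂, ι₂ (xGen p k e j 0)⁆

theorem xOneImage_one (j : Fin ℓ) : xOneImage φ ι₁ ι₂ 1 j =
    ι₁ (xGen p k 1 j 1) + ι₂ (xGen p k 1 j 1) + halfHbar k • (2 : ℤ) •
      -⁅casimirPart φ ι₁ ι₂, ι₁ (xGen p k 1 j 0)⁆ := by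
  rw [xOneImage, if_pos rfl]

theorem xOneImage_neg_one (j : Fin ℓ) : xOneImage φ ι₁ ι₂ (-1) j =
    ι₁ (xGen p k (-1) j 1) + ι₂ (xGen p k (-1) j 1) + halfHbar k • (2 : ℤ) •
      ⁅casimirPart φ ι₁ ι₂, ι₂ (xGen p k (-1) j 0)⁆ := by
  rw [xOneImage, if_neg (by decide)]

theorem lie_box (hc : SuperCommute ι₁ ι₂) {b : ZMod 2} {x y : Y p k} (hx : x ∈ grading p k 0)
    (hy : y ∈ grading p k b) :
    ⁅ι₁ x + ι₂ x, ι₁ y + ι₂ y⁆ = ι₁ ⁅x, y⁆ + ι₂ ⁅x, y⁆ := by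
  have := hc.sbr_box hx hy
  rwa [sbr_zero_left, sbr_zero_left] at this

/-- Jacobi for `ω_i = [h_i ⊗ 1, Ω]`: since `[Ω, □(x_j^+)] = -h_j ⊗ x_j^+` commutes with `h_i ⊗ 1`,
only `-[Ω, [h_i ⊗ 1, □(x_j^+)]]` is left. -/
theorem lie_omegaPart_e (hφ : IsCanonicalMap p k φ) (hc : SuperCommute ι₁ ι₂) (i j : Fin ℓ) :
    ⁅omegaPart φ ι₁ ι₂ i, ι₁ (xGen p k 1 j 0) + ι₂ (xGen p k 1 j 0)⁆ =
      cartan p i j • -⁅casimirPart φ ι₁ ι₂, ι₁ (xGen p k 1 j 0)⁆ := by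
  have hh := hGen_mem_grading p k i 0
  have h1 := rlie_jacobi (ι₁ (hGen p k i 0)) (casimirPart φ ι₁ ι₂)
    (ι₁ (xGen p k 1 j 0) + ι₂ (xGen p k 1 j 0))
  have h2 := hc.sbr_left_box hh (xGen_mem_grading p k 1 j 0)
  rw [sbr_zero_left, sbr_zero_left, lie_hGen_zero_xGen, map_zsmul, Units.val_one, one_mul] at h2
  rw [lie_casimirPart_e hφ hc, lie_left_casimirPart hφ hc, h2, rlie_neg, hc.lie_left_mul hh
    (xGen_mem_grading p k 1 j 0), lie_hGen_hGen, map_zero, zero_mul, neg_zero,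
    lie_zsmul_right] at h1
  rw [smul_neg]
  exact eq_neg_of_add_eq_zero_left h1.symm

/-- Now `[Ω, □(x_j^-)] = x_j^- ⊗ h_j` has weight `-c_ij` for `h_i ⊗ 1`. Together with the other
Jacobi term this leaves the bracket of `Ω` with the second component of `□(x_j^-)`. -/
theorem lie_omegaPart_f (hφ : IsCanonicalMap p k φ) (hc : SuperCommute ι₁ ι₂) (i j : Fin ℓ) :
    ⁅omegaPart φ ι₁ ι₂ i, ι₁ (xGen p k (-1) j 0) + ι₂ (xGen p k (-1) j 0)⁆ =
      -(cartan p i j • ⁅casimirPart φ ι₁ ι₂, ι₂ (xGen p k (-1) j 0)⁆) := by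
  have hh := hGen_mem_grading p k i 0
  have h1 := rlie_jacobi (ι₁ (hGen p k i 0)) (casimirPart φ ι₁ ι₂)
    (ι₁ (xGen p k (-1) j 0) + ι₂ (xGen p k (-1) j 0))
  have h2 := hc.sbr_left_box hh (xGen_mem_grading p k (-1) j 0)
  have h3 := lie_casimirPart_f hφ hc j
  rw [sbr_zero_left, sbr_zero_left, lie_hGen_zero_xGen, map_zsmul, Units.val_neg, Units.val_one,
    neg_one_mul] at h2
  rw [h3, lie_left_casimirPart hφ hc, h2, hc.lie_left_mul hh (hGen_mem_grading p k j 0),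
    lie_hGen_zero_xGen, map_zsmul, smul_mul_assoc, ← h3, rlie_add, lie_zsmul_right, Units.val_neg,
    Units.val_one, neg_one_mul] at h1
  rw [← sub_eq_iff_eq_add.2 h1]
  module

variable [CharZero k]

/-- The relations of level zero hold because `□` respects brackets. The others say that the
corrections by `Ω` match; they use only how `Ω`, the `ω_i` and `□(t_i)` bracket with each other and
with primitive elements. -/
theorem minRel_coproduct (hφ : IsCanonicalMap p k φ) (hc : SuperCommute ι₁ ι₂) :
    MinRel p (halfHbar k) (fun i => ι₁ (hGen p k i 0) + ι₂ (hGen p k i 0)) (tImage φ ι₁ ι₂)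
      (fun e j => ι₁ (xGen p k e j 0) + ι₂ (xGen p k e j 0)) (xOneImage φ ι₁ ι₂) := by
  have hh := fun i => hGen_mem_grading p k i 0
  have hx := fun e j r => xGen_mem_grading p k e j r
  have ht := fun i => tGen_mem_grading (p := p) (k := k) i
  obtain ⟨H, hH⟩ := exists_smul_eq_addMonoidHom (halfHbar k) C
  refine ⟨?_, ?_, ?_, ?_, ?_, ?_, ?_, ?_, ?_, ?_, ?_⟩
  · intro i j
    rw [lie_box hc (hh i) (hh j), lie_hGen_hGen, map_zero, map_zero, add_zero]
  · intro i j
    rw [tImage, add_rlie, lie_box hc (ht i) (hh j), lie_tGen_hGen, smul_rlie, zsmul_rlie,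
      rlie_skew (omegaPart φ ι₁ ι₂ i), lie_box_omegaPart hφ hc]
    simp only [map_zero, add_zero, neg_zero, smul_zero]
  · intro i j
    -- The terms of first order in `ω` amount to `-ħ² [ω_i, ω_j]` and cancel the term of second
    -- order.
    have h1 := lie_box_tGen_omegaPart hφ hc i j
    rw [tImage, tImage, add_rlie,
      rlie_add (ι₁ (tGen p k i) + ι₂ (tGen p k i)) (ι₁ (tGen p k j) + ι₂ (tGen p k j)),
      rlie_add (halfHbar k • (2 : ℤ) • omegaPart φ ι₁ ι₂ i) (ι₁ (tGen p k j) + ι₂ (tGen p k j)),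
      lie_box hc (ht i) (ht j), lie_tGen_tGen]
    simp only [smul_rlie, lie_smul_right]
    rw [rlie_skew (omegaPart φ ι₁ ι₂ i) (ι₁ (tGen p k j) + ι₂ (tGen p k j))]
    rw [sub_eq_iff_eq_add] at h1
    rw [h1]
    simp only [hH, map_zero, map_add, map_neg, map_zsmul]
    module
  · intro e i j
    rw [lie_box hc (hh i) (hx e j 0), lie_hGen_zero_xGen, map_zsmul, map_zsmul, smul_add]
  · intro e i j
    rw [tImage, add_rlie, lie_box hc (ht i) (hx e j 0), lie_tGen_xGen, smul_rlie, zsmul_rlie,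
      zero_add]
    rcases Int.units_eq_one_or e with rfl | rfl
    · rw [lie_omegaPart_e hφ hc, xOneImage_one]
      simp only [hH, map_zsmul, map_neg, Units.val_one]
      module
    · rw [lie_omegaPart_f hφ hc, xOneImage_neg_one]
      simp only [hH, map_zsmul, map_neg, Units.val_neg, Units.val_one]
      module
  · intro i j
    rw [hc.sbr_box (hx 1 i 0) (hx (-1) j 0), sbr_xGen_xGen_neg]
    split_ifs
    · rfl
    · rw [map_zero, map_zero, add_zero]
  · intro i
    have h1 : sbr (vtxParity p i) (vtxParity p i) (xGen p k 1 i 0) (xGen p k (-1) i 0) =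
        hGen p k i 0 := (sbr_xGen_xGen_neg p k i i 0 0).trans (if_pos rfl)
    have h2 : sbr (vtxParity p i) (vtxParity p i) (xGen p k 1 i 1) (xGen p k (-1) i 0) =
        hGen p k i 1 := (sbr_xGen_xGen_neg p k i i 1 0).trans (if_pos rfl)
    -- Apply `ad Ω` to `[x_i^+ ⊗ 1, □(x_i^-)] = h_i ⊗ 1`. This evaluates the correction as `ω_i +
    -- h_i ⊗ h_i`, and its last term is the cross term of `(ħ/2) □(h_i)²`.
    have h3 := lie_sbr (vtxParity p i) (vtxParity p i) (casimirPart φ ι₁ ι₂)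
      (ι₁ (xGen p k 1 i 0)) (ι₁ (xGen p k (-1) i 0) + ι₂ (xGen p k (-1) i 0))
    rw [hc.sbr_left_box (hx 1 i 0) (hx (-1) i 0), h1, lie_casimirPart_f hφ hc, rlie_skew,
      lie_left_casimirPart hφ hc] at h3
    have h4 : sbr (vtxParity p i) (vtxParity p i) (ι₁ (xGen p k 1 i 0))
        (ι₁ (xGen p k (-1) i 0) * ι₂ (hGen p k i 0)) =
        ι₁ (hGen p k i 0) * ι₂ (hGen p k i 0) := by
      have h5 := hc (hx 1 i 0) (hh i)
      rw [mul_zero, psign_zero, one_smul] at h5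
      have h6 : ι₁ (hGen p k i 0) = sbr (vtxParity p i) (vtxParity p i) (ι₁ (xGen p k 1 i 0))
          (ι₁ (xGen p k (-1) i 0)) := by rw [← map_sbr, h1]
      rw [h6, sbr, sbr, mul_assoc (ι₁ (xGen p k (-1) i 0)), h5, sub_mul, smul_mul_assoc]
      simp only [mul_assoc]
    have h5 := hc (hh i) (hh i)
    rw [mul_zero, psign_zero, one_smul] at h5
    rw [h4] at h3
    rw [xOneImage_one, sbr_add_left, hc.sbr_box (hx 1 i 1) (hx (-1) i 0), h2, sbr_smul_left,
      sbr_zsmul_left, sbr_neg_left, ← sub_eq_iff_eq_add.2 h3, tImage, tGen]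
    simp only [hH, map_sub, map_smul, map_mul, mul_add, add_mul, map_add, h5, map_zsmul, map_neg]
    module
  · intro e i j hij
    have h1 := sbr_xGen_xGen_succ p k e i j 0 0 hij
    rw [zero_add] at h1
    have h1' : ∀ ι : Y p k →ₐ[PowerSeries k] C, ι (sbr (vtxParity p i) (vtxParity p j)
        (xGen p k e i 1) (xGen p k e j 0)) = ι (sbr (vtxParity p i) (vtxParity p j)
        (xGen p k e i 0) (xGen p k e j 1)) + ((e : ℤ) * cartan p i j) •
        halfHbar k • ι (sabr (vtxParity p i) (vtxParity p j) (xGen p k e i 0)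
          (xGen p k e j 0)) := by
      intro ι
      rw [← sub_eq_iff_eq_add', ← map_sub, h1, map_smul, smul_assoc]
    rw [hc.sabr_box (hx e i 0) (hx e j 0)]
    have h2 := lie_sbr (vtxParity p i) (vtxParity p j) (casimirPart φ ι₁ ι₂)
    rcases Int.units_eq_one_or e with rfl | rfl
    -- Both `[x_i ⊗ 1, □(x_j)]` and `[□(x_i), x_j ⊗ 1]` equal `[x_i, x_j] ⊗ 1`, so `ad Ω` takes the
    -- same value on them. Expanding it in two ways leaves just the mixed tensors of `x_i` and
    -- `x_j`, which are the cross terms of the anticommutator.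
    · have h3 := h2 (ι₁ (xGen p k 1 i 0)) (ι₁ (xGen p k 1 j 0) + ι₂ (xGen p k 1 j 0))
      have h4 := h2 (ι₁ (xGen p k 1 i 0) + ι₂ (xGen p k 1 i 0)) (ι₁ (xGen p k 1 j 0))
      rw [hc.sbr_left_box (hx 1 i 0) (hx 1 j 0), lie_casimirPart_e hφ hc, sbr_neg_right,
        hc.sbr_left_mul (hx 1 i 0) (hx 1 j 0), rlie_skew (xGen p k 1 i 0), lie_hGen_zero_xGen,
        cartan_comm] at h3
      rw [hc.sbr_box_left (hx 1 i 0) (hx 1 j 0), lie_casimirPart_e hφ hc, sbr_neg_left,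
        hc.sbr_mul_left (hx 1 i 0) (hx 1 j 0), lie_hGen_zero_xGen] at h4
      rw [xOneImage_one, xOneImage_one,
        sbr_add_left _ _ (ι₁ (xGen p k 1 i 1) + ι₂ (xGen p k 1 i 1)),
        sbr_add_right _ _ _ (ι₁ (xGen p k 1 j 1) + ι₂ (xGen p k 1 j 1)),
        hc.sbr_box (hx 1 i 1) (hx 1 j 0), hc.sbr_box (hx 1 i 0) (hx 1 j 1), h1', h1']
      simp only [sbr_smul_left, sbr_smul_right, sbr_neg_left,
        sbr_neg_right]
      rw [← sub_eq_iff_eq_add'.2 h4, ← sub_eq_iff_eq_add.2 h3]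
      simp only [hH, smul_assoc, map_neg, map_sub, map_add, map_zsmul, neg_mul, smul_mul_assoc,
        Units.val_one]
      module
    · have h3 := h2 (ι₂ (xGen p k (-1) i 0)) (ι₁ (xGen p k (-1) j 0) + ι₂ (xGen p k (-1) j 0))
      have h4 := h2 (ι₁ (xGen p k (-1) i 0) + ι₂ (xGen p k (-1) i 0)) (ι₂ (xGen p k (-1) j 0))
      rw [hc.sbr_right_box (hx (-1) i 0) (hx (-1) j 0), lie_casimirPart_f hφ hc,
        hc.sbr_right_mul (hx (-1) i 0) (hx (-1) j 0), rlie_skew (xGen p k (-1) i 0),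
        lie_hGen_zero_xGen, cartan_comm] at h3
      rw [hc.sbr_box_right (hx (-1) i 0) (hx (-1) j 0), lie_casimirPart_f hφ hc,
        hc.sbr_mul_right (hx (-1) i 0) (hx (-1) j 0), lie_hGen_zero_xGen] at h4
      rw [xOneImage_neg_one, xOneImage_neg_one,
        sbr_add_left _ _ (ι₁ (xGen p k (-1) i 1) + ι₂ (xGen p k (-1) i 1)),
        sbr_add_right _ _ _ (ι₁ (xGen p k (-1) j 1) + ι₂ (xGen p k (-1) j 1)),
        hc.sbr_box (hx (-1) i 1) (hx (-1) j 0), hc.sbr_box (hx (-1) i 0) (hx (-1) j 1), h1', h1']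
      simp only [sbr_smul_left, sbr_smul_right]
      rw [← sub_eq_iff_eq_add'.2 h4, ← sub_eq_iff_eq_add.2 h3]
      simp only [hH, smul_assoc, map_neg, map_sub, map_add, map_zsmul, mul_neg, mul_smul_comm,
        Units.val_neg, Units.val_one]
      module
  · intro e i j hij
    rw [hc.sbr_box (hx e i 0) (hx e j 0), sbr_xGen_xGen_of_cartan_eq_zero p k e i j 0 0 hij,
      map_zero, map_zero, add_zero]
  · intro e i j hij hi
    have hi0 : xGen p k e i 0 ∈ grading p k 0 := hi ▸ hx e i 0
    have h1 := sbr_mem_grading hi0 (hx e j 0)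
    rw [sbr_zero_left] at h1
    rw [lie_box hc hi0 (hx e j 0), lie_box hc hi0 h1, xGen_serre_cubic p k e i j hij hi, map_zero,
      map_zero, add_zero]
  · intro e i j l hij hjl hj
    rw [hc.sbr_box (hx e i 0) (hx e j 0), hc.sbr_box (hx e j 0) (hx e l 0),
      hc.sbr_box (sbr_mem_grading (hx e i 0) (hx e j 0)) (sbr_mem_grading (hx e j 0) (hx e l 0)),
      xGen_serre_quartic p k e i j l hij hjl hj, map_zero, map_zero, add_zero]

end Coproduct

/-! ### The coproduct -/

section Extensionality

variable {ℓ : ℕ} {p : Fin (ℓ + 1) → ZMod 2} {k : Type*} [Field k]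
variable {C : Type*} [Ring C] [Algebra (PowerSeries k) C] {f g : Y p k →ₐ[PowerSeries k] C}

/-- The elements `x_{i,0}^{±}` and `h_{i,1}` generate the Yangian. -/
theorem hom_ext_of_zero_one (hp : Admissible p)
    (hx : ∀ e i, f (xGen p k e i 0) = g (xGen p k e i 0))
    (hh : ∀ i, f (hGen p k i 1) = g (hGen p k i 1)) : f = g := by
  have h0 : ∀ i, f (hGen p k i 0) = g (hGen p k i 0) := by
    intro i
    have : hGen p k i 0 = _ := (if_pos rfl).symm.trans (sbr_xGen_xGen_neg p k i i 0 0).symm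
    rw [this, map_sbr, map_sbr, hx, hx]
  have ht : ∀ i, f (tGen p k i) = g (tGen p k i) := by
    intro i
    rw [tGen, map_sub, map_sub, map_smul, map_smul, map_mul, map_mul, h0, hh]
  have hxr : ∀ e i r, f (xGen p k e i r) = g (xGen p k e i r) := by
    intro e i r
    induction r with
    | zero => exact hx e i
    | succ r ih =>
      have : xGen p k e i (r + 1) =
          ((e : ℤ) * cartan p (hp.nb i) i) • ⁅tGen p k (hp.nb i), xGen p k e i r⁆ := by
        rw [lie_tGen_xGen, smul_smul, unit_mul_cartan_sq e (hp.nb_adj i), one_smul]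
      simp only [this, Ring.lie_def, map_zsmul, map_sub, map_mul, ht, ih]
  apply hom_ext
  rintro (⟨i, r⟩ | ⟨e, i, r⟩)
  · change f (hGen p k i r) = g (hGen p k i r)
    have : hGen p k i r = _ := (if_pos rfl).symm.trans (sbr_xGen_xGen_neg p k i i r 0).symm
    rw [this, map_sbr, map_sbr, hxr, hxr]
  · exact hxr e i r

end Extensionality

/-! ### The graded tensor square and its parity automorphism -/

section TensorSquare

variable {ℓ : ℕ} (p : Fin (ℓ + 1) → ZMod 2) (k : Type*) [Field k] [CharZero k]

/-- The inclusion `y ↦ y ⊗ 1`. -/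
def inclLeft : Y p k →ₐ[PowerSeries k] YY p k :=
  GradedTensorProduct.includeLeft (grading p k) (grading p k)

/-- The inclusion `y ↦ 1 ⊗ y`. -/
def inclRight : Y p k →ₐ[PowerSeries k] YY p k :=
  GradedTensorProduct.includeRight (grading p k) (grading p k)

variable {p k}

theorem inclLeft_apply (y : Y p k) : inclLeft p k y = tens p k y 1 := rfl

theorem inclRight_apply (y : Y p k) : inclRight p k y = tens p k 1 y := rfl

theorem inclLeft_mul_inclRight (u v : Y p k) :
    inclLeft p k u * inclRight p k v = tens p k u v :=
  GradedTensorProduct.tmul_one_mul_one_tmul _ _ u v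

theorem box_eq (y : Y p k) : box p k y = inclLeft p k y + inclRight p k y := rfl

theorem superCommute_incl : SuperCommute (inclLeft p k) (inclRight p k) := by
  intro a b x y hx hy
  rw [inclLeft_mul_inclRight, inclLeft_apply, inclRight_apply]
  have := GradedTensorProduct.tmul_coe_mul_coe_tmul (grading p k) (grading p k) (1 : Y p k)
    ⟨y, hy⟩ ⟨x, hx⟩ (1 : Y p k)
  rw [one_mul, mul_one, mul_comm b a] at this
  exact this

/-- The parity automorphism of the tensor square. -/
def tensorInvol : YY p k →ₐ[PowerSeries k] YY p k :=
  GradedTensorProduct.lift (grading p k) (grading p k) ((inclLeft p k).comp (invol p k))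
    ((inclRight p k).comp (invol p k)) (by
      intro i j a b
      have h := superCommute_incl a.2 b.2
      have ha : invol p k a = _ := a.2
      have hb : invol p k b = _ := b.2
      simp only [AlgHom.comp_apply, ha, hb, map_zsmul, smul_mul_assoc, mul_smul_comm]
      rw [h, Units.smul_def, mul_comm j i]
      change _ = psign (i * j) • _
      rw [smul_comm (psign (i * j)), smul_comm (psign (i * j)), smul_smul (psign (i * j)),
        psign_mul_self, one_smul, smul_comm])

theorem tensorInvol_tens (u v : Y p k) :
    tensorInvol (tens p k u v) = tens p k (invol p k u) (invol p k v) := by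
  rw [← inclLeft_mul_inclRight (invol p k u)]
  exact GradedTensorProduct.lift_tmul _ _ _ _ _ u v

theorem tensorInvol_tens_of_mem {a b : ZMod 2} {u v : Y p k} (hu : u ∈ grading p k a)
    (hv : v ∈ grading p k b) :
    tensorInvol (tens p k u v) = psign (a + b) • tens p k u v := by
  rw [tensorInvol_tens, mem_grading p k |>.1 hu, mem_grading p k |>.1 hv,
    ← inclLeft_mul_inclRight, ← inclLeft_mul_inclRight, map_zsmul, map_zsmul, smul_mul_smul_comm,
    psign_add]

theorem tensorInvol_box {a : ZMod 2} {u : Y p k} (hu : u ∈ grading p k a) :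
    tensorInvol (box p k u) = psign a • box p k u := by
  have h1 : (1 : Y p k) ∈ grading p k 0 := SetLike.one_mem_graded _
  rw [box, map_add, tensorInvol_tens_of_mem hu h1, tensorInvol_tens_of_mem h1 hu, add_zero,
    zero_add, smul_add]

/-- This is twice the projection to parity `c`. On a homogeneous pure tensor it gives a multiple of
the tensor or zero, and such tensors span. -/
theorem add_tensorInvol_mem (c : ZMod 2) (z : YY p k) :
    z + psign c • tensorInvol z ∈ tensorGrading p k c := by
  have hhom : ∀ {a b : ZMod 2} {u v : Y p k}, u ∈ grading p k a → v ∈ grading p k b →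
      tens p k u v + psign c • tensorInvol (tens p k u v) ∈ tensorGrading p k c := by
    intro a b u v hu hv
    rw [tensorInvol_tens_of_mem hu hv]
    by_cases h : a + b = c
    · have hm : tens p k u v ∈ tensorGrading p k c :=
        Submodule.subset_span ⟨a, b, u, v, h, hu, hv, rfl⟩
      exact add_mem hm (zsmul_mem (zsmul_mem hm _) _)
    · have h' : ∀ d c : ZMod 2, d ≠ c → d = c + 1 := by decide
      rw [h' _ _ h, psign_add, psign_one, smul_smul, mul_neg_one, mul_neg, psign_mul_self,
        neg_one_smul, add_neg_cancel]
      exact zero_mem _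
  have htens : ∀ u v : Y p k,
      tens p k u v + psign c • tensorInvol (tens p k u v) ∈ tensorGrading p k c := by
    intro u v
    have e : tens p k u v = (tens p k (proj p k 0 u) (proj p k 0 v) +
        tens p k (proj p k 0 u) (proj p k 1 v)) + (tens p k (proj p k 1 u) (proj p k 0 v) +
        tens p k (proj p k 1 u) (proj p k 1 v)) := by
      simp only [← inclLeft_mul_inclRight, ← mul_add, ← add_mul, ← map_add, proj_add_proj]
    have hs : ∀ z w : YY p k, z + w + psign c • tensorInvol (z + w) =
        (z + psign c • tensorInvol z) + (w + psign c • tensorInvol w) := by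
      intro z w
      rw [map_add, smul_add]; abel
    rw [e, hs, hs, hs]
    exact add_mem (add_mem (hhom (proj_mem ..) (proj_mem ..)) (hhom (proj_mem ..) (proj_mem ..)))
      (add_mem (hhom (proj_mem ..) (proj_mem ..)) (hhom (proj_mem ..) (proj_mem ..)))
  have key : ∀ z : Y p k ⊗[PowerSeries k] Y p k,
      GradedTensorProduct.of (PowerSeries k) (grading p k) (grading p k) z +
        psign c • tensorInvol (GradedTensorProduct.of (PowerSeries k) (grading p k) (grading p k) z)
        ∈ tensorGrading p k c := by
    intro z
    induction z using TensorProduct.induction_on with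
    | zero => rw [map_zero, map_zero, smul_zero, add_zero]; exact zero_mem _
    | tmul u v => exact htens u v
    | add z w hz hw =>
      have := add_mem hz hw
      rwa [add_add_add_comm, ← smul_add, ← map_add, ← map_add] at this
  exact key z

/-- Half of the preceding element is `z` itself when `z` is an eigenvector. -/
theorem mem_tensorGrading {c : ZMod 2} {z : YY p k} (hz : tensorInvol z = psign c • z) :
    z ∈ tensorGrading p k c := by
  have h := Submodule.smul_mem _ (half k) (add_tensorInvol_mem c z)
  rwa [hz, smul_smul, psign_mul_self, one_smul, smul_add, ← add_smul, half_add_half,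
    one_smul] at h

end TensorSquare

/-! ### The coproduct: its two rules, parity and uniqueness -/

section Rules

variable {ℓ : ℕ} {p : Fin (ℓ + 1) → ZMod 2} {k : Type*} [Field k]
variable {φ : sl p k →ₗ[k] Y p k}

theorem isDiag_cartanH (i : Fin ℓ) :
    (cartanH p k i : Matrix (Fin (ℓ + 1)) (Fin (ℓ + 1)) k).IsDiag := by
  intro a b hab
  rw [cartanH_val, Matrix.sub_apply, Matrix.smul_apply, Matrix.smul_apply,
    Matrix.single_apply_of_ne, Matrix.single_apply_of_ne, smul_zero, smul_zero, sub_zero]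
  · rintro ⟨rfl, rfl⟩; exact hab rfl
  · rintro ⟨rfl, rfl⟩; exact hab rfl

theorem isHomog_of_isDiag {A : Matrix (Fin (ℓ + 1)) (Fin (ℓ + 1)) k} (hA : A.IsDiag) :
    IsHomog p 0 A := by
  intro a b hab
  refine hA ?_
  rintro rfl
  exact hab (CharTwo.add_self_eq_zero (p a))

theorem IsCanonicalMap.lie_hGen_of_isDiag (hφ : IsCanonicalMap p k φ) (i : Fin ℓ) {A : sl p k}
    (hA : (A : Matrix (Fin (ℓ + 1)) (Fin (ℓ + 1)) k).IsDiag) : ⁅hGen p k i 0, φ A⁆ = 0 := by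
  have h := hφ.bracket 0 0 (cartanH p k i) A (isHomog_of_isDiag (isDiag_cartanH i))
    (isHomog_of_isDiag hA)
  rw [← sbr_zero_left 0, ← hφ.map_h, ← h, ← map_zero φ]
  refine congrArg φ (Subtype.ext ?_)
  change sbr 0 0 _ _ = 0
  rw [sbr_zero_left, Ring.lie_def, ← (isDiag_cartanH (p := p) (k := k) i).diagonal_diag,
    ← hA.diagonal_diag, Matrix.diagonal_mul_diagonal, Matrix.diagonal_mul_diagonal, sub_eq_zero]
  simp only [mul_comm]

variable [CharZero k]

theorem sum_tens_eq_casimirPart :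
    ∑ α : PosRoot ℓ, tens p k (φ (rootF p k α)) (φ (rootE p k α)) =
      casimirPart φ (inclLeft p k) (inclRight p k) := by
  rw [casimirPart, ← sum_posRoot _ fun _ _ h => rootTensor_of_not_lt h]
  refine Finset.sum_congr rfl fun α _ => ?_
  rw [map_rootF, map_rootE, rootTensor, inclLeft_mul_inclRight]

theorem neg_sum_rootForm_smul_tens (i : Fin ℓ) :
    -∑ α : PosRoot ℓ, rootForm p (simpleRoot i) α • tens p k (φ (rootF p k α)) (φ (rootE p k α)) =
      omegaPart φ (inclLeft p k) (inclRight p k) i := by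
  rw [omegaPart, ← sum_posRoot (fun a b => (rootEps p i a - rootEps p i b) •
    rootTensor φ (inclLeft p k) (inclRight p k) a b) fun _ _ h => by
      rw [rootTensor_of_not_lt h, smul_zero]]
  refine congrArg _ (Finset.sum_congr rfl fun α _ => ?_)
  rw [map_rootF, map_rootE, rootTensor, inclLeft_mul_inclRight, rootForm_eq_rootEps]

/-- Diagonal matrices commute, so the Cartan part of `Ω^+` commutes with `h_{i0} ⊗ 1`.
Orthonormality plays no role. -/
theorem sbr_omegaPlus (hφ : IsCanonicalMap p k φ) {b : Fin ℓ → sl p k}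
    (hb : ∀ j, (b j : Matrix (Fin (ℓ + 1)) (Fin (ℓ + 1)) k).IsDiag) (i : Fin ℓ) :
    sbr 0 0 (tens p k (hGen p k i 0) 1) (omegaPlus p φ b) =
      omegaPart φ (inclLeft p k) (inclRight p k) i := by
  rw [sbr_zero_left, omegaPlus, ← inclLeft_apply, rlie_add, sum_tens_eq_casimirPart,
    lie_left_casimirPart hφ superCommute_incl, rlie_sum, Finset.sum_eq_zero, zero_add]
  intro j _
  rw [← inclLeft_mul_inclRight, superCommute_incl.lie_left_mul (hGen_mem_grading p k i 0)
    (hφ.even 0 (b j) (isHomog_of_isDiag (hb j))), hφ.lie_hGen_of_isDiag i (hb j), map_zero,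
    zero_mul]

theorem casimirRule_iff (hφ : IsCanonicalMap p k φ) {b : Fin ℓ → sl p k}
    (hb : IsOrthonormalCartan p k b) (Δ : Y p k →ₐ[PowerSeries k] YY p k) :
    CasimirRule p φ b Δ ↔ ExplicitRule p φ Δ := by
  refine forall_congr' fun i => ?_
  rw [sbr_omegaPlus hφ hb.diag, ← neg_sum_rootForm_smul_tens, ← sub_eq_add_neg]

/-- The coproduct of the Yangian. -/
def coproduct (hφ : IsCanonicalMap p k φ) (hp : Admissible p) :
    Y p k →ₐ[PowerSeries k] YY p k :=
  (minRel_coproduct hφ superCommute_incl).hom hp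

theorem coproduct_hGen_zero (hφ : IsCanonicalMap p k φ) (hp : Admissible p) (i : Fin ℓ) :
    coproduct hφ hp (hGen p k i 0) = box p k (hGen p k i 0) := by
  rw [coproduct, MinRel.hom_hGen, MinRel.hs_zero (minRel_coproduct hφ superCommute_incl), box_eq]

theorem coproduct_xGen_zero (hφ : IsCanonicalMap p k φ) (hp : Admissible p) (e : ℤˣ) (i : Fin ℓ) :
    coproduct hφ hp (xGen p k e i 0) = box p k (xGen p k e i 0) := by
  rw [coproduct, MinRel.hom_xGen, xs, box_eq]

/-- The image of `h_{i1}` is `T_i + (ħ/2) □(h_{i0})²`, and the mixed part of the square is `ħ h_{i0}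
⊗ h_{i0}`. -/
theorem explicitRule_coproduct (hφ : IsCanonicalMap p k φ) (hp : Admissible p) :
    ExplicitRule p φ (coproduct hφ hp) := by
  intro i
  have h := superCommute_incl (hGen_mem_grading p k i 0) (hGen_mem_grading p k i 0)
  rw [mul_zero, psign_zero, one_smul] at h
  rw [coproduct, MinRel.hom_hGen, MinRel.hs_one (minRel_coproduct hφ superCommute_incl), tImage,
    sub_eq_add_neg, neg_sum_rootForm_smul_tens, ← two_mul_halfHbar, two_mul, add_smul, tGen, box_eq,
    ← inclLeft_mul_inclRight]
  simp only [map_sub, map_smul, map_mul, mul_add, add_mul, h, smul_add, two_smul]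
  abel

/-- The elements on which the rule holds contain the simple root vectors and the `h_i`. Brackets of
primitive elements are primitive, which gives the other matrix units. -/
theorem primitiveRule_coproduct (hφ : IsCanonicalMap p k φ) (hp : Admissible p) :
    PrimitiveRule p φ (coproduct hφ hp) := by
  let S : Submodule k (sl p k) :=
    { carrier := {A | coproduct hφ hp (φ A) = box p k (φ A)}
      add_mem' := fun {A B} hA hB => by
        change coproduct hφ hp (φ (A + B)) = box p k (φ (A + B))
        rw [map_add, map_add, hA, hB]
        simp only [box_eq, map_add]
        abel
      zero_mem' := by
        change coproduct hφ hp (φ 0) = box p k (φ 0)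
        simp only [box_eq, map_zero, add_zero]
      smul_mem' := fun c A hA => by
        change coproduct hφ hp (φ (c • A)) = box p k (φ (c • A))
        have hc : ∀ y : Y p k, c • y = (algebraMap k (PowerSeries k) c) • y :=
          fun y => (algebraMap_smul (PowerSeries k) c y).symm
        rw [map_smul, hc, map_smul, hA]
        simp only [box_eq, map_smul, smul_add] }
  have hmem : ∀ (A : sl p k), A ∈ S → (A : Matrix _ _ k) ∈ Submodule.map (sl p k).subtype S :=
    fun A hA => ⟨A, hA, rfl⟩
  have he : ∀ i, rootE p k (simpleRoot i) ∈ S := fun i => by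
    change coproduct hφ hp (φ _) = box p k (φ _)
    rw [hφ.map_e, coproduct_xGen_zero]
  have hf : ∀ i, rootF p k (simpleRoot i) ∈ S := fun i => by
    change coproduct hφ hp (φ _) = box p k (φ _)
    rw [hφ.map_f, coproduct_xGen_zero]
  have hh : ∀ i, cartanH p k i ∈ S := fun i => by
    change coproduct hφ hp (φ _) = box p k (φ _)
    rw [hφ.map_h, coproduct_hGen_zero]
  have hsingle : ∀ a b : Fin (ℓ + 1), a ≠ b →
      Matrix.single a b 1 ∈ Submodule.map (sl p k).subtype S := by
    refine matrixUnit_induction (fun i => hmem _ (he i)) (fun i => ?_) ?_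
    · have := zsmul_mem (hmem _ (hf i)) (psign (p i.castSucc))
      rw [rootF_val, smul_smul, show (simpleRoot i).1.1 = i.castSucc from rfl, psign_mul_self,
        one_smul] at this
      exact this
    · rintro a b c - - hac ⟨A, hA, eA⟩ ⟨B, hB, eB⟩
      change (A : Matrix (Fin (ℓ + 1)) (Fin (ℓ + 1)) k) = _ at eA
      change (B : Matrix (Fin (ℓ + 1)) (Fin (ℓ + 1)) k) = _ at eB
      have homA : IsHomog p (p a + p b) (A : Matrix _ _ k) := by
        rw [eA]; exact isHomog_single p a b 1
      have homB : IsHomog p (p b + p c) (B : Matrix _ _ k) := by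
        rw [eB]; exact isHomog_single p b c 1
      have := hmem ⟨_, sbr_mem_sl p homA homB⟩ (by
        change coproduct hφ hp (φ _) = box p k (φ _)
        rw [hφ.bracket _ _ A B homA homB, map_sbr, hA, hB, box_eq, box_eq, box_eq,
          superCommute_incl.sbr_box (hφ.even _ _ homA) (hφ.even _ _ homB)])
      change sbr (p a + p b) (p b + p c) (A : Matrix (Fin (ℓ + 1)) (Fin (ℓ + 1)) k)
        (B : Matrix (Fin (ℓ + 1)) (Fin (ℓ + 1)) k) ∈ _ at this
      rwa [eA, eB, sbr_single_single hac] at this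
  intro A
  obtain ⟨A', hA', e⟩ := mem_of_mem_sl p (S := Submodule.map (sl p k).subtype S) A.2
    (fun a b hab _ => hsingle a b hab) (fun _ i => hmem _ (hh i))
  rw [← (Subtype.ext e : A' = A)]
  exact hA'

/-- Conjugating by the parity automorphisms of `Y` and `Y ⊗ Y` does not change the values on the
`x_{i0}^±` and `h_{i1}`, hence does not change the coproduct. So it maps eigenvectors to
eigenvectors with the same sign. -/
theorem isSuperHom_coproduct (hφ : IsCanonicalMap p k φ) (hp : Admissible p) :
    IsSuperHom p k (coproduct hφ hp) := by
  have key : (tensorInvol.comp (coproduct hφ hp)).comp (invol p k) = coproduct hφ hp := by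
    refine hom_ext_of_zero_one hp (fun e i => ?_) fun i => ?_
    · have hx := xGen_mem_grading p k e i 0
      rw [AlgHom.comp_apply, AlgHom.comp_apply, (mem_grading p k).1 hx, map_zsmul, map_zsmul,
        coproduct_xGen_zero, tensorInvol_box hx, smul_smul, psign_mul_self, one_smul]
    · have hh := hGen_mem_grading p k i
      have hsum : ∀ α : PosRoot ℓ, tensorInvol (tens p k (φ (rootF p k α)) (φ (rootE p k α))) =
          tens p k (φ (rootF p k α)) (φ (rootE p k α)) := by
        intro α
        rw [map_rootE, map_rootF, tensorInvol_tens_of_mem (hφ.fRoot_mem _ _) (hφ.eRoot_mem _ _),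
          CharTwo.add_self_eq_zero, psign_zero, one_smul]
      rw [AlgHom.comp_apply, AlgHom.comp_apply, (mem_grading p k).1 (hh 1), psign_zero, one_smul,
        explicitRule_coproduct hφ hp i, map_add, tensorInvol_box (hh 1), map_smul, map_sub,
        tensorInvol_tens_of_mem (hh 0) (hh 0), map_sum]
      simp only [map_zsmul, hsum, add_zero, psign_zero, one_smul]
  intro c y hy
  refine mem_tensorGrading ?_
  have h := DFunLike.congr_fun key y
  rw [AlgHom.comp_apply, AlgHom.comp_apply, (mem_grading p k).1 hy, map_zsmul, map_zsmul] at h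
  conv_rhs => rw [← h]
  rw [smul_smul, psign_mul_self, one_smul]

theorem eq_coproduct (hφ : IsCanonicalMap p k φ) (hp : Admissible p)
    {Δ : Y p k →ₐ[PowerSeries k] YY p k} (h0 : PrimitiveRule p φ Δ) (h1 : ExplicitRule p φ Δ) :
    Δ = coproduct hφ hp := by
  refine hom_ext_of_zero_one hp (fun e i => ?_) fun i => ?_
  · rw [coproduct_xGen_zero]
    rcases Int.units_eq_one_or e with rfl | rfl
    · rw [← hφ.map_e, h0]
    · rw [← hφ.map_f, h0]
  · rw [h1 i, explicitRule_coproduct hφ hp i]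

end Rules

end SuperYangian

end

/-! ### The main theorem -/

theorem mainTheorem5 {k : Type*} [Field k] [IsAlgClosed k] [CharZero k] {ℓ : ℕ}
    (p : Fin (ℓ + 1) → ZMod 2) (hp : SuperYangian.Admissible p) :
    (∃! φ : SuperYangian.sl p k →ₗ[k] SuperYangian.Y p k, SuperYangian.IsCanonicalMap p k φ) ∧
    ∀ φ : SuperYangian.sl p k →ₗ[k] SuperYangian.Y p k, SuperYangian.IsCanonicalMap p k φ →
      ∃ Δ : SuperYangian.Y p k →ₐ[PowerSeries k] SuperYangian.YY p k,
        SuperYangian.IsSuperHom p k Δ ∧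
        SuperYangian.PrimitiveRule p φ Δ ∧
        (∀ b : Fin ℓ → SuperYangian.sl p k, SuperYangian.IsOrthonormalCartan p k b →
          SuperYangian.CasimirRule p φ b Δ) ∧
        SuperYangian.ExplicitRule p φ Δ ∧
        ∀ Δ' : SuperYangian.Y p k →ₐ[PowerSeries k] SuperYangian.YY p k,
          SuperYangian.PrimitiveRule p φ Δ' →
          (SuperYangian.ExplicitRule p φ Δ' ∨
            ∃ b : Fin ℓ → SuperYangian.sl p k, SuperYangian.IsOrthonormalCartan p k b ∧
              SuperYangian.CasimirRule p φ b Δ') →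
          Δ' = Δ := by
  refine ⟨⟨SuperYangian.canonicalMap p k, SuperYangian.isCanonicalMap_canonicalMap p k,
    fun φ' h => h.eq (SuperYangian.isCanonicalMap_canonicalMap p k)⟩, fun φ hφ => ?_⟩
  refine ⟨SuperYangian.coproduct hφ hp, SuperYangian.isSuperHom_coproduct hφ hp,
    SuperYangian.primitiveRule_coproduct hφ hp,
    fun b hb => (SuperYangian.casimirRule_iff hφ hb _).2
      (SuperYangian.explicitRule_coproduct hφ hp),
    SuperYangian.explicitRule_coproduct hφ hp, fun Δ' h0 h1 => ?_⟩
  rcases h1 with h1 | ⟨b, hb, h1⟩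
  · exact SuperYangian.eq_coproduct hφ hp h0 h1
  · exact SuperYangian.eq_coproduct hφ hp h0 ((SuperYangian.casimirRule_iff hφ hb _).1 h1)
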